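/- A knot is a tame knot in $\mathbb{R}^3$, considered up to isotopy; it is prime if it is not the unknot and if, whenever it is a connected sum of two knots, one of these is the unknot. For a knot $K$ let $br(K)$ be its braid index, i.e. the least number of strands of a braid whose closure is isotopic to $K$. For $n\ge br(K)$ let $b_n(K)$ be the minimum length (number of crossings, i.e. number of letters $\sigma_i^{\pm1}$) of a braid word on $n$ strands whose closure is isotopic to $K$, and put $b_n'(K)=b_n(K)-n$. Theorem. Let $K$ be a prime knot, let $m\ge br(K)$, and suppose $b_m(K)=c$. Let $N=b_m'(K)=c-m$. 1. If $N\ge m$, then $b_n'(K)=b_N'(K)$ for all $n\ge N$. 2. If $N<br(K)$, then $b_n'(K)=b_m'(K)$ for all $n\ge m$. -/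

import Mathlib

namespace KnotBraid

/-- Three-dimensional space. Only its affine structure is used. -/
abbrev R3 : Type := Fin 3 → ℝ

/-- A (tame) knot: the underlying set of a simple closed polygon in space, with vertices
`v 0, …, v (k + 2)` (indices are cyclic, so that `v (i + 1)` follows `v i`). -/
def IsKnot (K : Set R3) : Prop :=
  ∃ (k : ℕ) (v : Fin (k + 3) → R3),
    Function.Injective v ∧
    (∀ i j, i ≠ j →
      segment ℝ (v i) (v (i + 1)) ∩ segment ℝ (v j) (v (j + 1)) ⊆
        ({v i, v (i + 1)} ∩ {v j, v (j + 1)} : Set R3)) ∧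
    K = ⋃ i, segment ℝ (v i) (v (i + 1))

/-- An elementary move (triangle move): `K` meets the nondegenerate solid triangle `abc`
exactly in the side `ab`, and `K'` arises from `K` by replacing this side by the two others. -/
def DeltaMove (K K' : Set R3) : Prop :=
  ∃ a b c : R3, AffineIndependent ℝ ![a, b, c] ∧
    K ∩ convexHull ℝ {a, b, c} = segment ℝ a b ∧
    K' = (K \ segment ℝ a b) ∪ (segment ℝ a c ∪ segment ℝ c b)

/-- Isotopy of polygonal knots (and links): the equivalence relation generated by the
elementary moves. -/
def Isotopic (K K' : Set R3) : Prop :=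
  Relation.EqvGen DeltaMove K K'

/-- The unknot: a knot isotopic to the boundary of a nondegenerate triangle. -/
def IsUnknot (K : Set R3) : Prop :=
  ∃ a b c : R3, AffineIndependent ℝ ![a, b, c] ∧
    Isotopic K (segment ℝ a b ∪ segment ℝ b c ∪ segment ℝ c a)

/-- `K` is a connected sum of `K₁` and `K₂`: up to isotopy, `K` meets some plane `f = r` in
exactly two points `p` and `q`, and the parts of `K` on the two sides of the plane, each closed
up by the straight segment `pq`, are isotopic to `K₁` and `K₂`. -/
def IsConnectedSum (K K₁ K₂ : Set R3) : Prop :=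
  ∃ (P : Set R3) (f : R3 →ₗ[ℝ] ℝ) (r : ℝ) (p q : R3),
    Isotopic K P ∧ f ≠ 0 ∧ p ≠ q ∧
    P ∩ {x | f x = r} = {p, q} ∧
    Isotopic ((P ∩ {x | f x ≤ r}) ∪ segment ℝ p q) K₁ ∧
    Isotopic ((P ∩ {x | r ≤ f x}) ∪ segment ℝ p q) K₂

/-- A knot is prime if it is not the unknot and if in every decomposition of it as a connected
sum of two knots one of the summands is the unknot. -/
def IsPrimeKnot (K : Set R3) : Prop :=
  IsKnot K ∧ ¬ IsUnknot K ∧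
    ∀ K₁ K₂ : Set R3, IsKnot K₁ → IsKnot K₂ → IsConnectedSum K K₁ K₂ →
      IsUnknot K₁ ∨ IsUnknot K₂

/-- Braid words on `n` strands: the letter `(i, true)` is the generator that crosses the strands
in the positions `i` and `i + 1` (positions are `0, …, n - 1`), and `(i, false)` is its inverse.
The length of the word is the number of crossings of the braid. -/
abbrev BraidWord (n : ℕ) : Type := List (Fin (n - 1) × Bool)

/-- The geometric picture of one letter between the heights `y = k` and `y = k + 1`, on `n`
strands whose positions are `x = 0, …, n - 1`: the strand from `i` to `i + 1` is straight, the
strand from `i + 1` to `i` passes it on one side or the other, according to the sign of the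
letter, and all other strands are vertical. -/
def letterSet (n k : ℕ) (l : Fin (n - 1) × Bool) : Set R3 :=
  let i : ℝ := (l.1 : ℕ)
  let e : ℝ := if l.2 then 1 / 2 else -1 / 2
  segment ℝ ![i, k, 0] ![i + 1, k + 1, 0] ∪
  segment ℝ ![i + 1, k, 0] ![i + 1 / 2, k + 1 / 2, e] ∪
  segment ℝ ![i + 1 / 2, k + 1 / 2, e] ![i, k + 1, 0] ∪
  ⋃ (j : Fin n) (_ : (j : ℕ) ≠ l.1 ∧ (j : ℕ) ≠ l.1 + 1),
    segment ℝ ![((j : ℕ) : ℝ), k, 0] ![((j : ℕ) : ℝ), k + 1, 0]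

/-- The arc that leads in the plane `x = j` from the top end `(j, L, 0)` of a braid of height `L`
back to its bottom end `(j, 0, 0)`, around the axis of the closed braid, which is parallel to
the `x`-axis. -/
def closingArc (L j : ℕ) : Set R3 :=
  segment ℝ ![(j : ℝ), L, 0] ![(j : ℝ), L, 1] ∪
  segment ℝ ![(j : ℝ), L, 1] ![(j : ℝ), -1, 1] ∪
  segment ℝ ![(j : ℝ), -1, 1] ![(j : ℝ), -1, 0] ∪
  segment ℝ ![(j : ℝ), -1, 0] ![(j : ℝ), 0, 0]

/-- The closure of a braid word on `n` strands, a polygonal link. -/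
def braidClosure {n : ℕ} (w : BraidWord n) : Set R3 :=
  (⋃ k : Fin w.length, letterSet n k (w.get k)) ∪ ⋃ j : Fin n, closingArc w.length j

/-- The `n`-braid `w` represents `K`: its closure is isotopic to `K`. -/
def Represents {n : ℕ} (w : BraidWord n) (K : Set R3) : Prop :=
  Isotopic (braidClosure w) K

/-- `K` can be expressed as a closed braid on `n` strands. -/
def HasBraidRep (K : Set R3) (n : ℕ) : Prop :=
  ∃ w : BraidWord n, Represents w K

/-- The braid index `br(K)`. -/
noncomputable def braidIndex (K : Set R3) : ℕ :=
  sInf {n | HasBraidRep K n}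

/-- `b_n(K)`, the minimum length of an `n`-braid representing `K`; meaningful if there is such
a braid. -/
noncomputable def b (n : ℕ) (K : Set R3) : ℕ :=
  sInf {c | ∃ w : BraidWord n, Represents w K ∧ w.length = c}

/-- `b_n'(K) = b_n(K) - n`. -/
noncomputable def b' (n : ℕ) (K : Set R3) : ℤ :=
  (b n K : ℤ) - n

end KnotBraid

/-! Everything rests on one step (`b_succ_eq`): if `b n K ≤ 2 * n`, then `b (n + 1) K = b n K + 1`.
Stabilization gives `≤`. Suppose the inequality is strict. The permutation of a braid that closes to
a knot is one cycle through all strands, so its length plus its number of strands is odd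
(`odd_length_add`). By parity the strict inequality improves to `b (n + 1) K ≤ b n K - 1 < 2 * n`. A
shortest word on `n + 1` strands uses each of its `n` generators, because its closure is connected
(`countP_pos_of_connected`); hence some generator occurs exactly once. A plane through this crossing
exhibits `K` as a connected sum of the closures of the letters to its left and to its right, and
since `K` is prime, one of these closures is already `K` (`exists_word_of_single`). Stabilizing it
up to `n` strands costs one crossing per generator, which the discarded side had anyway, and the
single crossing is saved (`HasBraidRepOfLength.pred`). So `b n K ≤ b (n + 1) K - 1`, a
contradiction.

Consequently `b' n K` stays constant from the first `n` with `b' n K ≤ n` on, as this condition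
persists when `n` grows (`b'_eq_of_le`). For `N ≥ m`, stabilization from `m` to `N` strands gives
the condition at `N`; for `N < br(K) ≤ m` it holds at `m`.

Most of the work makes the topology precise for polygons and triangle moves. Three tools carry it.

Links are described locally: compact sets that look near each point like two rays in different
directions. This property and connectedness are isotopy invariants, and a connected link is a closed
polygon (`isKnot_of_isLink`), so the two parts of a cut knot are knots, as the definition of
primeness requires.

Isotopies are produced by continuous families of injective, piecewise affine maps
(`isotopic_of_family`): nearby embeddings of the edge graph differ by moving one vertex at a time,
and one vertex moves by two triangle moves.

A connected sum with an unknotted summand is isotopic to the other summand (`Cut.isotopic_lower`).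
The part below the plane is regarded as an arc inserted into the closed-up upper part; its convex
hull meets that link only in the chord. While triangle moves turn the upper part into a triangle,
the arc is shrunk out of the way and carried along by affine maps (`State.isotopic`). In the end the
triangle itself can be collapsed to the chord (`State.triangle`).

The isotopies of closed braids (removing layers without crossings, stabilization, closing up the two
halves of a cut braid) are explicit triangle moves in coordinates. -/

namespace KnotBraid

open Set Filter Topology

/-! ### Rays and germs of polygonal links -/

/-- The closed ray from `x` in the direction `u`. -/
def ray (x u : R3) : Set R3 := {y | ∃ t : ℝ, 0 ≤ t ∧ y = x + t • u}

/-- Near `x`, the set `K` consists of two different rays from `x`. -/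
def LocArc (K : Set R3) (x : R3) : Prop :=
  ∃ u v : R3, ¬ SameRay ℝ u v ∧ K =ᶠ[𝓝 x] (ray x u ∪ ray x v : Set R3)

/-- A polygonal link, described locally. -/
def IsLink (K : Set R3) : Prop := IsCompact K ∧ ∀ x ∈ K, LocArc K x

theorem self_mem_ray (x u : R3) : x ∈ ray x u := ⟨0, le_rfl, by simp⟩

theorem ray_smul {c : ℝ} (hc : 0 < c) (x u : R3) : ray x (c • u) = ray x u := by
  ext y
  constructor
  · rintro ⟨t, ht, rfl⟩
    exact ⟨t * c, by positivity, by rw [smul_smul]⟩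
  · rintro ⟨t, ht, rfl⟩
    exact ⟨t / c, by positivity, by rw [smul_smul, div_mul_cancel₀ _ hc.ne']⟩

theorem sameRay_smul_left_iff_of_pos {u v : R3} {c : ℝ} (hc : 0 < c) :
    SameRay ℝ (c • u) v ↔ SameRay ℝ u v :=
  ⟨fun h => by simpa [smul_smul, inv_mul_cancel₀ hc.ne'] using h.pos_smul_left (inv_pos.2 hc),
    fun h => h.pos_smul_left hc⟩

theorem sameRay_smul_right_iff_of_pos {u v : R3} {c : ℝ} (hc : 0 < c) :
    SameRay ℝ u (c • v) ↔ SameRay ℝ u v := by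
  rw [SameRay.sameRay_comm, sameRay_smul_left_iff_of_pos hc, SameRay.sameRay_comm]

theorem ne_zero_of_not_sameRay {u v : R3} (h : ¬ SameRay ℝ u v) : u ≠ 0 ∧ v ≠ 0 :=
  ⟨fun hu => h (hu ▸ SameRay.zero_left v), fun hv => h (hv ▸ SameRay.zero_right u)⟩

theorem eventually_along {x : R3} {P : R3 → Prop} (h : ∀ᶠ y in 𝓝 x, P y) (u : R3) :
    ∃ ε : ℝ, 0 < ε ∧ ∀ t, |t| ≤ ε → P (x + t • u) := by
  have hc : Tendsto (fun t : ℝ => x + t • u) (𝓝 0) (𝓝 x) := by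
    have : Continuous (fun t : ℝ => x + t • u) := by fun_prop
    simpa using this.tendsto 0
  obtain ⟨ε, hε, H⟩ := Metric.eventually_nhds_iff.1 (hc.eventually h)
  refine ⟨ε / 2, by positivity, fun t ht => H ?_⟩
  rw [Real.dist_eq, sub_zero]
  linarith

theorem ray_inter_ray {x u v : R3} (h : ¬ SameRay ℝ u v) {y : R3} (h1 : y ∈ ray x u)
    (h2 : y ∈ ray x v) : y = x := by
  obtain ⟨s, hs, rfl⟩ := h1
  obtain ⟨t, ht, hst⟩ := h2
  rcases hs.eq_or_lt with rfl | hs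
  · simp
  rcases ht.eq_or_lt with rfl | ht
  · simpa using hst
  · exact absurd (Or.inr (Or.inr ⟨s, t, hs, ht, add_left_cancel hst⟩)) h

theorem ray_eq_of_mem {x u v : R3} (hu : u ≠ 0) {t : ℝ} (ht : 0 < t) (h : x + t • u ∈ ray x v) :
    ∃ c : ℝ, 0 < c ∧ u = c • v := by
  obtain ⟨s, hs, h⟩ := h
  have h := add_left_cancel h
  rcases hs.eq_or_lt with rfl | hs
  · simp [ht.ne', hu] at h
  · refine ⟨s / t, by positivity, ?_⟩
    rw [div_eq_inv_mul, mul_smul, ← h, smul_smul, inv_mul_cancel₀ ht.ne', one_smul]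

/-- One point of the ray close to `x` decides: whichever of the two rays contains it has the same
direction. Directions are read off from germs in this way throughout. -/
theorem ray_subset_union {x u v w : R3} (hu : u ≠ 0)
    (h : ∀ᶠ y in 𝓝 x, y ∈ ray x u → y ∈ ray x v ∪ ray x w) :
    (∃ c : ℝ, 0 < c ∧ u = c • v) ∨ ∃ c : ℝ, 0 < c ∧ u = c • w := by
  obtain ⟨ε, hε, H⟩ := eventually_along h u
  have := H ε (by rw [abs_of_pos hε]) ⟨ε, hε.le, rfl⟩
  exact this.imp (ray_eq_of_mem hu hε) (ray_eq_of_mem hu hε)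

theorem LocArc.congr {K K' : Set R3} {x : R3} (h : LocArc K x) (hK : K' =ᶠ[𝓝 x] K) :
    LocArc K' x := by
  obtain ⟨u, v, huv, h⟩ := h
  exact ⟨u, v, huv, hK.trans h⟩

theorem LocArc.exists_other {K : Set R3} {x u : R3} (h : LocArc K x) (hu : u ≠ 0)
    (hK : ∀ᶠ y in 𝓝 x, y ∈ ray x u → y ∈ K) :
    ∃ v, ¬ SameRay ℝ u v ∧ K =ᶠ[𝓝 x] (ray x u ∪ ray x v : Set R3) := by
  obtain ⟨v, w, hvw, h⟩ := h
  have h' : ∀ᶠ y in 𝓝 x, y ∈ ray x u → y ∈ ray x v ∪ ray x w := by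
    filter_upwards [hK, eventuallyEq_set.1 h] with y h1 h2 h3 using h2.1 (h1 h3)
  rcases ray_subset_union hu h' with ⟨c, hc, rfl⟩ | ⟨c, hc, rfl⟩
  · refine ⟨w, ?_, ?_⟩
    · rwa [sameRay_smul_left_iff_of_pos hc]
    · rwa [ray_smul hc]
  · refine ⟨v, ?_, ?_⟩
    · rw [sameRay_smul_left_iff_of_pos hc]; exact fun h => hvw h.symm
    · rwa [ray_smul hc, union_comm]

theorem LocArc.eq_rays {K : Set R3} {x u v : R3} (h : LocArc K x) (huv : ¬ SameRay ℝ u v)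
    (hu : ∀ᶠ y in 𝓝 x, y ∈ ray x u → y ∈ K) (hv : ∀ᶠ y in 𝓝 x, y ∈ ray x v → y ∈ K) :
    K =ᶠ[𝓝 x] (ray x u ∪ ray x v : Set R3) := by
  obtain ⟨hu0, hv0⟩ := ne_zero_of_not_sameRay huv
  obtain ⟨w, huw, h⟩ := h.exists_other hu0 hu
  have h' : ∀ᶠ y in 𝓝 x, y ∈ ray x v → y ∈ ray x u ∪ ray x w := by
    filter_upwards [hv, eventuallyEq_set.1 h] with y h1 h2 h3 using h2.1 (h1 h3)
  rcases ray_subset_union hv0 h' with ⟨c, hc, rfl⟩ | ⟨c, hc, rfl⟩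
  · exact absurd (SameRay.sameRay_pos_smul_right u hc) huv
  · rwa [ray_smul hc]

/-- A germ made of two rays has no room for a third: the two directions of `X` must be those of `K`.
Inclusions of local arcs are thus equalities of germs. -/
theorem LocArc.eq_of_subset {K X : Set R3} {x : R3} (h : LocArc K x) (hX : LocArc X x)
    (hs : X ⊆ K) : K =ᶠ[𝓝 x] X := by
  obtain ⟨u, v, huv, hX⟩ := hX
  refine (h.eq_rays huv ?_ ?_).trans hX.symm
  · filter_upwards [eventuallyEq_set.1 hX] with y hy h1 using hs (hy.2 (Or.inl h1))
  · filter_upwards [eventuallyEq_set.1 hX] with y hy h1 using hs (hy.2 (Or.inr h1))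

theorem germ_empty {K : Set R3} {x : R3} (hK : IsClosed K) (hx : x ∉ K) :
    K =ᶠ[𝓝 x] (∅ : Set R3) := by
  rw [eventuallyEq_set]
  filter_upwards [hK.isOpen_compl.mem_nhds hx] with y hy
  simp only [mem_empty_iff_false, iff_false]
  exact hy

theorem isCompact_segment (a b : R3) : IsCompact (segment ℝ a b) := by
  rw [segment_eq_image_lineMap]
  exact isCompact_Icc.image (by fun_prop)

theorem segment_eq_lines (a b : R3) :
    segment ℝ a b = {y | ∃ t : ℝ, 0 ≤ t ∧ t ≤ 1 ∧ y = a + t • (b - a)} := by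
  rw [segment_eq_image']
  ext y
  simp only [mem_image, mem_Icc, mem_ofPred_eq]
  constructor
  · rintro ⟨t, ⟨h0, h1⟩, rfl⟩; exact ⟨t, h0, h1, rfl⟩
  · rintro ⟨t, h0, h1, rfl⟩; exact ⟨t, ⟨h0, h1⟩, rfl⟩

theorem segment_germ_left {a b : R3} (hab : a ≠ b) :
    (segment ℝ a b : Set R3) =ᶠ[𝓝 a] ray a (b - a) := by
  rw [eventuallyEq_set, segment_eq_lines]
  have hpos : 0 < ‖b - a‖ := norm_pos_iff.2 (sub_ne_zero.2 hab.symm)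
  filter_upwards [Metric.ball_mem_nhds a hpos] with y hy
  constructor
  · rintro ⟨t, h0, h1, rfl⟩; exact ⟨t, h0, rfl⟩
  · rintro ⟨t, h0, rfl⟩
    refine ⟨t, h0, ?_, rfl⟩
    rw [Metric.mem_ball, dist_eq_norm, add_sub_cancel_left, norm_smul, Real.norm_of_nonneg h0] at hy
    by_contra h
    push Not at h
    nlinarith

theorem segment_germ_right {a b : R3} (hab : a ≠ b) :
    (segment ℝ a b : Set R3) =ᶠ[𝓝 b] ray b (a - b) := by
  rw [segment_symm]
  exact segment_germ_left hab.symm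

theorem segment_split {a b x : R3} (hx : x ∈ segment ℝ a b) :
    segment ℝ a b = segment ℝ x a ∪ segment ℝ x b := by
  rw [segment_eq_lines] at hx
  obtain ⟨s, hs0, hs1, rfl⟩ := hx
  apply Subset.antisymm
  · intro y hy
    rw [segment_eq_lines] at hy
    obtain ⟨t, ht0, ht1, rfl⟩ := hy
    rcases le_total t s with h | h
    · left
      rw [segment_symm, segment_eq_lines]
      rcases hs0.eq_or_lt with rfl | hs0
      · exact ⟨0, le_rfl, zero_le_one, by simp [le_antisymm h ht0]⟩
      · refine ⟨t / s, by positivity, (div_le_one hs0).2 h, ?_⟩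
        rw [add_sub_cancel_left, smul_smul, div_mul_cancel₀ _ hs0.ne']
    · right
      rw [segment_eq_lines]
      rcases hs1.eq_or_lt with rfl | hs1
      · exact ⟨0, le_rfl, zero_le_one, by simp [le_antisymm ht1 h]⟩
      · have h1s : 0 < 1 - s := by linarith
        refine ⟨(t - s) / (1 - s), div_nonneg (by linarith) h1s.le,
          (div_le_one h1s).2 (by linarith), ?_⟩
        have : b - (a + s • (b - a)) = (1 - s) • (b - a) := by module
        rw [this, smul_smul, div_mul_cancel₀ _ h1s.ne']
        module
  · have hm : a + s • (b - a) ∈ segment ℝ a b := by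
      rw [segment_eq_lines]; exact ⟨s, hs0, hs1, rfl⟩
    exact union_subset ((convex_segment a b).segment_subset hm (left_mem_segment ℝ a b))
      ((convex_segment a b).segment_subset hm (right_mem_segment ℝ a b))

theorem locArc_of_ends {x a b : R3} (h : ¬ SameRay ℝ (a - x) (b - x)) :
    LocArc (segment ℝ x a ∪ segment ℝ x b) x := by
  obtain ⟨ha, hb⟩ := ne_zero_of_not_sameRay h
  exact ⟨_, _, h, (segment_germ_left (sub_ne_zero.1 ha).symm).union
    (segment_germ_left (sub_ne_zero.1 hb).symm)⟩

theorem not_sameRay_neg_smul {u : R3} (hu : u ≠ 0) {s t : ℝ} (hs : 0 < s) (ht : 0 < t) :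
    ¬ SameRay ℝ (s • u) (-(t • u)) := by
  intro h
  rw [← smul_neg, sameRay_smul_left_iff_of_pos hs, sameRay_smul_right_iff_of_pos ht] at h
  exact hu (eq_zero_of_sameRay_self_neg h)

/-! ### Replacing an arc of a link by another arc -/

/-- A polygonal arc with the end points `a` and `b`, described locally. -/
structure IsArc (X : Set R3) (a b : R3) : Prop where
  compact : IsCompact X
  left_mem : a ∈ X
  right_mem : b ∈ X
  locArc : ∀ x ∈ X, x ≠ a → x ≠ b → LocArc X x
  left_germ : ∃ u : R3, u ≠ 0 ∧ X =ᶠ[𝓝 a] ray a u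
  right_germ : ∃ u : R3, u ≠ 0 ∧ X =ᶠ[𝓝 b] ray b u
  connected : IsConnected X

/-- Disjointness makes `R` the difference `(R ∪ X) \ X`, so its germ is obtained by subtraction. -/
theorem germ_rest {R X : Set R3} {a : R3} (hRX : Disjoint R X) {S T : Set R3}
    (hK : (R ∪ X : Set R3) =ᶠ[𝓝 a] S) (hX : X =ᶠ[𝓝 a] T) : R =ᶠ[𝓝 a] (S \ T : Set R3) := by
  have h := hK.diff hX
  rwa [union_sdiff_right, hRX.sdiff_eq_left] at h

/-- At the end `a` the rest is a ray along some `v` without its origin, and only the direction of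
the arc changes. The new direction cannot be that of `v`, for then `R` and `Y` would share points
near `a`. -/
theorem locArc_end {R X Y : Set R3} {a u u' : R3} (hu : u ≠ 0) (hu' : u' ≠ 0)
    (hX : X =ᶠ[𝓝 a] ray a u) (hY : Y =ᶠ[𝓝 a] ray a u') (hRX : Disjoint R X) (hRY : Disjoint R Y)
    (h : LocArc (R ∪ X) a) : LocArc (R ∪ Y) a := by
  obtain ⟨v, huv, hK⟩ := h.exists_other hu (by
    filter_upwards [eventuallyEq_set.1 hX] with y hy h1 using Or.inr (hy.2 h1))
  have hR := germ_rest hRX hK hX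
  have hv := (ne_zero_of_not_sameRay huv).2
  refine ⟨u', v, ?_, ?_⟩
  · intro hs
    obtain ⟨r₁, r₂, h1, h2, hr⟩ := hs.exists_pos hu' hv
    have hray : ray a u' = ray a v := by rw [← ray_smul h1, hr, ray_smul h2]
    rw [hray] at hY
    obtain ⟨ε, hε, H⟩ := eventually_along
      ((eventuallyEq_set.1 hR).and (eventuallyEq_set.1 hY)) v
    have hm : a + ε • v ∈ ray a v := ⟨ε, hε.le, rfl⟩
    obtain ⟨H1, H2⟩ := H ε (abs_of_pos hε).le
    refine disjoint_left.1 hRY (H1.2 ⟨Or.inr hm, fun h' => ?_⟩) (H2.2 hm)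
    have := ray_inter_ray huv h' hm
    simp [hε.ne', hv] at this
  · refine (hR.union hY).trans (Eq.eventuallyEq ?_)
    ext y
    constructor
    · rintro (⟨h1 | h1, h2⟩ | h1)
      · exact absurd h1 h2
      · exact Or.inr h1
      · exact Or.inl h1
    · rintro (h1 | h1)
      · exact Or.inr h1
      · by_cases h2 : y ∈ ray a u
        · exact Or.inr (ray_inter_ray huv h2 h1 ▸ self_mem_ray a u')
        · exact Or.inl ⟨Or.inr h1, h2⟩

/-- At an inner point of the arc, `X` fills the whole germ of the link, so the rest can accumulate
on `X` only at its ends. -/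
theorem closure_rest_subset {R X : Set R3} {a b : R3} (hX : IsArc X a b) (hRX : Disjoint R X)
    (h : IsLink (R ∪ X)) : closure R ⊆ R ∪ {a, b} := by
  intro x hx
  have hxK : x ∈ R ∪ X := h.1.isClosed.closure_subset_iff.2 subset_union_left hx
  rcases hxK with hxR | hxX
  · exact Or.inl hxR
  by_contra hne
  simp only [mem_union, mem_insert_iff, mem_singleton_iff, not_or] at hne
  have hXl := hX.locArc x hxX hne.2.1 hne.2.2
  have hg := (h.2 x (Or.inr hxX)).eq_of_subset hXl subset_union_right
  have hR := germ_rest hRX hg (EventuallyEq.refl _ X)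
  rw [sdiff_self, eventuallyEq_set] at hR
  obtain ⟨y, hy, hyR⟩ := mem_closure_iff_nhds.1 hx _ hR
  exact hy.1 hyR

/-- Points of the new set are of three kinds: the two ends, treated by `locArc_end`; other points of
`Y`, which lie off the old link, so that only `Y` is seen nearby; and points of `R` off `Y`, where
the germ is unchanged. The set is closed since `R` lacks at most the two ends, which belong to `Y`.
-/
theorem IsLink.replace_arc {R X Y : Set R3} {a b : R3} (hX : IsArc X a b) (hY : IsArc Y a b)
    (hRX : Disjoint R X) (hRY : Disjoint R Y) (hXY : X ∩ Y ⊆ {a, b}) (h : IsLink (R ∪ X)) :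
    IsLink (R ∪ Y) := by
  have hcl := closure_rest_subset hX hRX h
  have hab : ({a, b} : Set R3) ⊆ Y := by
    rintro x (rfl | rfl)
    exacts [hY.left_mem, hY.right_mem]
  have hRc : IsCompact (closure R) :=
    h.1.of_isClosed_subset isClosed_closure
      (h.1.isClosed.closure_subset_iff.2 subset_union_left)
  have hEq : R ∪ Y = closure R ∪ Y := by
    apply Subset.antisymm (union_subset_union_left _ subset_closure)
    refine union_subset (hcl.trans (union_subset_union_right _ hab)) subset_union_right
  refine ⟨hEq ▸ hRc.union hY.compact, ?_⟩
  rintro x hx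
  by_cases hxY : x ∈ Y
  · by_cases hxa : x = a
    · subst hxa
      obtain ⟨u, hu, hXu⟩ := hX.left_germ
      obtain ⟨u', hu', hYu⟩ := hY.left_germ
      exact locArc_end hu hu' hXu hYu hRX hRY (h.2 _ (Or.inr hX.left_mem))
    by_cases hxb : x = b
    · subst hxb
      obtain ⟨u, hu, hXu⟩ := hX.right_germ
      obtain ⟨u', hu', hYu⟩ := hY.right_germ
      exact locArc_end hu hu' hXu hYu hRX hRY (h.2 _ (Or.inr hX.right_mem))
    · have hxK : x ∉ R ∪ X := by
        rintro (h1 | h1)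
        · exact disjoint_left.1 hRY h1 hxY
        · rcases hXY ⟨h1, hxY⟩ with h2 | h2
          exacts [hxa h2, hxb h2]
      have hg := germ_empty h.1.isClosed hxK
      refine (hY.locArc x hxY hxa hxb).congr ?_
      have hg' : (R ∪ X ∪ Y : Set R3) =ᶠ[𝓝 x] (∅ ∪ Y : Set R3) := hg.union (EventuallyEq.refl _ Y)
      rw [empty_union] at hg'
      rw [eventuallyEq_set] at hg' ⊢
      filter_upwards [hg'] with y hy
      exact ⟨fun h1 => hy.1 (h1.imp Or.inl id), Or.inr⟩
  · have hxR : x ∈ R := hx.resolve_right hxY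
    have hxX : x ∉ X := disjoint_left.1 hRX hxR
    refine (h.2 x (Or.inl hxR)).congr ?_
    exact (EventuallyEq.refl _ R).union
      ((germ_empty hY.compact.isClosed hxY).trans (germ_empty hX.compact.isClosed hxX).symm)

/-- If two connected sets `X` and `Y` meet, and `R ∪ X` is connected where `R` has its limit points
in `R ∪ (X ∩ Y)`, then `R ∪ Y` is connected. -/
theorem isConnected_replace {R X Y : Set R3} (hXc : IsClosed X) (hX : X.Nonempty)
    (hY : IsConnected Y)
    (hRX : R ∩ X ⊆ Y) (hcl : closure R ⊆ R ∪ (X ∩ Y)) (h : IsConnected (R ∪ X)) :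
    IsConnected (R ∪ Y) := by
  refine ⟨hY.nonempty.mono subset_union_right, ?_⟩
  have key : ∀ C₁ C₂ : Set R3, IsClosed C₁ → IsClosed C₂ → R ∪ Y ⊆ C₁ ∪ C₂ →
      ((R ∪ Y) ∩ (C₁ ∩ C₂) = ∅) → Y ⊆ C₁ → ((R ∪ Y) ∩ C₂).Nonempty → False := by
    intro C₁ C₂ h1 h2 hsub hdis hYC ⟨z, hz, hzC⟩
    have hYC2 : ∀ y ∈ Y, y ∉ C₂ := fun y hy hyC => by
      have : y ∈ (R ∪ Y) ∩ (C₁ ∩ C₂) := ⟨Or.inr hy, hYC hy, hyC⟩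
      rw [hdis] at this; exact this
    have hzR : z ∈ R := hz.resolve_right fun hy => hYC2 z hy hzC
    -- A separation of `R ∪ Y` with `Y` inside `C₁` becomes one of `R ∪ X` by adding all of `X` to
    -- the side of `C₁`. By the hypothesis on `closure R`, a common point of the two closed sets
    -- would already be common to `C₁` and `C₂` within `R ∪ Y`.
    have hp := isPreconnected_closed_iff.1 h.isPreconnected (closure R ∩ C₁ ∪ X)
      (closure R ∩ C₂) ((isClosed_closure.inter h1).union hXc) (isClosed_closure.inter h2) ?_ ?_ ?_
    · obtain ⟨x, -, hx1, hx2⟩ := hp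
      rcases hx1 with hx1 | hx1
      · have hx : x ∈ R ∪ Y := (hcl hx1.1).imp id And.right
        have : x ∈ (R ∪ Y) ∩ (C₁ ∩ C₂) := ⟨hx, hx1.2, hx2.2⟩
        rw [hdis] at this; exact this
      · rcases hcl hx2.1 with h3 | h3
        · exact hYC2 x (hRX ⟨h3, hx1⟩) hx2.2
        · exact hYC2 x h3.2 hx2.2
    · rintro x (hx | hx)
      · exact (hsub (Or.inl hx)).imp (fun h => Or.inl ⟨subset_closure hx, h⟩)
          (fun h => ⟨subset_closure hx, h⟩)
      · exact Or.inl (Or.inr hx)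
    · obtain ⟨x, hx⟩ := hX
      exact ⟨x, Or.inr hx, Or.inr hx⟩
    · exact ⟨z, Or.inl hzR, subset_closure hzR, hzC⟩
  rw [isPreconnected_closed_iff]
  intro C₁ C₂ h1 h2 hsub hn1 hn2
  by_contra hne
  rw [not_nonempty_iff_eq_empty] at hne
  have hYs : Y ⊆ C₁ ∨ Y ⊆ C₂ := by
    by_contra hc
    push Not at hc
    obtain ⟨⟨y1, hy1, hy1'⟩, y2, hy2, hy2'⟩ := (not_subset.1 hc.1), (not_subset.1 hc.2)
    obtain ⟨y, hy, hyC⟩ := isPreconnected_closed_iff.1 hY.isPreconnected C₁ C₂ h1 h2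
      (subset_union_right.trans hsub) ⟨y2, hy2, (hsub (Or.inr hy2)).resolve_right hy2'⟩
      ⟨y1, hy1, (hsub (Or.inr hy1)).resolve_left hy1'⟩
    have : y ∈ (R ∪ Y) ∩ (C₁ ∩ C₂) := ⟨Or.inr hy, hyC⟩
    rw [hne] at this; exact this
  rcases hYs with hYs | hYs
  · exact key C₁ C₂ h1 h2 hsub hne hYs hn2
  · exact key C₂ C₁ h2 h1 (by rwa [union_comm C₂]) (by rwa [inter_comm C₂]) hYs hn1

theorem IsLink.replace_arc_connected {R X Y : Set R3} {a b : R3} (hX : IsArc X a b)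
    (hY : IsArc Y a b) (hRX : Disjoint R X) (h : IsLink (R ∪ X))
    (hc : IsConnected (R ∪ X)) : IsConnected (R ∪ Y) := by
  refine isConnected_replace hX.compact.isClosed ⟨a, hX.left_mem⟩ hY.connected ?_
    ((closure_rest_subset hX hRX h).trans (union_subset_union_right _ ?_)) hc
  · rw [hRX.inter_eq]; exact empty_subset _
  · rintro x (rfl | rfl)
    exacts [⟨hX.left_mem, hY.left_mem⟩, ⟨hX.right_mem, hY.right_mem⟩]

theorem isConnected_segment (a b : R3) : IsConnected (segment ℝ a b) :=
  (convex_segment a b).isConnected ⟨a, left_mem_segment ℝ a b⟩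

theorem not_sameRay_of_mem_segment {a b x : R3} (hx : x ∈ segment ℝ a b) (ha : x ≠ a)
    (hb : x ≠ b) : ¬ SameRay ℝ (a - x) (b - x) := by
  rw [segment_eq_lines] at hx
  obtain ⟨s, hs0, hs1, rfl⟩ := hx
  have hab : b - a ≠ 0 := fun h => ha (by simp [h])
  have h0 : 0 < s := hs0.lt_of_ne fun h => ha (by simp [← h])
  have h1 : s < 1 := hs1.lt_of_ne fun h => hb (by simp [h])
  have e1 : a - (a + s • (b - a)) = -(s • (b - a)) := by module
  have e2 : b - (a + s • (b - a)) = (1 - s) • (b - a) := by module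
  rw [e1, e2, SameRay.sameRay_comm]
  exact not_sameRay_neg_smul hab (by linarith) h0

theorem locArc_segment {a b x : R3} (hx : x ∈ segment ℝ a b) (ha : x ≠ a)
    (hb : x ≠ b) : LocArc (segment ℝ a b) x := by
  rw [segment_split hx]
  exact locArc_of_ends (not_sameRay_of_mem_segment hx ha hb)

theorem isArc_segment {a b : R3} (hab : a ≠ b) : IsArc (segment ℝ a b) a b :=
  ⟨isCompact_segment a b, left_mem_segment ℝ a b, right_mem_segment ℝ a b,
    fun _ hx ha hb => locArc_segment hx ha hb,
    ⟨b - a, sub_ne_zero.2 hab.symm, segment_germ_left hab⟩,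
    ⟨a - b, sub_ne_zero.2 hab, segment_germ_right hab⟩, isConnected_segment a b⟩

theorem isArc_two_segments {a b c : R3} (hca : c ≠ a) (hcb : c ≠ b)
    (h : segment ℝ a c ∩ segment ℝ c b ⊆ {c}) : IsArc (segment ℝ a c ∪ segment ℝ c b) a b := by
  have ha : a ∉ segment ℝ c b := fun h' => hca (h ⟨left_mem_segment ℝ a c, h'⟩).symm
  have hb : b ∉ segment ℝ a c := fun h' => hcb (h ⟨h', right_mem_segment ℝ c b⟩).symm
  have germ : ∀ {S T : Set R3} {x : R3}, IsClosed T → x ∉ T → (S ∪ T : Set R3) =ᶠ[𝓝 x] S := by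
    intro S T x hT hx
    simpa using (EventuallyEq.refl (𝓝 x) S).union (germ_empty hT hx)
  refine ⟨(isCompact_segment a c).union (isCompact_segment c b), Or.inl (left_mem_segment ℝ a c),
    Or.inr (right_mem_segment ℝ c b), ?_, ⟨c - a, sub_ne_zero.2 hca, ?_⟩,
    ⟨c - b, sub_ne_zero.2 hcb, ?_⟩, ?_⟩
  · intro x hx hxa hxb
    by_cases hxc : x = c
    · subst hxc
      rw [segment_symm ℝ a x]
      refine locArc_of_ends fun hs => ?_
      obtain ⟨r₁, r₂, h1, h2, hr⟩ := hs.exists_pos (sub_ne_zero.2 hca.symm) (sub_ne_zero.2 hcb.symm)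
      have hpos : 0 < r₁ + r₂ := by positivity
      -- If both sides left the corner in the same direction, this point would lie on both: from `r₁
      -- • (a - x) = r₂ • (b - x)`, division by `r₁ + r₂` brings both parameters below `1`.
      have hmem : x + (r₁ / (r₁ + r₂)) • (a - x) ∈ segment ℝ a x ∩ segment ℝ x b := by
        constructor
        · rw [segment_symm, segment_eq_lines]
          exact ⟨_, by positivity, (div_le_one hpos).2 (by linarith), rfl⟩
        · rw [segment_eq_lines]
          refine ⟨r₂ / (r₁ + r₂), by positivity, (div_le_one hpos).2 (by linarith), ?_⟩
          rw [div_eq_inv_mul, div_eq_inv_mul, mul_smul, mul_smul, hr]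
      have := h hmem
      simp [hpos.ne', h1.ne', sub_eq_zero, hca.symm] at this
    · rcases hx with hx | hx
      · have hx' : x ∉ segment ℝ c b := fun h' => hxc (h ⟨hx, h'⟩)
        exact (locArc_segment hx hxa hxc).congr (germ (isCompact_segment c b).isClosed hx')
      · have hx' : x ∉ segment ℝ a c := fun h' => hxc (h ⟨h', hx⟩)
        rw [union_comm]
        exact (locArc_segment hx hxc hxb).congr (germ (isCompact_segment a c).isClosed hx')
  · exact (germ (isCompact_segment c b).isClosed ha).trans (segment_germ_left hca.symm)
  · rw [union_comm]
    exact (germ (isCompact_segment a c).isClosed hb).trans (segment_germ_right hcb)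
  · exact IsConnected.union ⟨c, right_mem_segment ℝ a c, left_mem_segment ℝ c b⟩
      (isConnected_segment a c) (isConnected_segment c b)

/-! ### Triangles, elementary moves and their invariants -/

/-- The solid triangle with the given corners. -/
abbrev tri (a b c : R3) : Set R3 := convexHull ℝ {a, b, c}

theorem mem_tri {a b c y : R3} : y ∈ tri a b c ↔
    ∃ α β γ : ℝ, 0 ≤ α ∧ 0 ≤ β ∧ 0 ≤ γ ∧ α + β + γ = 1 ∧ y = α • a + β • b + γ • c := by
  constructor
  · intro h
    rw [tri, convexHull_insert ⟨b, by simp⟩, convexHull_pair, mem_convexJoin] at h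
    obtain ⟨a', ha', z, ⟨s, t, hs, ht, hst, rfl⟩, ⟨s', t', hs', ht', hst', rfl⟩⟩ := h
    rw [mem_singleton_iff] at ha'
    subst ha'
    refine ⟨s', t' * s, t' * t, hs', by positivity, by positivity, ?_, by module⟩
    rw [add_assoc, ← mul_add, hst, mul_one, hst']
  · rintro ⟨α, β, γ, h1, h2, h3, h4, rfl⟩
    have := (convex_convexHull ℝ ({a, b, c} : Set R3)).sum_mem (t := Finset.univ)
      (w := ![α, β, γ]) (z := ![a, b, c]) (by intro i _; fin_cases i <;> simpa)
      (by simp [Fin.sum_univ_three, h4])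
      (by intro i _; apply subset_convexHull; fin_cases i <;> simp)
    simpa [Fin.sum_univ_three] using this

theorem tri_weights {a b c : R3} (h : AffineIndependent ℝ ![a, b, c]) {α β γ : ℝ}
    (h0 : α + β + γ = 0) (h1 : α • a + β • b + γ • c = 0) : α = 0 ∧ β = 0 ∧ γ = 0 := by
  have := affineIndependent_iff.1 h Finset.univ ![α, β, γ] (by simpa [Fin.sum_univ_three] using h0)
    (by simpa [Fin.sum_univ_three] using h1)
  exact ⟨this 0 (Finset.mem_univ _), this 1 (Finset.mem_univ _), this 2 (Finset.mem_univ _)⟩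

theorem affineIndependent_of_weights {a b c : R3}
    (h : ∀ α β γ : ℝ, α + β + γ = 0 → α • a + β • b + γ • c = 0 → α = 0 ∧ β = 0 ∧ γ = 0) :
    AffineIndependent ℝ ![a, b, c] := by
  rw [affineIndependent_iff_of_fintype]
  intro w hw0 hw
  rw [Finset.weightedVSub_eq_linear_combination _ hw0] at hw
  obtain ⟨h1, h2, h3⟩ := h (w 0) (w 1) (w 2) (by simpa [Fin.sum_univ_three] using hw0)
    (by simpa [Fin.sum_univ_three] using hw)
  intro i
  fin_cases i
  exacts [h1, h2, h3]

theorem affineIndependent_swap {a b c : R3} (h : AffineIndependent ℝ ![a, b, c]) :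
    AffineIndependent ℝ ![b, a, c] :=
  affineIndependent_of_weights fun α β γ h0 h1 => by
    obtain ⟨h2, h3, h4⟩ := tri_weights h (α := β) (β := α) (γ := γ) (by linarith)
      (by rw [← h1]; module)
    exact ⟨h3, h2, h4⟩

theorem affineIndependent_rotate {a b c : R3} (h : AffineIndependent ℝ ![a, b, c]) :
    AffineIndependent ℝ ![b, c, a] :=
  affineIndependent_of_weights fun α β γ h0 h1 => by
    obtain ⟨h2, h3, h4⟩ := tri_weights h (α := γ) (β := α) (γ := β) (by linarith)
      (by rw [← h1]; module)
    exact ⟨h3, h4, h2⟩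

theorem segment_subset_tri_left (a b c : R3) : segment ℝ a b ⊆ tri a b c :=
  (convex_convexHull ℝ _).segment_subset (subset_convexHull _ _ (by simp))
    (subset_convexHull _ _ (by simp))

theorem segment_subset_tri_ac (a b c : R3) : segment ℝ a c ⊆ tri a b c :=
  (convex_convexHull ℝ _).segment_subset (subset_convexHull _ _ (by simp))
    (subset_convexHull _ _ (by simp))

theorem segment_subset_tri_cb (a b c : R3) : segment ℝ c b ⊆ tri a b c :=
  (convex_convexHull ℝ _).segment_subset (subset_convexHull _ _ (by simp))
    (subset_convexHull _ _ (by simp))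

theorem tri_swap (a b c : R3) : tri b a c = tri a b c := by
  rw [tri, insert_comm]

theorem segment_ac_inter_cb {a b c : R3} (h : AffineIndependent ℝ ![a, b, c]) :
    segment ℝ a c ∩ segment ℝ c b ⊆ {c} := by
  rintro x ⟨⟨s, t, hs, ht, hst, rfl⟩, ⟨s', t', hs', ht', hst', he⟩⟩
  obtain ⟨h1, h2, h3⟩ := tri_weights h (α := s) (β := -t') (γ := t - s') (by linarith)
    (by rw [← sub_eq_zero.2 he.symm]; module)
  rw [h1] at hst ⊢
  simp_all

theorem segment_ab_inter_ac {a b c : R3} (h : AffineIndependent ℝ ![a, b, c]) :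
    segment ℝ a b ∩ segment ℝ a c ⊆ {a} := by
  rw [segment_symm ℝ a b]
  exact segment_ac_inter_cb (affineIndependent_rotate h)

theorem tri_ne {a b c : R3} (h : AffineIndependent ℝ ![a, b, c]) : a ≠ b ∧ c ≠ a ∧ c ≠ b := by
  have := h.injective
  refine ⟨fun e => ?_, fun e => ?_, fun e => ?_⟩
  · exact absurd (@this 0 1 (by simpa using e)) (by decide)
  · exact absurd (@this 2 0 (by simpa using e)) (by decide)
  · exact absurd (@this 2 1 (by simpa using e)) (by decide)

theorem ab_inter_acb {a b c : R3} (h : AffineIndependent ℝ ![a, b, c]) :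
    segment ℝ a b ∩ (segment ℝ a c ∪ segment ℝ c b) ⊆ {a, b} := by
  rintro x ⟨h1, h2 | h2⟩
  · exact Or.inl (segment_ab_inter_ac h ⟨h1, h2⟩)
  · right
    rw [segment_symm] at h1 h2
    exact segment_ab_inter_ac (affineIndependent_swap h) ⟨h1, h2⟩

theorem isArc_acb {a b c : R3} (h : AffineIndependent ℝ ![a, b, c]) :
    IsArc (segment ℝ a c ∪ segment ℝ c b) a b :=
  isArc_two_segments (tri_ne h).2.1 (tri_ne h).2.2 (segment_ac_inter_cb h)

/-- The rest may contain `a` and `b`: the move deletes them with the closed side, but the new sides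
bring them back. In this form only the intersection of the rest with the triangle has to be checked.
-/
theorem deltaMove_of_rest {R : Set R3} {a b c : R3} (h : AffineIndependent ℝ ![a, b, c])
    (hR : R ∩ tri a b c ⊆ {a, b}) :
    DeltaMove (R ∪ segment ℝ a b) (R ∪ (segment ℝ a c ∪ segment ℝ c b)) := by
  refine ⟨a, b, c, h, ?_, ?_⟩
  · apply Subset.antisymm
    · rintro x ⟨h1 | h1, h2⟩
      · rcases hR ⟨h1, h2⟩ with rfl | rfl
        exacts [left_mem_segment ℝ _ _, right_mem_segment ℝ _ _]
      · exact h1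
    · exact fun x hx => ⟨Or.inr hx, segment_subset_tri_left a b c hx⟩
  · ext x
    constructor
    · rintro (h1 | h1)
      · by_cases h2 : x ∈ segment ℝ a b
        · rcases hR ⟨h1, segment_subset_tri_left a b c h2⟩ with rfl | rfl
          exacts [Or.inr (Or.inl (left_mem_segment ℝ _ _)),
            Or.inr (Or.inr (right_mem_segment ℝ _ _))]
        · exact Or.inl ⟨Or.inl h1, h2⟩
      · exact Or.inr h1
    · rintro (⟨h1 | h1, h2⟩ | h1)
      exacts [Or.inl h1, absurd h1 h2, Or.inr h1]

theorem isotopic_refl (K : Set R3) : Isotopic K K := Relation.EqvGen.refl K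

theorem Isotopic.symm {K K' : Set R3} (h : Isotopic K K') : Isotopic K' K :=
  Relation.EqvGen.symm _ _ h

theorem Isotopic.trans {K K' K'' : Set R3} (h : Isotopic K K') (h' : Isotopic K' K'') :
    Isotopic K K'' := Relation.EqvGen.trans _ _ _ h h'

theorem DeltaMove.isotopic {K K' : Set R3} (h : DeltaMove K K') : Isotopic K K' :=
  Relation.EqvGen.rel _ _ h

/-- Replacing the side `ab` of a triangle by the two other sides, in a set `R ∪ ab`. -/
theorem isotopic_of_rest {R : Set R3} {a b c : R3} (h : AffineIndependent ℝ ![a, b, c])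
    (hR : R ∩ tri a b c ⊆ {a, b}) :
    Isotopic (R ∪ segment ℝ a b) (R ∪ (segment ℝ a c ∪ segment ℝ c b)) :=
  (deltaMove_of_rest h hR).isotopic

/-- The part of a knot that an elementary move leaves alone. -/
theorem DeltaMove.exists_rest {K K' : Set R3} (h : DeltaMove K K') :
    ∃ (R : Set R3) (a b c : R3), AffineIndependent ℝ ![a, b, c] ∧ Disjoint R (tri a b c) ∧
      K = R ∪ segment ℝ a b ∧ K' = R ∪ (segment ℝ a c ∪ segment ℝ c b) := by
  obtain ⟨a, b, c, habc, hK, rfl⟩ := h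
  refine ⟨K \ segment ℝ a b, a, b, c, habc, ?_, ?_, rfl⟩
  · rw [disjoint_left]
    rintro x ⟨h1, h2⟩ h3
    exact h2 (hK ▸ ⟨h1, h3⟩)
  · rw [sdiff_union_self, union_eq_self_of_subset_right]
    exact hK ▸ inter_subset_left

theorem DeltaMove.isLink {K K' : Set R3} (h : DeltaMove K K') : IsLink K ↔ IsLink K' := by
  obtain ⟨R, a, b, c, habc, hR, rfl, rfl⟩ := h.exists_rest
  have h1 := isArc_segment (tri_ne habc).1
  have h2 := isArc_acb habc
  have d1 : Disjoint R (segment ℝ a b) := hR.mono_right (segment_subset_tri_left a b c)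
  have d2 : Disjoint R (segment ℝ a c ∪ segment ℝ c b) := hR.mono_right
    (union_subset (segment_subset_tri_ac a b c) (segment_subset_tri_cb a b c))
  exact ⟨fun h => h.replace_arc h1 h2 d1 d2 (ab_inter_acb habc),
    fun h => h.replace_arc h2 h1 d2 d1 (by rw [inter_comm]; exact ab_inter_acb habc)⟩

theorem DeltaMove.isConnected {K K' : Set R3} (h : DeltaMove K K') (hK : IsLink K) :
    IsConnected K ↔ IsConnected K' := by
  have hK' := h.isLink.1 hK
  obtain ⟨R, a, b, c, habc, hR, rfl, rfl⟩ := h.exists_rest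
  have h1 := isArc_segment (tri_ne habc).1
  have h2 := isArc_acb habc
  have d1 : Disjoint R (segment ℝ a b) := hR.mono_right (segment_subset_tri_left a b c)
  have d2 : Disjoint R (segment ℝ a c ∪ segment ℝ c b) := hR.mono_right
    (union_subset (segment_subset_tri_ac a b c) (segment_subset_tri_cb a b c))
  exact ⟨hK.replace_arc_connected h1 h2 d1, hK'.replace_arc_connected h2 h1 d2⟩

theorem Isotopic.isLink {K K' : Set R3} (h : Isotopic K K') : IsLink K ↔ IsLink K' := by
  induction h with
  | rel _ _ h => exact h.isLink
  | refl => exact Iff.rfl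
  | symm _ _ _ ih => exact ih.symm
  | trans _ _ _ _ _ ih1 ih2 => exact ih1.trans ih2

theorem Isotopic.isConnected {K K' : Set R3} (h : Isotopic K K') (hK : IsLink K) :
    IsConnected K ↔ IsConnected K' := by
  -- The induction on the generated equivalence relation needs a statement that is symmetric and
  -- passes through intermediate sets; the conjunction is such an invariant, connectedness under the
  -- assumption `hK` is not.
  suffices (IsLink K ∧ IsConnected K) ↔ (IsLink K' ∧ IsConnected K') by
    have := h.isLink
    tauto
  clear hK
  induction h with
  | rel _ _ h =>
    have h1 := h.isLink
    have h2 := fun hK => h.isConnected hK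
    tauto
  | refl => exact Iff.rfl
  | symm _ _ _ ih => exact ih.symm
  | trans _ _ _ _ _ ih1 ih2 => exact ih1.trans ih2

/-! ### Vertices and edges of a link -/

theorem exists_coord_ne {u : R3} (hu : u ≠ 0) : ∃ i, u i ≠ 0 := by
  by_contra h
  push Not at h
  exact hu (funext h)

theorem isClosed_ray {u : R3} (hu : u ≠ 0) (x : R3) : IsClosed (ray x u) := by
  obtain ⟨i, hi⟩ := exists_coord_ne hu
  have : ray x u = {y | 0 ≤ (y i - x i) / u i} ∩ {y | y = x + ((y i - x i) / u i) • u} := by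
    ext y
    constructor
    · rintro ⟨t, ht, rfl⟩
      have : ((x + t • u) i - x i) / u i = t := by simp [hi]
      simp only [mem_inter_iff, mem_ofPred_eq, this]
      exact ⟨ht, trivial⟩
    · rintro ⟨h1, h2⟩
      exact ⟨_, h1, h2⟩
  rw [this]
  refine IsClosed.inter (isClosed_le continuous_const ?_) (isClosed_eq continuous_id ?_) <;>
    fun_prop

theorem ray_germ_of_pos {x u : R3} (hu : u ≠ 0) {t : ℝ} (ht : 0 < t) :
    ray x u =ᶠ[𝓝 (x + t • u)] (ray (x + t • u) u ∪ ray (x + t • u) (-u) : Set R3) := by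
  obtain ⟨i, hi⟩ := exists_coord_ne hu
  rw [eventuallyEq_set]
  have hc : ContinuousAt (fun y : R3 => (y i - x i) / u i) (x + t • u) :=
    Continuous.continuousAt (by fun_prop)
  have hv : ((x + t • u) i - x i) / u i = t := by simp [hi]
  have hev : ∀ᶠ y in 𝓝 (x + t • u), 0 < (y i - x i) / u i :=
    hc.eventually (lt_mem_nhds (by simpa only [hv] using ht))
  filter_upwards [hev] with y hy
  have key : ∀ r : ℝ, y = x + r • u → 0 < r := by
    rintro r rfl
    simpa [hi] using hy
  constructor
  · rintro ⟨s, hs, rfl⟩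
    rcases le_total t s with h | h
    · exact Or.inl ⟨s - t, by linarith, by module⟩
    · exact Or.inr ⟨t - s, by linarith, by module⟩
  · rintro (⟨s, hs, h⟩ | ⟨s, hs, h⟩)
    · exact ⟨t + s, by linarith, h.trans (by module)⟩
    · have h' : y = x + (t - s) • u := h.trans (by module)
      exact ⟨t - s, (key _ h').le, h'⟩

/-- Near `x`, the set `K` is a straight line. -/
def Straight (K : Set R3) (x : R3) : Prop :=
  ∃ u : R3, u ≠ 0 ∧ K =ᶠ[𝓝 x] (ray x u ∪ ray x (-u) : Set R3)

/-- Away from its origin a ray is locally a line, and the other ray is closed and does not pass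
there. So corners are isolated. -/
theorem LocArc.eventually_straight {K : Set R3} {x : R3} (h : LocArc K x) :
    ∀ᶠ y in 𝓝 x, y ∈ K → y ≠ x → Straight K y := by
  obtain ⟨u, v, huv, h⟩ := h
  have aux : ∀ u v y : R3, ¬ SameRay ℝ u v → K =ᶠ[𝓝 y] (ray x u ∪ ray x v : Set R3) → y ≠ x →
      y ∈ ray x u → Straight K y := by
    intro u v y huv hy hne hm
    have hv : y ∉ ray x v := fun h' => hne (ray_inter_ray huv hm h')
    obtain ⟨hu0, hv0⟩ := ne_zero_of_not_sameRay huv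
    have hg := germ_empty (isClosed_ray hv0 x) hv
    obtain ⟨t, ht, rfl⟩ := hm
    have ht : 0 < t := ht.lt_of_ne fun h0 => hne (by simp [← h0])
    refine ⟨u, hu0, hy.trans ?_⟩
    simpa using (ray_germ_of_pos hu0 ht).union hg
  filter_upwards [eventually_eventually_nhds.2 h, h.mem_iff] with y hy hm hyK hne
  rcases hm.1 hyK with h1 | h1
  · exact aux u v y huv hy hne h1
  · exact aux v u y (fun h => huv h.symm) (by rwa [union_comm]) hne h1

/-- `V` is a possible set of vertices of `K`. -/
structure IsVertexSet (K : Set R3) (V : Set R3) : Prop where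
  finite : V.Finite
  subset : V ⊆ K
  straight : ∀ x ∈ K, x ∉ V → Straight K x

/-- By compactness finitely many neighbourhoods, each with at most its centre as a corner, cover the
link; the centres serve as vertices. Any finite set `F` of further points may be declared vertices,
which is used to refine a link along prescribed segments. -/
theorem IsLink.exists_vertexSet {K : Set R3} (hK : IsLink K) {F : Set R3} (hF : F.Finite)
    (hFK : F ⊆ K) : ∃ V, IsVertexSet K V ∧ F ⊆ V := by
  obtain ⟨t, htK⟩ := hK.1.elim_nhds_subcover'
    (fun x _ => {y | y ∈ K → y ≠ x → Straight K y})
    (fun x hx => (hK.2 x hx).eventually_straight)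
  refine ⟨(fun x : K => (x : R3)) '' (t : Set K) ∪ F, ⟨(t.finite_toSet.image _).union hF, ?_, ?_⟩,
    subset_union_right⟩
  · rintro x (⟨y, -, rfl⟩ | hx)
    exacts [y.2, hFK hx]
  · intro x hx hxV
    have := htK hx
    simp only [mem_iUnion] at this
    obtain ⟨y, hy, hxy⟩ := this
    exact hxy hx fun h => hxV (Or.inl ⟨y, hy, h.symm⟩)

/-- One walks from `x` along the ray as long as one stays in `K`. The walk is bounded, and its last
point `x + T • u` belongs to `K`. If no vertex had been met up to there, `K` would be straight at
this point and the walk could go on. Among the finitely many vertices met, the first is taken. -/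
theorem exists_vertex_on_ray {K V : Set R3} (hKc : IsCompact K) (hV : IsVertexSet K V) {x u : R3}
    (hu : u ≠ 0) (h : ∀ᶠ y in 𝓝 x, y ∈ ray x u → y ∈ K) :
    ∃ t : ℝ, 0 < t ∧ x + t • u ∈ V ∧ segment ℝ x (x + t • u) ⊆ K ∧
      ∀ s, 0 < s → s < t → x + s • u ∉ V := by
  set S : Set ℝ := {t | 0 ≤ t ∧ ∀ s, 0 ≤ s → s ≤ t → x + s • u ∈ K} with hS
  have hcont : Continuous fun t : ℝ => x + t • u := by fun_prop
  obtain ⟨ε, hε, hεK⟩ := eventually_along h u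
  have hεS : ε ∈ S :=
    ⟨hε.le, fun s h0 h1 => hεK s (by rwa [abs_of_nonneg h0]) ⟨s, h0, rfl⟩⟩
  have hbdd : BddAbove S := by
    obtain ⟨C, hC⟩ := hKc.isBounded.exists_norm_le
    refine ⟨(C + ‖x‖) / ‖u‖, fun t ht => ?_⟩
    have h1 := hC _ (ht.2 t ht.1 le_rfl)
    rw [le_div_iff₀ (norm_pos_iff.2 hu)]
    have h2 : ‖t • u‖ ≤ ‖x + t • u‖ + ‖x‖ := by
      have : t • u = (x + t • u) - x := by module
      calc ‖t • u‖ = ‖(x + t • u) - x‖ := by rw [← this]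
        _ ≤ _ := norm_sub_le _ _
    rw [norm_smul, Real.norm_of_nonneg ht.1] at h2
    linarith
  set T := sSup S with hT
  have hT0 : 0 < T := hε.trans_le (le_csSup hbdd hεS)
  have hlt : ∀ s, 0 ≤ s → s < T → x + s • u ∈ K := by
    intro s h0 h1
    obtain ⟨t, ht, hst⟩ := exists_lt_of_lt_csSup ⟨ε, hεS⟩ h1
    exact ht.2 s h0 hst.le
  have hTK : x + T • u ∈ K := by
    have hmem : T ∈ closure (Ico (0 : ℝ) T) := by
      rw [closure_Ico hT0.ne]; exact right_mem_Icc.2 hT0.le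
    have := map_mem_closure hcont hmem (t := K) fun s hs => hlt s hs.1 hs.2
    rwa [hKc.isClosed.closure_eq] at this
  have hle : ∀ s, 0 ≤ s → s ≤ T → x + s • u ∈ K := by
    intro s h0 h1
    rcases h1.eq_or_lt with rfl | h1
    exacts [hTK, hlt s h0 h1]
  set B : Set ℝ := {t | 0 < t ∧ t ≤ T ∧ x + t • u ∈ V}
  have hBfin : B.Finite := by
    have hinj : Function.Injective fun t : ℝ => x + t • u := fun s t hst => by
      simpa [hu] using smul_left_injective ℝ hu (add_left_cancel hst)
    exact (hV.finite.preimage hinj.injOn).subset fun t ht => ht.2.2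
  have hBne : B.Nonempty := by
    by_contra hB
    have hzV : x + T • u ∉ V := fun hz => hB ⟨T, hT0, le_rfl, hz⟩
    obtain ⟨w, hw, hg⟩ := hV.straight _ hTK hzV
    have hback : ∀ᶠ y in 𝓝 (x + T • u), y ∈ ray (x + T • u) (-u) → y ∈ K := by
      have := (ray_germ_of_pos (x := x) hu hT0).mem_iff
      obtain ⟨δ, hδ, H⟩ := Metric.eventually_nhds_iff.1 this
      have hpos : 0 < min δ (T * ‖u‖) := lt_min hδ (mul_pos hT0 (norm_pos_iff.2 hu))
      filter_upwards [Metric.ball_mem_nhds _ hpos] with y hy hr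
      obtain ⟨s, hs, rfl⟩ := hr
      have e : x + T • u + s • -u = x + (T - s) • u := by module
      rw [Metric.mem_ball, dist_eq_norm, add_sub_cancel_left, norm_smul, norm_neg,
        Real.norm_of_nonneg hs, lt_min_iff] at hy
      have : s < T := lt_of_mul_lt_mul_right hy.2 (norm_nonneg u)
      rw [e]
      exact hle _ (by linarith) (by linarith)
    have hsub : ∀ᶠ y in 𝓝 (x + T • u), y ∈ ray (x + T • u) (-u) →
        y ∈ ray (x + T • u) w ∪ ray (x + T • u) (-w) := by
      filter_upwards [hback, hg.mem_iff] with y h1 h2 h3 using h2.1 (h1 h3)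
    have hfor : ∀ᶠ y in 𝓝 (x + T • u), y ∈ ray (x + T • u) u → y ∈ K := by
      rcases ray_subset_union (neg_ne_zero.2 hu) hsub with ⟨c, hc, he⟩ | ⟨c, hc, he⟩
      · have : ray (x + T • u) u = ray (x + T • u) (-w) := by
          rw [← neg_neg u, he, ← smul_neg, ray_smul hc]
        rw [this]
        filter_upwards [hg.mem_iff] with y h2 h3 using h2.2 (Or.inr h3)
      · have : ray (x + T • u) u = ray (x + T • u) w := by
          rw [← neg_neg u, he, ← smul_neg, neg_neg, ray_smul hc]
        rw [this]
        filter_upwards [hg.mem_iff] with y h2 h3 using h2.2 (Or.inl h3)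
    obtain ⟨δ, hδ, H⟩ := eventually_along hfor u
    have : T + δ ∈ S := by
      refine ⟨by linarith, fun s h0 h1 => ?_⟩
      rcases le_total s T with h2 | h2
      · exact hle s h0 h2
      · have e : x + s • u = x + T • u + (s - T) • u := by module
        rw [e]
        exact H _ (by rw [abs_of_nonneg] <;> linarith) ⟨_, by linarith, rfl⟩
    have := le_csSup hbdd this
    linarith
  obtain ⟨t, ht, hmin⟩ := hBfin.exists_minimal hBne
  refine ⟨t, ht.1, ht.2.2, ?_, fun s h0 h1 hsV => ?_⟩
  · intro y hy
    rw [segment_eq_lines, add_sub_cancel_left] at hy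
    obtain ⟨r, hr0, hr1, rfl⟩ := hy
    rw [smul_smul]
    exact hle _ (mul_nonneg hr0 ht.1.le) ((mul_le_of_le_one_left ht.1.le hr1).trans ht.2.1)
  · exact absurd (hmin (y := s) ⟨h0, h1.le.trans ht.2.1, hsV⟩ h1.le) (not_le.2 h1)

/-- The segment from `x` to `y` is an edge of `K`, if `V` is taken as the set of vertices. -/
structure IsEdge (K V : Set R3) (x y : R3) : Prop where
  left_mem : x ∈ V
  right_mem : y ∈ V
  ne : x ≠ y
  subset : segment ℝ x y ⊆ K
  eq_end : ∀ z ∈ V, z ∈ segment ℝ x y → z = x ∨ z = y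

theorem IsEdge.symm {K V : Set R3} {x y : R3} (h : IsEdge K V x y) : IsEdge K V y x :=
  ⟨h.right_mem, h.left_mem, h.ne.symm, segment_symm ℝ x y ▸ h.subset,
    fun z hz hzs => (h.eq_end z hz (by rwa [segment_symm])).symm⟩

theorem segment_eventually {K : Set R3} {x y : R3} (hxy : x ≠ y) (h : segment ℝ x y ⊆ K) :
    ∀ᶠ z in 𝓝 x, z ∈ ray x (y - x) → z ∈ K := by
  filter_upwards [(segment_germ_left hxy).mem_iff] with z h1 h2 using h (h1.2 h2)

theorem add_smul_mem_segment {x y : R3} {t : ℝ} (h0 : 0 ≤ t) (h1 : t ≤ 1) :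
    x + t • (y - x) ∈ segment ℝ x y := by
  rw [segment_eq_lines]; exact ⟨t, h0, h1, rfl⟩

/-- Two points on the same ray from `z`: the nearer one lies between `z` and the other. -/
theorem mem_segment_of_smul {z x y : R3} {c : ℝ} (hc : 0 < c) (h : y - z = c • (x - z)) :
    y ∈ segment ℝ z x ∨ x ∈ segment ℝ z y := by
  rcases le_total c 1 with h1 | h1
  · left
    have : y = z + c • (x - z) := by rw [← h]; abel
    rw [this]; exact add_smul_mem_segment hc.le h1
  · right
    have : x = z + c⁻¹ • (y - z) := by rw [h, smul_smul, inv_mul_cancel₀ hc.ne']; simp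
    rw [this]; exact add_smul_mem_segment (inv_pos.2 hc).le (inv_le_one_of_one_le₀ h1)

/-- Each of the two directions at `x` leads to a first vertex. Any edge at `x` has one of these
directions, and two edges in the same direction coincide, because the nearer end would be a vertex
inside the longer edge. -/
theorem exists_two_edges {K V : Set R3} (hK : IsLink K) (hV : IsVertexSet K V) {x : R3}
    (hx : x ∈ V) : ∃ y z, y ≠ z ∧ IsEdge K V x y ∧ IsEdge K V x z ∧
      ∀ w, IsEdge K V x w → w = y ∨ w = z := by
  obtain ⟨u, v, huv, hg⟩ := hK.2 x (hV.subset hx)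
  obtain ⟨hu, hv⟩ := ne_zero_of_not_sameRay huv
  have aux : ∀ u, u ≠ 0 → (∀ᶠ y in 𝓝 x, y ∈ ray x u → y ∈ K) →
      ∃ t : ℝ, 0 < t ∧ IsEdge K V x (x + t • u) ∧
        ∀ w, IsEdge K V x w → (∃ c : ℝ, 0 < c ∧ w - x = c • u) → w = x + t • u := by
    intro u hu h
    obtain ⟨t, ht, htV, hseg, hno⟩ := exists_vertex_on_ray hK.1 hV hu h
    have hE : IsEdge K V x (x + t • u) := by
      refine ⟨hx, htV, by simp [ht.ne', hu], hseg, fun z hz hzs => ?_⟩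
      rw [segment_eq_lines, add_sub_cancel_left] at hzs
      obtain ⟨r, hr0, hr1, rfl⟩ := hzs
      rw [smul_smul] at hz ⊢
      rcases hr0.eq_or_lt with rfl | hr0
      · left; simp
      rcases hr1.eq_or_lt with rfl | hr1
      · right; simp
      exact absurd hz (hno _ (mul_pos hr0 ht) (by nlinarith))
    refine ⟨t, ht, hE, fun w hw ⟨c, hc, hcw⟩ => ?_⟩
    have hw' : w - x = (c / t) • (x + t • u - x) := by
      rw [add_sub_cancel_left, smul_smul, div_mul_cancel₀ _ ht.ne', hcw]
    rcases mem_segment_of_smul (div_pos hc ht) hw' with h | h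
    · exact (hE.eq_end w hw.right_mem h).resolve_left hw.ne.symm
    · exact ((hw.eq_end _ htV h).resolve_left hE.ne.symm).symm
  obtain ⟨s, hs, hsE, hsu⟩ := aux u hu
    (by filter_upwards [hg.mem_iff] with y h1 h2 using h1.2 (Or.inl h2))
  obtain ⟨t, ht, htE, htu⟩ := aux v hv
    (by filter_upwards [hg.mem_iff] with y h1 h2 using h1.2 (Or.inr h2))
  refine ⟨_, _, fun h => ?_, hsE, htE, fun w hw => ?_⟩
  · exact huv (Or.inr (Or.inr ⟨s, t, hs, ht, add_left_cancel h⟩))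
  · have : ∀ᶠ y in 𝓝 x, y ∈ ray x (w - x) → y ∈ ray x u ∪ ray x v := by
      filter_upwards [segment_eventually hw.ne hw.subset, hg.mem_iff] with y h1 h2 h3
        using h2.1 (h1 h3)
    rcases ray_subset_union (sub_ne_zero.2 hw.ne.symm) this with h | h
    exacts [Or.inl (hsu w hw h), Or.inr (htu w hw h)]

/-- At a point that is not a vertex the link is straight; walking both ways to the first vertices
gives the edge. -/
theorem exists_edge_of_mem {K V : Set R3} (hK : IsLink K) (hV : IsVertexSet K V) {z : R3}
    (hz : z ∈ K) : ∃ x y, IsEdge K V x y ∧ z ∈ segment ℝ x y := by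
  by_cases hzV : z ∈ V
  · obtain ⟨y, -, -, hy, -, -⟩ := exists_two_edges hK hV hzV
    exact ⟨z, y, hy, left_mem_segment ℝ z y⟩
  obtain ⟨u, hu, hg⟩ := hV.straight z hz hzV
  obtain ⟨s, hs, hsV, hsK, hsno⟩ := exists_vertex_on_ray hK.1 hV hu
    (by filter_upwards [hg.mem_iff] with y h1 h2 using h1.2 (Or.inl h2))
  obtain ⟨t, ht, htV, htK, htno⟩ := exists_vertex_on_ray hK.1 hV (neg_ne_zero.2 hu)
    (by filter_upwards [hg.mem_iff] with y h1 h2 using h1.2 (Or.inr h2))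
  have hst : 0 < s + t := by positivity
  have hm : z ∈ segment ℝ (z + s • u) (z + t • -u) := by
    have e : z = z + s • u + (s / (s + t)) • (z + t • -u - (z + s • u)) := by
      have : z + t • -u - (z + s • u) = -((s + t) • u) := by module
      rw [this, smul_neg, smul_smul, div_mul_cancel₀ _ hst.ne']
      module
    have h := add_smul_mem_segment (x := z + s • u) (y := z + t • -u) (t := s / (s + t))
      (by positivity) ((div_le_one hst).2 (by linarith))
    rwa [← e] at h
  refine ⟨_, _, ⟨hsV, htV, ?_, ?_, ?_⟩, hm⟩
  · intro h
    have : (s + t) • u = 0 := by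
      have h := sub_eq_zero.2 h
      rw [← h]; module
    simp [hst.ne', hu] at this
  · rw [segment_split hm]
    exact union_subset hsK htK
  · intro w hwV hw
    rw [segment_split hm] at hw
    rcases hw with hw | hw
    · left
      rw [segment_eq_lines, add_sub_cancel_left] at hw
      obtain ⟨r, hr0, hr1, rfl⟩ := hw
      rw [smul_smul] at hwV ⊢
      rcases hr0.eq_or_lt with rfl | hr0
      · simp at hwV; exact absurd hwV hzV
      rcases hr1.eq_or_lt with rfl | hr1
      · simp
      exact absurd hwV (hsno _ (mul_pos hr0 hs) (by nlinarith))
    · right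
      rw [segment_eq_lines, add_sub_cancel_left] at hw
      obtain ⟨r, hr0, hr1, rfl⟩ := hw
      rw [smul_smul] at hwV ⊢
      rcases hr0.eq_or_lt with rfl | hr0
      · simp at hwV; exact absurd hwV hzV
      rcases hr1.eq_or_lt with rfl | hr1
      · simp
      exact absurd hwV (htno _ (mul_pos hr0 ht) (by nlinarith))

theorem edge_dir {K V : Set R3} (hK : IsLink K) {x y z a : R3}
    (h : IsEdge K V x y) (hz : z ∈ segment ℝ x y) (hzV : z ∉ V) (haz : a ≠ z)
    (ha : segment ℝ z a ⊆ K) :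
    (∃ c : ℝ, 0 < c ∧ a - z = c • (x - z)) ∨ ∃ c : ℝ, 0 < c ∧ a - z = c • (y - z) := by
  have hzx : z ≠ x := fun e => hzV (e ▸ h.left_mem)
  have hzy : z ≠ y := fun e => hzV (e ▸ h.right_mem)
  have hg := (hK.2 z (h.subset hz)).eq_of_subset (locArc_segment hz hzx hzy) h.subset
  rw [segment_split hz] at hg
  have hg := hg.trans ((segment_germ_left hzx).union (segment_germ_left hzy))
  refine ray_subset_union (x := z) (sub_ne_zero.2 haz) ?_
  filter_upwards [segment_eventually haz.symm ha, hg.mem_iff] with w h1 h2 h3 using h2.1 (h1 h3)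

/-- A segment in `K` between vertices that has a point inside an edge contains the edge. -/
theorem edge_subset_segment {K V : Set R3} (hK : IsLink K) {x y z a b : R3}
    (h : IsEdge K V x y) (hz : z ∈ segment ℝ x y) (hzV : z ∉ V) (hab : segment ℝ a b ⊆ K)
    (haV : a ∈ V) (hbV : b ∈ V) (hzab : z ∈ segment ℝ a b) : segment ℝ x y ⊆ segment ℝ a b := by
  have haz : a ≠ z := fun e => hzV (e ▸ haV)
  have hbz : b ≠ z := fun e => hzV (e ▸ hbV)
  have hzx : z ≠ x := fun e => hzV (e ▸ h.left_mem)
  have hzy : z ≠ y := fun e => hzV (e ▸ h.right_mem)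
  have hsp := segment_split hzab
  have hza : segment ℝ z a ⊆ segment ℝ a b := hsp ▸ subset_union_left
  have hzb : segment ℝ z b ⊆ segment ℝ a b := hsp ▸ subset_union_right
  have hnot := not_sameRay_of_mem_segment hzab haz.symm hbz.symm
  have hnotx := not_sameRay_of_mem_segment hz hzx hzy
  have hzxs : segment ℝ z x ⊆ segment ℝ x y := segment_split hz ▸ subset_union_left
  have hzys : segment ℝ z y ⊆ segment ℝ x y := segment_split hz ▸ subset_union_right
  -- In a direction common to edge and segment, the vertex `a` cannot lie strictly between `z` and
  -- the end `x'` of the edge; so `x'` lies on `za`.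
  have key : ∀ x' y' a : R3, a ∈ V → segment ℝ z x' ⊆ segment ℝ x y →
      (∀ w ∈ V, w ∈ segment ℝ x y → w = x' ∨ w = y') → ¬ SameRay ℝ (x' - z) (y' - z) →
      (∃ c : ℝ, 0 < c ∧ a - z = c • (x' - z)) → x' ∈ segment ℝ z a := by
    intro x' y' a haV hs he hn ⟨c, hc, hcz⟩
    rcases mem_segment_of_smul hc hcz with h1 | h1
    · rcases he a haV (hs h1) with rfl | rfl
      · exact right_mem_segment ℝ z a
      · rw [hcz] at hn
        exact absurd (SameRay.sameRay_pos_smul_right _ hc) hn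
    · exact h1
  have cx := key x y
  have cy := fun a ha hs => key y x a ha hs (fun w hw hws => (h.eq_end w hw hws).symm)
    (fun h => hnotx h.symm)
  have hconv := convex_segment (𝕜 := ℝ) a b
  -- The germ at `z` is the edge, so `a` and `b` lie in its two directions. They are not both in the
  -- same one, because `z` is strictly between them.
  rcases edge_dir hK h hz hzV haz (hza.trans hab) with ⟨c, hc, h1⟩ | ⟨c, hc, h1⟩ <;>
  rcases edge_dir hK h hz hzV hbz (hzb.trans hab) with ⟨d, hd, h2⟩ | ⟨d, hd, h2⟩
  · refine absurd ?_ hnot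
    rw [h1, h2, sameRay_smul_left_iff_of_pos hc, sameRay_smul_right_iff_of_pos hd]
  · exact hconv.segment_subset (hza (cx a haV hzxs h.eq_end hnotx ⟨c, hc, h1⟩))
      (hzb (cy b hbV hzys ⟨d, hd, h2⟩))
  · exact hconv.segment_subset (hzb (cx b hbV hzxs h.eq_end hnotx ⟨d, hd, h2⟩))
      (hza (cy a haV hzys ⟨c, hc, h1⟩))
  · refine absurd ?_ hnot
    rw [h1, h2, sameRay_smul_left_iff_of_pos hc, sameRay_smul_right_iff_of_pos hd]

theorem edges_eq {K V : Set R3} (hK : IsLink K) {x y x' y' z : R3}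
    (h : IsEdge K V x y) (h' : IsEdge K V x' y') (hz : z ∈ segment ℝ x y)
    (hz' : z ∈ segment ℝ x' y') (hzV : z ∉ V) : x = x' ∧ y = y' ∨ x = y' ∧ y = x' := by
  have hs := edge_subset_segment hK h hz hzV h'.subset h'.left_mem h'.right_mem hz'
  have h1 := h'.eq_end x h.left_mem (hs (left_mem_segment ℝ x y))
  have h2 := h'.eq_end y h.right_mem (hs (right_mem_segment ℝ x y))
  have := h.ne
  grind

/-! ### Perturbing embedded straight-line graphs -/

/-- The points `p i` are the vertices of an embedded straight-line picture of the graph `G`. -/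
structure Emb {ι : Type*} (G : SimpleGraph ι) (p : ι → R3) : Prop where
  corner : ∀ i j k, G.Adj i j → G.Adj i k → j ≠ k → ∀ s ∈ Icc (0 : ℝ) 1,
    s • (p j - p i) ≠ (1 - s) • (p k - p i)
  apart : ∀ i j k l, G.Adj i j → G.Adj k l → i ≠ k → i ≠ l → j ≠ k → j ≠ l →
    ∀ s ∈ Icc (0 : ℝ) 1 ×ˢ Icc (0 : ℝ) 1,
      p i + s.1 • (p j - p i) ≠ p k + s.2 • (p l - p k)

/-- The straight-line picture of a graph. -/
def poly {ι : Type*} (G : SimpleGraph ι) (p : ι → R3) : Set R3 :=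
  {x | ∃ i j, G.Adj i j ∧ x ∈ segment ℝ (p i) (p j)}

/-- Both conditions of `Emb` say that a continuous function avoids `0` for all parameters in a
compact set, which is an open condition. For this reason `corner` compares directions with the
weights `s` and `1 - s`: two edges with a common end always meet, so their separation cannot be
stated as `apart` is. -/
theorem Emb.eventually {ι : Type*} [Finite ι] {G : SimpleGraph ι} {p : ι → R3} (h : Emb G p) :
    ∀ᶠ q in 𝓝 p, Emb G q := by
  have h1 : ∀ᶠ q : ι → R3 in 𝓝 p, ∀ i j k, G.Adj i j → G.Adj i k → j ≠ k →
      ∀ s ∈ Icc (0 : ℝ) 1, s • (q j - q i) ≠ (1 - s) • (q k - q i) := by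
    simp only [eventually_all]
    intro i j k hij hik hjk
    refine isCompact_Icc.eventually_forall_of_forall_eventually fun s hs => ?_
    have hc : Continuous fun z : (ι → R3) × ℝ =>
        z.2 • (z.1 j - z.1 i) - (1 - z.2) • (z.1 k - z.1 i) := by fun_prop
    have := hc.continuousAt.eventually_ne (y := 0) (x := (p, s))
      (sub_ne_zero.2 (h.corner i j k hij hik hjk s hs))
    filter_upwards [this] with z hz using sub_ne_zero.1 hz
  have h2 : ∀ᶠ q : ι → R3 in 𝓝 p, ∀ i j k l, G.Adj i j → G.Adj k l → i ≠ k → i ≠ l → j ≠ k →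
      j ≠ l → ∀ s ∈ Icc (0 : ℝ) 1 ×ˢ Icc (0 : ℝ) 1,
        q i + s.1 • (q j - q i) ≠ q k + s.2 • (q l - q k) := by
    simp only [eventually_all]
    intro i j k l hij hkl h1 h2 h3 h4
    refine (isCompact_Icc.prod isCompact_Icc).eventually_forall_of_forall_eventually
      fun s hs => ?_
    have hc : Continuous fun z : (ι → R3) × (ℝ × ℝ) =>
        z.1 i + z.2.1 • (z.1 j - z.1 i) - (z.1 k + z.2.2 • (z.1 l - z.1 k)) := by fun_prop
    have := hc.continuousAt.eventually_ne (y := 0) (x := (p, s))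
      (sub_ne_zero.2 (h.apart i j k l hij hkl h1 h2 h3 h4 s hs))
    filter_upwards [this] with z hz using sub_ne_zero.1 hz
  filter_upwards [h1, h2] with q hq1 hq2 using ⟨hq1, hq2⟩

theorem Emb.corner_inter {ι : Type*} {G : SimpleGraph ι} {p : ι → R3} (h : Emb G p) {i j k : ι}
    (hij : G.Adj i j) (hik : G.Adj i k) (hjk : j ≠ k) {z : R3} (h1 : z ∈ segment ℝ (p i) (p j))
    (h2 : z ∈ segment ℝ (p i) (p k)) : z = p i := by
  rw [segment_eq_lines] at h1 h2
  obtain ⟨s, hs0, hs1, rfl⟩ := h1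
  obtain ⟨t, ht0, ht1, he⟩ := h2
  rcases hs0.eq_or_lt with rfl | hs0
  · simp
  have hpos : 0 < s + t := by positivity
  refine absurd ?_ (h.corner i j k hij hik hjk (s / (s + t))
    ⟨by positivity, (div_le_one hpos).2 (by linarith)⟩)
  have : 1 - s / (s + t) = t / (s + t) := by field_simp; ring
  rw [this, div_eq_inv_mul, div_eq_inv_mul, mul_smul, mul_smul, add_left_cancel he]

theorem affineIndependent_of_functional {a b c : R3} (hab : a ≠ b) (f : R3 →ₗ[ℝ] ℝ)
    (h1 : f b = f a) (h2 : f c ≠ f a) : AffineIndependent ℝ ![a, b, c] := by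
  refine affineIndependent_of_weights fun α β γ h0 h => ?_
  have hf := congrArg f h
  simp only [map_add, map_smul, smul_eq_mul, map_zero, h1] at hf
  have hγ : γ = 0 := by
    have : γ * (f c - f a) = 0 := by linear_combination hf - f a * h0
    exact (mul_eq_zero.1 this).resolve_right (sub_ne_zero.2 h2)
  subst hγ
  have hβ : β = -α := by linarith
  subst hβ
  have : α • (a - b) = 0 := by rw [← h]; module
  have hα : α = 0 := (smul_eq_zero.1 this).resolve_right (sub_ne_zero.2 hab)
  simp [hα]

theorem exists_of_mem_tri {a b c z : R3} (h : z ∈ tri a b c) :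
    ∃ y ∈ segment ℝ b c, z ∈ segment ℝ a y := by
  rw [tri, convexHull_insert ⟨b, by simp⟩, convexHull_pair, mem_convexJoin] at h
  obtain ⟨a', ha', z, hz, h⟩ := h
  rw [mem_singleton_iff] at ha'
  exact ⟨z, hz, ha' ▸ h⟩

/-- The edges that do not end at the vertex `i`. -/
def polyRest {ι : Type*} (G : SimpleGraph ι) (p : ι → R3) (i : ι) : Set R3 :=
  {x | ∃ a b, G.Adj a b ∧ a ≠ i ∧ b ≠ i ∧ x ∈ segment ℝ (p a) (p b)}

theorem poly_eq_rest {ι : Type*} [DecidableEq ι] {G : SimpleGraph ι} (p : ι → R3) {i j k : ι}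
    (hn : ∀ l, G.Adj i l ↔ l = j ∨ l = k) (x : R3) :
    poly G (Function.update p i x) =
      polyRest G p i ∪ (segment ℝ x (p j) ∪ segment ℝ x (p k)) := by
  have hij : G.Adj i j := (hn j).2 (Or.inl rfl)
  have hik : G.Adj i k := (hn k).2 (Or.inr rfl)
  ext z
  constructor
  · rintro ⟨a, b, hab, hz⟩
    by_cases ha : a = i
    · subst ha
      right
      have hb := (hn b).1 hab
      rw [Function.update_self, Function.update_of_ne hab.ne.symm] at hz
      rcases hb with rfl | rfl
      exacts [Or.inl hz, Or.inr hz]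
    by_cases hb : b = i
    · subst hb
      right
      have ha := (hn a).1 hab.symm
      rw [Function.update_self, Function.update_of_ne hab.ne, segment_symm] at hz
      rcases ha with rfl | rfl
      exacts [Or.inl hz, Or.inr hz]
    · rw [Function.update_of_ne ha, Function.update_of_ne hb] at hz
      exact Or.inl ⟨a, b, hab, ha, hb, hz⟩
  · rintro (⟨a, b, hab, ha, hb, hz⟩ | hz | hz)
    · exact ⟨a, b, hab, by rwa [Function.update_of_ne ha, Function.update_of_ne hb]⟩
    · exact ⟨i, j, hij, by rwa [Function.update_self, Function.update_of_ne hij.ne.symm]⟩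
    · exact ⟨i, k, hik, by rwa [Function.update_self, Function.update_of_ne hik.ne.symm]⟩

theorem rest_inter_edge {ι : Type*} [DecidableEq ι] {G : SimpleGraph ι} {p : ι → R3} {i j : ι}
    {y : R3} (h : Emb G (Function.update p i y)) (hij : G.Adj i j) {z : R3}
    (hz : z ∈ polyRest G p i) (hz' : z ∈ segment ℝ y (p j)) : z = p j := by
  obtain ⟨a, b, hab, ha, hb, hzab⟩ := hz
  have e : ∀ c, c ≠ i → Function.update p i y c = p c := fun c hc => Function.update_of_ne hc _ _
  have ej := e j hij.ne.symm
  by_cases haj : a = j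
  · subst haj
    have := h.corner_inter (z := z) hab hij.symm hb (by rwa [e a ha, e b hb])
      (by rwa [e a ha, Function.update_self, segment_symm])
    rwa [e a ha] at this
  by_cases hbj : b = j
  · subst hbj
    have := h.corner_inter (z := z) hab.symm hij.symm ha (by rwa [e a ha, e b hb, segment_symm])
      (by rwa [e b hb, Function.update_self, segment_symm])
    rwa [e b hb] at this
  rw [segment_eq_lines] at hz' hzab
  obtain ⟨s, hs0, hs1, rfl⟩ := hz'
  obtain ⟨t, ht0, ht1, ht⟩ := hzab
  refine absurd ?_ (h.apart i j a b hij hab ha.symm hb.symm (Ne.symm haj) (Ne.symm hbj) (s, t)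
    ⟨⟨hs0, hs1⟩, ⟨ht0, ht1⟩⟩)
  simpa [e a ha, e b hb, ej] using ht

/-- Two moves suffice: `x` is inserted between `p i` and `p k`, then `p i` is removed between `p j`
and `x`. The triangles are swept out by the edges from the points `y` of the path to the neighbours,
so `Emb` at `y` keeps them off the edges elsewhere. The functional `f`, constant on the old vertex
and its neighbours, keeps them off the other edge at the vertex. -/
theorem isotopic_update_of_off_plane {ι : Type*} [DecidableEq ι] {G : SimpleGraph ι} {p : ι → R3}
    {i j k : ι} (hjk : j ≠ k) (hn : ∀ l, G.Adj i l ↔ l = j ∨ l = k) {x : R3}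
    (h : ∀ y ∈ segment ℝ (p i) x, Emb G (Function.update p i y)) (f : R3 →ₗ[ℝ] ℝ)
    (hfj : f (p j) = f (p i)) (hfk : f (p k) = f (p i)) (hfx : f x ≠ f (p i)) :
    Isotopic (poly G p) (poly G (Function.update p i x)) := by
  have hij : G.Adj i j := (hn j).2 (Or.inl rfl)
  have hik : G.Adj i k := (hn k).2 (Or.inr rfl)
  have hp : Emb G p := by simpa using h _ (left_mem_segment ℝ (p i) x)
  have e1 := poly_eq_rest p hn (p i)
  rw [Function.update_eq_self] at e1
  rw [e1, poly_eq_rest p hn x]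
  set R := polyRest G p i
  have hsub := sub_ne_zero.2 hfx
  have hvw : p i ≠ p k := fun e => hp.corner i j k hij hik hjk 0 (by simp) (by simp [e])
  have hvu : p i ≠ p j := fun e => hp.corner i j k hij hik hjk 1 (by simp) (by simp [e])
  have d1 : Isotopic (R ∪ segment ℝ (p i) (p j) ∪ segment ℝ (p i) (p k))
      (R ∪ segment ℝ (p i) (p j) ∪ (segment ℝ (p i) x ∪ segment ℝ x (p k))) := by
    refine isotopic_of_rest (affineIndependent_of_functional hvw f hfk hfx) ?_
    rintro z ⟨hz | hz, hzT⟩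
    · right
      have : tri (p i) (p k) x = tri (p k) (p i) x := (tri_swap _ _ _).symm
      rw [this] at hzT
      obtain ⟨y, hy, hzy⟩ := exists_of_mem_tri hzT
      exact rest_inter_edge (h y hy) hik hz (by rwa [segment_symm])
    · left
      obtain ⟨α, β, γ, hα, hβ, hγ, hs, he⟩ := mem_tri.1 hzT
      have hz' := hz
      rw [segment_eq_lines] at hz'
      obtain ⟨s, hs0, hs1, hse⟩ := hz'
      have hf := congrArg f (he.symm.trans hse)
      simp only [map_add, map_smul, smul_eq_mul, map_sub, hfj, hfk] at hf
      have hγ0 : γ = 0 := by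
        have : γ * (f x - f (p i)) = 0 := by linear_combination hf - f (p i) * hs
        exact (mul_eq_zero.1 this).resolve_right hsub
      refine hp.corner_inter hij hik hjk hz ⟨α, β, hα, hβ, by linarith, ?_⟩
      rw [he, hγ0, zero_smul, add_zero]
  have d2 : Isotopic (R ∪ segment ℝ x (p k) ∪ segment ℝ (p j) x)
      (R ∪ segment ℝ x (p k) ∪ (segment ℝ (p j) (p i) ∪ segment ℝ (p i) x)) := by
    refine isotopic_of_rest (affineIndependent_rotate
      (affineIndependent_of_functional hvu f hfj hfx)) ?_
    rintro z ⟨hz | hz, hzT⟩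
    · left
      obtain ⟨y, hy, hzy⟩ := exists_of_mem_tri hzT
      exact rest_inter_edge (h y (by rwa [segment_symm])) hij hz (by rwa [segment_symm])
    · right
      obtain ⟨α, β, γ, hα, hβ, hγ, hs, he⟩ := mem_tri.1 hzT
      rw [segment_eq_lines] at hz
      obtain ⟨s, hs0, hs1, hse⟩ := hz
      have hf := congrArg f (he.symm.trans hse)
      simp only [map_add, map_smul, smul_eq_mul, map_sub, hfj, hfk] at hf
      have hβs : β = 1 - s := by
        have : (β - (1 - s)) * (f x - f (p i)) = 0 := by linear_combination hf - f (p i) * hs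
        exact sub_eq_zero.1 ((mul_eq_zero.1 this).resolve_right hsub)
      rcases hs0.eq_or_lt with rfl | hs0
      · simpa using hse
      have hpos : 0 < α + s := by positivity
      refine absurd ?_ (hp.corner i j k hij hik hjk (α / (α + s))
        ⟨by positivity, (div_le_one hpos).2 (by linarith)⟩)
      have e3 : 1 - α / (α + s) = s / (α + s) := by field_simp; ring
      have e4 : α • (p j - p i) = s • (p k - p i) := by
        have e5 := he.symm.trans hse
        have hγs : γ = s - α := by linarith
        rw [hβs, hγs] at e5
        rw [← sub_eq_zero] at e5 ⊢
        rw [← e5]; module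
      rw [e3, div_eq_inv_mul, div_eq_inv_mul, mul_smul, mul_smul, e4]
  have d3 := d1.trans (K'' := R ∪ (segment ℝ x (p j) ∪ segment ℝ x (p k))) ?_
  · rwa [union_assoc] at d3
  · convert d2.symm using 1
    · rw [segment_symm ℝ (p j) (p i)]
      ext z; simp only [mem_union]; tauto
    · rw [segment_symm ℝ (p j) x]
      ext z; simp only [mem_union]; tauto

theorem exists_functional (a b : R3) : ∃ f : R3 →ₗ[ℝ] ℝ, f ≠ 0 ∧ f a = 0 ∧ f b = 0 := by
  have hlt : Submodule.span ℝ ({a, b} : Set R3) < ⊤ := by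
    rw [lt_top_iff_ne_top]
    intro h
    have h1 := finrank_span_le_card (R := ℝ) ({a, b} : Set R3)
    rw [h, finrank_top] at h1
    have h2 : ({a, b} : Set R3).toFinset.card ≤ 2 := by
      rw [toFinset_insert, toFinset_singleton]; exact Finset.card_le_two
    simp only [Module.finrank_fintype_fun_eq_card, Fintype.card_fin] at h1
    omega
  obtain ⟨f, hf, hle⟩ := Submodule.exists_le_ker_of_lt_top _ hlt
  exact ⟨f, hf, hle (Submodule.subset_span (by simp)), hle (Submodule.subset_span (by simp))⟩

theorem exists_common_direction {f g : R3 →ₗ[ℝ] ℝ} (hf : f ≠ 0) (hg : g ≠ 0) :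
    ∃ d, f d ≠ 0 ∧ g d ≠ 0 := by
  obtain ⟨d, hd⟩ := DFunLike.ne_iff.1 hf
  obtain ⟨e, he⟩ := DFunLike.ne_iff.1 hg
  simp only [LinearMap.zero_apply] at hd he
  by_cases h1 : g d = 0
  · by_cases h2 : f e = 0
    · exact ⟨d + e, by simpa [h2] using hd, by simpa [h1] using he⟩
    · exact ⟨e, h2, he⟩
  · exact ⟨d, hd, h1⟩

theorem exists_near_off_planes {f g : R3 →ₗ[ℝ] ℝ} (hf : f ≠ 0) (hg : g ≠ 0) {v : R3} {c : ℝ}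
    {U : Set R3} (hU : U ∈ 𝓝 v) : ∃ x ∈ U, f x ≠ f v ∧ g x ≠ c := by
  obtain ⟨d, hfd, hgd⟩ := exists_common_direction hf hg
  obtain ⟨ε, hε, H⟩ := eventually_along (P := (· ∈ U)) hU d
  by_cases h : g v + ε * g d = c
  · refine ⟨v + (ε / 2) • d, H _ (by rw [abs_of_pos] <;> linarith), ?_, ?_⟩
    · simp [hε.ne', hfd]
    · simp only [map_add, map_smul, smul_eq_mul, ← h]
      intro h'
      have : ε * g d = 0 := by linarith
      simp [hε.ne', hgd] at this
  · exact ⟨v + ε • d, H _ (abs_of_pos hε).le, by simp [hε.ne', hfd], by simpa using h⟩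

/-- A direct move may fail if `x` lies in a plane through `p i`, `p j`, `p k`. The detour goes
through a point `y` near `p i` off the plane of the old and the plane of the new corner; `p i` to
`y` and `x` to `y` are then both moves off a plane. The ball is convex, so all positions on the way
are embeddings. -/
theorem isotopic_update {ι : Type*} [Fintype ι] [DecidableEq ι] {G : SimpleGraph ι}
    (hreg : ∀ i, ∃ j k, j ≠ k ∧ ∀ l, G.Adj i l ↔ l = j ∨ l = k) {p₀ : ι → R3} {ε : ℝ}
    (hε : ∀ q ∈ Metric.ball p₀ ε, Emb G q) {p : ι → R3} {i : ι} {x : R3}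
    (hp : p ∈ Metric.ball p₀ ε) (hx : Function.update p i x ∈ Metric.ball p₀ ε) :
    Isotopic (poly G p) (poly G (Function.update p i x)) := by
  obtain ⟨j, k, hjk, hn⟩ := hreg i
  have hij : i ≠ j := ((hn j).2 (Or.inl rfl)).ne
  have hik : i ≠ k := ((hn k).2 (Or.inr rfl)).ne
  obtain ⟨f, hf, hf1, hf2⟩ := exists_functional (p j - p i) (p k - p i)
  obtain ⟨g, hg, hg1, hg2⟩ := exists_functional (p j - x) (p k - x)
  rw [map_sub, sub_eq_zero] at hf1 hf2 hg1 hg2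
  have hcont : Continuous fun y => Function.update p i y := continuous_const.update i continuous_id
  have hU : (fun y => Function.update p i y) ⁻¹' Metric.ball p₀ ε ∈ 𝓝 (p i) :=
    hcont.continuousAt.preimage_mem_nhds (by
      rw [Function.update_eq_self]; exact Metric.isOpen_ball.mem_nhds hp)
  obtain ⟨y, hyU, hfy, hgy⟩ := exists_near_off_planes hf hg (c := g x) hU
  have hconv : Convex ℝ ((fun y => Function.update p i y) ⁻¹' Metric.ball p₀ ε) := by
    intro a ha b hb s t hs ht hst
    have := convex_ball p₀ ε ha hb hs ht hst
    have e : Function.update p i (s • a + t • b) =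
        s • Function.update p i a + t • Function.update p i b := by
      funext l
      by_cases hl : l = i
      · subst hl; simp
      · simp only [Pi.add_apply, Pi.smul_apply, Function.update_of_ne hl]
        rw [← add_smul, hst, one_smul]
    rw [mem_preimage, e]
    exact this
  have hpi : p i ∈ (fun y => Function.update p i y) ⁻¹' Metric.ball p₀ ε := by simpa using hp
  have h1 := isotopic_update_of_off_plane hjk hn (p := p) (x := y)
    (fun z hz => hε _ (hconv.segment_subset hpi hyU hz)) f hf1 hf2 hfy
  have h2 := isotopic_update_of_off_plane hjk hn (p := Function.update p i x) (x := y)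
    (fun z hz => by
      rw [Function.update_idem]
      rw [Function.update_self] at hz
      exact hε _ (hconv.segment_subset hx hyU hz)) g
    (by rwa [Function.update_self, Function.update_of_ne hij.symm])
    (by rwa [Function.update_self, Function.update_of_ne hik.symm])
    (by rwa [Function.update_self])
  rw [Function.update_idem] at h2
  exact h1.trans h2.symm

/-- The vertices are moved one after the other. Every mixture of old and new positions stays in the
ball, because the distance is the maximum over the vertices. -/
theorem isotopic_of_near {ι : Type*} [Fintype ι] {G : SimpleGraph ι}
    (hreg : ∀ i, ∃ j k, j ≠ k ∧ ∀ l, G.Adj i l ↔ l = j ∨ l = k) {p : ι → R3} (hp : Emb G p) :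
    ∀ᶠ q in 𝓝 p, Isotopic (poly G p) (poly G q) := by
  classical
  obtain ⟨ε, hε, H⟩ := Metric.eventually_nhds_iff_ball.1 hp.eventually
  filter_upwards [Metric.ball_mem_nhds p hε] with q hq
  have hmem : ∀ s : Finset ι, s.piecewise q p ∈ Metric.ball p ε := by
    intro s
    rw [Metric.mem_ball, dist_pi_lt_iff hε] at hq ⊢
    intro i
    by_cases hi : i ∈ s
    · simpa [hi] using hq i
    · simpa [hi] using hε
  have key : ∀ s : Finset ι, Isotopic (poly G p) (poly G (s.piecewise q p)) := by
    intro s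
    induction s using Finset.induction_on with
    | empty => simpa using isotopic_refl _
    | insert i s _ ih =>
      refine ih.trans ?_
      have := hmem (insert i s)
      rw [Finset.piecewise_insert] at this ⊢
      exact isotopic_update hreg H (hmem s) this
  simpa using key Finset.univ

/-- A continuous family of embedded polygonal links is an isotopy. -/
theorem isotopic_of_continuous {ι : Type*} [Fintype ι] {G : SimpleGraph ι}
    (hreg : ∀ i, ∃ j k, j ≠ k ∧ ∀ l, G.Adj i l ↔ l = j ∨ l = k) {p : ℝ → ι → R3}
    (hc : ContinuousOn p (Icc 0 1)) (hp : ∀ t ∈ Icc (0 : ℝ) 1, Emb G (p t)) :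
    Isotopic (poly G (p 0)) (poly G (p 1)) := by
  -- The isotopy class, taken as a set of sets, is a locally constant function of `t`, hence
  -- constant on the connected interval.
  have hloc : IsLocallyConstant
      fun t : Icc (0 : ℝ) 1 => {K | Isotopic (poly G (p t)) K} := by
    rw [IsLocallyConstant.iff_eventually_eq]
    intro t
    have hct : ContinuousAt (fun t : Icc (0 : ℝ) 1 => p t) t :=
      (continuousOn_iff_continuous_domRestrict.1 hc).continuousAt
    filter_upwards [hct.eventually (isotopic_of_near hreg (hp t t.2))] with s hs
    ext K
    exact ⟨fun h => hs.trans h, fun h => hs.symm.trans h⟩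
  have := hloc.apply_eq_of_isPreconnected (isPreconnected_univ) (x := ⟨0, by simp⟩)
    (y := ⟨1, by simp⟩) (mem_univ _) (mem_univ _)
  have h1 : poly G (p 1) ∈ {K | Isotopic (poly G (p 1)) K} := isotopic_refl _
  simp only at this
  rw [← this] at h1
  exact h1

/-! ### Isotopies from families of piecewise affine maps -/

/-- `φ` is affine on the segment from `a` to `b`. -/
def AffOn (φ : R3 → R3) (a b : R3) : Prop :=
  ∀ s ∈ Icc (0 : ℝ) 1, φ (a + s • (b - a)) = φ a + s • (φ b - φ a)

theorem AffOn.mono {φ : R3 → R3} {a b x y : R3} (h : AffOn φ a b) (hx : x ∈ segment ℝ a b)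
    (hy : y ∈ segment ℝ a b) : AffOn φ x y := by
  rw [segment_eq_lines] at hx hy
  obtain ⟨s, hs0, hs1, rfl⟩ := hx
  obtain ⟨t, ht0, ht1, rfl⟩ := hy
  intro r hr
  have e : a + s • (b - a) + r • (a + t • (b - a) - (a + s • (b - a))) =
      a + ((1 - r) * s + r * t) • (b - a) := by module
  have h1 : 0 ≤ 1 - r := by linarith [hr.2]
  have h2 : 0 ≤ (1 - r) * s + r * t := by have := hr.1; positivity
  have h3 : (1 - r) * s + r * t ≤ 1 := by nlinarith [hr.1, hr.2]
  rw [e, h _ ⟨h2, h3⟩, h _ ⟨hs0, hs1⟩, h _ ⟨ht0, ht1⟩]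
  module

theorem AffOn.image {φ : R3 → R3} {a b : R3} (h : AffOn φ a b) :
    φ '' segment ℝ a b = segment ℝ (φ a) (φ b) := by
  ext z
  simp only [segment_eq_lines, mem_image, mem_ofPred_eq]
  constructor
  · rintro ⟨_, ⟨s, h0, h1, rfl⟩, rfl⟩
    exact ⟨s, h0, h1, h s ⟨h0, h1⟩⟩
  · rintro ⟨s, h0, h1, rfl⟩
    exact ⟨_, ⟨s, h0, h1, rfl⟩, h s ⟨h0, h1⟩⟩

/-- The union of a set of segments. -/
def segUnion (S : Set (R3 × R3)) : Set R3 := {x | ∃ e ∈ S, x ∈ segment ℝ e.1 e.2}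

/-- The graph of the edges of `K`. -/
def edgeGraph (K V : Set R3) : SimpleGraph V where
  Adj x y := IsEdge K V x y
  symm := ⟨fun _ _ h => h.symm⟩
  loopless := ⟨fun _ h => h.ne rfl⟩

theorem edgeGraph_regular {K V : Set R3} (hK : IsLink K) (hV : IsVertexSet K V) (i : V) :
    ∃ j k, j ≠ k ∧ ∀ l, (edgeGraph K V).Adj i l ↔ l = j ∨ l = k := by
  obtain ⟨y, z, hyz, hy, hz, h⟩ := exists_two_edges hK hV i.2
  refine ⟨⟨y, hy.right_mem⟩, ⟨z, hz.right_mem⟩, fun e => hyz (congrArg Subtype.val e), fun l => ?_⟩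
  constructor
  · intro hl
    exact (h l hl).imp Subtype.ext Subtype.ext
  · rintro (rfl | rfl)
    exacts [hy, hz]

theorem edges_share_vertex {K V : Set R3} (hK : IsLink K) {x y x' y' z : R3}
    (h : IsEdge K V x y) (h' : IsEdge K V x' y') (hz : z ∈ segment ℝ x y)
    (hz' : z ∈ segment ℝ x' y') :
    (x = x' ∧ y = y' ∨ x = y' ∧ y = x') ∨ (z = x ∨ z = y) ∧ (z = x' ∨ z = y') := by
  by_cases hzV : z ∈ V
  · exact Or.inr ⟨h.eq_end z hzV hz, h'.eq_end z hzV hz'⟩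
  · exact Or.inl (edges_eq hK h h' hz hz' hzV)

/-- Affinity on edges turns a coincidence of image edges into equal values of `φ` at points of `K`;
by injectivity the points agree, and edges of `K` meet only in common vertices. -/
theorem emb_edgeGraph {K V : Set R3} (hK : IsLink K) {φ : R3 → R3} (hinj : InjOn φ K)
    (haff : ∀ x y, IsEdge K V x y → AffOn φ x y) :
    Emb (edgeGraph K V) fun v => φ v := by
  constructor
  · intro i j k hij hik hjk s hs he
    have hij : IsEdge K V i j := hij
    have hik : IsEdge K V i k := hik
    have hs' : 1 - s ∈ Icc (0 : ℝ) 1 := ⟨by linarith [hs.2], by linarith [hs.1]⟩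
    have e1 : φ (i + s • ((j : R3) - i)) = φ (i + (1 - s) • ((k : R3) - i)) := by
      rw [haff i j hij s hs, haff i k hik _ hs', he]
    have m1 := add_smul_mem_segment (x := (i : R3)) (y := j) hs.1 hs.2
    have m2 := add_smul_mem_segment (x := (i : R3)) (y := k) hs'.1 hs'.2
    have e2 := hinj (hij.subset m1) (hik.subset m2) e1
    rcases edges_share_vertex hK hij hik m1 (e2 ▸ m2) with (⟨-, h⟩ | ⟨h, -⟩) | ⟨h1, h2⟩
    · exact hjk (Subtype.ext h)
    · exact hik.ne h
    · rcases h1 with h1 | h1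
      · have a1 : s = 0 := by simpa [sub_eq_zero, hij.ne.symm] using h1
        rw [e2] at h1
        have a2 : 1 - s = 0 := by simpa [sub_eq_zero (b := (i : R3)), hik.ne.symm] using h1
        rw [a1] at a2
        norm_num at a2
      · rcases h2 with h2 | h2
        · exact hij.ne (h2.symm.trans h1)
        · exact hjk (Subtype.ext (h1.symm.trans h2))
  · intro i j k l hij hkl h1 h2 h3 h4 s hs he
    have hij : IsEdge K V i j := hij
    have hkl : IsEdge K V k l := hkl
    rw [← haff i j hij _ hs.1, ← haff k l hkl _ hs.2] at he
    have m1 := add_smul_mem_segment (x := (i : R3)) (y := j) hs.1.1 hs.1.2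
    have m2 := add_smul_mem_segment (x := (k : R3)) (y := l) hs.2.1 hs.2.2
    have e2 := hinj (hij.subset m1) (hkl.subset m2) he
    rw [Ne, ← Subtype.coe_inj] at h1 h2 h3 h4
    have := edges_share_vertex hK hij hkl m1 (e2 ▸ m2)
    grind

theorem poly_edgeGraph {K V : Set R3} (hK : IsLink K) (hV : IsVertexSet K V) {φ : R3 → R3}
    (haff : ∀ x y, IsEdge K V x y → AffOn φ x y) :
    poly (edgeGraph K V) (fun v => φ v) = φ '' K := by
  ext z
  constructor
  · rintro ⟨i, j, hij, hz⟩
    have hij : IsEdge K V i j := hij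
    rw [← (haff i j hij).image] at hz
    exact image_mono hij.subset hz
  · rintro ⟨x, hx, rfl⟩
    obtain ⟨a, b, hab, hxab⟩ := exists_edge_of_mem hK hV hx
    exact ⟨⟨a, hab.left_mem⟩, ⟨b, hab.right_mem⟩, hab, (haff a b hab).image ▸ mem_image_of_mem φ hxab⟩

theorem midpoint_notMem {K V : Set R3} {x y : R3} (h : IsEdge K V x y) :
    x + (1 / 2 : ℝ) • (y - x) ∈ segment ℝ x y ∧ x + (1 / 2 : ℝ) • (y - x) ∉ V := by
  have hm := add_smul_mem_segment (x := x) (y := y) (t := 1 / 2) (by norm_num) (by norm_num)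
  refine ⟨hm, fun hV => ?_⟩
  rcases h.eq_end _ hV hm with h1 | h1
  · simp [sub_eq_zero, h.ne.symm] at h1
  · have : (1 / 2 : ℝ) • (y - x) = 0 := by
      have h2 : x + (1 / 2 : ℝ) • (y - x) - y = 0 := by rw [h1]; simp
      have h3 : x + (1 / 2 : ℝ) • (y - x) - y = -((1 / 2 : ℝ) • (y - x)) := by module
      rwa [h3, neg_eq_zero] at h2
    simp [sub_eq_zero, h.ne.symm] at this

/-- A continuous family of injective maps, affine on the segments that make up a link, is an
isotopy. -/
theorem isotopic_of_family {K : Set R3} (hK : IsLink K) {S : Set (R3 × R3)} (hS : S.Finite)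
    (hKS : K = segUnion S) {φ : ℝ → R3 → R3}
    (hcont : ∀ x ∈ K, ContinuousOn (fun t => φ t x) (Icc 0 1))
    (haff : ∀ t ∈ Icc (0 : ℝ) 1, ∀ e ∈ S, AffOn (φ t) e.1 e.2)
    (hinj : ∀ t ∈ Icc (0 : ℝ) 1, InjOn (φ t) K) : Isotopic (φ 0 '' K) (φ 1 '' K) := by
  have hsegK : ∀ e ∈ S, segment ℝ e.1 e.2 ⊆ K := fun e he x hx => hKS ▸ ⟨e, he, hx⟩
  -- All end points of the given segments become vertices, so each edge lies in a single segment of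
  -- `S`, where `φ t` is affine.
  obtain ⟨V, hV, hFV⟩ := hK.exists_vertexSet (F := Prod.fst '' S ∪ Prod.snd '' S)
    ((hS.image _).union (hS.image _)) (by
      rintro x (⟨e, he, rfl⟩ | ⟨e, he, rfl⟩)
      exacts [hsegK e he (left_mem_segment ℝ _ _), hsegK e he (right_mem_segment ℝ _ _)])
  have haff' : ∀ t ∈ Icc (0 : ℝ) 1, ∀ x y, IsEdge K V x y → AffOn (φ t) x y := by
    intro t ht x y hxy
    obtain ⟨hm, hmV⟩ := midpoint_notMem hxy
    obtain ⟨e, he, hme⟩ : _ ∈ segUnion S := hKS ▸ hxy.subset hm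
    have hsub := edge_subset_segment hK hxy hm hmV (hsegK e he)
      (hFV (Or.inl ⟨e, he, rfl⟩)) (hFV (Or.inr ⟨e, he, rfl⟩)) hme
    exact (haff t ht e he).mono (hsub (left_mem_segment ℝ _ _)) (hsub (right_mem_segment ℝ _ _))
  have := hV.finite.fintype
  have h0 : (0 : ℝ) ∈ Icc (0 : ℝ) 1 := by simp
  have h1 : (1 : ℝ) ∈ Icc (0 : ℝ) 1 := by simp
  rw [← poly_edgeGraph hK hV (haff' 0 h0), ← poly_edgeGraph hK hV (haff' 1 h1)]
  refine isotopic_of_continuous (p := fun t (v : V) => φ t v) (edgeGraph_regular hK hV) ?_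
    fun t ht => emb_edgeGraph hK (hinj t ht) (haff' t ht)
  exact continuousOn_pi.2 fun v => hcont v (hV.subset v.2)

/-- The segments are the edges for a vertex set containing `F`. An edge that shares more than an end
of `ab` with `ab` is contained in it. This is what allows a segment to be taken out of a link. -/
theorem IsLink.exists_segUnion {K : Set R3} (hK : IsLink K) {F : Set R3} (hF : F.Finite)
    (hFK : F ⊆ K) : ∃ S : Set (R3 × R3), S.Finite ∧ K = segUnion S ∧
      ∀ e ∈ S, ∀ a ∈ F, ∀ b ∈ F, segment ℝ a b ⊆ K →
        segment ℝ e.1 e.2 ⊆ segment ℝ a b ∨ segment ℝ e.1 e.2 ∩ segment ℝ a b ⊆ {a, b} := by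
  obtain ⟨V, hV, hFV⟩ := hK.exists_vertexSet hF hFK
  refine ⟨{e | IsEdge K V e.1 e.2}, ?_, ?_, ?_⟩
  · exact (hV.finite.prod hV.finite).subset fun e he => ⟨he.left_mem, he.right_mem⟩
  · ext x
    constructor
    · intro hx
      obtain ⟨a, b, h, hxs⟩ := exists_edge_of_mem hK hV hx
      exact ⟨(a, b), h, hxs⟩
    · rintro ⟨e, he, hx⟩
      exact he.subset hx
  · intro e he a ha b hb hab
    refine or_iff_not_imp_right.2 fun hcon => ?_
    obtain ⟨z, ⟨hze, hzab⟩, hne⟩ := not_subset.1 hcon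
    rw [mem_insert_iff, mem_singleton_iff, not_or] at hne
    have key : ∀ w ∈ segment ℝ e.1 e.2, w ∈ segment ℝ a b → w ∉ V →
        segment ℝ e.1 e.2 ⊆ segment ℝ a b :=
      fun w h1 h2 h3 => edge_subset_segment hK he h1 h3 hab (hFV ha) (hFV hb) h2
    by_cases hzV : z ∈ V
    -- Here the common point is a vertex inside `ab`. Near it the link is just `ab`, so a point
    -- slightly further along the edge also lies on `ab`; stopping at most halfway ensures that it
    -- is not a vertex.
    · have hg := ((hK.2 z (he.subset hze)).eq_of_subset
        (locArc_segment hzab hne.1 hne.2) hab).mem_iff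
      have aux : ∀ y, IsEdge K V z y → segment ℝ z y = segment ℝ e.1 e.2 →
          segment ℝ e.1 e.2 ⊆ segment ℝ a b := by
        intro y hy hye
        obtain ⟨ε, hε, H⟩ := eventually_along hg (y - z)
        have hpos : 0 < min ε (1 / 2) := lt_min hε (by norm_num)
        have hle : min ε (1 / 2) ≤ 1 / 2 := min_le_right _ _
        have hm := add_smul_mem_segment (x := z) (y := y) hpos.le (by linarith)
        refine key _ (hye ▸ hm) ((H _ ?_).1 (hy.subset hm)) fun hV' => ?_
        · rw [abs_of_pos hpos]; exact min_le_left _ _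
        · rcases hy.eq_end _ hV' hm with h | h
          · rw [add_eq_left, smul_eq_zero, sub_eq_zero] at h
            exact h.elim hpos.ne' hy.ne.symm
          · have h2 : (1 - min ε (1 / 2)) • (y - z) = 0 := by
              have h3 := sub_eq_zero.2 h.symm
              rw [← h3]; module
            have h4 : 1 - min ε (1 / 2) ≠ 0 := by intro h5; linarith
            rcases smul_eq_zero.1 h2 with h5 | h5
            · exact h4 h5
            · exact hy.ne (sub_eq_zero.1 h5).symm
      rcases he.eq_end z hzV hze with rfl | rfl
      · exact aux _ he rfl
      · exact aux _ he.symm (segment_symm ℝ _ _)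
    · exact key z hze hzab hzV

/-- If the ends lie on different sides of the plane, the intermediate value theorem gives a point on
it; otherwise the end `a` will do. -/
theorem segment_split_functional (f : R3 →ₗ[ℝ] ℝ) (c : ℝ) (a b : R3) :
    ∃ x ∈ segment ℝ a b, (f x ≤ c ∧ f a ≤ c ∨ c ≤ f x ∧ c ≤ f a) ∧
      (f x ≤ c ∧ f b ≤ c ∨ c ≤ f x ∧ c ≤ f b) := by
  have hcont : Continuous fun t : ℝ => f (a + t • (b - a)) := by
    have := f.continuous_of_finiteDimensional
    fun_prop
  have hm : ∀ t ∈ Icc (0 : ℝ) 1, a + t • (b - a) ∈ segment ℝ a b := fun t ht =>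
    add_smul_mem_segment ht.1 ht.2
  by_cases h : f a ≤ c ∧ f b ≤ c ∨ c ≤ f a ∧ c ≤ f b
  · refine ⟨a, left_mem_segment ℝ a b, ?_, h⟩
    rcases le_total (f a) c with h | h <;> simp [h]
  · have hmem : c ∈ uIcc (f (a + (0 : ℝ) • (b - a))) (f (a + (1 : ℝ) • (b - a))) := by
      rw [zero_smul, add_zero, one_smul, add_sub_cancel, mem_uIcc]
      rcases le_total (f a) c with h1 | h1 <;> rcases le_total (f b) c with h2 | h2 <;> simp_all
    obtain ⟨t, ht, hfc⟩ := intermediate_value_uIcc hcont.continuousOn hmem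
    rw [uIcc_of_le zero_le_one] at ht
    have hfc : f (a + t • (b - a)) = c := hfc
    refine ⟨_, hm t ht, ?_, ?_⟩
    · rw [hfc]; simp [le_total]
    · rw [hfc]; simp [le_total]

theorem segUnion_split {S : Set (R3 × R3)} (hS : S.Finite) (f : R3 →ₗ[ℝ] ℝ) (c : ℝ) :
    ∃ S' : Set (R3 × R3), S'.Finite ∧ segUnion S' = segUnion S ∧
      ∀ e' ∈ S', (∃ e ∈ S, e'.1 ∈ segment ℝ e.1 e.2 ∧ e'.2 ∈ segment ℝ e.1 e.2) ∧
        (f e'.1 ≤ c ∧ f e'.2 ≤ c ∨ c ≤ f e'.1 ∧ c ≤ f e'.2) := by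
  choose x hx h1 h2 using fun e : R3 × R3 => segment_split_functional f c e.1 e.2
  refine ⟨⋃ e ∈ S, {(x e, e.1), (x e, e.2)}, hS.biUnion fun e _ => by simp, ?_, ?_⟩
  · ext z
    simp only [segUnion, mem_ofPred_eq, mem_iUnion, mem_insert_iff, mem_singleton_iff]
    constructor
    · rintro ⟨e', ⟨e, he, rfl | rfl⟩, hz⟩
      · exact ⟨e, he, segment_split (hx e) ▸ Or.inl hz⟩
      · exact ⟨e, he, segment_split (hx e) ▸ Or.inr hz⟩
    · rintro ⟨e, he, hz⟩
      rw [segment_split (hx e)] at hz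
      rcases hz with hz | hz
      · exact ⟨_, ⟨e, he, Or.inl rfl⟩, hz⟩
      · exact ⟨_, ⟨e, he, Or.inr rfl⟩, hz⟩
  · intro e' he'
    simp only [mem_iUnion, mem_insert_iff, mem_singleton_iff] at he'
    obtain ⟨e, he, rfl | rfl⟩ := he'
    · exact ⟨⟨e, he, hx e, left_mem_segment ℝ _ _⟩, h1 e⟩
    · exact ⟨⟨e, he, hx e, right_mem_segment ℝ _ _⟩, h2 e⟩

/-! ### Knots are the connected links -/

theorem fin_add_one_ne {k : ℕ} (i : Fin (k + 3)) : i + 1 ≠ i := by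
  intro h
  simp at h

theorem fin_add_two_ne {k : ℕ} (i : Fin (k + 3)) : i + 1 + 1 ≠ i := by
  intro h
  rw [add_assoc] at h
  have : (1 + 1 : Fin (k + 3)) = 0 := by simpa using h
  have h2 := congrArg Fin.val this
  simp only [Fin.val_add, Fin.val_one, Fin.val_zero] at h2
  rw [Nat.mod_eq_of_lt (by omega)] at h2
  omega

theorem eq_or_eq_of_pair {α : Type*} {a b c j l : α} (ha : a = j ∨ a = l) (hb : b = j ∨ b = l)
    (hc : c = j ∨ c = l) (hab : a ≠ b) : c = a ∨ c = b := by
  grind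

theorem IsKnot.isLink {K : Set R3} (h : IsKnot K) : IsLink K := by
  obtain ⟨k, v, hinj, hseg, rfl⟩ := h
  have hcl : ∀ T : Set (Fin (k + 3)), IsClosed (⋃ i ∈ T, segment ℝ (v i) (v (i + 1))) := fun T =>
    T.toFinite.isClosed_biUnion fun i _ => (isCompact_segment _ _).isClosed
  have hne : ∀ i, v i ≠ v (i + 1) := fun i h => fin_add_one_ne i (hinj h).symm
  refine ⟨isCompact_iUnion fun i => isCompact_segment _ _, ?_⟩
  have hvert : ∀ i, LocArc (⋃ i, segment ℝ (v i) (v (i + 1))) (v (i + 1)) := by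
    intro i
    have hx : v (i + 1) ∉ ⋃ j ∈ ({i, i + 1}ᶜ : Set (Fin (k + 3))), segment ℝ (v j) (v (j + 1)) := by
      simp only [mem_iUnion, not_exists]
      intro j hj hm
      simp only [mem_compl_iff, mem_insert_iff, mem_singleton_iff, not_or] at hj
      have := (hseg i j (Ne.symm hj.1) ⟨right_mem_segment ℝ _ _, hm⟩).2
      rcases this with h | h
      · exact hj.2 (hinj h).symm
      · exact hj.1 (add_right_cancel (hinj h)).symm
    have hEq : (⋃ i, segment ℝ (v i) (v (i + 1))) =
        (segment ℝ (v (i + 1)) (v i) ∪ segment ℝ (v (i + 1)) (v (i + 1 + 1))) ∪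
        ⋃ j ∈ ({i, i + 1}ᶜ : Set (Fin (k + 3))), segment ℝ (v j) (v (j + 1)) := by
      ext x
      simp only [mem_iUnion, mem_union]
      constructor
      · rintro ⟨j, hj⟩
        by_cases h1 : j = i
        · subst h1; exact Or.inl (Or.inl (by rwa [segment_symm]))
        by_cases h2 : j = i + 1
        · subst h2; exact Or.inl (Or.inr hj)
        · exact Or.inr ⟨j, by simp [h1, h2], hj⟩
      · rintro ((h | h) | ⟨j, -, h⟩)
        · exact ⟨i, by rwa [segment_symm]⟩
        · exact ⟨i + 1, h⟩
        · exact ⟨j, h⟩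
    rw [hEq]
    have hg := (EventuallyEq.refl (𝓝 (v (i + 1)))
      (segment ℝ (v (i + 1)) (v i) ∪ segment ℝ (v (i + 1)) (v (i + 1 + 1)) : Set R3)).union
      (germ_empty (hcl _) hx)
    rw [union_empty] at hg
    refine LocArc.congr (locArc_of_ends fun hs => ?_) hg
    obtain ⟨r₁, r₂, h1, h2, hr⟩ := hs.exists_pos (sub_ne_zero.2 (hne i))
      (sub_ne_zero.2 (hne (i + 1)).symm)
    have hpos : 0 < r₁ + r₂ := by positivity
    have hm := hseg i (i + 1) (fin_add_one_ne i).symm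
      (a := v (i + 1) + (r₁ / (r₁ + r₂)) • (v i - v (i + 1))) ⟨by
        rw [segment_symm]
        exact add_smul_mem_segment (by positivity) ((div_le_one hpos).2 (by linarith)), by
        have e : (r₁ / (r₁ + r₂)) • (v i - v (i + 1)) =
            (r₂ / (r₁ + r₂)) • (v (i + 1 + 1) - v (i + 1)) := by
          rw [div_eq_inv_mul, div_eq_inv_mul, mul_smul, mul_smul, hr]
        rw [e]
        exact add_smul_mem_segment (by positivity) ((div_le_one hpos).2 (by linarith))⟩
    obtain ⟨m1, m2⟩ := hm
    have : v (i + 1) + (r₁ / (r₁ + r₂)) • (v i - v (i + 1)) = v (i + 1) := by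
      rcases m1 with m1 | m1
      · rcases m2 with m2 | m2
        · exact m2
        · exact absurd (hinj (m1.symm.trans m2)).symm (fin_add_two_ne i)
      · exact m1
    simp [hpos.ne', h1.ne', sub_eq_zero, hne i] at this
  intro x hx
  obtain ⟨i, hi⟩ := mem_iUnion.1 hx
  by_cases h1 : x = v (i + 1)
  · exact h1 ▸ hvert i
  by_cases h2 : x = v i
  · have := hvert (i - 1)
    rw [sub_add_cancel] at this
    exact h2 ▸ this
  have hx' : x ∉ ⋃ j ∈ ({i}ᶜ : Set (Fin (k + 3))), segment ℝ (v j) (v (j + 1)) := by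
    simp only [mem_iUnion, not_exists]
    intro j hj hm
    rcases (hseg i j (Ne.symm hj) ⟨hi, hm⟩).1 with h | h
    exacts [h2 h, h1 h]
  have hEq : (⋃ i, segment ℝ (v i) (v (i + 1))) = segment ℝ (v i) (v (i + 1)) ∪
      ⋃ j ∈ ({i}ᶜ : Set (Fin (k + 3))), segment ℝ (v j) (v (j + 1)) := by
    ext x
    simp only [mem_iUnion, mem_union]
    constructor
    · rintro ⟨j, hj⟩
      by_cases h1 : j = i
      · subst h1; exact Or.inl hj
      · exact Or.inr ⟨j, h1, hj⟩
    · rintro (h | ⟨j, -, h⟩)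
      exacts [⟨i, h⟩, ⟨j, h⟩]
  rw [hEq]
  have hg := (EventuallyEq.refl (𝓝 x) (segment ℝ (v i) (v (i + 1)) : Set R3)).union
    (germ_empty (hcl _) hx')
  rw [union_empty] at hg
  exact (locArc_segment hi h2 h1).congr hg

theorem IsKnot.isConnected {K : Set R3} (h : IsKnot K) : IsConnected K := by
  obtain ⟨k, v, -, -, rfl⟩ := h
  have hstep : ∀ i : Fin (k + 3), Relation.ReflTransGen
      (fun i j => (segment ℝ (v i) (v (i + 1)) ∩ segment ℝ (v j) (v (j + 1))).Nonempty) 0 i := by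
    intro i
    induction i using Fin.induction with
    | zero => exact Relation.ReflTransGen.refl
    | succ i ih =>
      refine ih.tail ⟨v i.succ, ?_, left_mem_segment ℝ _ _⟩
      rw [← Fin.coeSucc_eq_succ]
      exact right_mem_segment ℝ _ _
  refine IsConnected.iUnion_of_reflTransGen (fun i => isConnected_segment _ _) fun i j => ?_
  have hsymm : Std.Symm fun i j : Fin (k + 3) =>
      (segment ℝ (v i) (v (i + 1)) ∩ segment ℝ (v j) (v (j + 1))).Nonempty :=
    ⟨fun a b h => by rwa [inter_comm]⟩
  exact (Relation.ReflTransGen.stdSymm.symm _ _ (hstep i)).trans (hstep j)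

/-- The edge graph is finite and each vertex has exactly two neighbours. Connectedness of `K` makes
the graph connected, so it is a single cycle, and the vertices in the order of this cycle are those
of the polygon. -/
theorem isKnot_of_isLink {K : Set R3} (hK : IsLink K) (hc : IsConnected K) : IsKnot K := by
  classical
  obtain ⟨V, hV, -⟩ := hK.exists_vertexSet (F := ∅) finite_empty (empty_subset _)
  have := hV.finite.fintype
  set G := edgeGraph K V with hG
  have hreg := edgeGraph_regular hK hV
  have hcyc : G.IsCycles := by
    intro i _
    obtain ⟨j, k, hjk, h⟩ := hreg i
    have : G.neighborSet i = {j, k} := by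
      ext l; exact h l
    rw [this, ncard_pair hjk]
  obtain ⟨z, hz⟩ := hc.nonempty
  obtain ⟨x, y, hxy, -⟩ := exists_edge_of_mem hK hV hz
  set x₀ : V := ⟨x, hxy.left_mem⟩
  have hreach : ∀ y : V, G.Reachable x₀ y := by
    by_contra hcon
    push Not at hcon
    obtain ⟨y₀, hy₀⟩ := hcon
    set A : Set R3 := ⋃ e ∈ {e : V × V | G.Adj e.1 e.2 ∧ G.Reachable x₀ e.1},
      segment ℝ (e.1 : R3) e.2
    set B : Set R3 := ⋃ e ∈ {e : V × V | G.Adj e.1 e.2 ∧ ¬ G.Reachable x₀ e.1},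
      segment ℝ (e.1 : R3) e.2
    have hAc : IsClosed A := (toFinite _).isClosed_biUnion fun i _ => (isCompact_segment _ _).isClosed
    have hBc : IsClosed B := (toFinite _).isClosed_biUnion fun i _ => (isCompact_segment _ _).isClosed
    -- Edges reachable from `x₀` and edges that are not form two nonempty closed sets covering `K`.
    -- A common point would force two such edges to share a vertex.
    obtain ⟨w, -, hwA, hwB⟩ := isPreconnected_closed_iff.1 hc.isPreconnected A B hAc hBc (by
      intro w hw
      obtain ⟨a, b, hab, hwab⟩ := exists_edge_of_mem hK hV hw
      by_cases hr : G.Reachable x₀ ⟨a, hab.left_mem⟩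
      · exact Or.inl (mem_biUnion (x := ((⟨a, hab.left_mem⟩, ⟨b, hab.right_mem⟩) : V × V)) ⟨hab, hr⟩ hwab)
      · exact Or.inr (mem_biUnion (x := ((⟨a, hab.left_mem⟩, ⟨b, hab.right_mem⟩) : V × V)) ⟨hab, hr⟩ hwab))
      ⟨x, hV.subset hxy.left_mem, mem_biUnion (x := ((x₀, ⟨y, hxy.right_mem⟩) : V × V))
        ⟨hxy, SimpleGraph.Reachable.refl _⟩ (left_mem_segment ℝ _ _)⟩
      (by
        obtain ⟨j, l, hjl, h⟩ := hreg y₀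
        exact ⟨y₀, hV.subset y₀.2, mem_biUnion (x := (y₀, j))
          ⟨(h j).2 (Or.inl rfl), hy₀⟩ (left_mem_segment ℝ _ _)⟩)
    simp only [A, B, mem_iUnion] at hwA hwB
    obtain ⟨⟨a, b⟩, ⟨hab, hr⟩, hw1⟩ := hwA
    obtain ⟨⟨c, d⟩, ⟨hcd, hr'⟩, hw2⟩ := hwB
    have hrb : G.Reachable x₀ b := hr.trans hab.reachable
    have hrd : ¬ G.Reachable x₀ d := fun h => hr' (h.trans hcd.symm.reachable)
    have n1 : a ≠ c := fun h => hr' (h ▸ hr)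
    have n2 : a ≠ d := fun h => hrd (h ▸ hr)
    have n3 : b ≠ c := fun h => hr' (h ▸ hrb)
    have n4 : b ≠ d := fun h => hrd (h ▸ hrb)
    rw [Ne, ← Subtype.coe_inj] at n1 n2 n3 n4
    have := edges_share_vertex hK hab hcd hw1 hw2
    grind
  -- In a graph with two neighbours at each vertex there is a cycle through all vertices of the
  -- component, which is everything here.
  obtain ⟨p, hp, hverts⟩ := hcyc.exists_cycle_toSubgraph_verts_eq_connectedComponentSupp
    (c := G.connectedComponentMk x₀) (v := x₀) rfl ⟨⟨y, hxy.right_mem⟩, hxy⟩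
  have hall : ∀ y : V, y ∈ p.support := by
    intro y
    rw [← SimpleGraph.Walk.mem_verts_toSubgraph, hverts]
    exact (SimpleGraph.ConnectedComponent.eq.2 (hreach y).symm)
  obtain ⟨k, hk⟩ := Nat.exists_eq_add_of_le' hp.three_le_length
  have hsucc : ∀ i : Fin (k + 3), p.getVert ((i + 1 : Fin (k + 3)) : ℕ) = p.getVert (i + 1) := by
    intro i
    rcases lt_or_eq_of_le (Nat.succ_le_of_lt i.2) with h | h
    · rw [Fin.val_add_one_of_lt' (by simpa using h)]
    · have : i = Fin.last _ := Fin.ext (by simpa using Nat.succ_injective h)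
      subst this
      simp only [Fin.last_add_one, Fin.val_zero, SimpleGraph.Walk.getVert_zero, Fin.val_last]
      rw [show k + 2 + 1 = p.length by omega, SimpleGraph.Walk.getVert_length]
  have hadj : ∀ i : Fin (k + 3), G.Adj (p.getVert i) (p.getVert ((i + 1 : Fin (k + 3)) : ℕ)) := by
    intro i
    rw [hsucc]
    exact p.adj_getVert_succ (by omega)
  have hinj : Function.Injective fun i : Fin (k + 3) => ((p.getVert i : V) : R3) := by
    intro i j hij
    have := hp.getVert_injOn' (x₁ := (i : ℕ)) (x₂ := (j : ℕ)) (by simp; omega) (by simp; omega)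
      (Subtype.ext hij)
    exact Fin.ext this
  have hsurj : ∀ y : V, ∃ i : Fin (k + 3), p.getVert i = y := by
    intro y
    obtain ⟨n, hn, hle⟩ := SimpleGraph.Walk.mem_support_iff_exists_getVert.1 (hall y)
    rcases hle.lt_or_eq with h | h
    · exact ⟨⟨n, by omega⟩, hn⟩
    -- The closed walk returns to its start at time `p.length`, which is not an index of `Fin (k +
    -- 3)`; the index `0` names the same vertex.
    · refine ⟨0, ?_⟩
      rw [h, SimpleGraph.Walk.getVert_length] at hn
      simpa using hn
  refine ⟨k, fun i => p.getVert i, hinj, ?_, ?_⟩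
  · rintro i j hij w ⟨h1, h2⟩
    rcases edges_share_vertex hK (hadj i) (hadj j) h1 h2 with (⟨h, -⟩ | ⟨h, h'⟩) | h
    · exact absurd (hinj h) hij
    · have a1 : i = j + 1 := hinj h
      have a2 : i + 1 = j := hinj h'
      rw [a1] at a2
      exact absurd a2 (fin_add_two_ne j)
    · exact h
  · ext w
    simp only [mem_iUnion]
    constructor
    · intro hw
      obtain ⟨a, b, hab, hwab⟩ := exists_edge_of_mem hK hV hw
      obtain ⟨i, hi⟩ := hsurj ⟨a, hab.left_mem⟩
      obtain ⟨j, l, hjl, hn⟩ := hreg (p.getVert i)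
      have m1 := (hn _).1 (hadj i)
      have m2 := (hn _).1 (by have := hadj (i - 1); rw [sub_add_cancel] at this; exact this.symm)
      have m3 := (hn ⟨b, hab.right_mem⟩).1 (by rw [hi]; exact hab)
      have hne : p.getVert ((i + 1 : Fin (k + 3)) : ℕ) ≠ p.getVert ((i - 1 : Fin (k + 3)) : ℕ) := by
        intro h
        have := hinj (congrArg Subtype.val h)
        have h2 := fin_add_two_ne (i - 1)
        rw [sub_add_cancel] at h2
        exact h2 this
      have hia : ((p.getVert i : V) : R3) = a := congrArg Subtype.val hi
      have := eq_or_eq_of_pair m1 m2 m3 hne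
      rcases this with h | h
      · have hb : b = ((p.getVert ((i + 1 : Fin (k + 3)) : ℕ) : V) : R3) := congrArg Subtype.val h
        exact ⟨i, by rwa [hia, ← hb]⟩
      · have hb : b = ((p.getVert ((i - 1 : Fin (k + 3)) : ℕ) : V) : R3) := congrArg Subtype.val h
        exact ⟨i - 1, by rwa [sub_add_cancel, hia, ← hb, segment_symm]⟩
    · rintro ⟨i, hi⟩
      exact IsEdge.subset (hadj i) hi

/-! ### Affine maps acting on links and on pieces of links -/

theorem aff_apply (A : R3 ≃ᵃ[ℝ] R3) (x y : R3) (s : ℝ) :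
    A (x + s • (y - x)) = A x + s • (A y - A x) := by
  have h := A.toAffineMap.apply_lineMap x y s
  simp only [AffineMap.lineMap_apply, vsub_eq_sub, vadd_eq_add, AffineEquiv.coe_toAffineMap] at h
  rw [add_comm, h, add_comm]

theorem aff_continuous (A : R3 ≃ᵃ[ℝ] R3) : Continuous A :=
  A.toAffineMap.continuous_of_finiteDimensional

theorem aff_image_segment (A : R3 ≃ᵃ[ℝ] R3) (a b : R3) :
    A '' segment ℝ a b = segment ℝ (A a) (A b) :=
  AffOn.image fun s _ => aff_apply A a b s

theorem aff_image_ray (A : R3 ≃ᵃ[ℝ] R3) (x u : R3) : A '' ray x u = ray (A x) (A.linear u) := by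
  have h : ∀ t : ℝ, A (x + t • u) = A x + t • A.linear u := by
    intro t
    have := A.map_vadd x (t • u)
    simp only [vadd_eq_add, map_smul] at this
    rw [add_comm, this, add_comm]
  ext y
  constructor
  · rintro ⟨_, ⟨t, ht, rfl⟩, rfl⟩
    exact ⟨t, ht, h t⟩
  · rintro ⟨t, ht, rfl⟩
    exact ⟨_, ⟨t, ht, rfl⟩, h t⟩

theorem germ_image (A : R3 ≃ᵃ[ℝ] R3) {K S : Set R3} {x : R3} (h : K =ᶠ[𝓝 x] S) :
    (A '' K : Set R3) =ᶠ[𝓝 (A x)] (A '' S : Set R3) := by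
  have hc : Tendsto A.symm (𝓝 (A x)) (𝓝 x) := by
    simpa using (aff_continuous A.symm).tendsto (A x)
  rw [eventuallyEq_set]
  filter_upwards [hc.eventually h.mem_iff] with y hy
  have e : ∀ S : Set R3, y ∈ A '' S ↔ A.symm y ∈ S := fun S => by
    constructor
    · rintro ⟨z, hz, rfl⟩; simpa using hz
    · intro h; exact ⟨_, h, by simp⟩
  rw [e, e, hy]

theorem IsLink.image {K : Set R3} (h : IsLink K) (A : R3 ≃ᵃ[ℝ] R3) : IsLink (A '' K) := by
  refine ⟨h.1.image (aff_continuous A), ?_⟩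
  rintro _ ⟨x, hx, rfl⟩
  obtain ⟨u, v, huv, hg⟩ := h.2 x hx
  refine ⟨A.linear u, A.linear v, ?_, ?_⟩
  · rwa [SameRay.sameRay_map_iff]
  · have := germ_image A hg
    rwa [image_union, aff_image_ray, aff_image_ray] at this

/-- An isotopy that moves each of finitely many pieces of a link by affine maps. -/
theorem isotopic_of_pieces {J : Type*} [Finite J] (Kp : J → Set R3)
    (hseg : ∀ j, ∃ S : Set (R3 × R3), S.Finite ∧ Kp j = segUnion S)
    (ψ : ℝ → J → R3 ≃ᵃ[ℝ] R3) (hcont : ∀ j x, Continuous fun t => ψ t j x)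
    (hinj : ∀ t ∈ Icc (0 : ℝ) 1, ∀ i j, ∀ x ∈ Kp i, ∀ y ∈ Kp j, ψ t i x = ψ t j y ↔ x = y)
    (hK : IsLink (⋃ j, ψ 0 j '' Kp j)) :
    Isotopic (⋃ j, ψ 0 j '' Kp j) (⋃ j, ψ 1 j '' Kp j) := by
  classical
  -- A point of the link at time `0` is assigned a piece and a preimage by choice. The equivalence
  -- `hinj` says that pieces stay glued exactly where they were, so neither the value nor the
  -- injectivity depends on the choice.
  set φ : ℝ → R3 → R3 := fun t z =>
    if h : ∃ jx : J × R3, jx.2 ∈ Kp jx.1 ∧ ψ 0 jx.1 jx.2 = z then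
      ψ t h.choose.1 h.choose.2 else z with hφ
  have h01 : (0 : ℝ) ∈ Icc (0 : ℝ) 1 := by simp
  have hφ' : ∀ t ∈ Icc (0 : ℝ) 1, ∀ j, ∀ x ∈ Kp j, φ t (ψ 0 j x) = ψ t j x := by
    intro t ht j x hx
    have h : ∃ jx : J × R3, jx.2 ∈ Kp jx.1 ∧ ψ 0 jx.1 jx.2 = ψ 0 j x := ⟨(j, x), hx, rfl⟩
    simp only [hφ, dif_pos h]
    obtain ⟨h1, h2⟩ := h.choose_spec
    rw [hinj t ht _ _ _ h1 _ hx]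
    exact (hinj 0 h01 _ _ _ h1 _ hx).1 h2
  have himg : ∀ t ∈ Icc (0 : ℝ) 1, φ t '' (⋃ j, ψ 0 j '' Kp j) = ⋃ j, ψ t j '' Kp j := by
    intro t ht
    rw [image_iUnion]
    refine iUnion_congr fun j => ?_
    rw [image_image]
    exact image_congr fun x hx => hφ' t ht j x hx
  choose S hSfin hS using hseg
  have := isotopic_of_family hK (S := ⋃ j, (fun e : R3 × R3 => (ψ 0 j e.1, ψ 0 j e.2)) '' S j)
    (finite_iUnion fun j => (hSfin j).image _) ?_ (φ := φ) ?_ ?_ ?_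
  · rwa [himg 0 h01, himg 1 (by simp)] at this
  · ext z
    simp only [segUnion, mem_iUnion, mem_ofPred_eq, mem_image]
    constructor
    · rintro ⟨j, x, hx, rfl⟩
      rw [hS j] at hx
      obtain ⟨e, he, hx⟩ := hx
      exact ⟨_, ⟨j, e, he, rfl⟩, by rw [← aff_image_segment]; exact ⟨x, hx, rfl⟩⟩
    · rintro ⟨_, ⟨j, e, he, rfl⟩, hz⟩
      rw [← aff_image_segment] at hz
      obtain ⟨x, hx, rfl⟩ := hz
      exact ⟨j, x, by rw [hS j]; exact ⟨e, he, hx⟩, rfl⟩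
  · intro z hz
    obtain ⟨j, x, hx, rfl⟩ := mem_iUnion.1 hz
    exact (hcont j x).continuousOn.congr fun t ht => hφ' t ht j x hx
  · intro t ht e he
    simp only [mem_iUnion, mem_image] at he
    obtain ⟨j, e, he, rfl⟩ := he
    have hm : ∀ x ∈ segment ℝ e.1 e.2, x ∈ Kp j := fun x hx => by
      rw [hS j]; exact ⟨e, he, hx⟩
    intro s hs
    simp only
    rw [← aff_apply, hφ' t ht j _ (hm _ (add_smul_mem_segment hs.1 hs.2)),
      hφ' t ht j _ (hm _ (left_mem_segment ℝ _ _)), hφ' t ht j _ (hm _ (right_mem_segment ℝ _ _)),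
      aff_apply]
  · intro t ht z hz w hw hzw
    obtain ⟨i, x, hx, rfl⟩ := mem_iUnion.1 hz
    obtain ⟨j, y, hy, rfl⟩ := mem_iUnion.1 hw
    rw [hφ' t ht i x hx, hφ' t ht j y hy, hinj t ht i j x hx y hy] at hzw
    exact (hinj 0 h01 i j x hx y hy).2 hzw

/-- Reversing time shows that it is enough to know that one of the two final positions is a link. -/
theorem isotopic_of_pieces' {J : Type*} [Finite J] (Kp : J → Set R3)
    (hseg : ∀ j, ∃ S : Set (R3 × R3), S.Finite ∧ Kp j = segUnion S)
    (ψ : ℝ → J → R3 ≃ᵃ[ℝ] R3) (hcont : ∀ j x, Continuous fun t => ψ t j x)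
    (hinj : ∀ t ∈ Icc (0 : ℝ) 1, ∀ i j, ∀ x ∈ Kp i, ∀ y ∈ Kp j, ψ t i x = ψ t j y ↔ x = y)
    (hK : IsLink (⋃ j, ψ 0 j '' Kp j) ∨ IsLink (⋃ j, ψ 1 j '' Kp j)) :
    Isotopic (⋃ j, ψ 0 j '' Kp j) (⋃ j, ψ 1 j '' Kp j) := by
  rcases hK with hK | hK
  · exact isotopic_of_pieces Kp hseg ψ hcont hinj hK
  · have := isotopic_of_pieces Kp hseg (fun t => ψ (1 - t))
      (fun j x => (hcont j x).comp (by fun_prop : Continuous fun t : ℝ => 1 - t))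
      (fun t ht => hinj (1 - t) ⟨by linarith [ht.2], by linarith [ht.1]⟩) (by simpa using hK)
    simpa using this.symm

/-- An affine map that does not change the isotopy type of links. -/
def Good (A : R3 ≃ᵃ[ℝ] R3) : Prop := ∀ L, IsLink L → Isotopic L (A '' L)

theorem Good.trans {A B : R3 ≃ᵃ[ℝ] R3} (hA : Good A) (hB : Good B) : Good (A.trans B) := by
  intro L hL
  have e : (A.trans B) '' L = B '' (A '' L) := by rw [image_image]; rfl
  rw [e]
  exact (hA L hL).trans (hB _ (hL.image A))

theorem aff_image_symm_image (A : R3 ≃ᵃ[ℝ] R3) (L : Set R3) : A '' (A.symm '' L) = L := by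
  rw [image_image]; simp

theorem Good.symm {A : R3 ≃ᵃ[ℝ] R3} (hA : Good A) : Good A.symm := by
  intro L hL
  have := hA _ (hL.image A.symm)
  rw [aff_image_symm_image] at this
  exact this.symm

theorem good_of_family {A : R3 ≃ᵃ[ℝ] R3} (ψ : ℝ → R3 ≃ᵃ[ℝ] R3)
    (hcont : ∀ x, Continuous fun t => ψ t x) (h0 : ∀ x, ψ 0 x = x) (h1 : ∀ x, ψ 1 x = A x) :
    Good A := by
  intro L hL
  obtain ⟨S, hS, hLS, -⟩ := hL.exists_segUnion finite_empty (empty_subset _)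
  have e0 : ψ 0 '' L = L := by
    rw [image_congr fun x _ => h0 x, image_id']
  have e1 : ψ 1 '' L = A '' L := image_congr fun x _ => h1 x
  have := isotopic_of_pieces (J := Unit) (fun _ => L) (fun _ => ⟨S, hS, hLS⟩) (fun t _ => ψ t)
    (fun _ x => hcont x) (fun t _ _ _ x _ y _ => (ψ t).injective.eq_iff)
    (by rw [iUnion_const, e0]; exact hL)
  rwa [iUnion_const, iUnion_const, e0, e1] at this

/-- The homothety with centre `o` and ratio `c` (the identity if `c = 0`). -/
noncomputable def hom (o : R3) (c : ℝ) : R3 ≃ᵃ[ℝ] R3 :=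
  if h : c = 0 then AffineEquiv.refl ℝ R3 else AffineEquiv.homothetyUnitsMulHom o (Units.mk0 c h)

theorem hom_apply {c : ℝ} (hc : c ≠ 0) (o x : R3) : hom o c x = o + c • (x - o) := by
  simp only [hom, dif_neg hc, AffineEquiv.coe_homothetyUnitsMulHom_apply, Units.val_mk0,
    AffineMap.homothety_apply, vsub_eq_sub, vadd_eq_add]
  rw [add_comm]

theorem good_hom (o : R3) {c : ℝ} (hc : 0 < c) : Good (hom o c) := by
  -- The family is indexed by all real `t`, so the ratio is bounded below by `min 1 c`; on `[0, 1]`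
  -- this changes nothing.
  have hpos : ∀ t : ℝ, 0 < max (1 + t * (c - 1)) (min 1 c) := fun t =>
    lt_max_of_lt_right (lt_min one_pos hc)
  refine good_of_family (fun t => hom o (max (1 + t * (c - 1)) (min 1 c))) ?_ ?_ ?_
  · intro x
    simp only [hom_apply (hpos _).ne']
    fun_prop
  · intro x
    rw [hom_apply (hpos 0).ne']
    simp
  · intro x
    rw [hom_apply (hpos 1).ne', hom_apply hc.ne']
    simp

/-- The shear `x ↦ x + (ℓ x + c) v`, for `ℓ v = 0`. -/
noncomputable def shear (ℓ : R3 →ₗ[ℝ] ℝ) (v : R3) (h : ℓ v = 0) (c : ℝ) : R3 ≃ᵃ[ℝ] R3 :=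
  AffineEquiv.mk' (fun x => x + (ℓ x + c) • v)
    (LinearEquiv.ofLinearMap (LinearMap.id + ℓ.smulRight v) (LinearMap.id - ℓ.smulRight v)
      (by ext x; simp [h]) (by ext x; simp [h])) 0
    (by intro x; simp; module)

theorem shear_apply (ℓ : R3 →ₗ[ℝ] ℝ) (v : R3) (h : ℓ v = 0) (c : ℝ) (x : R3) :
    shear ℓ v h c x = x + (ℓ x + c) • v := rfl

theorem good_shear (ℓ : R3 →ₗ[ℝ] ℝ) (v : R3) (h : ℓ v = 0) (c : ℝ) : Good (shear ℓ v h c) := by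
  refine good_of_family (fun t => shear (t • ℓ) v (by simp [h]) (t * c)) ?_ ?_ ?_
  · intro x
    simp only [shear_apply, LinearMap.smul_apply, smul_eq_mul]
    fun_prop
  · intro x; simp [shear_apply]
  · intro x; simp [shear_apply]

/-- The form used for inserted arcs: the rest stays fixed while two pieces, typically the arc and an
adjacent segment, move by different affine maps that agree where the pieces meet. -/
theorem isotopic_of_three_pieces {K₀ K₁ K₂ : Set R3}
    (h₀ : ∃ S : Set (R3 × R3), S.Finite ∧ K₀ = segUnion S)
    (h₁ : ∃ S : Set (R3 × R3), S.Finite ∧ K₁ = segUnion S)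
    (h₂ : ∃ S : Set (R3 × R3), S.Finite ∧ K₂ = segUnion S)
    (σ τ : ℝ → R3 ≃ᵃ[ℝ] R3) (hσ : ∀ x, Continuous fun t => σ t x)
    (hτ : ∀ x, Continuous fun t => τ t x)
    (h01 : ∀ t ∈ Icc (0 : ℝ) 1, ∀ x ∈ K₀, ∀ y ∈ K₁, x = σ t y ↔ x = y)
    (h02 : ∀ t ∈ Icc (0 : ℝ) 1, ∀ x ∈ K₀, ∀ y ∈ K₂, x = τ t y ↔ x = y)
    (h12 : ∀ t ∈ Icc (0 : ℝ) 1, ∀ x ∈ K₁, ∀ y ∈ K₂, σ t x = τ t y ↔ x = y)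
    (hK : IsLink (K₀ ∪ (σ 0 '' K₁ ∪ τ 0 '' K₂)) ∨ IsLink (K₀ ∪ (σ 1 '' K₁ ∪ τ 1 '' K₂))) :
    Isotopic (K₀ ∪ (σ 0 '' K₁ ∪ τ 0 '' K₂)) (K₀ ∪ (σ 1 '' K₁ ∪ τ 1 '' K₂)) := by
  set Kp : Fin 3 → Set R3 := ![K₀, K₁, K₂]
  set ψ : ℝ → Fin 3 → R3 ≃ᵃ[ℝ] R3 := fun t => ![AffineEquiv.refl ℝ R3, σ t, τ t]
  have hU : ∀ t, (⋃ j, ψ t j '' Kp j) = K₀ ∪ (σ t '' K₁ ∪ τ t '' K₂) := by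
    intro t
    ext x
    rw [mem_iUnion, Fin.exists_fin_succ, Fin.exists_fin_two]
    simp [Kp, ψ]
  rw [← hU, ← hU] at hK ⊢
  refine isotopic_of_pieces' Kp ?_ ψ ?_ ?_ hK
  · intro j
    fin_cases j
    exacts [h₀, h₁, h₂]
  · intro j x
    fin_cases j
    · exact continuous_const
    · exact hσ x
    · exact hτ x
  · intro t ht
    have hlt : ∀ i j, i < j → ∀ x ∈ Kp i, ∀ y ∈ Kp j, ψ t i x = ψ t j y ↔ x = y := by
      intro i j hij
      fin_cases i <;> fin_cases j <;> first | exact absurd hij (by decide) | skip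
      · exact h01 t ht
      · exact h02 t ht
      · exact h12 t ht
    intro i j x hx y hy
    rcases lt_trichotomy i j with h | h | h
    · exact hlt i j h x hx y hy
    · subst h; exact (ψ t i).injective.eq_iff
    · rw [eq_comm, hlt j i h y hy x hx, eq_comm]

/-! ### Arcs inserted into a link, and shrinking them -/

theorem IsLink.segUnion_compl {Q : Set R3} (hQ : IsLink Q) {c d : R3} (h : segment ℝ c d ⊆ Q) :
    ∃ S : Set (R3 × R3), S.Finite ∧ (Q \ segment ℝ c d) ∪ {c, d} = segUnion S := by
  have hcQ := h (left_mem_segment ℝ c d)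
  have hdQ := h (right_mem_segment ℝ c d)
  obtain ⟨S, hS, hQS, hdich⟩ := hQ.exists_segUnion (F := {c, d}) (by simp)
    (by rintro x (rfl | rfl); exacts [hcQ, hdQ])
  refine ⟨{e ∈ S | segment ℝ e.1 e.2 ∩ segment ℝ c d ⊆ {c, d}} ∪ {(c, c), (d, d)},
    (hS.sep _).union (by simp), ?_⟩
  ext x
  constructor
  · rintro (⟨hxQ, hx⟩ | rfl | rfl)
    · rw [hQS] at hxQ
      obtain ⟨e, he, hxe⟩ := hxQ
      refine ⟨e, Or.inl ⟨he, ?_⟩, hxe⟩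
      refine (hdich e he c (by simp) d (by simp) h).resolve_left fun hsub => hx (hsub hxe)
    · exact ⟨(x, x), by simp, by simp⟩
    · exact ⟨(x, x), by simp, by simp⟩
  · rintro ⟨e, ⟨he, hsub⟩ | rfl | rfl, hx⟩
    · by_cases hxs : x ∈ segment ℝ c d
      · exact Or.inr (hsub ⟨hx, hxs⟩)
      · exact Or.inl ⟨hQS ▸ ⟨e, he, hx⟩, hxs⟩
    · right; left; simpa using hx
    · right; right; simpa using hx

/-- An arc `α` from `p` to `q` whose convex hull meets the line `pq` in the segment `pq` only. -/
structure Tangle (α : Set R3) (p q : R3) : Prop where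
  left_mem : p ∈ α
  right_mem : q ∈ α
  ne : p ≠ q
  segs : ∃ S : Set (R3 × R3), S.Finite ∧ α = segUnion S
  thin : ∀ s : ℝ, p + s • (q - p) ∈ convexHull ℝ α → 0 ≤ s ∧ s ≤ 1

theorem Tangle.symm {α : Set R3} {p q : R3} (h : Tangle α p q) : Tangle α q p :=
  ⟨h.right_mem, h.left_mem, h.ne.symm, h.segs, fun s hs => by
    have := h.thin (1 - s) (by convert hs using 1; module)
    constructor <;> linarith [this.1, this.2]⟩

theorem Tangle.isCompact_hull {α : Set R3} {p q : R3} (h : Tangle α p q) :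
    IsCompact (convexHull ℝ α) := by
  obtain ⟨S, hS, hαS⟩ := h.segs
  set F : Set R3 := Prod.fst '' S ∪ Prod.snd '' S
  have hF : F.Finite := (hS.image _).union (hS.image _)
  have hFα : F ⊆ α := by
    rintro x (⟨e, he, rfl⟩ | ⟨e, he, rfl⟩)
    · exact hαS ▸ ⟨e, he, left_mem_segment ℝ _ _⟩
    · exact hαS ▸ ⟨e, he, right_mem_segment ℝ _ _⟩
  have hαF : α ⊆ convexHull ℝ F := by
    intro x hx
    rw [hαS] at hx
    obtain ⟨e, he, hx⟩ := hx
    exact (convex_convexHull ℝ F).segment_subset (subset_convexHull ℝ F (Or.inl ⟨e, he, rfl⟩))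
      (subset_convexHull ℝ F (Or.inr ⟨e, he, rfl⟩)) hx
  have : convexHull ℝ α = convexHull ℝ F :=
    Subset.antisymm (convexHull_min hαF (convex_convexHull ℝ F)) (convexHull_mono hFα)
  rw [this]
  exact Set.Finite.isCompact_convexHull (𝕜 := ℝ) hF

/-- The result of replacing the segment `A '' pq` of `Q` by the arc `A '' α`. -/
def ins (α : Set R3) (p q : R3) (Q : Set R3) (A : R3 ≃ᵃ[ℝ] R3) : Set R3 :=
  (Q \ A '' segment ℝ p q) ∪ A '' α

theorem ins_symm (α : Set R3) (p q : R3) (Q : Set R3) (A : R3 ≃ᵃ[ℝ] R3) :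
    ins α q p Q A = ins α p q Q A := by rw [ins, segment_symm]; rfl

/-- The arc `A '' α` can be inserted into `Q`: its convex hull meets `Q` in the segment `A '' pq`,
which lies inside a segment `ab` of `Q`. -/
structure State (α : Set R3) (p q : R3) (Q : Set R3) (A : R3 ≃ᵃ[ℝ] R3) (a b : R3) : Prop where
  good : Good A
  sub : segment ℝ a b ⊆ Q
  margin : ∃ s₁ s₂ : ℝ, 0 < s₁ ∧ s₁ < s₂ ∧ s₂ < 1 ∧ A p = a + s₁ • (b - a) ∧
    A q = a + s₂ • (b - a)
  clear : ∀ x ∈ convexHull ℝ α, A x ∈ Q → x ∈ segment ℝ p q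

theorem State.symm {α : Set R3} {p q : R3} {Q : Set R3} {A : R3 ≃ᵃ[ℝ] R3} {a b : R3}
    (h : State α p q Q A a b) : State α q p Q A b a := by
  obtain ⟨s₁, s₂, h1, h2, h3, e1, e2⟩ := h.margin
  refine ⟨h.good, segment_symm ℝ a b ▸ h.sub, ⟨1 - s₂, 1 - s₁, by linarith, by linarith,
    by linarith, ?_, ?_⟩, fun x hx hA => segment_symm ℝ p q ▸ h.clear x hx hA⟩
  · rw [e2]; module
  · rw [e1]; module

theorem param_inj {d : R3} (hd : d ≠ 0) {a : R3} {u u' : ℝ} (h : a + u • d = a + u' • d) :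
    u = u' := smul_left_injective ℝ hd (add_left_cancel h)

theorem margin_ne {p q a b : R3} {A : R3 ≃ᵃ[ℝ] R3} {s₁ s₂ : ℝ} (hpq : p ≠ q)
    (e1 : A p = a + s₁ • (b - a)) (e2 : A q = a + s₂ • (b - a)) : b - a ≠ 0 := by
  intro h
  rw [h, smul_zero] at e1 e2
  exact hpq (A.injective (e1.trans e2.symm))

/-- Points of the line `ab` in the image of the hull. -/
theorem Tangle.line_mem {α : Set R3} {p q : R3} (h : Tangle α p q) {A : R3 ≃ᵃ[ℝ] R3} {a b : R3}
    {s₁ s₂ : ℝ} (h12 : s₁ < s₂) (e1 : A p = a + s₁ • (b - a)) (e2 : A q = a + s₂ • (b - a))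
    {x : R3} (hx : x ∈ convexHull ℝ α) {u : ℝ} (hu : A x = a + u • (b - a)) :
    s₁ ≤ u ∧ u ≤ s₂ ∧ x = p + ((u - s₁) / (s₂ - s₁)) • (q - p) := by
  have hpos : 0 < s₂ - s₁ := by linarith
  have hx' : x = p + ((u - s₁) / (s₂ - s₁)) • (q - p) := by
    apply A.injective
    rw [aff_apply, hu, e1, e2]
    have : a + s₂ • (b - a) - (a + s₁ • (b - a)) = (s₂ - s₁) • (b - a) := by module
    rw [this, smul_smul, div_mul_cancel₀ _ hpos.ne']
    module
  obtain ⟨h0, h1⟩ := h.thin _ (hx' ▸ hx)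
  rw [div_nonneg_iff] at h0
  rw [div_le_one hpos] at h1
  refine ⟨?_, by linarith, hx'⟩
  rcases h0 with h0 | h0 <;> linarith [h0.1, h0.2]

/-- A homothety of ratio at most `1` about a point of the chord maps the convex hull into itself.
Hence shrinking an inserted arc never creates new intersections with the link. -/
theorem Tangle.hom_mem {α : Set R3} {p q : R3} (h : Tangle α p q) {o : R3}
    (ho : o ∈ segment ℝ p q) {c : ℝ} (hc : 0 < c) (hc1 : c ≤ 1) {x : R3}
    (hx : x ∈ convexHull ℝ α) : hom o c x ∈ convexHull ℝ α := by
  rw [hom_apply hc.ne']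
  have ho' : o ∈ convexHull ℝ α := (convex_convexHull ℝ α).segment_subset
    (subset_convexHull ℝ α h.left_mem) (subset_convexHull ℝ α h.right_mem) ho
  exact (convex_convexHull ℝ α).segment_subset ho' hx (add_smul_mem_segment hc.le hc1)

theorem mem_aff_image (A : R3 ≃ᵃ[ℝ] R3) (S : Set R3) (x : R3) : A x ∈ A '' S ↔ x ∈ S :=
  A.injective.mem_set_image

/-- The end at `q` is fixed. While the arc shrinks towards `q`, the segment from `a` to the moving
end is stretched by a homothety about `a`, so that the two stay attached. This is an isotopy in
three pieces: rest, segment, arc. -/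
theorem State.shrink_right {α : Set R3} {p q : R3} (hα : Tangle α p q) {Q : Set R3}
    {A : R3 ≃ᵃ[ℝ] R3} {a b : R3} (h : State α p q Q A a b) (hQ : IsLink Q)
    (hI : IsLink (ins α p q Q A)) {c : ℝ} (hc : 0 < c) (hc1 : c ≤ 1) :
    State α p q Q ((hom q c).trans A) a b ∧
      Isotopic (ins α p q Q A) (ins α p q Q ((hom q c).trans A)) := by
  obtain ⟨s₁, s₂, h1, h2, h3, e1, e2⟩ := h.margin
  have hd := margin_ne hα.ne e1 e2
  have hqs : q ∈ segment ℝ p q := right_mem_segment ℝ p q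
  -- the position of the moving end point
  have hp : ∀ c : ℝ, 0 < c → A (hom q c p) = a + (s₂ - c * (s₂ - s₁)) • (b - a) := by
    intro c hc
    rw [hom_apply hc.ne', aff_apply, e1, e2]; module
  have hq : ∀ c : ℝ, 0 < c → hom q c q = q := by
    intro c hc; rw [hom_apply hc.ne']; simp
  -- points of the shrunk hull on the line
  have hline : ∀ c : ℝ, 0 < c → ∀ x ∈ convexHull ℝ α, ∀ u : ℝ, A (hom q c x) = a + u • (b - a) →
      s₂ - c * (s₂ - s₁) ≤ u ∧ u ≤ s₂ ∧ (u = s₂ - c * (s₂ - s₁) → x = p) ∧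
        (u = s₂ → x = q) ∧ x ∈ segment ℝ p q := by
    intro c hc x hx u hu
    have hAx : A x = a + (s₂ + (u - s₂) / c) • (b - a) := by
      rw [hom_apply hc.ne', aff_apply, e2] at hu
      have e3 : c • A x = (a + u • (b - a)) - (a + s₂ • (b - a)) + c • (a + s₂ • (b - a)) := by
        rw [← hu]; module
      have e4 : A x = c⁻¹ • (c • A x) := by rw [smul_smul, inv_mul_cancel₀ hc.ne', one_smul]
      rw [e4, e3, div_eq_inv_mul]
      have : c⁻¹ • c • (a + s₂ • (b - a)) = a + s₂ • (b - a) := by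
        rw [smul_smul, inv_mul_cancel₀ hc.ne', one_smul]
      rw [smul_add, this]
      module
    obtain ⟨l1, l2, l3⟩ := hα.line_mem h2 e1 e2 hx hAx
    have l1' : (s₁ - s₂) * c ≤ u - s₂ := by
      rw [← le_div_iff₀ hc]; linarith
    have l2' : u - s₂ ≤ 0 := by
      by_contra hcon
      push Not at hcon
      have := div_pos hcon hc
      linarith
    refine ⟨by linarith, by linarith, fun hu => ?_, fun hu => ?_, ?_⟩
    · apply A.injective
      rw [hAx, e1, hu]
      congr 2
      field_simp
      ring
    · apply A.injective
      rw [hAx, e2, hu]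
      simp
    · have hpos : 0 < s₂ - s₁ := by linarith
      rw [l3]
      exact add_smul_mem_segment (div_nonneg (by linarith) hpos.le)
        ((div_le_one hpos).2 (by linarith))
  have hsegpq : ∀ x ∈ segment ℝ p q, ∃ u, s₁ ≤ u ∧ u ≤ s₂ ∧ A x = a + u • (b - a) := by
    intro x hx
    rw [segment_eq_lines] at hx
    obtain ⟨s, hs0, hs1, rfl⟩ := hx
    refine ⟨s₁ + s * (s₂ - s₁), by nlinarith, by nlinarith, ?_⟩
    rw [aff_apply, e1, e2]; module
  have hState : State α p q Q ((hom q c).trans A) a b := by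
    refine ⟨(good_hom q hc).trans h.good, h.sub, ⟨s₂ - c * (s₂ - s₁), s₂, by nlinarith,
      by nlinarith, h3, hp c hc, ?_⟩, fun x hx hAx => ?_⟩
    · rw [AffineEquiv.trans_apply, hq c hc, e2]
    · rw [AffineEquiv.trans_apply] at hAx
      obtain ⟨u, -, -, hu⟩ := hsegpq _ (h.clear _ (hα.hom_mem hqs hc hc1 hx) hAx)
      exact (hline c hc x hx u hu).2.2.2.2
  refine ⟨hState, ?_⟩
  -- the isotopy
  set r : ℝ → ℝ := fun t => max c (min 1 (1 - t * (1 - c))) with hr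
  have hrc : Continuous r := by fun_prop
  have hr0 : ∀ t, 0 < r t := fun t => lt_max_of_lt_left hc
  have hr1 : ∀ t, r t ≤ 1 := fun t => max_le hc1 (min_le_left _ _)
  have hr00 : r 0 = 1 := by simp [hr, hc1]
  have hr11 : r 1 = c := by simp [hr, hc1]
  set w : ℝ → ℝ := fun t => s₂ - r t * (s₂ - s₁) with hw
  have hw1 : ∀ t, s₁ ≤ w t := fun t => by simp only [hw]; nlinarith [hr1 t]
  have hw2 : ∀ t, w t < s₂ := fun t => by
    simp only [hw]; have := mul_pos (hr0 t) (sub_pos.2 h2); linarith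
  have hw0 : ∀ t, 0 < w t / s₁ := fun t => div_pos (h1.trans_le (hw1 t)) h1
  -- The fixed piece: the segment from `a` to the fixed end is taken out and its ends are put back,
  -- since these are the points where the moving pieces are attached.
  set K₀ : Set R3 := (Q \ segment ℝ a (A q)) ∪ {a, A q} with hK0
  have haq : ∀ x, x ∈ segment ℝ a (A q) ↔ ∃ u : ℝ, 0 ≤ u ∧ u ≤ s₂ ∧ x = a + u • (b - a) := by
    intro x
    rw [segment_eq_lines, e2, add_sub_cancel_left]
    constructor
    · rintro ⟨t, ht0, ht1, rfl⟩
      exact ⟨t * s₂, by nlinarith, by nlinarith, by rw [smul_smul]⟩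
    · rintro ⟨u, hu0, hu1, rfl⟩
      have : 0 < s₂ := by linarith
      exact ⟨u / s₂, by positivity, (div_le_one this).2 hu1,
        by rw [smul_smul, div_mul_cancel₀ _ this.ne']⟩
  have hap : ∀ x, x ∈ segment ℝ a (A p) ↔ ∃ u : ℝ, 0 ≤ u ∧ u ≤ 1 ∧ x = a + (u * s₁) • (b - a) := by
    intro x
    rw [segment_eq_lines, e1, add_sub_cancel_left]
    simp only [smul_smul]; rfl
  have hab : ∀ u : ℝ, 0 ≤ u → u ≤ 1 → a + u • (b - a) ∈ Q := fun u hu0 hu1 =>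
    h.sub (add_smul_mem_segment hu0 hu1)
  have hK0u : ∀ u : ℝ, 0 ≤ u → u ≤ s₂ → a + u • (b - a) ∈ K₀ → u = 0 ∨ u = s₂ := by
    rintro u hu0 hu1 (⟨-, hx⟩ | hx | hx)
    · exact absurd ((haq _).2 ⟨u, hu0, hu1, rfl⟩) hx
    · left; exact param_inj hd (a := a) (by simpa using hx)
    · right; exact param_inj hd (a := a) (by rw [hx, e2])
  have hK0Q : K₀ ⊆ Q := by
    rintro x (hx | rfl | rfl)
    · exact hx.1
    · exact h.sub (left_mem_segment ℝ _ _)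
    · rw [e2]; exact hab _ (by linarith) (by linarith)
  have h_a : ∀ t x, hom a (w t / s₁) x = a + (w t / s₁) • (x - a) := fun t x =>
    hom_apply (hw0 t).ne' a x
  -- At each time the three pieces make up the link with the shrunk arc inserted: between the moving
  -- and the fixed end the segment is replaced by the arc, and before the moving end it is the
  -- stretched segment.
  have hEq : ∀ t, K₀ ∪ (hom a (w t / s₁) '' segment ℝ a (A p) ∪
      (A.symm.trans ((hom q (r t)).trans A)) '' (A '' α)) =
      ins α p q Q ((hom q (r t)).trans A) := by
    intro t
    have hwt := h1.trans_le (hw1 t)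
    have i1 : hom a (w t / s₁) '' segment ℝ a (A p) = segment ℝ a (a + w t • (b - a)) := by
      rw [aff_image_segment, h_a, h_a, e1, add_sub_cancel_left, smul_smul,
        div_mul_cancel₀ _ h1.ne']
      simp
    have i2 : (A.symm.trans ((hom q (r t)).trans A)) '' (A '' α) =
        ((hom q (r t)).trans A) '' α := by
      rw [image_image]
      exact image_congr fun x _ => by simp
    have i3 : ((hom q (r t)).trans A) '' segment ℝ p q =
        segment ℝ (a + w t • (b - a)) (a + s₂ • (b - a)) := by
      rw [aff_image_segment, AffineEquiv.trans_apply, AffineEquiv.trans_apply, hp _ (hr0 t),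
        hq _ (hr0 t), e2]
    have hpα : a + w t • (b - a) ∈ ((hom q (r t)).trans A) '' α :=
      ⟨p, hα.left_mem, hp _ (hr0 t)⟩
    have hqα : A q ∈ ((hom q (r t)).trans A) '' α :=
      ⟨q, hα.right_mem, by rw [AffineEquiv.trans_apply, hq _ (hr0 t)]⟩
    have i4 : ∀ u : ℝ, a + u • (b - a) ∈ segment ℝ (a + w t • (b - a)) (a + s₂ • (b - a)) ↔
        w t ≤ u ∧ u ≤ s₂ := by
      intro u
      have hpos : 0 < s₂ - w t := sub_pos.2 (hw2 t)
      rw [segment_eq_lines]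
      constructor
      · rintro ⟨s, hs0, hs1, he⟩
        have he' : a + u • (b - a) = a + (w t + s * (s₂ - w t)) • (b - a) := by
          rw [he]; module
        have := param_inj hd he'
        constructor <;> nlinarith
      · rintro ⟨hu0, hu1⟩
        refine ⟨(u - w t) / (s₂ - w t), div_nonneg (by linarith) hpos.le,
          (div_le_one hpos).2 (by linarith), ?_⟩
        have : a + s₂ • (b - a) - (a + w t • (b - a)) = (s₂ - w t) • (b - a) := by module
        rw [this, smul_smul, div_mul_cancel₀ _ hpos.ne']
        module
    have i5 : ∀ u : ℝ, 0 ≤ u → u ≤ w t → a + u • (b - a) ∈ ins α p q Q ((hom q (r t)).trans A) := by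
      intro u hu0 hu1
      rcases hu1.eq_or_lt with rfl | hu1
      · exact Or.inr hpα
      · refine Or.inl ⟨hab u hu0 (by linarith [hw2 t]), ?_⟩
        rw [i3, i4]
        intro h'
        linarith [h'.1]
    rw [i1, i2]
    apply Subset.antisymm
    · rintro x ((⟨hxQ, hx⟩ | rfl | rfl) | hx | hx)
      · refine Or.inl ⟨hxQ, fun hx' => hx ?_⟩
        rw [i3] at hx'
        refine (convex_segment a (A q)).segment_subset ?_ ?_ hx'
        · exact (haq _).2 ⟨_, hwt.le, (hw2 t).le, rfl⟩
        · rw [e2]; exact right_mem_segment ℝ _ _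
      · simpa using i5 0 le_rfl hwt.le
      · exact Or.inr hqα
      · rw [segment_eq_lines, add_sub_cancel_left] at hx
        obtain ⟨s, hs0, hs1, rfl⟩ := hx
        rw [smul_smul]
        exact i5 _ (by positivity) (by nlinarith)
      · exact Or.inr hx
    · rintro x (⟨hxQ, hx⟩ | hx)
      · by_cases hxs : x ∈ segment ℝ a (A q)
        · obtain ⟨u, hu0, hu1, rfl⟩ := (haq x).1 hxs
          rw [i3, i4] at hx
          have hu : u ≤ w t := by
            by_contra hcon
            exact hx ⟨(not_le.1 hcon).le, hu1⟩
          refine Or.inr (Or.inl ?_)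
          rw [segment_eq_lines, add_sub_cancel_left]
          exact ⟨u / w t, by positivity, (div_le_one hwt).2 hu,
            by rw [smul_smul, div_mul_cancel₀ _ hwt.ne']⟩
        · exact Or.inl (Or.inl ⟨hxQ, hxs⟩)
      · exact Or.inr (Or.inr hx)
  have h_one : (hom q (r 0)).trans A = A := by
    ext1 x
    rw [AffineEquiv.trans_apply, hom_apply (hr0 0).ne', hr00]
    simp
  have key := isotopic_of_three_pieces (K₀ := K₀) (K₁ := segment ℝ a (A p)) (K₂ := A '' α)
    (hQ.segUnion_compl fun x hx => by
      obtain ⟨u, hu0, hu1, rfl⟩ := (haq x).1 hx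
      exact hab u hu0 (by linarith))
    ⟨{(a, A p)}, by simp, by simp [segUnion]⟩
    (by
      obtain ⟨S, hS, hαS⟩ := hα.segs
      refine ⟨(fun e : R3 × R3 => (A e.1, A e.2)) '' S, hS.image _, ?_⟩
      rw [hαS]
      ext x
      constructor
      · rintro ⟨y, ⟨e, he, hy⟩, rfl⟩
        exact ⟨_, ⟨e, he, rfl⟩, by rw [← aff_image_segment]; exact ⟨y, hy, rfl⟩⟩
      · rintro ⟨_, ⟨e, he, rfl⟩, hx⟩
        rw [← aff_image_segment] at hx
        obtain ⟨y, hy, rfl⟩ := hx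
        exact ⟨y, ⟨e, he, hy⟩, rfl⟩)
    (fun t => hom a (w t / s₁)) (fun t => A.symm.trans ((hom q (r t)).trans A))
    (fun x => by simp only [h_a]; fun_prop)
    (fun x => by
      simp only [AffineEquiv.trans_apply, hom_apply (hr0 _).ne']
      exact (aff_continuous A).comp (by fun_prop))
    (by
      intro t _ x hx y hy
      obtain ⟨u, hu0, hu1, rfl⟩ := (hap y).1 hy
      have e3 : hom a (w t / s₁) (a + (u * s₁) • (b - a)) = a + (u * w t) • (b - a) := by
        rw [h_a, add_sub_cancel_left, smul_smul]
        congr 2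
        field_simp
      rw [e3]
      have hwt := h1.trans_le (hw1 t)
      constructor
      · intro hxe
        rw [hxe] at hx
        rcases hK0u _ (by positivity) (by nlinarith [hw2 t]) hx with h0 | h0
        · rw [hxe, h0]
          rcases mul_eq_zero.1 h0 with h0 | h0
          · simp [h0]
          · linarith
        · nlinarith [hw2 t]
      · intro hxe
        rw [hxe] at hx
        rcases hK0u _ (by positivity) (by nlinarith) hx with h0 | h0
        · rcases mul_eq_zero.1 h0 with h0 | h0
          · rw [hxe, h0]; simp
          · linarith
        · nlinarith)
    (by
      rintro t _ x hx _ ⟨y, hy, rfl⟩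
      simp only [AffineEquiv.trans_apply, AffineEquiv.symm_apply_apply]
      have hyC := subset_convexHull ℝ α hy
      have hyC' := hα.hom_mem hqs (hr0 t) (hr1 t) hyC
      constructor
      · intro hxe
        have hs := h.clear _ hyC' (hxe ▸ hK0Q hx)
        obtain ⟨u, hu0, hu1, hu⟩ := hsegpq _ hs
        rw [hxe, hu] at hx
        rcases hK0u u (by linarith) hu1 hx with h0 | h0
        · linarith
        · have hyq := (hline _ (hr0 t) y hyC u hu).2.2.2.1 h0
          rw [hxe, hyq, hq _ (hr0 t)]
      · intro hxe
        have hs := h.clear _ hyC (hxe ▸ hK0Q hx)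
        obtain ⟨u, hu0, hu1, hu⟩ := hsegpq _ hs
        rw [hxe, hu] at hx
        rcases hK0u u (by linarith) hu1 hx with h0 | h0
        · linarith
        · have hyq : y = q := A.injective (by rw [hu, h0, e2])
          rw [hxe, hyq, hq _ (hr0 t)])
    (by
      rintro t _ x hx _ ⟨y, hy, rfl⟩
      simp only [AffineEquiv.trans_apply, AffineEquiv.symm_apply_apply]
      have hyC := subset_convexHull ℝ α hy
      obtain ⟨u, hu0, hu1, rfl⟩ := (hap x).1 hx
      have e3 : hom a (w t / s₁) (a + (u * s₁) • (b - a)) = a + (u * w t) • (b - a) := by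
        rw [h_a, add_sub_cancel_left, smul_smul]
        congr 2
        field_simp
      rw [e3]
      have hwt := h1.trans_le (hw1 t)
      constructor
      · intro hxe
        obtain ⟨l1, l2, l3, l4, l5⟩ := hline _ (hr0 t) y hyC _ hxe.symm
        have hu : u = 1 := by
          have : w t ≤ u * w t := l1
          nlinarith
        rw [l3 (by rw [hu, one_mul]), e1, hu, one_mul]
      · intro hxe
        obtain ⟨l1, l2, l3⟩ := hα.line_mem h2 e1 e2 hyC hxe.symm
        have hu : u = 1 := by nlinarith
        have hyp : y = p := A.injective (by rw [← hxe, hu, one_mul, e1])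
        rw [hyp, hp _ (hr0 t), hu, one_mul])
    (Or.inl ?_)
  · rwa [hEq, hEq, h_one, hr11] at key
  · rwa [hEq, h_one]

/-- Shrinking the inserted arc towards an inner point of its chord. -/
theorem State.shrink {α : Set R3} {p q : R3} (hα : Tangle α p q) {Q : Set R3}
    {A : R3 ≃ᵃ[ℝ] R3} {a b : R3} (h : State α p q Q A a b) (hQ : IsLink Q)
    (hI : IsLink (ins α p q Q A)) {θ : ℝ} (hθ : 0 < θ) (hθ1 : θ < 1) {c : ℝ} (hc : 0 < c)
    (hc1 : c ≤ 1) :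
    State α p q Q ((hom (p + θ • (q - p)) c).trans A) a b ∧
      Isotopic (ins α p q Q A) (ins α p q Q ((hom (p + θ • (q - p)) c).trans A)) := by
  -- The homothety of ratio `c` about `p + θ • (q - p)` is the one about `p` with ratio `c / (1 - (1
  -- - c) * θ)` followed by the one about `q` with ratio `1 - (1 - c) * θ`. So shrinking towards the
  -- two ends in turn suffices.
  have hl : 0 < 1 - (1 - c) * θ := by nlinarith
  have hl1 : 1 - (1 - c) * θ ≤ 1 := by nlinarith
  obtain ⟨hS1, hI1⟩ := h.shrink_right hα hQ hI hl hl1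
  have hS1' := hS1.symm
  have hI1' := hI1.isLink.1 hI
  rw [← ins_symm] at hI1'
  have hm : 0 < c / (1 - (1 - c) * θ) := div_pos hc hl
  obtain ⟨hS2, hI2⟩ := hS1'.shrink_right hα.symm hQ hI1' hm ((div_le_one hl).2 (by nlinarith))
  have e : (hom p (c / (1 - (1 - c) * θ))).trans ((hom q (1 - (1 - c) * θ)).trans A) =
      (hom (p + θ • (q - p)) c).trans A := by
    ext1 x
    rw [AffineEquiv.trans_apply, AffineEquiv.trans_apply, AffineEquiv.trans_apply]
    congr 1
    rw [hom_apply hc.ne', hom_apply hl.ne', hom_apply hm.ne']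
    have : (1 - (1 - c) * θ) • (p + (c / (1 - (1 - c) * θ)) • (x - p) - q) =
        (1 - (1 - c) * θ) • (p - q) + c • (x - p) := by
      rw [add_sub_right_comm, smul_add, smul_smul, mul_div_cancel₀ _ hl.ne']
    rw [this]
    module
  rw [e] at hS2 hI2
  refine ⟨hS2.symm, hI1.trans ?_⟩
  rwa [ins_symm α p q, ins_symm α p q] at hI2

theorem State.image_subset {α : Set R3} {p q : R3} {Q : Set R3} {A : R3 ≃ᵃ[ℝ] R3} {a b : R3}
    (h : State α p q Q A a b) : A '' segment ℝ p q ⊆ segment ℝ a b := by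
  obtain ⟨s₁, s₂, h1, h2, h3, e1, e2⟩ := h.margin
  rw [aff_image_segment, e1, e2]
  exact (convex_segment a b).segment_subset (add_smul_mem_segment h1.le (by linarith))
    (add_smul_mem_segment (by linarith) h3.le)

/-- The hull is compact, so small ratios bring all of it into `U`. Besides the arc, the segment that
carries it is shortened and lies in `U` too; this localizes the whole situation at one point of the
chord. -/
theorem State.shrink_into {α : Set R3} {p q : R3} (hα : Tangle α p q) {Q : Set R3}
    {A : R3 ≃ᵃ[ℝ] R3} {a b : R3} (h : State α p q Q A a b) (hQ : IsLink Q)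
    (hI : IsLink (ins α p q Q A)) {θ : ℝ} (hθ : 0 < θ) (hθ1 : θ < 1) {U : Set R3}
    (hU : U ∈ 𝓝 (A (p + θ • (q - p)))) :
    ∃ c : ℝ, 0 < c ∧ ∃ a' b', State α p q Q ((hom (p + θ • (q - p)) c).trans A) a' b' ∧
      Isotopic (ins α p q Q A) (ins α p q Q ((hom (p + θ • (q - p)) c).trans A)) ∧
      (∀ x ∈ convexHull ℝ α, A (hom (p + θ • (q - p)) c x) ∈ U) ∧ segment ℝ a' b' ⊆ U ∧
      segment ℝ a' b' ⊆ segment ℝ a b := by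
  set o := p + θ • (q - p) with ho
  have hos : o ∈ segment ℝ p q := add_smul_mem_segment hθ.le hθ1.le
  have hCc : IsCompact (convexHull ℝ α) := hα.isCompact_hull
  have hev : ∀ᶠ c in 𝓝 (0 : ℝ), ∀ x ∈ convexHull ℝ α, A (o + c • (x - o)) ∈ U := by
    refine hCc.eventually_forall_of_forall_eventually fun x _ => ?_
    have hc : Continuous fun z : ℝ × R3 => A (o + z.1 • (z.2 - o)) :=
      (aff_continuous A).comp (by fun_prop)
    exact hc.continuousAt.eventually_mem (by simpa using hU)
  obtain ⟨ε, hε, H⟩ := Metric.eventually_nhds_iff.1 hev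
  set c₀ := min (ε / 2) 1 with hc0
  have hc0p : 0 < c₀ := lt_min (by positivity) one_pos
  have hc01 : c₀ ≤ 1 := min_le_right _ _
  have hc0e : c₀ < ε := (min_le_left _ _).trans_lt (by linarith)
  have hcU : ∀ c, 0 < c → c ≤ c₀ → ∀ x ∈ convexHull ℝ α, A (hom o c x) ∈ U := by
    intro c h0 h1 x hx
    rw [hom_apply h0.ne']
    exact H (by rw [Real.dist_eq, sub_zero, abs_of_pos h0]; linarith) x hx
  have hhp : ∀ c : ℝ, 0 < c → A (hom o c p) = A p + ((1 - c) * θ) • (A q - A p) := by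
    intro c h0
    rw [hom_apply h0.ne', ho, ← aff_apply]; congr 1; module
  have hhq : ∀ c : ℝ, 0 < c → A (hom o c q) = A p + ((1 - c) * θ + c) • (A q - A p) := by
    intro c h0
    rw [hom_apply h0.ne', ho, ← aff_apply]; congr 1; module
  have hseg : segment ℝ (A (hom o c₀ p)) (A (hom o c₀ q)) =
      A '' (hom o c₀ '' segment ℝ p q) := by
    rw [aff_image_segment, aff_image_segment]
  have hsub0 : hom o c₀ '' segment ℝ p q ⊆ segment ℝ p q := by
    rintro _ ⟨x, hx, rfl⟩
    rw [hom_apply hc0p.ne']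
    exact (convex_segment p q).segment_subset hos hx (add_smul_mem_segment hc0p.le hc01)
  have hsubab : segment ℝ (A (hom o c₀ p)) (A (hom o c₀ q)) ⊆ segment ℝ a b := by
    rw [hseg]
    exact (image_mono hsub0).trans h.image_subset
  -- The arc is shrunk by `c₀ / 2`, while the image of the chord under the ratio `c₀` serves as new
  -- carrier segment; the factor `2` leaves the margin at both ends.
  obtain ⟨hS, hIs⟩ := h.shrink hα hQ hI hθ hθ1 (c := c₀ / 2) (by positivity) (by linarith)
  refine ⟨c₀ / 2, by positivity, A (hom o c₀ p), A (hom o c₀ q), ?_, hIs,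
    hcU _ (by positivity) (by linarith), ?_, hsubab⟩
  · refine ⟨hS.good, hsubab.trans h.sub, ⟨θ / 2, θ / 2 + 1 / 2, by positivity, by linarith,
      by linarith, ?_, ?_⟩, hS.clear⟩
    · rw [AffineEquiv.trans_apply, hhp _ (by positivity), hhp _ hc0p, hhq _ hc0p]
      module
    · rw [AffineEquiv.trans_apply, hhq _ (by positivity), hhp _ hc0p, hhq _ hc0p]
      module
  · rw [hseg]
    rintro _ ⟨_, ⟨x, hx, rfl⟩, rfl⟩
    refine hcU c₀ hc0p le_rfl x ?_
    exact (convex_convexHull ℝ α).segment_subset (subset_convexHull ℝ α hα.left_mem)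
      (subset_convexHull ℝ α hα.right_mem) hx

/-! ### Carrying an inserted arc along triangle moves -/

theorem segUnion_union {A B : Set R3} (hA : ∃ S : Set (R3 × R3), S.Finite ∧ A = segUnion S)
    (hB : ∃ S : Set (R3 × R3), S.Finite ∧ B = segUnion S) :
    ∃ S : Set (R3 × R3), S.Finite ∧ A ∪ B = segUnion S := by
  obtain ⟨S, hS, rfl⟩ := hA
  obtain ⟨T, hT, rfl⟩ := hB
  refine ⟨S ∪ T, hS.union hT, ?_⟩
  ext x
  constructor
  · rintro (⟨e, he, hx⟩ | ⟨e, he, hx⟩)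
    exacts [⟨e, Or.inl he, hx⟩, ⟨e, Or.inr he, hx⟩]
  · rintro ⟨e, he | he, hx⟩
    exacts [Or.inl ⟨e, he, hx⟩, Or.inr ⟨e, he, hx⟩]

theorem segUnion_image {α : Set R3} (hα : ∃ S : Set (R3 × R3), S.Finite ∧ α = segUnion S)
    (A : R3 ≃ᵃ[ℝ] R3) : ∃ S : Set (R3 × R3), S.Finite ∧ A '' α = segUnion S := by
  obtain ⟨S, hS, rfl⟩ := hα
  refine ⟨(fun e : R3 × R3 => (A e.1, A e.2)) '' S, hS.image _, ?_⟩
  ext x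
  constructor
  · rintro ⟨y, ⟨e, he, hy⟩, rfl⟩
    exact ⟨_, ⟨e, he, rfl⟩, by rw [← aff_image_segment]; exact ⟨y, hy, rfl⟩⟩
  · rintro ⟨_, ⟨e, he, rfl⟩, hx⟩
    rw [← aff_image_segment] at hx
    obtain ⟨y, hy, rfl⟩ := hx
    exact ⟨y, ⟨e, he, hy⟩, rfl⟩

theorem segUnion_segment (a b : R3) :
    ∃ S : Set (R3 × R3), S.Finite ∧ segment ℝ a b = segUnion S :=
  ⟨{(a, b)}, by simp, by simp [segUnion]⟩

/-- Membership in a segment of a line with a parameter. -/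
theorem mem_segment_param {x e : R3} (he : e ≠ 0) {s t u : ℝ} (hst : s ≤ t) :
    x + u • e ∈ segment ℝ (x + s • e) (x + t • e) ↔ s ≤ u ∧ u ≤ t := by
  rw [segment_eq_lines]
  constructor
  · rintro ⟨r, hr0, hr1, h⟩
    have h' : x + u • e = x + (s + r * (t - s)) • e := by rw [h]; module
    have := param_inj he h'
    constructor <;> nlinarith
  · rintro ⟨h1, h2⟩
    rcases hst.eq_or_lt with rfl | hst
    · exact ⟨0, le_rfl, zero_le_one, by rw [le_antisymm h1 h2]; simp⟩
    · have hpos : 0 < t - s := by linarith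
      refine ⟨(u - s) / (t - s), div_nonneg (by linarith) hpos.le,
        (div_le_one hpos).2 (by linarith), ?_⟩
      have : x + t • e - (x + s • e) = (t - s) • e := by module
      rw [this, smul_smul, div_mul_cancel₀ _ hpos.ne']
      module

theorem exists_param_of_mem_segment {x e : R3} {s t : ℝ} (hst : s ≤ t) {y : R3}
    (hy : y ∈ segment ℝ (x + s • e) (x + t • e)) : ∃ u, s ≤ u ∧ u ≤ t ∧ y = x + u • e := by
  rw [segment_eq_lines] at hy
  obtain ⟨r, hr0, hr1, rfl⟩ := hy
  exact ⟨s + r * (t - s), by nlinarith, by nlinarith, by module⟩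

theorem segUnion_segment_diff {x y c d : R3} (hc : c ∈ segment ℝ x y) (hd : d ∈ segment ℝ x y) :
    ∃ S : Set (R3 × R3), S.Finite ∧ (segment ℝ x y \ segment ℝ c d) ∪ {c, d} = segUnion S := by
  have hc' := hc
  have hd' := hd
  rw [segment_eq_lines] at hc' hd'
  obtain ⟨s, hs0, hs1, hs⟩ := hc'
  obtain ⟨t, ht0, ht1, ht⟩ := hd'
  wlog hst : s ≤ t generalizing c d s t
  · have := this hd hc t ht0 ht1 ht s hs0 hs1 hs (le_of_not_ge hst)
    rwa [segment_symm ℝ d c, pair_comm d c] at this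
  subst hs ht
  by_cases he : y - x = 0
  · obtain rfl : y = x := sub_eq_zero.1 he
    obtain ⟨S, hS, h⟩ := segUnion_segment y y
    refine ⟨S, hS, ?_⟩
    rw [← h]
    simp
  obtain ⟨S, hS, h⟩ := segUnion_union (segUnion_segment x (x + s • (y - x)))
    (segUnion_segment (x + t • (y - x)) y)
  refine ⟨S, hS, ?_⟩
  rw [← h]
  have ex : x = x + (0 : ℝ) • (y - x) := by simp
  have ey : y = x + (1 : ℝ) • (y - x) := by simp
  have m1 : ∀ u : ℝ, x + u • (y - x) ∈ segment ℝ x (x + s • (y - x)) ↔ 0 ≤ u ∧ u ≤ s := by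
    intro u
    have := mem_segment_param (x := x) he (u := u) hs0
    rwa [← ex] at this
  have m2 : ∀ u : ℝ, x + u • (y - x) ∈ segment ℝ (x + t • (y - x)) y ↔ t ≤ u ∧ u ≤ 1 := by
    intro u
    have := mem_segment_param (x := x) he (u := u) ht1
    rwa [← ey] at this
  ext z
  constructor
  · rintro (⟨hz, hz'⟩ | rfl | rfl)
    · rw [segment_eq_lines] at hz
      obtain ⟨u, hu0, hu1, rfl⟩ := hz
      rw [mem_segment_param he hst, not_and_or, not_le, not_le] at hz'
      rcases hz' with h | h
      · exact Or.inl ((m1 u).2 ⟨hu0, h.le⟩)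
      · exact Or.inr ((m2 u).2 ⟨h.le, hu1⟩)
    · exact Or.inl (right_mem_segment ℝ _ _)
    · exact Or.inr (left_mem_segment ℝ _ _)
  · have key : ∀ u : ℝ, 0 ≤ u → u ≤ 1 → (u ≤ s ∨ t ≤ u) → x + u • (y - x) ∈
        (segment ℝ x y \ segment ℝ (x + s • (y - x)) (x + t • (y - x))) ∪
          {x + s • (y - x), x + t • (y - x)} := by
      intro u hu0 hu1 h
      by_cases h1 : u = s
      · subst h1; simp
      by_cases h2 : u = t
      · subst h2; simp
      · refine Or.inl ⟨add_smul_mem_segment hu0 hu1, ?_⟩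
        rw [mem_segment_param he hst]
        rintro ⟨h3, h4⟩
        rcases h with h | h
        · exact h1 (le_antisymm h h3)
        · exact h2 (le_antisymm h4 h)
    rintro (hz | hz)
    · have hz' := hz
      rw [ex, ← ex] at hz'
      rw [segment_eq_lines, add_sub_cancel_left] at hz'
      obtain ⟨r, hr0, hr1, rfl⟩ := hz'
      rw [smul_smul] at hz ⊢
      have := (m1 _).1 hz
      exact key _ this.1 (by linarith [this.2]) (Or.inl this.2)
    · have hsub : segment ℝ (x + t • (y - x)) y ⊆ segment ℝ x y :=
        (convex_segment x y).segment_subset hd (right_mem_segment ℝ x y)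
      have hz' := hsub hz
      rw [segment_eq_lines] at hz'
      obtain ⟨u, hu0, hu1, rfl⟩ := hz'
      exact key u hu0 hu1 (Or.inr ((m2 u).1 hz).1)

theorem Tangle.mem_segment_of_line {α : Set R3} {p q : R3} (h : Tangle α p q) {B : R3 ≃ᵃ[ℝ] R3}
    {d e : R3} {s₁ s₂ u : ℝ} (e1 : B p = d + s₁ • e) (e2 : B q = d + s₂ • e) {x : R3}
    (hx : x ∈ convexHull ℝ α) (hu : B x = d + u • e) : x ∈ segment ℝ p q := by
  have hne : s₂ - s₁ ≠ 0 := by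
    intro h0
    apply h.ne
    apply B.injective
    rw [e1, e2, sub_eq_zero.1 h0]
  have hx' : x = p + ((u - s₁) / (s₂ - s₁)) • (q - p) := by
    apply B.injective
    rw [aff_apply, hu, e1, e2]
    have : d + s₂ • e - (d + s₁ • e) = (s₂ - s₁) • e := by module
    rw [this, smul_smul, div_mul_cancel₀ _ hne]
    module
  obtain ⟨h0, h1⟩ := h.thin _ (hx' ▸ hx)
  rw [hx']
  exact add_smul_mem_segment h0 h1

/-- The move of the corner `m`, the midpoint of `d₁d₂`, to `d₃`, with an arc inserted between `d₁`
and `m`. -/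
theorem tent_move {α : Set R3} {p q : R3} (hα : Tangle α p q) {R : Set R3} {d₁ d₂ d₃ : R3}
    (hd : AffineIndependent ℝ ![d₁, d₂, d₃]) (hR : Disjoint R (tri d₁ d₂ d₃))
    (hQ : IsLink (R ∪ segment ℝ d₁ d₂)) {u₀ : ℝ} (hu0 : 0 < u₀) (hu1 : u₀ < 1 / 2) :
    ∃ σ : R3 ≃ᵃ[ℝ] R3, Good σ ∧ (∀ u : ℝ, σ (d₁ + (u / 2) • (d₂ - d₁)) = d₁ + u • (d₃ - d₁)) ∧
      ∃ U ∈ 𝓝 (d₁ + u₀ • (d₂ - d₁)), ∀ (B : R3 ≃ᵃ[ℝ] R3) (a b : R3), Good B →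
        (∃ s₁ s₂ : ℝ, 0 < s₁ ∧ s₁ < s₂ ∧ s₂ < 1 ∧ B p = a + s₁ • (b - a) ∧
          B q = a + s₂ • (b - a)) →
        a ∈ segment ℝ d₁ (d₁ + (1 / 2 : ℝ) • (d₂ - d₁)) →
        b ∈ segment ℝ d₁ (d₁ + (1 / 2 : ℝ) • (d₂ - d₁)) → (∀ x ∈ convexHull ℝ α, B x ∈ U) →
        State α p q (R ∪ segment ℝ d₁ d₂) B a b ∧
        State α p q (R ∪ (segment ℝ d₁ d₃ ∪ segment ℝ d₃ d₂)) (B.trans σ) (σ a) (σ b) ∧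
        (IsLink (ins α p q (R ∪ segment ℝ d₁ d₂) B) ∨
          IsLink (ins α p q (R ∪ (segment ℝ d₁ d₃ ∪ segment ℝ d₃ d₂)) (B.trans σ)) →
          Isotopic (ins α p q (R ∪ segment ℝ d₁ d₂) B)
            (ins α p q (R ∪ (segment ℝ d₁ d₃ ∪ segment ℝ d₃ d₂)) (B.trans σ))) := by
  obtain ⟨hd12, hd31, hd32⟩ := tri_ne hd
  set e := d₂ - d₁ with he
  have he0 : e ≠ 0 := sub_ne_zero.2 hd12.symm
  set m := d₁ + (1 / 2 : ℝ) • e with hm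
  set v := d₃ - m with hv
  -- the functional that is constant along `v`
  obtain ⟨ℓ, hℓv, hℓe⟩ : ∃ ℓ : R3 →ₗ[ℝ] ℝ, ℓ v = 0 ∧ ℓ e = 2 := by
    have hmem : e ∉ Submodule.span ℝ {v} := by
      rw [Submodule.mem_span_singleton]
      rintro ⟨c, hc⟩
      have := tri_weights hd (α := -1 + c / 2) (β := 1 + c / 2) (γ := -c) (by ring) (by
        have h0 : e - c • v = 0 := by rw [hc, sub_self]
        rw [← h0, hv, hm, he]; module)
      linarith [this.1, this.2.1, this.2.2]
    obtain ⟨f, hf, hle⟩ := Submodule.exists_le_ker_of_notMem hmem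
    refine ⟨(2 / f e) • f, ?_, ?_⟩
    · have : f v = 0 := hle (Submodule.mem_span_singleton_self v)
      simp [this]
    · simp [hf]
  have hℓd2 : ℓ d₂ = ℓ d₁ + 2 := by
    have : d₂ = d₁ + e := by rw [he]; abel
    rw [this, map_add, hℓe]
  have hℓm : ℓ m = ℓ d₁ + 1 := by rw [hm, map_add, map_smul, hℓe]; norm_num
  have hℓd3 : ℓ d₃ = ℓ d₁ + 1 := by
    have : d₃ = m + v := by rw [hv]; abel
    rw [this, map_add, hℓv, hℓm, add_zero]
  -- Two shears along `v` that preserve `ℓ`. The shear `σ` fixes the level of `d₁`, `τ` that of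
  -- `d₂`, and on the level of `m` they agree, both taking `m` to `d₃` at time `1`. So the half with
  -- the arc and the other half, being separated by `ℓ`, never meet except in the moving corner.
  set σ : ℝ → R3 ≃ᵃ[ℝ] R3 := fun t => shear (t • ℓ) v (by simp [hℓv]) (-(t * ℓ d₁)) with hσ
  set τ : ℝ → R3 ≃ᵃ[ℝ] R3 := fun t => shear (-(t • ℓ)) v (by simp [hℓv]) (t * ℓ d₂) with hτ
  have hσ' : ∀ t x, σ t x = x + (t * (ℓ x - ℓ d₁)) • v := fun t x => by
    simp only [hσ, shear_apply, LinearMap.smul_apply, smul_eq_mul]; congr 2; ring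
  have hτ' : ∀ t x, τ t x = x + (t * (ℓ d₂ - ℓ x)) • v := fun t x => by
    simp only [hτ, shear_apply, LinearMap.neg_apply, LinearMap.smul_apply, smul_eq_mul]
    congr 2; ring
  have hℓσ : ∀ t x, ℓ (σ t x) = ℓ x := fun t x => by rw [hσ']; simp [hℓv]
  have hℓτ : ∀ t x, ℓ (τ t x) = ℓ x := fun t x => by rw [hτ']; simp [hℓv]
  have hℓu : ∀ u : ℝ, ℓ (d₁ + u • e) = ℓ d₁ + 2 * u := fun u => by
    rw [map_add, map_smul, hℓe, smul_eq_mul]; ring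
  have hσd1 : ∀ t, σ t d₁ = d₁ := fun t => by rw [hσ']; simp
  have hτd2 : ∀ t, τ t d₂ = d₂ := fun t => by rw [hτ']; simp
  have hσm : σ 1 m = d₃ := by rw [hσ', hℓm, hv]; simp
  have hτm : τ 1 m = d₃ := by rw [hτ', hℓm, hℓd2, hv]; norm_num
  have hστm : ∀ t, σ t m = τ t m := fun t => by
    rw [hσ', hτ', hℓm, hℓd2]; congr 2; ring
  -- the moving polygon stays in the triangle
  have hσT : ∀ t ∈ Icc (0 : ℝ) 1, ∀ u : ℝ, 0 ≤ u → u ≤ 1 / 2 →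
      σ t (d₁ + u • e) ∈ tri d₁ d₂ d₃ := by
    intro t ht u h0 h1
    rw [hσ', hℓu, mem_tri]
    refine ⟨1 - u - t * u, u - t * u, 2 * t * u, ?_, ?_, ?_, by ring, ?_⟩
    · nlinarith [ht.1, ht.2]
    · nlinarith [ht.1, ht.2]
    · have := ht.1; positivity
    · rw [hv, hm, he]; module
  have hτT : ∀ t ∈ Icc (0 : ℝ) 1, ∀ u : ℝ, 1 / 2 ≤ u → u ≤ 1 →
      τ t (d₁ + u • e) ∈ tri d₁ d₂ d₃ := by
    intro t ht u h0 h1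
    rw [hτ', hℓu, hℓd2, mem_tri]
    refine ⟨(1 - u) * (1 - t), u - t * (1 - u), 2 * t * (1 - u), ?_, ?_, ?_, by ring, ?_⟩
    · exact mul_nonneg (by linarith) (by linarith [ht.2])
    · nlinarith [ht.1, ht.2]
    · have := ht.1; have : 0 ≤ 1 - u := by linarith
      positivity
    · rw [hv, hm, he]; module
  have hd1R : d₁ ∉ R := fun h => disjoint_left.1 hR h (subset_convexHull ℝ _ (by simp))
  have hd2R : d₂ ∉ R := fun h => disjoint_left.1 hR h (subset_convexHull ℝ _ (by simp))
  set Rb : Set R3 := R ∪ {d₁, d₂} with hRb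
  have hRX : Disjoint R (segment ℝ d₁ d₂) := hR.mono_right (segment_subset_tri_left _ _ _)
  have hRbEq : (R ∪ segment ℝ d₁ d₂) \ segment ℝ d₁ d₂ ∪ {d₁, d₂} = Rb := by
    rw [union_sdiff_right, hRX.sdiff_eq_left]
  have hRbT : ∀ x ∈ Rb, x ∈ tri d₁ d₂ d₃ → x = d₁ ∨ x = d₂ := by
    rintro x (hx | hx) hT
    · exact absurd hT (disjoint_left.1 hR hx)
    · exact hx
  have hRbQ : Rb ⊆ R ∪ segment ℝ d₁ d₂ := by
    rintro x (hx | rfl | rfl)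
    exacts [Or.inl hx, Or.inr (left_mem_segment ℝ _ _), Or.inr (right_mem_segment ℝ _ _)]
  have hRbc : IsCompact Rb := by
    refine hQ.1.of_isClosed_subset ?_ hRbQ
    refine isClosed_of_closure_subset ?_
    rw [hRb, closure_union]
    refine union_subset (closure_rest_subset (isArc_segment hd12) hRX hQ) ?_
    rw [(by simp : ({d₁, d₂} : Set R3).Finite).isClosed.closure_eq]
    exact subset_union_right
  -- the neighbourhood
  set Z : Set R3 := (fun z : ℝ × R3 => z.2 - (z.1 * (ℓ z.2 - ℓ d₁)) • v) '' (Icc 0 1 ×ˢ Rb) with hZ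
  have hℓc : Continuous ℓ := ℓ.continuous_of_finiteDimensional
  have hZc : IsClosed Z := ((isCompact_Icc.prod hRbc).image (by fun_prop)).isClosed
  -- The set `Z` consists of the points that some `σ t` carries into the rest. It is closed as `Rb`
  -- and `[0, 1]` are compact, and an arc off `Z` avoids the rest during the whole move.
  have hZm : ∀ x, x ∉ Z → ∀ t ∈ Icc (0 : ℝ) 1, σ t x ∉ Rb := by
    intro x hx t ht h
    refine hx ⟨(t, σ t x), ⟨ht, h⟩, ?_⟩
    simp only [hℓσ]
    rw [hσ']; module
  have hσuRb : ∀ t ∈ Icc (0 : ℝ) 1, ∀ u : ℝ, 0 ≤ u → u ≤ 1 / 2 → σ t (d₁ + u • e) ∈ Rb →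
      u = 0 := by
    intro t ht u h0 h1 h
    rcases hRbT _ h (hσT t ht u h0 h1) with h2 | h2
    · have := congrArg ℓ h2
      rw [hℓσ, hℓu] at this
      linarith
    · have := congrArg ℓ h2
      rw [hℓσ, hℓu, hℓd2] at this
      linarith
  have ho : d₁ + u₀ • e ∉ Z := by
    rintro ⟨⟨t, x⟩, ⟨ht, hx⟩, hxe⟩
    simp only at hxe hx ht
    have hσx : σ t (d₁ + u₀ • e) = x := by
      rw [hσ', ← hxe]
      simp only [map_sub, map_smul, hℓv, smul_zero, sub_zero]
      module
    have := hσuRb t ht u₀ hu0.le hu1.le (hσx ▸ hx)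
    linarith
  refine ⟨σ 1, good_shear _ _ _ _, ?_, Zᶜ ∩ {y | ℓ y < ℓ m}, ?_, ?_⟩
  · intro u
    rw [hσ', hℓu, hv, hm]
    module
  · refine inter_mem (hZc.isOpen_compl.mem_nhds ho)
      ((isOpen_lt hℓc continuous_const).mem_nhds ?_)
    show ℓ _ < _
    rw [hℓu, hℓm]; linarith
  intro B a b hB hmarg ha hb hBU
  have hpC := subset_convexHull ℝ α hα.left_mem
  have hqC := subset_convexHull ℝ α hα.right_mem
  have hZB : ∀ x ∈ convexHull ℝ α, ∀ t ∈ Icc (0 : ℝ) 1, σ t (B x) ∉ Rb := fun x hx =>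
    hZm _ (hBU x hx).1
  have hℓB : ∀ x ∈ convexHull ℝ α, ℓ (B x) < ℓ m := fun x hx => (hBU x hx).2
  have ha' : ∃ u : ℝ, 0 ≤ u ∧ u ≤ 1 / 2 ∧ a = d₁ + u • e :=
    exists_param_of_mem_segment (x := d₁) (e := e) (s := 0) (t := 1 / 2) (by norm_num)
      (by rw [zero_smul, add_zero]; exact ha)
  have hb' : ∃ u : ℝ, 0 ≤ u ∧ u ≤ 1 / 2 ∧ b = d₁ + u • e :=
    exists_param_of_mem_segment (x := d₁) (e := e) (s := 0) (t := 1 / 2) (by norm_num)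
      (by rw [zero_smul, add_zero]; exact hb)
  obtain ⟨ua, ha0, ha1, hae⟩ := ha'
  obtain ⟨ub, hb0, hb1, hbe⟩ := hb'
  obtain ⟨s₁, s₂, h1, h2, h3, e1, e2⟩ := hmarg
  have hBp : B p = d₁ + (ua + s₁ * (ub - ua)) • e := by rw [e1, hae, hbe]; module
  have hBq : B q = d₁ + (ua + s₂ * (ub - ua)) • e := by rw [e2, hae, hbe]; module
  have hpm : 0 ≤ ua + s₁ * (ub - ua) ∧ ua + s₁ * (ub - ua) ≤ 1 / 2 := by
    constructor <;> nlinarith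
  have hqm : 0 ≤ ua + s₂ * (ub - ua) ∧ ua + s₂ * (ub - ua) ≤ 1 / 2 := by
    constructor <;> nlinarith
  have hpar : ∀ x, x ∈ segment ℝ d₁ m ↔ ∃ u : ℝ, 0 ≤ u ∧ u ≤ 1 / 2 ∧ x = d₁ + u • e := by
    intro x
    constructor
    · intro hx
      exact exists_param_of_mem_segment (x := d₁) (e := e) (s := 0) (t := 1 / 2) (by norm_num)
        (by rw [zero_smul, add_zero]; exact hx)
    · rintro ⟨u, h0, h1, rfl⟩
      have := (mem_segment_param (x := d₁) he0 (u := u) (s := 0) (t := 1 / 2)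
        (by norm_num)).2 ⟨h0, h1⟩
      rwa [zero_smul, add_zero] at this
  have hpar2 : ∀ x, x ∈ segment ℝ m d₂ → ∃ u : ℝ, 1 / 2 ≤ u ∧ u ≤ 1 ∧ x = d₁ + u • e := by
    intro x hx
    have hd2 : d₁ + (1 : ℝ) • e = d₂ := by rw [he]; simp
    exact exists_param_of_mem_segment (x := d₁) (e := e) (s := 1 / 2) (t := 1) (by norm_num)
      (by rw [hd2]; exact hx)
  have hBpm : B p ∈ segment ℝ d₁ m := (hpar _).2 ⟨_, hpm.1, hpm.2, hBp⟩
  have hBqm : B q ∈ segment ℝ d₁ m := (hpar _).2 ⟨_, hqm.1, hqm.2, hBq⟩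
  have hBseg : B '' segment ℝ p q ⊆ segment ℝ d₁ m := by
    rw [aff_image_segment]
    exact (convex_segment d₁ m).segment_subset hBpm hBqm
  have hsegC : segment ℝ p q ⊆ convexHull ℝ α := (convex_convexHull ℝ α).segment_subset hpC hqC
  have hσseg : σ 1 '' segment ℝ d₁ m = segment ℝ d₁ d₃ := by
    rw [aff_image_segment, hσd1, hσm]
  have hτseg : τ 1 '' segment ℝ m d₂ = segment ℝ d₃ d₂ := by
    rw [aff_image_segment, hτd2, hτm]
  have hsplit : segment ℝ d₁ d₂ = segment ℝ d₁ m ∪ segment ℝ m d₂ := by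
    rw [segment_split (add_smul_mem_segment (by norm_num) (by norm_num) : m ∈ segment ℝ d₁ d₂),
      segment_symm ℝ m d₁]
  have hclear1 : ∀ x ∈ convexHull ℝ α, B x ∈ R ∪ segment ℝ d₁ d₂ → x ∈ segment ℝ p q := by
    rintro x hx (hxR | hxs)
    · have := hZB x hx 0 (by simp)
      rw [hσ', zero_mul, zero_smul, add_zero] at this
      exact absurd (Or.inl hxR) this
    · rw [segment_eq_lines] at hxs
      obtain ⟨u, -, -, hu⟩ := hxs
      exact hα.mem_segment_of_line hBp hBq hx hu
  have hS1 : State α p q (R ∪ segment ℝ d₁ d₂) B a b := by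
    refine ⟨hB, ?_, ⟨s₁, s₂, h1, h2, h3, e1, e2⟩, hclear1⟩
    refine ((convex_segment d₁ m).segment_subset ha hb).trans ?_
    rw [hsplit]
    exact subset_union_left.trans subset_union_right
  have hsubab : segment ℝ a b ⊆ segment ℝ d₁ m := (convex_segment d₁ m).segment_subset ha hb
  have hτℓ : ∀ y ∈ segment ℝ m d₂, ℓ m ≤ ℓ y := by
    intro y hy
    obtain ⟨u, hu0, hu1, rfl⟩ := hpar2 y hy
    rw [hℓm, hℓu]; linarith
  have hS2 : State α p q (R ∪ (segment ℝ d₁ d₃ ∪ segment ℝ d₃ d₂)) (B.trans (σ 1)) (σ 1 a)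
      (σ 1 b) := by
    refine ⟨hB.trans (good_shear _ _ _ _), ?_, ⟨s₁, s₂, h1, h2, h3, ?_, ?_⟩, ?_⟩
    · rw [← aff_image_segment]
      refine (image_mono hsubab).trans ?_
      rw [hσseg]
      exact subset_union_left.trans subset_union_right
    · rw [AffineEquiv.trans_apply, e1, aff_apply]
    · rw [AffineEquiv.trans_apply, e2, aff_apply]
    · rintro x hx (hxR | hxs | hxs)
      · exact absurd (Or.inl hxR) (hZB x hx 1 (by simp))
      · rw [← hσseg, AffineEquiv.trans_apply, mem_aff_image] at hxs
        refine hclear1 x hx (Or.inr ?_)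
        rw [hsplit]; exact Or.inl hxs
      · rw [← hτseg] at hxs
        obtain ⟨y, hy, hye⟩ := hxs
        have := congrArg ℓ hye
        rw [hℓτ, AffineEquiv.trans_apply, hℓσ] at this
        have h4 := hτℓ y hy
        have h5 := hℓB x hx
        linarith
  refine ⟨hS1, hS2, fun hlink => ?_⟩
  -- The first half of the edge with the arc inserted; it is the piece that moves with `σ`.
  set M : Set R3 := (segment ℝ d₁ m \ segment ℝ (B p) (B q)) ∪ {B p, B q} ∪ B '' α with hM
  have hMcases : ∀ y ∈ M, (∃ u : ℝ, 0 ≤ u ∧ u ≤ 1 / 2 ∧ y = d₁ + u • e) ∨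
      ∃ x ∈ convexHull ℝ α, y = B x := by
    rintro y ((⟨hy, -⟩ | hy | hy) | ⟨x, hx, rfl⟩)
    · exact Or.inl ((hpar y).1 hy)
    · exact Or.inr ⟨p, hpC, hy⟩
    · exact Or.inr ⟨q, hqC, hy⟩
    · exact Or.inr ⟨x, subset_convexHull ℝ α hx, rfl⟩
  have hσ0 : ∀ x, σ 0 x = x := fun x => by rw [hσ']; simp
  have hτ0 : ∀ x, τ 0 x = x := fun x => by rw [hτ']; simp
  have hRbM : ∀ t ∈ Icc (0 : ℝ) 1, ∀ y ∈ M, σ t y ∈ Rb → y = d₁ := by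
    intro t ht y hy h
    rcases hMcases y hy with ⟨u, h0, h1, rfl⟩ | ⟨x, hx, rfl⟩
    · rw [hσuRb t ht u h0 h1 h]; simp
    · exact absurd h (hZB x hx t ht)
  have hRbm : ∀ t ∈ Icc (0 : ℝ) 1, ∀ y ∈ segment ℝ m d₂, τ t y ∈ Rb → y = d₂ := by
    intro t ht y hy h
    obtain ⟨u, h0, h1, rfl⟩ := hpar2 y hy
    rcases hRbT _ h (hτT t ht u h0 h1) with h2 | h2
    · have := congrArg ℓ h2
      rw [hℓτ, hℓu] at this
      linarith
    · have := congrArg ℓ h2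
      rw [hℓτ, hℓu, hℓd2] at this
      have : u = 1 := by linarith
      rw [this, he]; simp
  have hMm : ∀ y ∈ M, ∀ z ∈ segment ℝ m d₂, ℓ y = ℓ z → y = m ∧ z = m := by
    intro y hy z hz h
    have h4 := hτℓ z hz
    rcases hMcases y hy with ⟨u, h0, h1, rfl⟩ | ⟨x, hx, rfl⟩
    · obtain ⟨u', h0', h1', rfl⟩ := hpar2 z hz
      rw [hℓu, hℓu] at h
      have hu : u = 1 / 2 := by linarith
      have hu' : u' = 1 / 2 := by linarith
      rw [hu, hu']; exact ⟨rfl, rfl⟩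
    · have := hℓB x hx
      linarith
  have hiso := isotopic_of_three_pieces (K₀ := Rb) (K₁ := M) (K₂ := segment ℝ m d₂)
    (by
      obtain ⟨S, hS, h⟩ := hQ.segUnion_compl (c := d₁) (d := d₂) subset_union_right
      exact ⟨S, hS, hRbEq ▸ h⟩)
    (segUnion_union (segUnion_segment_diff hBpm hBqm) (segUnion_image hα.segs B))
    (segUnion_segment m d₂) σ τ
    (fun x => by simp only [hσ']; fun_prop) (fun x => by simp only [hτ']; fun_prop)
    (by
      intro t ht x hx y hy
      constructor
      · intro h
        have hy1 := hRbM t ht y hy (h ▸ hx)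
        rw [h, hy1, hσd1]
      · intro h
        have hy1 := hRbM 0 (by simp) y hy (by rw [hσ0, ← h]; exact hx)
        rw [h, hy1, hσd1])
    (by
      intro t ht x hx y hy
      constructor
      · intro h
        have hy1 := hRbm t ht y hy (h ▸ hx)
        rw [h, hy1, hτd2]
      · intro h
        have hy1 := hRbm 0 (by simp) y hy (by rw [hτ0, ← h]; exact hx)
        rw [h, hy1, hτd2])
    (by
      intro t ht x hx y hy
      constructor
      · intro h
        obtain ⟨hx1, hy1⟩ := hMm x hx y hy (by rw [← hℓσ t x, h, hℓτ])
        rw [hx1, hy1]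
      · intro h
        obtain ⟨hx1, hy1⟩ := hMm x hx y hy (by rw [h])
        rw [hx1, hy1, hστm])
  have hset : ∀ t ∈ Icc (0 : ℝ) 1, Rb ∪ (σ t '' M ∪ τ t '' segment ℝ m d₂) =
      (R ∪ (σ t '' segment ℝ d₁ m ∪ τ t '' segment ℝ m d₂)) \ (σ t '' (B '' segment ℝ p q)) ∪
        σ t '' (B '' α) := by
    intro t ht
    have hnot : ∀ x ∈ Rb, x ∉ σ t '' (B '' segment ℝ p q) := by
      rintro _ hx ⟨_, ⟨y, hy, rfl⟩, rfl⟩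
      exact hZB y (hsegC hy) t ht hx
    have hBα : ∀ y ∈ α, σ t (B y) ∈ σ t '' (B '' α) := fun y hy => ⟨_, ⟨y, hy, rfl⟩, rfl⟩
    apply Subset.antisymm
    · rintro x (hx | ⟨y, hy, rfl⟩ | ⟨y, hy, rfl⟩)
      · refine Or.inl ⟨?_, hnot x hx⟩
        rcases hx with hx | rfl | rfl
        · exact Or.inl hx
        · exact Or.inr (Or.inl ⟨x, left_mem_segment ℝ _ _, hσd1 t⟩)
        · exact Or.inr (Or.inr ⟨x, right_mem_segment ℝ _ _, hτd2 t⟩)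
      · rcases hy with (⟨hy, hy'⟩ | rfl | rfl) | hy
        · refine Or.inl ⟨Or.inr (Or.inl ⟨y, hy, rfl⟩), fun h => hy' ?_⟩
          rw [mem_aff_image, aff_image_segment] at h
          exact h
        · exact Or.inr (hBα p hα.left_mem)
        · exact Or.inr (hBα q hα.right_mem)
        · exact Or.inr ⟨y, hy, rfl⟩
      · refine Or.inl ⟨Or.inr (Or.inr ⟨y, hy, rfl⟩), ?_⟩
        rintro ⟨_, ⟨z, hz, rfl⟩, h⟩
        have h6 := congrArg ℓ h
        rw [hℓτ, hℓσ] at h6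
        have h4 := hτℓ y hy
        have h5 := hℓB z (hsegC hz)
        linarith
    · rintro x (⟨hx | ⟨y, hy, rfl⟩ | hx, hx'⟩ | ⟨y, hy, rfl⟩)
      · exact Or.inl (Or.inl hx)
      · refine Or.inr (Or.inl ⟨y, Or.inl (Or.inl ⟨hy, fun h => hx' ?_⟩), rfl⟩)
        rw [mem_aff_image, aff_image_segment]
        exact h
      · exact Or.inr (Or.inr hx)
      · exact Or.inr (Or.inl ⟨y, Or.inr hy, rfl⟩)
  have himg0 : ∀ X : Set R3, σ 0 '' X = X := fun X => by
    rw [image_congr fun x _ => hσ0 x, image_id']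
  have himg0' : ∀ X : Set R3, τ 0 '' X = X := fun X => by
    rw [image_congr fun x _ => hτ0 x, image_id']
  have hset0 := hset 0 (by simp)
  have hset1 := hset 1 (by simp)
  simp only [himg0, himg0'] at hset0
  rw [← hsplit] at hset0
  rw [hσseg, hτseg] at hset1
  have i0 : Rb ∪ (σ 0 '' M ∪ τ 0 '' segment ℝ m d₂) = ins α p q (R ∪ segment ℝ d₁ d₂) B := by
    rw [himg0, himg0', hset0]; rfl
  have i1 : Rb ∪ (σ 1 '' M ∪ τ 1 '' segment ℝ m d₂) =
      ins α p q (R ∪ (segment ℝ d₁ d₃ ∪ segment ℝ d₃ d₂)) (B.trans (σ 1)) := by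
    rw [hτseg, hset1, ins, AffineEquiv.coe_trans, image_comp, image_comp]
  rw [i0, i1] at hiso
  exact hiso hlink

theorem exists_param_avoid (A : R3 ≃ᵃ[ℝ] R3) {p q : R3} (hpq : p ≠ q) {F : Set R3}
    (hF : F.Finite) : ∃ θ : ℝ, 0 < θ ∧ θ < 1 ∧ A (p + θ • (q - p)) ∉ F := by
  have hinj : Function.Injective fun θ : ℝ => A (p + θ • (q - p)) := fun s t h =>
    param_inj (sub_ne_zero.2 hpq.symm) (A.injective h)
  obtain ⟨θ, hθ, h⟩ := ((Ioo_infinite (zero_lt_one (α := ℝ))).sdiff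
    (hF.preimage hinj.injOn)).nonempty
  exact ⟨θ, hθ.1, hθ.2, h⟩

/-- A triangle move away from the inserted arc. -/
theorem State.off {α : Set R3} {p q : R3} (hα : Tangle α p q) {R X Y T : Set R3}
    {A : R3 ≃ᵃ[ℝ] R3} {a b : R3} (h : State α p q (R ∪ X) A a b) (hX : X ⊆ T) (hY : Y ⊆ T)
    (hA : ∀ x ∈ convexHull ℝ α, A x ∉ T) (hab : Disjoint (segment ℝ a b) T) :
    State α p q (R ∪ Y) A a b ∧
      ins α p q (R ∪ X) A = (R \ A '' segment ℝ p q ∪ A '' α) ∪ X ∧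
      ins α p q (R ∪ Y) A = (R \ A '' segment ℝ p q ∪ A '' α) ∪ Y := by
  have hseg : segment ℝ p q ⊆ convexHull ℝ α := (convex_convexHull ℝ α).segment_subset
    (subset_convexHull ℝ α hα.left_mem) (subset_convexHull ℝ α hα.right_mem)
  have key : ∀ Z ⊆ T, ins α p q (R ∪ Z) A = (R \ A '' segment ℝ p q ∪ A '' α) ∪ Z := by
    intro Z hZ
    have hd : Z \ A '' segment ℝ p q = Z := by
      rw [sdiff_eq_left, disjoint_left]
      rintro _ hz ⟨x, hx, rfl⟩
      exact hA x (hseg hx) (hZ hz)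
    rw [ins, union_sdiff_distrib, hd, union_right_comm]
  refine ⟨⟨h.good, fun x hx => ?_, h.margin, ?_⟩, key X hX, key Y hY⟩
  · rcases h.sub hx with h1 | h1
    · exact Or.inl h1
    · exact absurd (hX h1) (disjoint_left.1 hab hx)
  · rintro x hx (h1 | h1)
    · exact h.clear x hx (Or.inl h1)
    · exact absurd (hY h1) (hA x hx)

theorem off_isotopic {α : Set R3} {p q : R3} {R : Set R3}
    {d₁ d₂ d₃ : R3} (hd : AffineIndependent ℝ ![d₁, d₂, d₃]) (hR : Disjoint R (tri d₁ d₂ d₃))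
    {A : R3 ≃ᵃ[ℝ] R3} (hA : ∀ x ∈ convexHull ℝ α, A x ∉ tri d₁ d₂ d₃) :
    Isotopic ((R \ A '' segment ℝ p q ∪ A '' α) ∪ segment ℝ d₁ d₂)
      ((R \ A '' segment ℝ p q ∪ A '' α) ∪ (segment ℝ d₁ d₃ ∪ segment ℝ d₃ d₂)) := by
  refine isotopic_of_rest hd ?_
  rintro x ⟨⟨hx, -⟩ | ⟨y, hy, rfl⟩, hT⟩
  · exact absurd hT (disjoint_left.1 hR hx)
  · exact absurd hT (hA y (subset_convexHull ℝ α hy))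

theorem isClosed_rest {R : Set R3} {d₁ d₂ d₃ : R3} (hd : AffineIndependent ℝ ![d₁, d₂, d₃])
    (hR : Disjoint R (tri d₁ d₂ d₃)) (hQ : IsLink (R ∪ segment ℝ d₁ d₂)) :
    IsClosed (R ∪ {d₁, d₂}) := by
  refine isClosed_of_closure_subset ?_
  rw [closure_union]
  refine union_subset (closure_rest_subset (isArc_segment (tri_ne hd).1)
    (hR.mono_right (segment_subset_tri_left _ _ _)) hQ) ?_
  rw [(by simp : ({d₁, d₂} : Set R3).Finite).isClosed.closure_eq]
  exact subset_union_right

theorem isClosed_segment (a b : R3) : IsClosed (segment ℝ a b) := (isCompact_segment a b).isClosed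

theorem isClosed_tri (a b c : R3) : IsClosed (tri a b c) :=
  (Set.Finite.isCompact_convexHull (𝕜 := ℝ) (by simp : ({a, b, c} : Set R3).Finite)).isClosed

/-- Transport of a state along a triangle move, when the arc lies on the first half of the edge. -/
theorem State.tent_forward {α : Set R3} {p q : R3} (hα : Tangle α p q) {R : Set R3}
    {d₁ d₂ d₃ : R3} (hd : AffineIndependent ℝ ![d₁, d₂, d₃]) (hR : Disjoint R (tri d₁ d₂ d₃))
    (hQ : IsLink (R ∪ segment ℝ d₁ d₂)) {A : R3 ≃ᵃ[ℝ] R3} {a b : R3}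
    (h : State α p q (R ∪ segment ℝ d₁ d₂) A a b)
    (hI : IsLink (ins α p q (R ∪ segment ℝ d₁ d₂) A)) {θ : ℝ} (hθ : 0 < θ) (hθ1 : θ < 1)
    {u₀ : ℝ} (hu0 : 0 < u₀) (hu1 : u₀ < 1 / 2)
    (hu : A (p + θ • (q - p)) = d₁ + u₀ • (d₂ - d₁)) :
    ∃ A' a' b', State α p q (R ∪ (segment ℝ d₁ d₃ ∪ segment ℝ d₃ d₂)) A' a' b' ∧
      Isotopic (ins α p q (R ∪ segment ℝ d₁ d₂) A)
        (ins α p q (R ∪ (segment ℝ d₁ d₃ ∪ segment ℝ d₃ d₂)) A') := by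
  obtain ⟨σ, hσ, hσe, U, hU, H⟩ := tent_move hα hd hR hQ hu0 hu1
  have he0 : d₂ - d₁ ≠ 0 := sub_ne_zero.2 (tri_ne hd).1.symm
  set m := d₁ + (1 / 2 : ℝ) • (d₂ - d₁) with hm
  have hms : m ∈ segment ℝ d₁ d₂ := add_smul_mem_segment (by norm_num) (by norm_num)
  have hd2 : d₁ + (1 : ℝ) • (d₂ - d₁) = d₂ := by simp
  -- Besides `U`, the neighbourhood avoids the rest and the second half of the edge, so the carrier
  -- segment obtained by shrinking lies on the first half.
  have hV : U ∩ ((R ∪ {d₁, d₂}) ∪ segment ℝ m d₂)ᶜ ∈ 𝓝 (A (p + θ • (q - p))) := by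
    rw [hu]
    refine inter_mem hU (((isClosed_rest hd hR hQ).union (isClosed_segment _ _)).isOpen_compl.mem_nhds
      ?_)
    rintro ((h1 | h1 | h1) | h1)
    · exact disjoint_left.1 hR h1 (segment_subset_tri_left _ _ _
        (add_smul_mem_segment hu0.le (by linarith)))
    · exact hu0.ne' (param_inj he0 (a := d₁) (by rw [h1]; simp))
    · exact absurd (param_inj he0 (h1.trans hd2.symm)) (by linarith)
    · have := (mem_segment_param (x := d₁) he0 (u := u₀) (s := 1 / 2) (t := 1)
        (by norm_num)).1 (by rwa [hd2])
      linarith [this.1]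
  obtain ⟨c, hc, a', b', hS, hIs, hhull, hab, -⟩ := h.shrink_into hα hQ hI hθ hθ1 hV
  have hsub : segment ℝ a' b' ⊆ segment ℝ d₁ m := by
    intro x hx
    have h1 := hab hx
    rcases hS.sub hx with h2 | h2
    · exact absurd (Or.inl (Or.inl h2)) h1.2
    · rw [segment_split hms] at h2
      rcases h2 with h2 | h2
      · rwa [segment_symm]
      · exact absurd (Or.inr h2) h1.2
  obtain ⟨-, hS2, hI2⟩ := H _ a' b' hS.good hS.margin (hsub (left_mem_segment ℝ _ _))
    (hsub (right_mem_segment ℝ _ _)) fun x hx => (hhull x hx).1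
  exact ⟨_, _, _, hS2, hIs.trans (hI2 (Or.inl (hIs.isLink.1 hI)))⟩

/-- Transport of a state along an inverse triangle move, when the arc lies on the first edge. -/
theorem State.tent_backward {α : Set R3} {p q : R3} (hα : Tangle α p q) {R : Set R3}
    {d₁ d₂ d₃ : R3} (hd : AffineIndependent ℝ ![d₁, d₂, d₃]) (hR : Disjoint R (tri d₁ d₂ d₃))
    (hQ : IsLink (R ∪ segment ℝ d₁ d₂))
    (hQ' : IsLink (R ∪ (segment ℝ d₁ d₃ ∪ segment ℝ d₃ d₂))) {A : R3 ≃ᵃ[ℝ] R3} {a b : R3}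
    (h : State α p q (R ∪ (segment ℝ d₁ d₃ ∪ segment ℝ d₃ d₂)) A a b)
    (hI : IsLink (ins α p q (R ∪ (segment ℝ d₁ d₃ ∪ segment ℝ d₃ d₂)) A))
    {θ : ℝ} (hθ : 0 < θ) (hθ1 : θ < 1) {u₀ : ℝ} (hu0 : 0 < u₀) (hu1 : u₀ < 1)
    (hu : A (p + θ • (q - p)) = d₁ + u₀ • (d₃ - d₁)) :
    ∃ A' a' b', State α p q (R ∪ segment ℝ d₁ d₂) A' a' b' ∧
      Isotopic (ins α p q (R ∪ (segment ℝ d₁ d₃ ∪ segment ℝ d₃ d₂)) A)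
        (ins α p q (R ∪ segment ℝ d₁ d₂) A') := by
  -- The shear maps the first half of `d₁d₂` onto all of `d₁d₃`, hence the parameter is halved.
  obtain ⟨σ, hσ, hσe, U, hU, H⟩ := tent_move hα hd hR hQ (u₀ := u₀ / 2) (by linarith)
    (by linarith)
  set m := d₁ + (1 / 2 : ℝ) • (d₂ - d₁) with hm
  have hσ1 : σ d₁ = d₁ := by simpa using hσe 0
  have hσm : σ m = d₃ := by simpa [hm] using hσe 1
  have hσs : σ '' segment ℝ d₁ m = segment ℝ d₁ d₃ := by rw [aff_image_segment, hσ1, hσm]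
  have hud : A (p + θ • (q - p)) = σ (d₁ + (u₀ / 2) • (d₂ - d₁)) := by rw [hσe, hu]
  have hw : d₁ + u₀ • (d₃ - d₁) = (1 - u₀) • d₁ + (0 : ℝ) • d₂ + u₀ • d₃ := by module
  have hV : σ.symm ⁻¹' U ∩ ((R ∪ {d₁, d₂}) ∪ segment ℝ d₃ d₂)ᶜ ∈ 𝓝 (A (p + θ • (q - p))) := by
    refine inter_mem ?_ (((isClosed_rest hd hR hQ).union
      (isClosed_segment _ _)).isOpen_compl.mem_nhds ?_)
    · refine (aff_continuous σ.symm).continuousAt ?_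
      rw [hud, AffineEquiv.symm_apply_apply]
      exact hU
    rw [hu]
    rintro ((h1 | h1 | h1) | h1)
    · exact disjoint_left.1 hR h1 (segment_subset_tri_ac _ _ _
        (add_smul_mem_segment hu0.le hu1.le))
    · have := tri_weights hd (α := -u₀) (β := 0) (γ := u₀) (by ring)
        (by rw [show (0 : R3) = d₁ + u₀ • (d₃ - d₁) - d₁ by rw [h1, sub_self]]; module)
      linarith [this.1]
    · have := tri_weights hd (α := 1 - u₀) (β := -1) (γ := u₀) (by ring)
        (by rw [show (0 : R3) = d₁ + u₀ • (d₃ - d₁) - d₂ by rw [h1, sub_self]]; module)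
      linarith [this.2.1]
    · rw [segment_eq_lines] at h1
      obtain ⟨t, -, -, h1⟩ := h1
      have := tri_weights hd (α := 1 - u₀) (β := -t) (γ := u₀ - 1 + t) (by ring)
        (by rw [← sub_self (d₁ + u₀ • (d₃ - d₁))]; nth_rw 2 [h1]; module)
      linarith [this.1]
  obtain ⟨c, hc, a', b', hS, hIs, hhull, hab, -⟩ := h.shrink_into hα hQ' hI hθ hθ1 hV
  set A' := (hom (p + θ • (q - p)) c).trans A with hA'
  have hsub : segment ℝ a' b' ⊆ segment ℝ d₁ d₃ := by
    intro x hx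
    have h1 := hab hx
    rcases hS.sub hx with h2 | h2 | h2
    · exact absurd (Or.inl (Or.inl h2)) h1.2
    · exact h2
    · exact absurd (Or.inr h2) h1.2
  have hmem : ∀ x ∈ segment ℝ d₁ d₃, σ.symm x ∈ segment ℝ d₁ m := by
    intro x hx
    rw [← hσs] at hx
    obtain ⟨y, hy, rfl⟩ := hx
    rwa [AffineEquiv.symm_apply_apply]
  obtain ⟨s₁, s₂, h1, h2, h3, e1, e2⟩ := hS.margin
  -- The tent move is applied to the arc pulled back by `σ` and is then read backwards.
  obtain ⟨hS1, -, hI2⟩ := H (A'.trans σ.symm) (σ.symm a') (σ.symm b') (hS.good.trans hσ.symm)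
    ⟨s₁, s₂, h1, h2, h3, by rw [AffineEquiv.trans_apply, e1, aff_apply],
      by rw [AffineEquiv.trans_apply, e2, aff_apply]⟩
    (hmem _ (hsub (left_mem_segment ℝ _ _))) (hmem _ (hsub (right_mem_segment ℝ _ _)))
    fun x hx => (hhull x hx).1
  have hAA : (A'.trans σ.symm).trans σ = A' := by
    ext1 x; simp
  rw [hAA] at hI2
  exact ⟨_, _, _, hS1, hIs.trans (hI2 (Or.inr (hIs.isLink.1 hI))).symm⟩

theorem exists_param_of_mem_of_ne {a b x : R3} (hx : x ∈ segment ℝ a b) (ha : x ≠ a) (hb : x ≠ b) :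
    ∃ u : ℝ, 0 < u ∧ u < 1 ∧ x = a + u • (b - a) := by
  rw [segment_eq_lines] at hx
  obtain ⟨u, h0, h1, rfl⟩ := hx
  refine ⟨u, h0.lt_of_ne ?_, h1.lt_of_ne ?_, rfl⟩
  · rintro rfl; simp at ha
  · rintro rfl; simp at hb

/-- If an inner point of the image of the chord is off the triangle, the arc is shrunk to that point
and the move does not touch it. Otherwise the inner points of the chord lie on the edge `d₁d₂`. One
away from the midpoint is chosen, and the tent move applies, with `d₁` and `d₂` exchanged if the
point lies on the second half. -/
theorem State.forward {α : Set R3} {p q : R3} (hα : Tangle α p q) {R : Set R3}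
    {d₁ d₂ d₃ : R3} (hd : AffineIndependent ℝ ![d₁, d₂, d₃]) (hR : Disjoint R (tri d₁ d₂ d₃))
    (hQ : IsLink (R ∪ segment ℝ d₁ d₂)) {A : R3 ≃ᵃ[ℝ] R3} {a b : R3}
    (h : State α p q (R ∪ segment ℝ d₁ d₂) A a b)
    (hI : IsLink (ins α p q (R ∪ segment ℝ d₁ d₂) A)) :
    ∃ A' a' b', State α p q (R ∪ (segment ℝ d₁ d₃ ∪ segment ℝ d₃ d₂)) A' a' b' ∧
      Isotopic (ins α p q (R ∪ segment ℝ d₁ d₂) A)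
        (ins α p q (R ∪ (segment ℝ d₁ d₃ ∪ segment ℝ d₃ d₂)) A') := by
  by_cases hout : ∃ θ : ℝ, 0 < θ ∧ θ < 1 ∧ A (p + θ • (q - p)) ∉ tri d₁ d₂ d₃
  · obtain ⟨θ, hθ, hθ1, hT⟩ := hout
    obtain ⟨c, hc, a', b', hS, hIs, hhull, hab, -⟩ := h.shrink_into hα hQ hI hθ hθ1
      ((isClosed_tri d₁ d₂ d₃).isOpen_compl.mem_nhds hT)
    obtain ⟨hS', e1, e2⟩ := hS.off hα (segment_subset_tri_left d₁ d₂ d₃)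
      (union_subset (segment_subset_tri_ac _ _ _) (segment_subset_tri_cb _ _ _)) hhull
      (subset_compl_iff_disjoint_right.1 hab)
    refine ⟨_, _, _, hS', hIs.trans ?_⟩
    rw [e1, e2]
    exact off_isotopic hd hR hhull
  · push Not at hout
    set m := d₁ + (1 / 2 : ℝ) • (d₂ - d₁) with hm
    obtain ⟨θ, hθ, hθ1, hF⟩ := exists_param_avoid A hα.ne (F := {d₁, d₂, m}) (by simp)
    have hT := hout θ hθ hθ1
    have hmem : A (p + θ • (q - p)) ∈ segment ℝ d₁ d₂ := by
      rcases h.sub (h.image_subset ⟨_, add_smul_mem_segment hθ.le hθ1.le, rfl⟩) with h1 | h1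
      · exact absurd hT (disjoint_left.1 hR h1)
      · exact h1
    simp only [mem_insert_iff, mem_singleton_iff, not_or] at hF
    obtain ⟨u, hu0, hu1, hu⟩ := exists_param_of_mem_of_ne hmem hF.1 hF.2.1
    rcases lt_trichotomy u (1 / 2) with hlt | heq | hgt
    · exact h.tent_forward hα hd hR hQ hI hθ hθ1 hu0 hlt hu
    · exact absurd (by rw [hu, heq]) hF.2.2
    · have := State.tent_forward (d₁ := d₂) (d₂ := d₁) (d₃ := d₃) (R := R) (A := A) (a := a)
        (b := b) hα (affineIndependent_swap hd) (by rwa [← tri_swap]) (by rwa [segment_symm])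
        (by rwa [segment_symm]) (by rwa [segment_symm]) hθ hθ1 (u₀ := 1 - u) (by linarith)
        (by linarith) (by rw [hu]; module)
      rwa [segment_symm ℝ d₂ d₁, union_comm (segment ℝ d₂ d₃), segment_symm ℝ d₃ d₁,
        segment_symm ℝ d₂ d₃] at this

/-- As for the forward move: either the arc can be shrunk off the triangle, or an inner point of the
chord other than a corner lies on one of the sides at `d₃`, and the two sides are interchangeable.
-/
theorem State.backward {α : Set R3} {p q : R3} (hα : Tangle α p q) {R : Set R3}
    {d₁ d₂ d₃ : R3} (hd : AffineIndependent ℝ ![d₁, d₂, d₃]) (hR : Disjoint R (tri d₁ d₂ d₃))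
    (hQ : IsLink (R ∪ segment ℝ d₁ d₂))
    (hQ' : IsLink (R ∪ (segment ℝ d₁ d₃ ∪ segment ℝ d₃ d₂))) {A : R3 ≃ᵃ[ℝ] R3} {a b : R3}
    (h : State α p q (R ∪ (segment ℝ d₁ d₃ ∪ segment ℝ d₃ d₂)) A a b)
    (hI : IsLink (ins α p q (R ∪ (segment ℝ d₁ d₃ ∪ segment ℝ d₃ d₂)) A)) :
    ∃ A' a' b', State α p q (R ∪ segment ℝ d₁ d₂) A' a' b' ∧
      Isotopic (ins α p q (R ∪ (segment ℝ d₁ d₃ ∪ segment ℝ d₃ d₂)) A)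
        (ins α p q (R ∪ segment ℝ d₁ d₂) A') := by
  by_cases hout : ∃ θ : ℝ, 0 < θ ∧ θ < 1 ∧ A (p + θ • (q - p)) ∉ tri d₁ d₂ d₃
  · obtain ⟨θ, hθ, hθ1, hT⟩ := hout
    obtain ⟨c, hc, a', b', hS, hIs, hhull, hab, -⟩ := h.shrink_into hα hQ' hI hθ hθ1
      ((isClosed_tri d₁ d₂ d₃).isOpen_compl.mem_nhds hT)
    obtain ⟨hS', e1, e2⟩ := hS.off hα
      (union_subset (segment_subset_tri_ac _ _ _) (segment_subset_tri_cb _ _ _))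
      (segment_subset_tri_left d₁ d₂ d₃) hhull (subset_compl_iff_disjoint_right.1 hab)
    refine ⟨_, _, _, hS', hIs.trans ?_⟩
    rw [e1, e2]
    exact (off_isotopic (A := (hom (p + θ • (q - p)) c).trans A) hd hR hhull).symm
  · push Not at hout
    obtain ⟨θ, hθ, hθ1, hF⟩ := exists_param_avoid A hα.ne (F := {d₁, d₂, d₃}) (by simp)
    have hT := hout θ hθ hθ1
    have hmem : A (p + θ • (q - p)) ∈ segment ℝ d₁ d₃ ∪ segment ℝ d₃ d₂ := by
      rcases h.sub (h.image_subset ⟨_, add_smul_mem_segment hθ.le hθ1.le, rfl⟩) with h1 | h1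
      · exact absurd hT (disjoint_left.1 hR h1)
      · exact h1
    simp only [mem_insert_iff, mem_singleton_iff, not_or] at hF
    rcases hmem with hmem | hmem
    · obtain ⟨u, hu0, hu1, hu⟩ := exists_param_of_mem_of_ne hmem hF.1 hF.2.2
      exact h.tent_backward hα hd hR hQ hQ' hI hθ hθ1 hu0 hu1 hu
    · rw [segment_symm] at hmem
      obtain ⟨u, hu0, hu1, hu⟩ := exists_param_of_mem_of_ne hmem hF.2.1 hF.2.2
      have e : segment ℝ d₂ d₃ ∪ segment ℝ d₃ d₁ = segment ℝ d₁ d₃ ∪ segment ℝ d₃ d₂ := by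
        rw [union_comm, segment_symm ℝ d₃ d₁, segment_symm ℝ d₂ d₃]
      have := State.tent_backward (d₁ := d₂) (d₂ := d₁) (d₃ := d₃) (R := R) (A := A) (a := a)
        (b := b) hα (affineIndependent_swap hd) (by rwa [← tri_swap]) (by rwa [segment_symm])
        (by rwa [e]) (by rwa [e]) (by rwa [e]) hθ hθ1 hu0 hu1 hu
      rwa [segment_symm ℝ d₂ d₁, e] at this

theorem State.deltaMove {α : Set R3} {p q : R3} (hα : Tangle α p q) {Q Q' : Set R3}
    (hD : DeltaMove Q Q') (hQ : IsLink Q) {A : R3 ≃ᵃ[ℝ] R3} {a b : R3}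
    (h : State α p q Q A a b) (hI : IsLink (ins α p q Q A)) :
    ∃ A' a' b', State α p q Q' A' a' b' ∧ Isotopic (ins α p q Q A) (ins α p q Q' A') := by
  obtain ⟨R, d₁, d₂, d₃, hd, hR, rfl, rfl⟩ := hD.exists_rest
  exact h.forward hα hd hR hQ hI

theorem State.deltaMove_symm {α : Set R3} {p q : R3} (hα : Tangle α p q) {Q Q' : Set R3}
    (hD : DeltaMove Q' Q) (hQ : IsLink Q) {A : R3 ≃ᵃ[ℝ] R3} {a b : R3}
    (h : State α p q Q A a b) (hI : IsLink (ins α p q Q A)) :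
    ∃ A' a' b', State α p q Q' A' a' b' ∧ Isotopic (ins α p q Q A) (ins α p q Q' A') := by
  have hQ' := hD.isotopic.isLink.2 hQ
  obtain ⟨R, d₁, d₂, d₃, hd, hR, rfl, rfl⟩ := hD.exists_rest
  exact h.backward hα hd hR hQ' hQ hI

/-- An arc inserted into a link can be carried along an isotopy of the link. -/
theorem State.isotopic {α : Set R3} {p q : R3} (hα : Tangle α p q) {Q Q' : Set R3}
    (hQQ : Isotopic Q Q') (hQ : IsLink Q) {A : R3 ≃ᵃ[ℝ] R3} {a b : R3}
    (h : State α p q Q A a b) (hI : IsLink (ins α p q Q A)) :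
    ∃ A' a' b', State α p q Q' A' a' b' ∧ Isotopic (ins α p q Q A) (ins α p q Q' A') := by
  -- Both directions are carried through the induction together, since the generated equivalence
  -- relation contains inverses of moves.
  have key : ∀ {Q Q'}, Isotopic Q Q' → IsLink Q →
      (∀ A a b, State α p q Q A a b → IsLink (ins α p q Q A) →
        ∃ A' a' b', State α p q Q' A' a' b' ∧ Isotopic (ins α p q Q A) (ins α p q Q' A')) ∧
      ∀ A a b, State α p q Q' A a b → IsLink (ins α p q Q' A) →
        ∃ A' a' b', State α p q Q A' a' b' ∧ Isotopic (ins α p q Q' A) (ins α p q Q A') := by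
    intro Q Q' hQQ
    induction hQQ with
    | rel Q Q' hD =>
      intro hQ
      exact ⟨fun A a b h hI => h.deltaMove hα hD hQ hI,
        fun A a b h hI => h.deltaMove_symm hα hD (hD.isotopic.isLink.1 hQ) hI⟩
    | refl Q =>
      intro _
      exact ⟨fun A a b h _ => ⟨A, a, b, h, isotopic_refl _⟩,
        fun A a b h _ => ⟨A, a, b, h, isotopic_refl _⟩⟩
    | symm Q Q' hQQ ih =>
      intro hQ
      exact (ih ((Isotopic.isLink hQQ).2 hQ)).symm
    | trans Q₁ Q₂ Q₃ h12 h23 ih1 ih2 =>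
      intro hQ
      have i1 := ih1 hQ
      have i2 := ih2 ((Isotopic.isLink h12).1 hQ)
      constructor
      · intro A a b h hI
        obtain ⟨A', a', b', h', hI'⟩ := i1.1 A a b h hI
        obtain ⟨A'', a'', b'', h'', hI''⟩ := i2.1 A' a' b' h' (hI'.isLink.1 hI)
        exact ⟨A'', a'', b'', h'', hI'.trans hI''⟩
      · intro A a b h hI
        obtain ⟨A', a', b', h', hI'⟩ := i2.2 A a b h hI
        obtain ⟨A'', a'', b'', h'', hI''⟩ := i1.2 A' a' b' h' (hI'.isLink.1 hI)
        exact ⟨A'', a'', b'', h'', hI'.trans hI''⟩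
  exact (key hQQ hQ).1 A a b h hI

/-! ### Closing up an arc inserted into a triangle -/

theorem smul_eq_zero_of_ne {e : R3} (he : e ≠ 0) {c : ℝ} (h : c • e = 0) : c = 0 :=
  (smul_eq_zero.1 h).resolve_right he

/-- A polygon `x₁d₁sd₂x₂` on one side of a plane, with `d₁x₁x₂d₂` in the plane, can be pulled back
to the segment `x₁x₂` of the plane. -/
theorem isotopic_pull_back {X : Set R3} {f : R3 →ₗ[ℝ] ℝ} {r : ℝ} {d₁ e s : R3} {t₁ t₂ : ℝ}
    (he : e ≠ 0) (hd1 : f d₁ = r) (hfe : f e = 0) (hs : r < f s)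
    (h1 : 0 < t₁) (h12 : t₁ < t₂) (h2 : t₂ < 1)
    (hX : ∀ x ∈ X, f x ≤ r ∧ (f x = r → x = d₁ + t₁ • e ∨ x = d₁ + t₂ • e)) :
    Isotopic (X ∪ segment ℝ d₁ (d₁ + t₁ • e) ∪ segment ℝ (d₁ + t₂ • e) (d₁ + e) ∪
      segment ℝ (d₁ + e) s ∪ segment ℝ s d₁) (X ∪ segment ℝ (d₁ + t₁ • e) (d₁ + t₂ • e)) := by
  set x₁ := d₁ + t₁ • e with hx1
  set x₂ := d₁ + t₂ • e with hx2
  set d₂ := d₁ + e with hd2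
  have fx1 : f x₁ = r := by simp [hx1, hd1, hfe]
  have fx2 : f x₂ = r := by simp [hx2, hd1, hfe]
  have fd2 : f d₂ = r := by simp [hd2, hd1, hfe]
  have n1 : d₁ ≠ x₁ := by
    intro h
    exact h1.ne' (smul_eq_zero_of_ne he (by rw [hx1] at h; exact left_eq_add.1 h))
  have n2 : d₂ ≠ x₂ := by
    intro h
    have : (1 - t₂) • e = 0 := by
      rw [← sub_eq_zero.2 h, hd2, hx2]; module
    linarith [smul_eq_zero_of_ne he this]
  have n3 : x₁ ≠ x₂ := by
    intro h
    have := param_inj he h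
    linarith
  -- The three moves are used backwards: they remove `d₂`, then `d₁`, then `s`. The triangles lie in
  -- `r ≤ f`, where `X` has at most the points `x₁` and `x₂`.
  have m1 := isotopic_of_rest (R := X ∪ segment ℝ d₁ x₁ ∪ segment ℝ s d₁)
    (affineIndependent_rotate (affineIndependent_of_functional (c := s) n2 f (by rw [fx2, fd2])
      (by rw [fd2]; exact hs.ne'))) (by
      rintro x ⟨hx, hT⟩
      obtain ⟨α, β, γ, hα, hβ, hγ, hsum, rfl⟩ := mem_tri.1 hT
      have hfx : f (α • x₂ + β • s + γ • d₂) = r + β * (f s - r) := by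
        simp only [map_add, map_smul, smul_eq_mul, fx2, fd2]
        rw [show α = 1 - β - γ by linarith]; ring
      have hline : β = 0 → α • x₂ + β • s + γ • d₂ = d₁ + (α * t₂ + γ) • e := by
        intro h0
        rw [h0, hx2, hd2, show α = 1 - γ by linarith]; module
      rcases hx with (hx | hx) | hx
      · obtain ⟨h3, h4⟩ := hX _ hx
        have hβ0 : β = 0 := by
          by_contra hne
          have := mul_pos (lt_of_le_of_ne hβ (Ne.symm hne)) (sub_pos.2 hs)
          linarith
        rcases h4 (by rw [hfx, hβ0]; ring) with h5 | h5
        · rw [hline hβ0] at h5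
          have := param_inj he h5
          nlinarith
        · exact Or.inl h5
      · exfalso
        rw [segment_eq_lines] at hx
        obtain ⟨u, hu0, hu1, hu⟩ := hx
        have hβ0 : β = 0 := by
          have := congrArg f hu
          rw [hfx, map_add, map_smul, map_sub, fx1, hd1, sub_self, smul_zero, add_zero] at this
          rcases mul_eq_zero.1 (by linarith : β * (f s - r) = 0) with h | h
          · exact h
          · linarith
        rw [hline hβ0, hx1, add_sub_cancel_left, smul_smul] at hu
        have := param_inj he hu
        nlinarith
      · rw [segment_eq_lines] at hx
        obtain ⟨u, hu0, hu1, hu⟩ := hx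
        have hβu : β = 1 - u := by
          have := congrArg f hu
          rw [hfx, map_add, map_smul, map_sub, hd1, smul_eq_mul] at this
          have h5 : (β - (1 - u)) * (f s - r) = 0 := by linarith
          rcases mul_eq_zero.1 h5 with h | h
          · linarith
          · linarith
        have h6 : (α * t₂ + γ) • e = 0 := by
          have : α • x₂ + β • s + γ • d₂ - (s + u • (d₁ - s)) = (α * t₂ + γ) • e := by
            rw [hx2, hd2, hβu, show γ = u - α by linarith]; module
          rw [← this, hu, sub_self]
        have h7 := smul_eq_zero_of_ne he h6
        have ha0 : α = 0 := by nlinarith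
        have hg0 : γ = 0 := by nlinarith
        right
        rw [ha0, hg0, show β = 1 by linarith]
        simp)
  have m2 := isotopic_of_rest (R := X ∪ segment ℝ x₂ s)
    (affineIndependent_rotate (affineIndependent_of_functional (c := s) n1 f (by rw [fx1, hd1])
      (by rw [hd1]; exact hs.ne'))) (by
      rintro x ⟨hx, hT⟩
      obtain ⟨α, β, γ, hα, hβ, hγ, hsum, rfl⟩ := mem_tri.1 hT
      have hfx : f (α • x₁ + β • s + γ • d₁) = r + β * (f s - r) := by
        simp only [map_add, map_smul, smul_eq_mul, fx1, hd1]
        rw [show α = 1 - β - γ by linarith]; ring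
      have hline : β = 0 → α • x₁ + β • s + γ • d₁ = d₁ + (α * t₁) • e := by
        intro h0
        rw [h0, hx1, show α = 1 - γ by linarith]; module
      rcases hx with hx | hx
      · obtain ⟨h3, h4⟩ := hX _ hx
        have hβ0 : β = 0 := by
          by_contra hne
          have := mul_pos (lt_of_le_of_ne hβ (Ne.symm hne)) (sub_pos.2 hs)
          linarith
        rcases h4 (by rw [hfx, hβ0]; ring) with h5 | h5
        · exact Or.inl h5
        · rw [hline hβ0] at h5
          have := param_inj he h5
          nlinarith
      · rw [segment_symm, segment_eq_lines] at hx
        obtain ⟨u, hu0, hu1, hu⟩ := hx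
        have hβu : β = 1 - u := by
          have := congrArg f hu
          rw [hfx, map_add, map_smul, map_sub, fx2, smul_eq_mul] at this
          have h5 : (β - (1 - u)) * (f s - r) = 0 := by linarith
          rcases mul_eq_zero.1 h5 with h | h
          · linarith
          · linarith
        have h6 : (α * t₁ - u * t₂) • e = 0 := by
          have : α • x₁ + β • s + γ • d₁ - (s + u • (x₂ - s)) = (α * t₁ - u * t₂) • e := by
            rw [hx2, hx1, hβu, show γ = u - α by linarith]; module
          rw [← this, hu, sub_self]
        have h7 := smul_eq_zero_of_ne he h6
        have hu0' : u = 0 := by nlinarith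
        right
        rw [hu, hu0']
        simp)
  have m3 := isotopic_of_rest (R := X) (affineIndependent_of_functional (c := s) n3 f
    (by rw [fx1, fx2]) (by rw [fx1]; exact hs.ne')) (by
      rintro x ⟨hx, hT⟩
      obtain ⟨α, β, γ, hα, hβ, hγ, hsum, rfl⟩ := mem_tri.1 hT
      have hfx : f (α • x₁ + β • x₂ + γ • s) = r + γ * (f s - r) := by
        simp only [map_add, map_smul, smul_eq_mul, fx1, fx2]
        rw [show α = 1 - β - γ by linarith]; ring
      obtain ⟨h3, h4⟩ := hX _ hx
      have hγ0 : γ = 0 := by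
        by_contra hne
        have := mul_pos (lt_of_le_of_ne hγ (Ne.symm hne)) (sub_pos.2 hs)
        linarith
      exact h4 (by rw [hfx, hγ0]; ring))
  have e1 : X ∪ segment ℝ d₁ x₁ ∪ segment ℝ x₂ d₂ ∪ segment ℝ d₂ s ∪ segment ℝ s d₁ =
      X ∪ segment ℝ d₁ x₁ ∪ segment ℝ s d₁ ∪ (segment ℝ x₂ d₂ ∪ segment ℝ d₂ s) := by
    ac_rfl
  have e2 : X ∪ segment ℝ d₁ x₁ ∪ segment ℝ s d₁ ∪ segment ℝ x₂ s =
      X ∪ segment ℝ x₂ s ∪ (segment ℝ x₁ d₁ ∪ segment ℝ d₁ s) := by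
    rw [segment_symm ℝ x₁, segment_symm ℝ d₁ s]; ac_rfl
  have e3 : X ∪ segment ℝ x₂ s ∪ segment ℝ x₁ s = X ∪ (segment ℝ x₁ s ∪ segment ℝ s x₂) := by
    rw [segment_symm ℝ s x₂]; ac_rfl
  rw [e1]
  refine m1.symm.trans ?_
  rw [e2]
  refine m2.symm.trans ?_
  rw [e3]
  exact m3.symm

/-- Replacing the apex of a triangle by a point off its plane. -/
theorem isotopic_change_apex {Y : Set R3} {d₁ d₂ d₃ s : R3} {h : R3 →ₗ[ℝ] ℝ} {k : ℝ}
    (hd : AffineIndependent ℝ ![d₁, d₂, d₃]) (h1 : h d₁ = k) (h2 : h d₂ = k) (h3 : h d₃ = k)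
    (hs : h s ≠ k)
    (hY : ∀ y ∈ Y, y ∈ segment ℝ d₁ d₂ ∨ y ∉ tri d₁ d₃ s ∧ y ∉ tri s d₂ d₃) :
    Isotopic (Y ∪ segment ℝ d₂ d₃ ∪ segment ℝ d₃ d₁) (Y ∪ segment ℝ d₂ s ∪ segment ℝ s d₁) := by
  obtain ⟨n12, n31, n32⟩ := tri_ne hd
  have hsk : h s - k ≠ 0 := sub_ne_zero.2 hs
  have zero : ∀ {c : ℝ}, c * (h s - k) = 0 → c = 0 := fun hc =>
    (mul_eq_zero.1 hc).resolve_right hsk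
  -- First `s` is inserted between `d₁` and `d₃`; then `d₃` is removed between `s` and `d₂` by the
  -- second move read backwards. The functional `h` separates `s` from the plane of the old
  -- triangle.
  have m1 := isotopic_of_rest (R := Y ∪ segment ℝ d₂ d₃) (a := d₁) (b := d₃) (c := s)
    (affineIndependent_of_functional n31.symm h (by rw [h1, h3]) (by rwa [h1])) (by
      rintro x ⟨hx, hT⟩
      have hT' := hT
      obtain ⟨α, β, γ, hα, hβ, hγ, hsum, rfl⟩ := mem_tri.1 hT'
      have hh : h (α • d₁ + β • d₃ + γ • s) = k + γ * (h s - k) := by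
        simp only [map_add, map_smul, smul_eq_mul, h1, h3]
        rw [show α = 1 - β - γ by linarith]; ring
      have key : ∀ a b c : ℝ, a + b + c = 1 → α • d₁ + β • d₃ + γ • s = a • d₁ + b • d₂ + c • d₃ →
          γ = 0 ∧ α = a ∧ b = 0 ∧ β = c := by
        intro a b c habc he
        have hγ0 : γ = 0 := by
          apply zero
          have := congrArg h he
          rw [hh] at this
          simp only [map_add, map_smul, smul_eq_mul, h1, h2, h3] at this
          have h4 : a * k + b * k + c * k = k := by rw [← add_mul, ← add_mul, habc, one_mul]
          linarith
        obtain ⟨w1, w2, w3⟩ := tri_weights hd (α := α - a) (β := -b) (γ := β - c) (by linarith)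
          (by rw [← sub_eq_zero.2 he, hγ0]; module)
        exact ⟨hγ0, by linarith, by linarith, by linarith⟩
      rcases hx with hx | hx
      · rcases hY _ hx with h4 | h4
        · obtain ⟨a, b, ha, hb, hab, he⟩ := h4
          obtain ⟨w1, w2, w3, w4⟩ := key a b 0 (by linarith) (by rw [← he]; module)
          left
          rw [w1, w4, show α = 1 by linarith]; simp
        · exact absurd hT h4.1
      · obtain ⟨a, b, ha, hb, hab, he⟩ := hx
        obtain ⟨w1, w2, w3, w4⟩ := key 0 a b (by linarith) (by rw [← he]; module)
        right
        rw [w1, w2, show β = 1 by linarith]; simp)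
  have m2 := isotopic_of_rest (R := Y ∪ segment ℝ d₁ s) (a := s) (b := d₂) (c := d₃)
    (affineIndependent_rotate (affineIndependent_rotate
      (affineIndependent_of_functional n32.symm h (by rw [h2, h3]) (by rwa [h2])))) (by
      rintro x ⟨hx, hT⟩
      have hT' := hT
      obtain ⟨α, β, γ, hα, hβ, hγ, hsum, rfl⟩ := mem_tri.1 hT'
      have hh : h (α • s + β • d₂ + γ • d₃) = k + α * (h s - k) := by
        simp only [map_add, map_smul, smul_eq_mul, h2, h3]
        rw [show β = 1 - α - γ by linarith]; ring
      rcases hx with hx | hx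
      · rcases hY _ hx with h4 | h4
        · obtain ⟨a, b, ha, hb, hab, he⟩ := h4
          have hα0 : α = 0 := by
            apply zero
            have := congrArg h he
            rw [hh] at this
            simp only [map_add, map_smul, smul_eq_mul, h1, h2] at this
            have h4 : a * k + b * k = k := by rw [← add_mul, hab, one_mul]
            linarith
          obtain ⟨w1, w2, w3⟩ := tri_weights hd (α := a) (β := b - β) (γ := -γ) (by linarith)
            (by rw [← sub_eq_zero.2 he, hα0]; module)
          right
          rw [hα0, show γ = 0 by linarith, show β = 1 by linarith]; simp
        · exact absurd hT h4.2
      · obtain ⟨a, b, ha, hb, hab, he⟩ := hx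
        have hα0 : α - b = 0 := by
          apply zero
          have := congrArg h he
          rw [hh] at this
          simp only [map_add, map_smul, smul_eq_mul, h1] at this
          rw [show a = 1 - b by linarith] at this
          linarith
        obtain ⟨w1, w2, w3⟩ := tri_weights hd (α := a) (β := -β) (γ := -γ) (by linarith)
          (by rw [← sub_eq_zero.2 he, show α = b by linarith]; module)
        left
        rw [show γ = 0 by linarith, show β = 0 by linarith, show α = 1 by linarith]; simp)
  have e1 : Y ∪ segment ℝ d₂ d₃ ∪ segment ℝ d₃ d₁ = Y ∪ segment ℝ d₂ d₃ ∪ segment ℝ d₁ d₃ := by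
    rw [segment_symm ℝ d₁ d₃]
  have e2 : Y ∪ segment ℝ d₂ d₃ ∪ (segment ℝ d₁ s ∪ segment ℝ s d₃) =
      Y ∪ segment ℝ d₁ s ∪ (segment ℝ s d₃ ∪ segment ℝ d₃ d₂) := by
    rw [segment_symm ℝ d₃ d₂]; ac_rfl
  have e3 : Y ∪ segment ℝ d₁ s ∪ segment ℝ s d₂ = Y ∪ segment ℝ d₂ s ∪ segment ℝ s d₁ := by
    rw [segment_symm ℝ d₁ s, segment_symm ℝ s d₂]; ac_rfl
  rw [e1]
  refine m1.trans ?_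
  rw [e2]
  refine m2.symm.trans ?_
  rw [e3]
  exact isotopic_refl _

theorem exists_plane (d₁ d₂ d₃ : R3) :
    ∃ h : R3 →ₗ[ℝ] ℝ, h ≠ 0 ∧ h d₂ = h d₁ ∧ h d₃ = h d₁ := by
  obtain ⟨h, h0, h1, h2⟩ := exists_functional (d₂ - d₁) (d₃ - d₁)
  rw [map_sub, sub_eq_zero] at h1 h2
  exact ⟨h, h0, h1, h2⟩

/-- Once the arc is shrunk near an inner point of the edge `d₁d₂`, its chord lies on this edge,
which therefore lies in the plane `f = r`. The apex `d₃` is exchanged for a point `s` above the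
plane; then everything but the arc lies on the other side and collapses to the chord by
`isotopic_pull_back`. Undoing the shrinking, which is a good affine map, gives the original arc with
its chord. -/
theorem State.triangle_edge {α : Set R3} {p q : R3} (hα : Tangle α p q) {f : R3 →ₗ[ℝ] ℝ} {r : ℝ}
    (hf : f ≠ 0) (hp : f p = r) (hq : f q = r) (hαf : ∀ x ∈ α, f x ≤ r ∧ (f x = r → x = p ∨ x = q))
    {d₁ d₂ d₃ : R3} (hd : AffineIndependent ℝ ![d₁, d₂, d₃]) {a b : R3}
    (h : State α p q (segment ℝ d₁ d₂ ∪ segment ℝ d₂ d₃ ∪ segment ℝ d₃ d₁)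
      (AffineEquiv.refl ℝ R3) a b)
    (hQ : IsLink (segment ℝ d₁ d₂ ∪ segment ℝ d₂ d₃ ∪ segment ℝ d₃ d₁))
    (hI : IsLink (ins α p q (segment ℝ d₁ d₂ ∪ segment ℝ d₂ d₃ ∪ segment ℝ d₃ d₁)
      (AffineEquiv.refl ℝ R3))) {θ : ℝ} (hθ : 0 < θ) (hθ1 : θ < 1) {u₀ : ℝ} (hu0 : 0 < u₀)
    (hu1 : u₀ < 1) (hu : p + θ • (q - p) = d₁ + u₀ • (d₂ - d₁)) :
    Isotopic (ins α p q (segment ℝ d₁ d₂ ∪ segment ℝ d₂ d₃ ∪ segment ℝ d₃ d₁)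
      (AffineEquiv.refl ℝ R3)) (α ∪ segment ℝ p q) := by
  set Q := segment ℝ d₁ d₂ ∪ segment ℝ d₂ d₃ ∪ segment ℝ d₃ d₁ with hQdef
  obtain ⟨n12, n31, n32⟩ := tri_ne hd
  set e := d₂ - d₁ with he
  have he0 : e ≠ 0 := sub_ne_zero.2 n12.symm
  obtain ⟨g, hg0, hg2, hg3⟩ := exists_plane d₁ d₂ d₃
  -- The new apex has to be above the plane of the cut and off the plane of the triangle, on which
  -- `g` is constant.
  obtain ⟨s, hs, hgs⟩ : ∃ s, r < f s ∧ g s ≠ g d₁ := by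
    obtain ⟨v, hv⟩ := DFunLike.ne_iff.1 hf
    rw [LinearMap.zero_apply] at hv
    set w := ((r + 1) / f v) • v with hw
    have hfw : f w = r + 1 := by rw [hw, map_smul, smul_eq_mul, div_mul_cancel₀ _ hv]
    have hfc : Continuous f := f.continuous_of_finiteDimensional
    obtain ⟨x, hx, -, h2⟩ := exists_near_off_planes hg0 hg0 (v := w) (c := g d₁)
      ((isOpen_lt continuous_const hfc).mem_nhds (show r < f w by rw [hfw]; linarith))
    exact ⟨x, hx, h2⟩
  set o := p + θ • (q - p) with ho
  have hfo : f o = r := by rw [ho, map_add, map_smul, map_sub, hp, hq]; simp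
  have hgo : g o = g d₁ := by rw [hu, map_add, map_smul, he, map_sub, hg2]; simp
  have key : ∀ a b c : ℝ, a + b + c = 1 → o = a • d₁ + b • d₂ + c • d₃ →
      a = 1 - u₀ ∧ b = u₀ ∧ c = 0 := by
    intro a b c habc h
    rw [hu] at h
    obtain ⟨w1, w2, w3⟩ := tri_weights hd (α := a - (1 - u₀)) (β := b - u₀) (γ := c)
      (by linarith) (by rw [← sub_eq_zero.2 h.symm, he]; module)
    exact ⟨by linarith, by linarith, w3⟩
  have hV : (segment ℝ d₂ d₃ ∪ segment ℝ d₃ d₁ ∪ (tri d₁ d₃ s ∪ tri s d₂ d₃))ᶜ ∈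
      𝓝 ((AffineEquiv.refl ℝ R3) o) := by
    refine (((isClosed_segment _ _).union (isClosed_segment _ _)).union
      ((isClosed_tri _ _ _).union (isClosed_tri _ _ _))).isOpen_compl.mem_nhds ?_
    rw [AffineEquiv.refl_apply]
    rintro ((⟨a, b, ha, hb, hab, h1⟩ | ⟨a, b, ha, hb, hab, h1⟩) | h1 | h1)
    · have := key 0 a b (by linarith) (by rw [← h1]; module)
      linarith [this.1]
    · have := key b 0 a (by linarith) (by rw [← h1]; module)
      linarith [this.2.1]
    · obtain ⟨a, b, c, ha, hb, hc, habc, h1⟩ := mem_tri.1 h1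
      have hc0 : c = 0 := by
        have := congrArg g h1
        simp only [map_add, map_smul, smul_eq_mul, hg3, hgo] at this
        have h5 : c * (g s - g d₁) = 0 := by
          rw [show a = 1 - b - c by linarith] at this
          linarith
        exact (mul_eq_zero.1 h5).resolve_right (sub_ne_zero.2 hgs)
      have := key a 0 b (by linarith) (by rw [h1, hc0]; module)
      linarith [this.2.1]
    · obtain ⟨a, b, c, ha, hb, hc, habc, h1⟩ := mem_tri.1 h1
      have ha0 : a = 0 := by
        have := congrArg g h1
        simp only [map_add, map_smul, smul_eq_mul, hg3, hg2, hgo] at this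
        have h5 : a * (g s - g d₁) = 0 := by
          rw [show b = 1 - a - c by linarith] at this
          linarith
        exact (mul_eq_zero.1 h5).resolve_right (sub_ne_zero.2 hgs)
      have := key 0 b c (by linarith) (by rw [h1, ha0]; module)
      linarith [this.1]
  obtain ⟨c, hc, a', b', hS, hIs, hhull, hab, -⟩ := h.shrink_into hα hQ hI hθ hθ1 hV
  have hA : ∀ x, ((hom o c).trans (AffineEquiv.refl ℝ R3)) x = hom o c x := fun x => rfl
  set A := (hom o c).trans (AffineEquiv.refl ℝ R3) with hAdef
  have hAf : ∀ x, f (A x) = r + c * (f x - r) := by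
    intro x
    rw [hA, hom_apply hc.ne', map_add, map_smul, map_sub, hfo, smul_eq_mul]
  have hsub : segment ℝ a' b' ⊆ segment ℝ d₁ d₂ := by
    intro x hx
    have h1 := hab hx
    rcases hS.sub hx with (h2 | h2) | h2
    · exact h2
    · exact absurd (Or.inl (Or.inl h2)) h1
    · exact absurd (Or.inl (Or.inr h2)) h1
  have hpC := subset_convexHull ℝ α hα.left_mem
  have hqC := subset_convexHull ℝ α hα.right_mem
  have hends : ∀ x ∈ convexHull ℝ α, A x ∈ segment ℝ d₁ d₂ →
      ∃ t : ℝ, 0 < t ∧ t < 1 ∧ A x = d₁ + t • e := by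
    intro x hx hxs
    refine exists_param_of_mem_of_ne hxs ?_ ?_
    · intro h1
      refine hhull x hx (Or.inl (Or.inr ?_))
      change A x ∈ _
      rw [h1]
      exact right_mem_segment ℝ _ _
    · intro h1
      refine hhull x hx (Or.inl (Or.inl ?_))
      change A x ∈ _
      rw [h1]
      exact left_mem_segment ℝ _ _
  have hpq : ∀ x ∈ segment ℝ p q, A x ∈ segment ℝ d₁ d₂ := fun x hx =>
    hsub (hS.image_subset ⟨x, hx, rfl⟩)
  obtain ⟨t₁, ht10, ht11, ht1⟩ := hends p hpC (hpq p (left_mem_segment ℝ _ _))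
  obtain ⟨t₂, ht20, ht21, ht2⟩ := hends q hqC (hpq q (right_mem_segment ℝ _ _))
  have hne : t₁ ≠ t₂ := by
    rintro rfl
    exact hα.ne (A.injective (ht1.trans ht2.symm))
  -- Both ends of the shrunk chord lie on the line `d₁d₂` and in the plane `f = r`, so `f` is
  -- constant along this line.
  have hfe : f e = 0 := by
    have h1 := hAf p
    have h2 := hAf q
    rw [ht1, hp, sub_self, mul_zero, add_zero, map_add, map_smul, smul_eq_mul] at h1
    rw [ht2, hq, sub_self, mul_zero, add_zero, map_add, map_smul, smul_eq_mul] at h2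
    have : (t₁ - t₂) * f e = 0 := by linarith
    exact (mul_eq_zero.1 this).resolve_left (sub_ne_zero.2 hne)
  have hfd1 : f d₁ = r := by
    have h1 := hAf p
    rwa [ht1, hp, sub_self, mul_zero, add_zero, map_add, map_smul, hfe, smul_zero, add_zero] at h1
  have hd2e : d₁ + e = d₂ := by rw [he]; abel
  refine hIs.trans ?_
  have hIA := hIs.isLink.1 hI
  set Y := segment ℝ d₁ d₂ \ A '' segment ℝ p q ∪ A '' α with hY
  have hhull' : ∀ x ∈ convexHull ℝ α, A x ∉ segment ℝ d₂ d₃ ∧ A x ∉ segment ℝ d₃ d₁ ∧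
      A x ∉ tri d₁ d₃ s ∧ A x ∉ tri s d₂ d₃ := by
    intro x hx
    have := hhull x hx
    change A x ∈ _ at this
    simp only [mem_compl_iff, mem_union, not_or] at this
    tauto
  have hsegC : segment ℝ p q ⊆ convexHull ℝ α := (convex_convexHull ℝ α).segment_subset hpC hqC
  have i0 : ins α p q Q A = Y ∪ segment ℝ d₂ d₃ ∪ segment ℝ d₃ d₁ := by
    have hd23 : segment ℝ d₂ d₃ \ A '' segment ℝ p q = segment ℝ d₂ d₃ := by
      rw [sdiff_eq_left, disjoint_left]
      rintro _ hx ⟨y, hy, rfl⟩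
      exact (hhull' y (hsegC hy)).1 hx
    have hd31 : segment ℝ d₃ d₁ \ A '' segment ℝ p q = segment ℝ d₃ d₁ := by
      rw [sdiff_eq_left, disjoint_left]
      rintro _ hx ⟨y, hy, rfl⟩
      exact (hhull' y (hsegC hy)).2.1 hx
    rw [ins, hQdef, union_sdiff_distrib, union_sdiff_distrib, hd23, hd31, hY]
    ac_rfl
  have m1 := isotopic_change_apex (Y := Y) (s := s) hd rfl hg2 hg3 hgs (by
    rintro y (⟨hy, -⟩ | ⟨x, hx, rfl⟩)
    · exact Or.inl hy
    · exact Or.inr (hhull' x (subset_convexHull ℝ α hx)).2.2)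
  have hXf : ∀ x ∈ A '' α, f x ≤ r ∧ (f x = r → x = A p ∨ x = A q) := by
    rintro _ ⟨x, hx, rfl⟩
    obtain ⟨h1, h2⟩ := hαf x hx
    rw [hAf]
    refine ⟨by nlinarith, fun h3 => ?_⟩
    have : c * (f x - r) = 0 := by linarith
    rcases h2 (by linarith [(mul_eq_zero.1 this).resolve_left hc.ne']) with rfl | rfl
    · exact Or.inl rfl
    · exact Or.inr rfl
  -- Stated for arbitrary points `x₁`, `x₂`, because the chord may run along the edge in either
  -- direction.
  have hYeq : ∀ {x₁ x₂ : R3} {t₁ t₂ : ℝ}, x₁ = d₁ + t₁ • e → x₂ = d₁ + t₂ • e → 0 < t₁ → t₁ < t₂ →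
      t₂ < 1 → x₁ ∈ A '' α → x₂ ∈ A '' α →
      segment ℝ d₁ d₂ \ segment ℝ x₁ x₂ ∪ A '' α = A '' α ∪ segment ℝ d₁ x₁ ∪ segment ℝ x₂ d₂ := by
    rintro x₁ x₂ t₁ t₂ rfl rfl h1 h12 h2 hx1 hx2
    have p0 : ∀ u : ℝ, d₁ + u • e ∈ segment ℝ d₁ d₂ ↔ 0 ≤ u ∧ u ≤ 1 := fun u => by
      have := mem_segment_param (x := d₁) he0 (u := u) (zero_le_one (α := ℝ))
      rwa [zero_smul, add_zero, one_smul, hd2e] at this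
    have p1 : ∀ u : ℝ, d₁ + u • e ∈ segment ℝ d₁ (d₁ + t₁ • e) ↔ 0 ≤ u ∧ u ≤ t₁ := fun u => by
      have := mem_segment_param (x := d₁) he0 (u := u) h1.le
      rwa [zero_smul, add_zero] at this
    have p2 : ∀ u : ℝ, d₁ + u • e ∈ segment ℝ (d₁ + t₂ • e) d₂ ↔ t₂ ≤ u ∧ u ≤ 1 := fun u => by
      have := mem_segment_param (x := d₁) he0 (u := u) h2.le
      rwa [one_smul, hd2e] at this
    have p3 := fun u : ℝ => mem_segment_param (x := d₁) he0 (u := u) h12.le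
    have hds : ∀ u : ℝ, 0 ≤ u → u ≤ 1 → d₁ + u • e ∈ segment ℝ d₁ d₂ := fun u hu0 hu1 =>
      (p0 u).2 ⟨hu0, hu1⟩
    have key2 : ∀ u : ℝ, 0 ≤ u → u ≤ 1 → (d₁ + u • e ∈
        segment ℝ d₁ d₂ \ segment ℝ (d₁ + t₁ • e) (d₁ + t₂ • e) ∪ A '' α ↔
        d₁ + u • e ∈ A '' α ∪ segment ℝ d₁ (d₁ + t₁ • e) ∪ segment ℝ (d₁ + t₂ • e) d₂) := by
      intro u hu0 hu1
      have q0 := p0 u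
      have q1 := p1 u
      have q2 := p2 u
      have q3 := p3 u
      by_cases e1 : u = t₁
      · rw [e1]; simp only [mem_union, hx1, true_or, or_true]
      by_cases e2 : u = t₂
      · rw [e2]; simp only [mem_union, hx2, true_or, or_true]
      simp only [mem_union, Set.mem_sdiff, q0, q1, q2, q3]
      constructor
      · rintro (⟨-, h3⟩ | h3)
        · rw [not_and_or, not_le, not_le] at h3
          rcases h3 with h3 | h3
          · exact Or.inl (Or.inr ⟨hu0, h3.le⟩)
          · exact Or.inr ⟨h3.le, hu1⟩
        · exact Or.inl (Or.inl h3)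
      · rintro ((h3 | h3) | h3)
        · exact Or.inr h3
        · exact Or.inl ⟨⟨hu0, hu1⟩, fun h4 => e1 (le_antisymm h3.2 h4.1)⟩
        · exact Or.inl ⟨⟨hu0, hu1⟩, fun h4 => e2 (le_antisymm h4.2 h3.1)⟩
    have hsub1 : segment ℝ d₁ (d₁ + t₁ • e) ⊆ segment ℝ d₁ d₂ := (convex_segment _ _).segment_subset
      (left_mem_segment ℝ _ _) (hds _ h1.le (by linarith))
    have hsub2 : segment ℝ (d₁ + t₂ • e) d₂ ⊆ segment ℝ d₁ d₂ := (convex_segment _ _).segment_subset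
      (hds _ (by linarith) h2.le) (right_mem_segment ℝ _ _)
    ext x
    by_cases hx : x ∈ segment ℝ d₁ d₂
    · have hx' := hx
      rw [segment_eq_lines] at hx'
      obtain ⟨u, hu0, hu1, rfl⟩ := hx'
      exact key2 u hu0 hu1
    · constructor
      · rintro (h3 | h3)
        · exact absurd h3.1 hx
        · exact Or.inl (Or.inl h3)
      · rintro ((h3 | h3) | h3)
        · exact Or.inr h3
        · exact absurd (hsub1 h3) hx
        · exact absurd (hsub2 h3) hx
  have m2 : Isotopic (Y ∪ segment ℝ d₂ s ∪ segment ℝ s d₁) (A '' α ∪ segment ℝ (A p) (A q)) := by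
    rw [hY, aff_image_segment]
    rcases lt_or_gt_of_ne hne with hlt | hlt
    · rw [hYeq ht1 ht2 ht10 hlt ht21 ⟨p, hα.left_mem, rfl⟩ ⟨q, hα.right_mem, rfl⟩]
      have := isotopic_pull_back (X := A '' α) he0 hfd1 hfe hs ht10 hlt ht21
        (by rw [← ht1, ← ht2]; exact hXf)
      rwa [← ht1, ← ht2, hd2e] at this
    · rw [segment_symm ℝ (A p),
        hYeq ht2 ht1 ht20 hlt ht11 ⟨q, hα.right_mem, rfl⟩ ⟨p, hα.left_mem, rfl⟩]
      have := isotopic_pull_back (X := A '' α) he0 hfd1 hfe hs ht20 hlt ht11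
        (by rw [← ht1, ← ht2]; exact fun x hx => ⟨(hXf x hx).1, fun h => ((hXf x hx).2 h).symm⟩)
      rwa [← ht1, ← ht2, hd2e] at this
  have m3 := m1.trans m2
  rw [i0] at hIA ⊢
  refine m3.trans ?_
  have hL := m3.isLink.1 hIA
  have e3 : A '' (α ∪ segment ℝ p q) = A '' α ∪ segment ℝ (A p) (A q) := by
    rw [image_union, aff_image_segment]
  rw [← e3] at hL ⊢
  have := hS.good.symm _ hL
  rwa [show A.symm '' (A '' (α ∪ segment ℝ p q)) = α ∪ segment ℝ p q by
    rw [image_image]; simp] at this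

/-- An arc inserted into a triangle can be closed up directly. -/
theorem State.triangle {α : Set R3} {p q : R3} (hα : Tangle α p q) {f : R3 →ₗ[ℝ] ℝ} {r : ℝ}
    (hf : f ≠ 0) (hp : f p = r) (hq : f q = r) (hαf : ∀ x ∈ α, f x ≤ r ∧ (f x = r → x = p ∨ x = q))
    {d₁ d₂ d₃ : R3} (hd : AffineIndependent ℝ ![d₁, d₂, d₃]) {A : R3 ≃ᵃ[ℝ] R3} {a b : R3}
    (h : State α p q (segment ℝ d₁ d₂ ∪ segment ℝ d₂ d₃ ∪ segment ℝ d₃ d₁) A a b)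
    (hQ : IsLink (segment ℝ d₁ d₂ ∪ segment ℝ d₂ d₃ ∪ segment ℝ d₃ d₁))
    (hI : IsLink (ins α p q (segment ℝ d₁ d₂ ∪ segment ℝ d₂ d₃ ∪ segment ℝ d₃ d₁) A)) :
    Isotopic (ins α p q (segment ℝ d₁ d₂ ∪ segment ℝ d₂ d₃ ∪ segment ℝ d₃ d₁) A)
      (α ∪ segment ℝ p q) := by
  -- The good map `A` is undone on the whole picture, which reduces to an arc in its original
  -- position inserted into the image of the triangle.
  set B := A.symm with hB
  have hBA : ∀ x, B (A x) = x := fun x => A.symm_apply_apply x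
  have hAB : ∀ x, A (B x) = x := fun x => A.apply_symm_apply x
  have hins : ∀ Q, B '' ins α p q Q A = ins α p q (B '' Q) (AffineEquiv.refl ℝ R3) := by
    intro Q
    rw [ins, ins, image_union, image_sdiff B.injective, image_image, image_image]
    simp [hBA]
  have hst : ∀ {Q a b}, State α p q Q A a b →
      State α p q (B '' Q) (AffineEquiv.refl ℝ R3) (B a) (B b) := by
    intro Q a b h
    obtain ⟨s₁, s₂, h1, h2, h3, e1, e2⟩ := h.margin
    refine ⟨fun L _ => ?_, ?_, ⟨s₁, s₂, h1, h2, h3, ?_, ?_⟩, ?_⟩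
    · simpa using isotopic_refl L
    · rw [← aff_image_segment]
      exact image_mono h.sub
    · rw [← aff_apply, ← e1, hBA]; rfl
    · rw [← aff_apply, ← e2, hBA]; rfl
    · rintro x hx ⟨y, hy, hyx⟩
      refine h.clear x hx ?_
      rw [AffineEquiv.refl_apply] at hyx
      rwa [← hyx, hAB]
  refine (h.good.symm _ hI).trans ?_
  have hQ' := hQ.image B
  have hI' := hI.image B
  have h' := hst h
  have hd' : AffineIndependent ℝ ![B d₁, B d₂, B d₃] := by
    have := (AffineEquiv.affineIndependent_iff B).2 hd
    convert this using 1
    ext i j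
    fin_cases i <;> rfl
  rw [← hB, hins]
  rw [hins] at hI'
  simp only [image_union, aff_image_segment] at hQ' hI' h' ⊢
  generalize B d₁ = c₁, B d₂ = c₂, B d₃ = c₃, B a = a', B b = b' at hQ' hI' h' hd' ⊢
  obtain ⟨θ, hθ, hθ1, hF⟩ := exists_param_avoid (AffineEquiv.refl ℝ R3) hα.ne
    (F := {c₁, c₂, c₃}) (by simp)
  have hmem := h'.sub (h'.image_subset ⟨_, add_smul_mem_segment hθ.le hθ1.le, rfl⟩)
  rw [AffineEquiv.refl_apply] at hF hmem
  simp only [mem_insert_iff, mem_singleton_iff, not_or] at hF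
  rcases hmem with (hmem | hmem) | hmem
  · obtain ⟨u, hu0, hu1, hu⟩ := exists_param_of_mem_of_ne hmem hF.1 hF.2.1
    exact h'.triangle_edge hα hf hp hq hαf hd' hQ' hI' hθ hθ1 hu0 hu1 hu
  · obtain ⟨u, hu0, hu1, hu⟩ := exists_param_of_mem_of_ne hmem hF.2.1 hF.2.2
    have e : segment ℝ c₁ c₂ ∪ segment ℝ c₂ c₃ ∪ segment ℝ c₃ c₁ =
        segment ℝ c₂ c₃ ∪ segment ℝ c₃ c₁ ∪ segment ℝ c₁ c₂ := by ac_rfl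
    rw [e] at h' hQ' hI' ⊢
    exact h'.triangle_edge hα hf hp hq hαf (affineIndependent_rotate hd') hQ' hI' hθ hθ1 hu0 hu1 hu
  · obtain ⟨u, hu0, hu1, hu⟩ := exists_param_of_mem_of_ne hmem hF.2.2 hF.1
    have e : segment ℝ c₁ c₂ ∪ segment ℝ c₂ c₃ ∪ segment ℝ c₃ c₁ =
        segment ℝ c₃ c₁ ∪ segment ℝ c₁ c₂ ∪ segment ℝ c₂ c₃ := by ac_rfl
    rw [e] at h' hQ' hI' ⊢
    exact h'.triangle_edge hα hf hp hq hαf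
      (affineIndependent_rotate (affineIndependent_rotate hd')) hQ' hI' hθ hθ1 hu0 hu1 hu

/-! ### Cutting a link by a plane -/

/-- The link `P` crosses the plane `f = r` transversally in the two points `p` and `q`. -/
structure Cut (P : Set R3) (f : R3 →ₗ[ℝ] ℝ) (r : ℝ) (p q : R3) : Prop where
  link : IsLink P
  ne : p ≠ q
  inter : P ∩ {x | f x = r} = {p, q}
  germ_left : ∃ u v, f u < 0 ∧ 0 < f v ∧ P =ᶠ[𝓝 p] (ray p u ∪ ray p v : Set R3)
  germ_right : ∃ u v, f u < 0 ∧ 0 < f v ∧ P =ᶠ[𝓝 q] (ray q u ∪ ray q v : Set R3)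

section Cut

variable {P : Set R3} {f : R3 →ₗ[ℝ] ℝ} {r : ℝ} {p q : R3}

theorem Cut.symm (h : Cut P f r p q) : Cut P f r q p :=
  ⟨h.link, h.ne.symm, by rw [h.inter, pair_comm], h.germ_right, h.germ_left⟩

theorem Cut.neg (h : Cut P f r p q) : Cut P (-f) (-r) p q := by
  refine ⟨h.link, h.ne, ?_, ?_, ?_⟩
  · rw [← h.inter]; ext x; simp
  · obtain ⟨u, v, hu, hv, hg⟩ := h.germ_left
    exact ⟨v, u, by simpa using hv, by simpa using hu, by rwa [union_comm]⟩
  · obtain ⟨u, v, hu, hv, hg⟩ := h.germ_right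
    exact ⟨v, u, by simpa using hv, by simpa using hu, by rwa [union_comm]⟩

theorem Cut.left_mem (h : Cut P f r p q) : p ∈ P ∧ f p = r := by
  have : p ∈ P ∩ {x | f x = r} := by rw [h.inter]; simp
  exact this

theorem Cut.right_mem (h : Cut P f r p q) : q ∈ P ∧ f q = r := h.symm.left_mem

theorem Cut.eq_or (h : Cut P f r p q) {x : R3} (hx : x ∈ P) (hf : f x = r) : x = p ∨ x = q := by
  have : x ∈ P ∩ {x | f x = r} := ⟨hx, hf⟩
  rwa [h.inter] at this

theorem Cut.map_sub (h : Cut P f r p q) : f (q - p) = 0 := by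
  rw [LinearMap.map_sub, h.left_mem.2, h.right_mem.2, sub_self]

theorem Cut.map_segment (h : Cut P f r p q) {x : R3} (hx : x ∈ segment ℝ p q) : f x = r := by
  rw [segment_eq_lines] at hx
  obtain ⟨s, -, -, rfl⟩ := hx
  rw [map_add, map_smul, h.map_sub, smul_zero, add_zero, h.left_mem.2]

theorem Cut.ne_zero (h : Cut P f r p q) : f ≠ 0 := by
  rintro rfl
  obtain ⟨u, v, hu, -⟩ := h.germ_left
  simp at hu

theorem not_sameRay_of_functional {f : R3 →ₗ[ℝ] ℝ} {u v : R3} (hu : 0 < f u) (hv : f v = 0)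
    (hv0 : v ≠ 0) : ¬ SameRay ℝ u v := by
  intro h
  rcases h with h | h | ⟨a, b, ha, hb, h⟩
  · rw [h, map_zero] at hu; exact lt_irrefl _ hu
  · exact hv0 h
  · have := congrArg f h
    simp only [map_smul, smul_eq_mul, hv, mul_zero] at this
    have := mul_pos ha hu
    linarith

theorem continuous_functional (f : R3 →ₗ[ℝ] ℝ) : Continuous f := f.continuous_of_finiteDimensional

theorem Cut.germ_upper (h : Cut P f r p q) :
    LocArc ((P ∩ {x | r ≤ f x}) ∪ segment ℝ p q) p := by
  obtain ⟨u, v, hu, hv, hg⟩ := h.germ_left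
  refine ⟨v, q - p, not_sameRay_of_functional hv h.map_sub (sub_ne_zero.2 h.ne.symm), ?_⟩
  have h2 := segment_germ_left h.ne
  rw [eventuallyEq_set] at hg h2 ⊢
  filter_upwards [hg, h2] with y hy hy2
  rw [mem_union, mem_union, hy2, mem_inter_iff, hy]
  refine or_congr ⟨?_, ?_⟩ Iff.rfl
  · rintro ⟨⟨t, ht, rfl⟩ | hy, hf⟩
    · have hf : r ≤ f (p + t • u) := hf
      rw [map_add, map_smul, h.left_mem.2, smul_eq_mul] at hf
      have : t = 0 := by nlinarith
      exact ⟨0, le_rfl, by rw [this]; simp⟩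
    · exact hy
  · rintro ⟨t, ht, rfl⟩
    refine ⟨Or.inr ⟨t, ht, rfl⟩, ?_⟩
    show r ≤ f (p + t • v)
    rw [map_add, map_smul, h.left_mem.2, smul_eq_mul]
    nlinarith

theorem Cut.isLink_upper (h : Cut P f r p q) : IsLink ((P ∩ {x | r ≤ f x}) ∪ segment ℝ p q) := by
  have hfc := continuous_functional f
  have hc : IsClosed {x | r ≤ f x} := isClosed_le continuous_const hfc
  have hβ : IsCompact (P ∩ {x | r ≤ f x}) := h.link.1.inter_right hc
  refine ⟨hβ.union (isCompact_segment p q), ?_⟩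
  intro x hx
  by_cases hxp : x = p
  · rw [hxp]; exact h.germ_upper
  by_cases hxq : x = q
  · rw [hxq, segment_symm]; exact h.symm.germ_upper
  by_cases hxs : x ∈ segment ℝ p q
  · have hxβ : x ∉ P ∩ {x | r ≤ f x} := fun hxβ => by
      rcases h.eq_or hxβ.1 (h.map_segment hxs) with h1 | h1
      exacts [hxp h1, hxq h1]
    refine (locArc_segment hxs hxp hxq).congr ?_
    have := (germ_empty hβ.isClosed hxβ).union (EventuallyEq.refl (𝓝 x) (segment ℝ p q))
    rwa [empty_union] at this
  · have hxβ := hx.resolve_right hxs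
    have hlt : r < f x := lt_of_le_of_ne hxβ.2 fun heq => by
      rcases h.eq_or hxβ.1 heq.symm with h1 | h1
      exacts [hxp h1, hxq h1]
    refine (h.link.2 x hxβ.1).congr ?_
    rw [eventuallyEq_set]
    filter_upwards [(isClosed_segment p q).isOpen_compl.mem_nhds hxs,
      (isOpen_lt continuous_const hfc).mem_nhds hlt] with y hy hy2
    have hy2 : r < f y := hy2
    rw [mem_union, mem_inter_iff]
    constructor
    · rintro (h1 | h1)
      exacts [h1.1, absurd h1 hy]
    · exact fun h1 => Or.inl ⟨h1, hy2.le⟩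

/-- The closed lower part is replaced by the chord in the sense of `isConnected_replace`, with the
strictly upper part as the rest. The replaced set need not be connected there, so nothing has to be
known about the lower part. -/
theorem Cut.isConnected_upper (h : Cut P f r p q) (hP : IsConnected P) :
    IsConnected ((P ∩ {x | r ≤ f x}) ∪ segment ℝ p q) := by
  have hfc := continuous_functional f
  have hα : IsClosed (P ∩ {x | f x ≤ r}) :=
    h.link.1.isClosed.inter (isClosed_le hfc continuous_const)
  have hβ : IsClosed (P ∩ {x | r ≤ f x}) :=
    h.link.1.isClosed.inter (isClosed_le continuous_const hfc)
  have e1 : (P ∩ {x | r < f x}) ∪ (P ∩ {x | f x ≤ r}) = P := by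
    ext x
    have : r < f x ∨ f x ≤ r := lt_or_ge _ _
    simp only [mem_union, mem_inter_iff, mem_ofPred_eq]
    tauto
  have e2 : (P ∩ {x | r < f x}) ∪ segment ℝ p q = (P ∩ {x | r ≤ f x}) ∪ segment ℝ p q := by
    apply Subset.antisymm
    · exact union_subset_union_left _ fun x hx => ⟨hx.1, le_of_lt (show r < f x from hx.2)⟩
    · rintro x (⟨hx, hf⟩ | hx)
      · rcases (show r ≤ f x from hf).eq_or_lt with h1 | h1
        · right
          rcases h.eq_or hx h1.symm with rfl | rfl
          exacts [left_mem_segment ℝ _ _, right_mem_segment ℝ _ _]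
        · exact Or.inl ⟨hx, h1⟩
      · exact Or.inr hx
  rw [← e2]
  refine isConnected_replace hα ⟨p, h.left_mem.1, h.left_mem.2.le⟩ (isConnected_segment p q)
    ?_ ?_ (by rwa [e1])
  · rintro x ⟨⟨-, h1⟩, ⟨-, h2⟩⟩
    exact absurd (show f x ≤ r from h2) (not_le.2 h1)
  · have hsub : closure (P ∩ {x | r < f x}) ⊆ P ∩ {x | r ≤ f x} :=
      closure_minimal (fun x hx => ⟨hx.1, le_of_lt (show r < f x from hx.2)⟩) hβ
    intro x hx
    obtain ⟨hxP, hxf⟩ := hsub hx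
    rcases (show r ≤ f x from hxf).eq_or_lt with h1 | h1
    · right
      refine ⟨⟨hxP, h1.ge⟩, ?_⟩
      rcases h.eq_or hxP h1.symm with rfl | rfl
      exacts [left_mem_segment ℝ _ _, right_mem_segment ℝ _ _]
    · exact Or.inl ⟨hxP, h1⟩

/-- The open half-space together with the chord, a convex subset of the boundary plane, is convex
and contains the lower part. Hence the hull of the lower part meets the upper side only in the
chord. -/
theorem Cut.hull_lower (h : Cut P f r p q) {x : R3} (hx : x ∈ convexHull ℝ (P ∩ {x | f x ≤ r}))
    (hf : r ≤ f x) : x ∈ segment ℝ p q := by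
  have hsub : convexHull ℝ (P ∩ {x | f x ≤ r}) ⊆ {x | f x < r} ∪ segment ℝ p q := by
    refine convexHull_min ?_ ?_
    · rintro y ⟨hy, hyf⟩
      rcases (show f y ≤ r from hyf).eq_or_lt with h1 | h1
      · right
        rcases h.eq_or hy h1 with rfl | rfl
        exacts [left_mem_segment ℝ _ _, right_mem_segment ℝ _ _]
      · exact Or.inl h1
    · have hle : ∀ y ∈ ({x | f x < r} ∪ segment ℝ p q : Set R3), f y ≤ r := by
        rintro y (hy | hy)
        exacts [le_of_lt hy, (h.map_segment hy).le]
      have key : ∀ y ∈ ({x | f x < r} ∪ segment ℝ p q : Set R3),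
          ∀ z ∈ ({x | f x < r} ∪ segment ℝ p q : Set R3), ∀ a b : ℝ, 0 < a → 0 < b → a + b = 1 →
          a • y + b • z ∈ ({x | f x < r} ∪ segment ℝ p q : Set R3) := by
        intro y hy z hz a b ha hb hab
        have hly := hle y hy
        have hlz := hle z hz
        rcases hy with hy | hy
        · left
          have hy : f y < r := hy
          show f (a • y + b • z) < r
          rw [map_add, map_smul, map_smul, smul_eq_mul, smul_eq_mul]
          obtain rfl : a = 1 - b := by linarith
          nlinarith
        · rcases hz with hz | hz
          · left
            have hz : f z < r := hz
            show f (a • y + b • z) < r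
            rw [map_add, map_smul, map_smul, smul_eq_mul, smul_eq_mul]
            obtain rfl : a = 1 - b := by linarith
            nlinarith
          · exact Or.inr (convex_segment p q hy hz ha.le hb.le hab)
      intro y hy z hz a b ha hb hab
      rcases ha.eq_or_lt with rfl | ha
      · rw [zero_add] at hab; rw [hab]; simpa using hz
      rcases hb.eq_or_lt with rfl | hb
      · rw [add_zero] at hab; rw [hab]; simpa using hy
      exact key y hy z hz a b ha hb hab
  rcases hsub hx with h1 | h1
  · exact absurd hf (not_le.2 h1)
  · exact h1

theorem Cut.tangle (h : Cut P f r p q) : Tangle (P ∩ {x | f x ≤ r}) p q := by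
  refine ⟨⟨h.left_mem.1, h.left_mem.2.le⟩, ⟨h.right_mem.1, h.right_mem.2.le⟩, h.ne, ?_, ?_⟩
  · obtain ⟨S, hS, hPS, -⟩ := h.link.exists_segUnion finite_empty (empty_subset _)
    obtain ⟨S', hS', hSS, hside⟩ := segUnion_split hS f r
    rw [← hSS] at hPS
    refine ⟨{e ∈ S' | f e.1 ≤ r ∧ f e.2 ≤ r} ∪ {(p, p), (q, q)}, (hS'.sep _).union (by simp), ?_⟩
    ext x
    constructor
    · rintro ⟨hx, hxf⟩
      have hxf : f x ≤ r := hxf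
      by_cases hxr : f x = r
      · rcases h.eq_or hx hxr with rfl | rfl
        · exact ⟨(x, x), by simp, by simp⟩
        · exact ⟨(x, x), by simp, by simp⟩
      · rw [hPS] at hx
        obtain ⟨e, he, hxe⟩ := hx
        rcases (hside e he).2 with h1 | h1
        · exact ⟨e, Or.inl ⟨he, h1⟩, hxe⟩
        · exfalso
          obtain ⟨a, b, ha, hb, hab, rfl⟩ := hxe
          rw [map_add, map_smul, map_smul, smul_eq_mul, smul_eq_mul] at hxf hxr
          apply hxr
          obtain rfl : a = 1 - b := by linarith
          nlinarith [h1.1, h1.2]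
    · rintro ⟨e, ⟨he, h1⟩ | he, hxe⟩
      · refine ⟨hPS ▸ ⟨e, he, hxe⟩, ?_⟩
        obtain ⟨a, b, ha, hb, hab, rfl⟩ := hxe
        show f _ ≤ r
        rw [map_add, map_smul, map_smul, smul_eq_mul, smul_eq_mul]
        obtain rfl : a = 1 - b := by linarith
        nlinarith [h1.1, h1.2]
      · rcases he with rfl | rfl
        · rw [segment_same] at hxe
          rw [hxe]; exact ⟨h.left_mem.1, h.left_mem.2.le⟩
        · rw [segment_same] at hxe
          rw [hxe]; exact ⟨h.right_mem.1, h.right_mem.2.le⟩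
  · intro s hs
    have hfs : f (p + s • (q - p)) = r := by
      rw [map_add, map_smul, h.map_sub, smul_zero, add_zero, h.left_mem.2]
    have := h.hull_lower hs hfs.ge
    rw [segment_eq_lines] at this
    obtain ⟨t, ht0, ht1, he⟩ := this
    rw [param_inj (sub_ne_zero.2 h.ne.symm) he]
    exact ⟨ht0, ht1⟩

/-- Near `p`, the part of `P` above the plane can be replaced by a path that begins on the
extension of the segment `qp`. -/
theorem Cut.exists_spur (h : Cut P f r p q) {U : Set R3} (hU : U ∈ 𝓝 p) :
    ∃ (ε : ℝ) (p₂ : R3), 0 < ε ∧ r < f p₂ ∧ segment ℝ p p₂ ⊆ P ∧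
      tri p p₂ (p - ε • (q - p)) ⊆ U ∧ P ∩ tri p p₂ (p - ε • (q - p)) ⊆ segment ℝ p p₂ := by
  obtain ⟨u, v, hu, hv, hg⟩ := h.germ_left
  rw [eventuallyEq_set] at hg
  obtain ⟨δ, hδ, hball⟩ := Metric.mem_nhds_iff.1 (inter_mem hU hg)
  have hnb := Metric.ball_mem_nhds p hδ
  obtain ⟨t, ht, Ht⟩ := eventually_along (P := (· ∈ Metric.ball p δ)) hnb v
  obtain ⟨ε, hε, Hε⟩ := eventually_along (P := (· ∈ Metric.ball p δ)) hnb (q - p)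
  have hp' : p - ε • (q - p) ∈ Metric.ball p δ := by
    have := Hε (-ε) (by rw [abs_neg, abs_of_pos hε])
    rwa [neg_smul, ← sub_eq_add_neg] at this
  have hp2 : p + t • v ∈ Metric.ball p δ := Ht t (by rw [abs_of_pos ht])
  have hT : tri p (p + t • v) (p - ε • (q - p)) ⊆ Metric.ball p δ := by
    refine convexHull_min ?_ (convex_ball p δ)
    rintro x (rfl | rfl | rfl)
    exacts [Metric.mem_ball_self hδ, hp2, hp']
  refine ⟨ε, p + t • v, hε, ?_, ?_, fun x hx => (hball (hT hx)).1, ?_⟩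
  · rw [map_add, map_smul, h.left_mem.2, smul_eq_mul]
    have := mul_pos ht hv
    linarith
  · intro x hx
    refine (hball (hT (segment_subset_tri_left _ _ _ hx))).2.2 (Or.inr ?_)
    rw [segment_eq_lines] at hx
    obtain ⟨s, hs0, -, rfl⟩ := hx
    exact ⟨s * t, by positivity, by rw [add_sub_cancel_left, smul_smul]⟩
  · rintro x ⟨hxP, hxT⟩
    have hx := (hball (hT hxT)).2.1 hxP
    obtain ⟨a, b, c, ha, hb, hc, habc, he⟩ := mem_tri.1 hxT
    have hx' : x = p + (b * t) • v - (c * ε) • (q - p) := by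
      rw [he, show a = 1 - b - c by linarith]; module
    have hfx : f x = r + b * t * f v := by
      rw [hx', LinearMap.map_sub, map_add, map_smul, map_smul, h.map_sub, h.left_mem.2, smul_eq_mul,
        smul_zero, sub_zero]
    rcases hx with ⟨s, hs, rfl⟩ | ⟨s, hs, rfl⟩
    · rw [map_add, map_smul, h.left_mem.2, smul_eq_mul] at hfx
      have h1 : 0 ≤ b * t * f v := by positivity
      have : s = 0 := by nlinarith
      rw [this, zero_smul, add_zero]
      exact left_mem_segment ℝ _ _
    · rw [map_add, map_smul, h.left_mem.2, smul_eq_mul] at hfx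
      have h1 : (s - b * t) * f v = 0 := by linarith
      have h2 : s = b * t := by linarith [(mul_eq_zero.1 h1).resolve_right hv.ne']
      have h3 := add_smul_mem_segment (x := p) (y := p + t • v) hb (by linarith)
      rwa [add_sub_cancel_left, smul_smul, ← h2] at h3

/-- If the part of `P` above the plane is unknotted, then `P` is isotopic to the part below. -/
theorem Cut.isotopic_lower (h : Cut P f r p q)
    (hun : IsUnknot ((P ∩ {x | r ≤ f x}) ∪ segment ℝ p q)) :
    Isotopic P ((P ∩ {x | f x ≤ r}) ∪ segment ℝ p q) := by
  set α := P ∩ {x | f x ≤ r} with hα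
  set β := P ∩ {x | r ≤ f x} with hβ
  obtain ⟨Up, Uq, hUpo, hUqo, hpU, hqU, hdis⟩ := t2_separation h.ne
  -- A `State` needs the chord strictly inside a segment of the link. Therefore the upper part is
  -- first bent near `p` and `q` so that it starts along the extensions of the chord to `p'` and
  -- `q'`. Disjoint neighbourhoods keep the two changes apart.
  obtain ⟨ε, p₂, hε, hp2, hp2P, hTU, hTP⟩ := h.exists_spur (hUpo.mem_nhds hpU)
  obtain ⟨δ, q₂, hδ, hq2, hq2P, hTU', hTP'⟩ := h.symm.exists_spur (hUqo.mem_nhds hqU)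
  set p' := p - ε • (q - p) with hp'
  set q' := q - δ • (p - q) with hq'
  have hfp := h.left_mem.2
  have hfq := h.right_mem.2
  have hqp0 : q - p ≠ 0 := sub_ne_zero.2 h.ne.symm
  have hfp' : f p' = r := by
    rw [hp', LinearMap.map_sub, map_smul, h.map_sub, smul_zero, sub_zero, hfp]
  have hfq' : f q' = r := by
    rw [hq', LinearMap.map_sub, map_smul, h.symm.map_sub, smul_zero, sub_zero, hfq]
  have hq'' : q' = p + (1 + δ) • (q - p) := by rw [hq']; module
  have hp'' : p' = p + (-ε) • (q - p) := by rw [hp']; module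
  have hne1 : p' ≠ p := by
    intro he
    have := param_inj hqp0 (u' := 0) (by rw [← hp'', he]; simp : p + (-ε) • (q - p) = _)
    linarith
  have hne2 : q' ≠ q := by
    intro he
    have := param_inj hqp0 (u' := 1) (by rw [← hq'', he]; simp : p + (1 + δ) • (q - p) = _)
    linarith
  have hA1 : AffineIndependent ℝ ![p, p₂, p'] := affineIndependent_rotate
    (affineIndependent_of_functional hne1 f (by rw [hfp, hfp']) (by rw [hfp']; exact hp2.ne'))
  have hA2 : AffineIndependent ℝ ![q, q₂, q'] := affineIndependent_rotate
    (affineIndependent_of_functional hne2 f (by rw [hfq, hfq']) (by rw [hfq']; exact hq2.ne'))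
  -- points of the triangles in the closed lower half space
  have htri : ∀ {a b c x : R3}, f a = r → r < f b → f c = r → x ∈ tri a b c → f x ≤ r →
      ∃ t : ℝ, 0 ≤ t ∧ t ≤ 1 ∧ x = a + t • (c - a) := by
    intro a b c x ha hb hc hx hfx
    obtain ⟨w₁, w₂, w₃, h1, h2, h3, hs, rfl⟩ := mem_tri.1 hx
    simp only [map_add, map_smul, smul_eq_mul, ha, hc] at hfx
    have : w₂ = 0 := by
      obtain rfl : w₁ = 1 - w₂ - w₃ := by linarith
      by_contra hne
      have := mul_pos (lt_of_le_of_ne h2 (Ne.symm hne)) (sub_pos.2 hb)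
      linarith
    exact ⟨w₃, h3, by linarith, by rw [this, show w₁ = 1 - w₃ by linarith]; module⟩
  have hTp : ∀ x ∈ tri p p₂ p', f x ≤ r → ∃ t : ℝ, t ≤ 0 ∧ -ε ≤ t ∧ x = p + t • (q - p) := by
    intro x hx hfx
    obtain ⟨t, h0, h1, rfl⟩ := htri hfp hp2 hfp' hx hfx
    exact ⟨-(t * ε), by nlinarith, by nlinarith, by rw [hp'']; module⟩
  have hTq : ∀ x ∈ tri q q₂ q', f x ≤ r → ∃ t : ℝ, 1 ≤ t ∧ t ≤ 1 + δ ∧ x = p + t • (q - p) := by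
    intro x hx hfx
    obtain ⟨t, h0, h1, rfl⟩ := htri hfq hq2 hfq' hx hfx
    exact ⟨1 + t * δ, by nlinarith, by nlinarith, by rw [hq'']; module⟩
  set β₀ := β \ (segment ℝ p p₂ ∪ segment ℝ q q₂) with hβ0
  have hup : ∀ {a b x : R3}, f a = r → r < f b → x ∈ segment ℝ a b → r ≤ f x := by
    rintro a b x ha hb ⟨s, t, hs, ht, hst, rfl⟩
    rw [map_add, map_smul, map_smul, ha, smul_eq_mul, smul_eq_mul]
    obtain rfl : s = 1 - t := by linarith
    nlinarith
  have hβeq : β = β₀ ∪ segment ℝ p p₂ ∪ segment ℝ q q₂ := by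
    rw [hβ0, union_assoc, sdiff_union_self]
    refine (union_eq_self_of_subset_right ?_).symm
    refine union_subset (fun x hx => ⟨hp2P hx, hup hfp hp2 hx⟩)
      fun x hx => ⟨hq2P hx, hup hfq hq2 hx⟩
  have hβ0f : ∀ x ∈ β₀, f x = r → False := by
    intro x hx hfx
    rcases h.eq_or hx.1.1 hfx with rfl | rfl
    · exact hx.2 (Or.inl (left_mem_segment ℝ _ _))
    · exact hx.2 (Or.inr (left_mem_segment ℝ _ _))
  -- The same two moves are used twice: with the lower part as `W` for the link itself, and with the
  -- chord as `W` for the closed-up upper part.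
  have hmove : ∀ W : Set R3, W ∩ tri p p₂ p' ⊆ {p} → W ∩ tri q q₂ q' ⊆ {q} →
      Isotopic (W ∪ β₀ ∪ segment ℝ p p₂ ∪ segment ℝ q q₂)
        (W ∪ β₀ ∪ (segment ℝ p p' ∪ segment ℝ p' p₂) ∪ (segment ℝ q q' ∪ segment ℝ q' q₂)) := by
    intro W hW1 hW2
    have m1 := isotopic_of_rest (R := W ∪ β₀ ∪ segment ℝ q q₂) hA1 (by
      rintro x ⟨(hx | hx) | hx, hT⟩
      · exact Or.inl (hW1 ⟨hx, hT⟩)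
      · exact absurd (Or.inl (hTP ⟨hx.1.1, hT⟩)) hx.2
      · exact absurd (hTU' (segment_subset_tri_left _ _ _ hx)) (disjoint_left.1 hdis (hTU hT)))
    have m2 := isotopic_of_rest (R := W ∪ β₀ ∪ (segment ℝ p p' ∪ segment ℝ p' p₂)) hA2 (by
      rintro x ⟨(hx | hx) | hx, hT⟩
      · exact Or.inl (hW2 ⟨hx, hT⟩)
      · exact absurd (Or.inr (hTP' ⟨hx.1.1, hT⟩)) hx.2
      · refine absurd (hTU' hT) (disjoint_left.1 hdis (hTU ?_))
        rcases hx with hx | hx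
        exacts [segment_subset_tri_ac _ _ _ hx, segment_subset_tri_cb _ _ _ hx])
    rw [union_right_comm] at m1
    rw [union_right_comm _ (segment ℝ q q₂)] at m1
    exact m1.trans m2
  set B₁ := β₀ ∪ (segment ℝ p p' ∪ segment ℝ p' p₂) ∪ (segment ℝ q q' ∪ segment ℝ q' q₂) with hB1
  have hP1 : Isotopic P (α ∪ B₁) := by
    have := hmove α (by
      rintro x ⟨hx, hT⟩
      obtain ⟨t, ht, -, he⟩ := hTp x hT hx.2
      rcases h.eq_or hx.1 (by rw [he, map_add, map_smul, h.map_sub, smul_zero, add_zero, hfp])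
        with h1 | h1
      · exact h1
      · exfalso
        have := param_inj hqp0 (u' := 1) (by rw [← he, h1]; simp : p + t • (q - p) = _)
        linarith) (by
      rintro x ⟨hx, hT⟩
      obtain ⟨t, ht, -, he⟩ := hTq x hT hx.2
      rcases h.eq_or hx.1 (by rw [he, map_add, map_smul, h.map_sub, smul_zero, add_zero, hfp])
        with h1 | h1
      · exfalso
        have := param_inj hqp0 (u' := 0) (by rw [← he, h1]; simp : p + t • (q - p) = _)
        linarith
      · exact h1)
    rw [union_assoc α, union_assoc α, ← hβeq, union_assoc α, union_assoc α, ← hB1] at this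
    convert this using 1
    rw [hα, hβ, ← inter_union_distrib_left]
    refine (inter_eq_self_of_subset_left fun x _ => ?_).symm
    exact le_total (f x) r
  have hQ1 : Isotopic (β ∪ segment ℝ p q) (segment ℝ p q ∪ B₁) := by
    have := hmove (segment ℝ p q) (by
      rintro x ⟨hx, hT⟩
      obtain ⟨t, ht, -, he⟩ := hTp x hT (h.map_segment hx).le
      rw [segment_eq_lines] at hx
      obtain ⟨s, hs0, hs1, hs⟩ := hx
      have := param_inj hqp0 (he.symm.trans hs)
      rw [hs, show s = 0 by linarith]
      simp) (by
      rintro x ⟨hx, hT⟩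
      obtain ⟨t, ht, -, he⟩ := hTq x hT (h.map_segment hx).le
      rw [segment_eq_lines] at hx
      obtain ⟨s, hs0, hs1, hs⟩ := hx
      have := param_inj hqp0 (he.symm.trans hs)
      rw [hs, show s = 1 by linarith]
      simp)
    rw [union_assoc (segment ℝ p q), union_assoc (segment ℝ p q), ← hβeq,
      union_assoc (segment ℝ p q), union_assoc (segment ℝ p q), ← hB1, union_comm] at this
    exact this
  have hQl := hQ1.isLink.1 h.isLink_upper
  have hB1T : ∀ x ∈ B₁, x ∈ β₀ ∨ x ∈ tri p p₂ p' ∨ x ∈ tri q q₂ q' := by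
    rintro x ((hx | hx | hx) | hx | hx)
    · exact Or.inl hx
    · exact Or.inr (Or.inl (segment_subset_tri_ac _ _ _ hx))
    · exact Or.inr (Or.inl (segment_subset_tri_cb _ _ _ hx))
    · exact Or.inr (Or.inr (segment_subset_tri_ac _ _ _ hx))
    · exact Or.inr (Or.inr (segment_subset_tri_cb _ _ _ hx))
  have hB1f : ∀ x ∈ B₁, f x ≤ r → ∃ t : ℝ, (t ≤ 0 ∨ 1 ≤ t) ∧ x = p + t • (q - p) := by
    intro x hx hfx
    rcases hB1T x hx with h1 | h1 | h1
    · exact absurd (le_antisymm hfx h1.1.2) fun h2 => hβ0f x h1 h2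
    · obtain ⟨t, h2, -, h3⟩ := hTp x h1 hfx
      exact ⟨t, Or.inl h2, h3⟩
    · obtain ⟨t, h2, -, h3⟩ := hTq x h1 hfx
      exact ⟨t, Or.inr h2, h3⟩
  have hpα : p ∈ α := ⟨h.left_mem.1, hfp.le⟩
  have hqα : q ∈ α := ⟨h.right_mem.1, hfq.le⟩
  have hins : ins α p q (segment ℝ p q ∪ B₁) (AffineEquiv.refl ℝ R3) = α ∪ B₁ := by
    rw [ins]
    simp only [AffineEquiv.coe_refl, image_id]
    apply Subset.antisymm
    · rintro x (⟨hx | hx, hx'⟩ | hx)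
      exacts [absurd hx hx', Or.inr hx, Or.inl hx]
    · rintro x (hx | hx)
      · exact Or.inr hx
      · by_cases hxs : x ∈ segment ℝ p q
        · right
          obtain ⟨t, ht, he⟩ := hB1f x hx (h.map_segment hxs).le
          rw [segment_eq_lines] at hxs
          obtain ⟨s, hs0, hs1, hs⟩ := hxs
          have hst := param_inj hqp0 (he.symm.trans hs)
          rcases ht with ht | ht
          · rw [he, show t = 0 by linarith, zero_smul, add_zero]; exact hpα
          · rw [he, show t = 1 by linarith, one_smul, add_sub_cancel]; exact hqα
        · exact Or.inl ⟨Or.inr hx, hxs⟩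
  have hstate : State α p q (segment ℝ p q ∪ B₁) (AffineEquiv.refl ℝ R3) p' q' := by
    have hden : 0 < 1 + δ + ε := by linarith
    refine ⟨fun L _ => by simpa using isotopic_refl L, ?_, ⟨ε / (1 + δ + ε),
      (1 + ε) / (1 + δ + ε), by positivity, ?_, ?_, ?_, ?_⟩, ?_⟩
    · intro x hx
      rw [hp'', hq''] at hx
      obtain ⟨t, ht0, ht1, rfl⟩ := exists_param_of_mem_segment (by linarith) hx
      by_cases h0 : t ≤ 0
      · right; left; right; left
        rw [hp'', segment_symm]
        have := (mem_segment_param (x := p) hqp0 (u := t) (s := -ε) (t := 0) (by linarith)).2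
          ⟨ht0, h0⟩
        rwa [zero_smul, add_zero] at this
      by_cases h1 : t ≤ 1
      · exact Or.inl (add_smul_mem_segment (not_le.1 h0).le h1)
      · right; right; left
        have := (mem_segment_param (x := p) hqp0 (u := t) (s := 1) (t := 1 + δ)
          (by linarith)).2 ⟨(not_le.1 h1).le, ht1⟩
        rwa [one_smul, add_sub_cancel, ← hq''] at this
    · gcongr; linarith
    · rw [div_lt_one hden]; linarith
    · rw [AffineEquiv.refl_apply, hp'', hq'']
      have : p + (1 + δ) • (q - p) - (p + (-ε) • (q - p)) = (1 + δ + ε) • (q - p) := by module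
      rw [this, smul_smul, div_mul_cancel₀ _ hden.ne']
      module
    · rw [AffineEquiv.refl_apply, hp'', hq'']
      have : p + (1 + δ) • (q - p) - (p + (-ε) • (q - p)) = (1 + δ + ε) • (q - p) := by module
      rw [this, smul_smul, div_mul_cancel₀ _ hden.ne']
      module
    · rintro x hx (hxQ | hxQ)
      · exact hxQ
      · rw [AffineEquiv.refl_apply] at hxQ
        refine h.hull_lower hx ?_
        rcases hB1T x hxQ with h1 | h1 | h1
        · exact h1.1.2
        · obtain ⟨a, b, c, ha, hb, hc, hs, rfl⟩ := mem_tri.1 h1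
          simp only [map_add, map_smul, smul_eq_mul, hfp, hfp']
          obtain rfl : a = 1 - b - c := by linarith
          nlinarith
        · obtain ⟨a, b, c, ha, hb, hc, hs, rfl⟩ := mem_tri.1 h1
          simp only [map_add, map_smul, smul_eq_mul, hfq, hfq']
          obtain rfl : a = 1 - b - c := by linarith
          nlinarith
  have hIl : IsLink (ins α p q (segment ℝ p q ∪ B₁) (AffineEquiv.refl ℝ R3)) := by
    rw [hins]; exact hP1.isLink.1 h.link
  -- The closed-up upper part becomes a triangle; the lower part, inserted along the chord, is
  -- carried along and then closed up.
  obtain ⟨d₁, d₂, d₃, hd, hiso⟩ := hun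
  have hiso' := hQ1.symm.trans hiso
  obtain ⟨A, a, b, hS, hI⟩ := hstate.isotopic h.tangle hiso' hQl hIl
  refine hP1.trans ?_
  rw [← hins]
  refine hI.trans ?_
  refine hS.triangle h.tangle h.ne_zero hfp hfq ?_ hd (hiso'.isLink.1 hQl) (hI.isLink.1 hIl)
  exact fun x hx => ⟨hx.2, fun h1 => h.eq_or hx.1 h1⟩

/-- If the part of `P` below the plane is unknotted, then `P` is isotopic to the part above. -/
theorem Cut.isotopic_upper (h : Cut P f r p q)
    (hun : IsUnknot ((P ∩ {x | f x ≤ r}) ∪ segment ℝ p q)) :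
    Isotopic P ((P ∩ {x | r ≤ f x}) ∪ segment ℝ p q) := by
  have := h.neg.isotopic_lower
  simp only [LinearMap.neg_apply, neg_le_neg_iff] at this
  exact this hun

theorem Cut.isLink_lower (h : Cut P f r p q) : IsLink ((P ∩ {x | f x ≤ r}) ∪ segment ℝ p q) := by
  have := h.neg.isLink_upper
  simp only [LinearMap.neg_apply, neg_le_neg_iff] at this
  exact this

theorem Cut.isConnected_lower (h : Cut P f r p q) (hP : IsConnected P) :
    IsConnected ((P ∩ {x | f x ≤ r}) ∪ segment ℝ p q) := by
  have := h.neg.isConnected_upper hP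
  simp only [LinearMap.neg_apply, neg_le_neg_iff] at this
  exact this

/-- A prime knot that crosses a plane in two points is isotopic to one of its two parts, and the
other part is a knot. -/
theorem Cut.prime (h : Cut P f r p q) {K : Set R3} (hK : IsPrimeKnot K) (hKP : Isotopic K P) :
    Isotopic K ((P ∩ {x | f x ≤ r}) ∪ segment ℝ p q) ∨
      Isotopic K ((P ∩ {x | r ≤ f x}) ∪ segment ℝ p q) := by
  have hPc : IsConnected P := (hKP.isConnected hK.1.isLink).1 hK.1.isConnected
  rcases hK.2.2 _ _ (isKnot_of_isLink h.isLink_lower (h.isConnected_lower hPc))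
    (isKnot_of_isLink h.isLink_upper (h.isConnected_upper hPc))
    ⟨P, f, r, p, q, hKP, h.ne_zero, h.ne, h.inter, isotopic_refl _, isotopic_refl _⟩ with h1 | h1
  · exact Or.inr (hKP.trans (h.isotopic_upper h1))
  · exact Or.inl (hKP.trans (h.isotopic_lower h1))

end Cut

/-! ### Explicit isotopies in coordinates -/

theorem eq_vec_iff {x : R3} {a b c : ℝ} : x = ![a, b, c] ↔ x 0 = a ∧ x 1 = b ∧ x 2 = c := by
  constructor
  · rintro rfl; simp
  · rintro ⟨h0, h1, h2⟩
    ext i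
    fin_cases i <;> simp [h0, h1, h2]

theorem mem_segment_coord {x a b : R3} (h : x ∈ segment ℝ a b) :
    ∃ t : ℝ, 0 ≤ t ∧ t ≤ 1 ∧ x 0 = a 0 + t * (b 0 - a 0) ∧ x 1 = a 1 + t * (b 1 - a 1) ∧
      x 2 = a 2 + t * (b 2 - a 2) := by
  rw [segment_eq_lines] at h
  obtain ⟨t, h0, h1, rfl⟩ := h
  exact ⟨t, h0, h1, by simp⟩

theorem mem_segment_of_coord {x a b : R3} {t : ℝ} (h0 : 0 ≤ t) (h1 : t ≤ 1)
    (e0 : x 0 = a 0 + t * (b 0 - a 0)) (e1 : x 1 = a 1 + t * (b 1 - a 1))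
    (e2 : x 2 = a 2 + t * (b 2 - a 2)) : x ∈ segment ℝ a b := by
  rw [segment_eq_lines]
  refine ⟨t, h0, h1, ?_⟩
  ext i
  fin_cases i <;> simp [e0, e1, e2]

theorem affineIndependent_of_minor {a b c : R3} (i j : Fin 3)
    (h : (b i - a i) * (c j - a j) - (b j - a j) * (c i - a i) ≠ 0) :
    AffineIndependent ℝ ![a, b, c] := by
  refine affineIndependent_of_weights fun α β γ h0 h1 => ?_
  have hi := congrFun h1 i
  have hj := congrFun h1 j
  simp only [Pi.add_apply, Pi.smul_apply, smul_eq_mul, Pi.zero_apply] at hi hj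
  obtain rfl : α = -β - γ := by linarith
  have hβ : β * ((b i - a i) * (c j - a j) - (b j - a j) * (c i - a i)) = 0 := by
    linear_combination (c j - a j) * hi - (c i - a i) * hj
  have hγ : γ * ((b i - a i) * (c j - a j) - (b j - a j) * (c i - a i)) = 0 := by
    linear_combination (b i - a i) * hj - (b j - a j) * hi
  have hβ' := (mul_eq_zero.1 hβ).resolve_right h
  have hγ' := (mul_eq_zero.1 hγ).resolve_right h
  exact ⟨by linarith, hβ', hγ'⟩

/-- Insertion of a vertex `c` into the side `ab`, in coordinates. -/
theorem isotopic_vertex {R S S' : Set R3} (a b c : R3) (i j : Fin 3)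
    (hd : (b i - a i) * (c j - a j) - (b j - a j) * (c i - a i) ≠ 0)
    (hR : ∀ x ∈ R, ∀ β γ : ℝ, 0 ≤ β → 0 ≤ γ → β + γ ≤ 1 →
      x 0 = a 0 + β * (b 0 - a 0) + γ * (c 0 - a 0) →
      x 1 = a 1 + β * (b 1 - a 1) + γ * (c 1 - a 1) →
      x 2 = a 2 + β * (b 2 - a 2) + γ * (c 2 - a 2) → γ = 0 ∧ (β = 0 ∨ β = 1))
    (hS : S = R ∪ segment ℝ a b) (hS' : S' = R ∪ (segment ℝ a c ∪ segment ℝ c b)) :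
    Isotopic S S' := by
  subst hS hS'
  refine isotopic_of_rest (affineIndependent_of_minor i j hd) ?_
  rintro x ⟨hx, hT⟩
  obtain ⟨α, β, γ, hα, hβ, hγ, hs, he⟩ := mem_tri.1 hT
  obtain rfl : α = 1 - β - γ := by linarith
  obtain ⟨h1, h2⟩ := hR x hx β γ hβ hγ (by linarith) (by rw [he]; simp; ring)
    (by rw [he]; simp; ring) (by rw [he]; simp; ring)
  rcases h2 with h2 | h2
  · left; rw [he, h1, h2]; simp
  · right; rw [he, h1, h2]; simp

set_option maxHeartbeats 1000000 in
/-- Half of sliding a crossing along two vertical strands: the crossing in the upper (lower) half of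
a box is stretched to the whole box. -/
theorem isotopic_stretch {R : Set R3} {c m σ e : ℝ} (hσ : σ = 1 ∨ σ = -1)
    (he : e = 1 / 2 ∨ e = -1 / 2)
    (hR : ∀ x ∈ R, c - 1 / 2 ≤ x 0 → x 0 ≤ c + 1 / 2 → m - 1 < x 1 → x 1 < m + 1 → -1 < x 2 →
      x 2 < 1 → False) :
    Isotopic (R ∪ ((segment ℝ ![c - σ / 2, m - σ, 0] ![c - σ / 2, m, 0] ∪
        segment ℝ ![c - σ / 2, m, 0] ![c + σ / 2, m + σ, 0]) ∪
        (segment ℝ ![c + σ / 2, m - σ, 0] ![c + σ / 2, m, 0] ∪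
        segment ℝ ![c + σ / 2, m, 0] ![c, m + σ / 2, e] ∪
        segment ℝ ![c, m + σ / 2, e] ![c - σ / 2, m + σ, 0])))
      (R ∪ (segment ℝ ![c - σ / 2, m - σ, 0] ![c + σ / 2, m + σ, 0] ∪
        (segment ℝ ![c + σ / 2, m - σ, 0] ![c, m, e] ∪
        segment ℝ ![c, m, e] ![c - σ / 2, m + σ, 0]))) := by
  set A₁ : R3 := ![c - σ / 2, m - σ, 0] with hA1
  set A₂ : R3 := ![c + σ / 2, m + σ, 0] with hA2
  set A₃ : R3 := ![c - σ / 2, m, 0] with hA3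
  set B₁ : R3 := ![c + σ / 2, m - σ, 0] with hB1
  set B₂ : R3 := ![c + σ / 2, m, 0] with hB2
  set B₃ : R3 := ![c - σ / 2, m + σ, 0] with hB3
  set M : R3 := ![c, m + σ / 2, e] with hM
  set M' : R3 := ![c, m, e] with hM'
  -- The corner `A₃` of the straight strand and the corner `B₂` of the bent one are removed; then
  -- the middle `M'` at the new height is inserted, and the old middle `M` is removed. The box
  -- contains nothing else.
  have s1 : Isotopic (R ∪ (segment ℝ A₁ A₂ ∪ (segment ℝ B₁ B₂ ∪ segment ℝ B₂ M ∪ segment ℝ M B₃)))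
      (R ∪ ((segment ℝ A₁ A₃ ∪ segment ℝ A₃ A₂) ∪
        (segment ℝ B₁ B₂ ∪ segment ℝ B₂ M ∪ segment ℝ M B₃))) := by
    refine isotopic_vertex (R := R ∪ (segment ℝ B₁ B₂ ∪ segment ℝ B₂ M ∪ segment ℝ M B₃))
      A₁ A₂ A₃ 0 1 ?_ ?_ (by ac_rfl) (by ac_rfl)
    · rcases hσ with rfl | rfl <;> simp [hA1, hA2, hA3]
    · intro x hx β γ hβ hγ hs e0 e1 e2
      simp only [hA1, hA2, hA3, Matrix.cons_val] at e0 e1 e2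
      rcases hx with hx | (hx | hx) | hx
      · by_cases h1 : m - 1 < x 1
        · by_cases h2 : x 1 < m + 1
          · exfalso
            rcases hσ with rfl | rfl <;>
              exact hR x hx (by linarith) (by linarith) h1 h2 (by linarith) (by linarith)
          · rcases hσ with rfl | rfl
            · exact ⟨by linarith, Or.inr (by linarith)⟩
            · exact ⟨by linarith, Or.inl (by linarith)⟩
        · rcases hσ with rfl | rfl
          · exact ⟨by linarith, Or.inl (by linarith)⟩
          · exact ⟨by linarith, Or.inr (by linarith)⟩
      all_goals
        obtain ⟨t, ht0, ht1, f0, f1, f2⟩ := mem_segment_coord hx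
        simp only [hB1, hB2, hB3, hM, Matrix.cons_val] at f0 f1 f2
        exfalso
        rcases hσ with rfl | rfl <;> rcases he with rfl | rfl <;> linarith
  have s2 : Isotopic (R ∪ (segment ℝ A₁ A₂ ∪ (segment ℝ B₁ M ∪ segment ℝ M B₃)))
      (R ∪ (segment ℝ A₁ A₂ ∪ (segment ℝ B₁ B₂ ∪ segment ℝ B₂ M ∪ segment ℝ M B₃))) := by
    refine isotopic_vertex (R := R ∪ segment ℝ A₁ A₂ ∪ segment ℝ M B₃)
      B₁ M B₂ 0 1 ?_ ?_ (by ac_rfl) (by ac_rfl)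
    · rcases hσ with rfl | rfl <;> simp [hB1, hB2, hM]
    · intro x hx β γ hβ hγ hs e0 e1 e2
      simp only [hB1, hB2, hM, Matrix.cons_val] at e0 e1 e2
      rcases hx with (hx | hx) | hx
      · by_cases h1 : m - 1 < x 1
        · by_cases h2 : x 1 < m + 1
          · exfalso
            rcases hσ with rfl | rfl <;> rcases he with rfl | rfl <;>
              exact hR x hx (by linarith) (by linarith) h1 h2 (by linarith) (by linarith)
          · rcases hσ with rfl | rfl
            · exfalso; linarith
            · exact ⟨by linarith, Or.inl (by linarith)⟩
        · rcases hσ with rfl | rfl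
          · exact ⟨by linarith, Or.inl (by linarith)⟩
          · exfalso; linarith
      · obtain ⟨t, ht0, ht1, f0, f1, f2⟩ := mem_segment_coord hx
        simp only [hA1, hA2, Matrix.cons_val] at f0 f1 f2
        exfalso
        rcases hσ with rfl | rfl <;> rcases he with rfl | rfl <;> linarith
      · obtain ⟨t, ht0, ht1, f0, f1, f2⟩ := mem_segment_coord hx
        simp only [hB3, hM, Matrix.cons_val] at f0 f1 f2
        rcases hσ with rfl | rfl <;> rcases he with rfl | rfl <;>
          exact ⟨by linarith, Or.inr (by linarith)⟩
  have s3 : Isotopic (R ∪ (segment ℝ A₁ A₂ ∪ (segment ℝ B₁ M ∪ segment ℝ M B₃)))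
      (R ∪ (segment ℝ A₁ A₂ ∪ (segment ℝ B₁ M' ∪ segment ℝ M' M ∪ segment ℝ M B₃))) := by
    refine isotopic_vertex (R := R ∪ segment ℝ A₁ A₂ ∪ segment ℝ M B₃)
      B₁ M M' 0 1 ?_ ?_ (by ac_rfl) (by ac_rfl)
    · rcases hσ with rfl | rfl <;> simp [hB1, hM', hM] <;> norm_num
    · intro x hx β γ hβ hγ hs e0 e1 e2
      simp only [hB1, hM', hM, Matrix.cons_val] at e0 e1 e2
      rcases hx with (hx | hx) | hx
      · by_cases h1 : m - 1 < x 1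
        · by_cases h2 : x 1 < m + 1
          · exfalso
            rcases hσ with rfl | rfl <;> rcases he with rfl | rfl <;>
              exact hR x hx (by linarith) (by linarith) h1 h2 (by linarith) (by linarith)
          · rcases hσ with rfl | rfl
            · exfalso; linarith
            · exact ⟨by linarith, Or.inl (by linarith)⟩
        · rcases hσ with rfl | rfl
          · exact ⟨by linarith, Or.inl (by linarith)⟩
          · exfalso; linarith
      · obtain ⟨t, ht0, ht1, f0, f1, f2⟩ := mem_segment_coord hx
        simp only [hA1, hA2, Matrix.cons_val] at f0 f1 f2
        exfalso
        rcases hσ with rfl | rfl <;> rcases he with rfl | rfl <;> linarith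
      · obtain ⟨t, ht0, ht1, f0, f1, f2⟩ := mem_segment_coord hx
        simp only [hB3, hM, Matrix.cons_val] at f0 f1 f2
        rcases hσ with rfl | rfl <;> rcases he with rfl | rfl <;>
          exact ⟨by linarith, Or.inr (by linarith)⟩
  have s4 : Isotopic (R ∪ (segment ℝ A₁ A₂ ∪ (segment ℝ B₁ M' ∪ segment ℝ M' B₃)))
      (R ∪ (segment ℝ A₁ A₂ ∪ (segment ℝ B₁ M' ∪ segment ℝ M' M ∪ segment ℝ M B₃))) := by
    refine isotopic_vertex (R := R ∪ segment ℝ A₁ A₂ ∪ segment ℝ B₁ M')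
      M' B₃ M 0 1 ?_ ?_ (by ac_rfl) (by ac_rfl)
    · rcases hσ with rfl | rfl <;> simp [hB3, hM', hM]
    · intro x hx β γ hβ hγ hs e0 e1 e2
      simp only [hB3, hM', hM, Matrix.cons_val] at e0 e1 e2
      rcases hx with (hx | hx) | hx
      · by_cases h1 : m - 1 < x 1
        · by_cases h2 : x 1 < m + 1
          · exfalso
            rcases hσ with rfl | rfl <;> rcases he with rfl | rfl <;>
              exact hR x hx (by linarith) (by linarith) h1 h2 (by linarith) (by linarith)
          · rcases hσ with rfl | rfl
            · exact ⟨by linarith, Or.inr (by linarith)⟩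
            · exfalso; linarith
        · rcases hσ with rfl | rfl
          · exfalso; linarith
          · exact ⟨by linarith, Or.inr (by linarith)⟩
      · obtain ⟨t, ht0, ht1, f0, f1, f2⟩ := mem_segment_coord hx
        simp only [hA1, hA2, Matrix.cons_val] at f0 f1 f2
        exfalso
        rcases hσ with rfl | rfl <;> rcases he with rfl | rfl <;> linarith
      · obtain ⟨t, ht0, ht1, f0, f1, f2⟩ := mem_segment_coord hx
        simp only [hB1, hM', Matrix.cons_val] at f0 f1 f2
        rcases hσ with rfl | rfl <;> rcases he with rfl | rfl <;>
          exact ⟨by linarith, Or.inl (by linarith)⟩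
  exact s1.symm.trans (s2.symm.trans (s3.trans s4.symm))

/-! ### Closed braids as stacks of layers -/

/-- The elevation of the middle of the bent strand of a crossing. -/
noncomputable def elev (s : Bool) : ℝ := if s then 1 / 2 else -1 / 2

theorem elev_cases (s : Bool) : elev s = 1 / 2 ∨ elev s = -1 / 2 := by
  cases s <;> simp [elev]

/-- The strand that begins at the position `j` of the `k`-th layer, which is a crossing `(i, s)` or
consists of vertical strands. -/
noncomputable def strand (k : ℕ) (o : Option (ℕ × Bool)) (j : ℕ) : Set R3 :=
  match o with
  | none => segment ℝ ![(j : ℝ), k, 0] ![(j : ℝ), k + 1, 0]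
  | some (i, s) =>
    if j = i then segment ℝ ![(i : ℝ), k, 0] ![(i : ℝ) + 1, k + 1, 0]
    else if j = i + 1 then segment ℝ ![(i : ℝ) + 1, k, 0] ![(i : ℝ) + 1 / 2, k + 1 / 2, elev s] ∪
      segment ℝ ![(i : ℝ) + 1 / 2, k + 1 / 2, elev s] ![(i : ℝ), k + 1, 0]
    else segment ℝ ![(j : ℝ), k, 0] ![(j : ℝ), k + 1, 0]

/-- The closure of a stack of layers on the strands `lo, …, hi - 1`. -/
def closedStack (lo hi : ℕ) (v : List (Option (ℕ × Bool))) : Set R3 :=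
  {x | ∃ k o j, v[k]? = some o ∧ lo ≤ j ∧ j < hi ∧ x ∈ strand k o j} ∪
    {x | ∃ j, lo ≤ j ∧ j < hi ∧ x ∈ closingArc v.length j}

theorem strand_none (k j : ℕ) :
    strand k none j = segment ℝ ![(j : ℝ), k, 0] ![(j : ℝ), k + 1, 0] := rfl

theorem strand_left (k i : ℕ) (s : Bool) :
    strand k (some (i, s)) i = segment ℝ ![(i : ℝ), k, 0] ![(i : ℝ) + 1, k + 1, 0] := by
  simp [strand]

theorem strand_right (k i : ℕ) (s : Bool) : strand k (some (i, s)) (i + 1) =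
    segment ℝ ![(i : ℝ) + 1, k, 0] ![(i : ℝ) + 1 / 2, k + 1 / 2, elev s] ∪
      segment ℝ ![(i : ℝ) + 1 / 2, k + 1 / 2, elev s] ![(i : ℝ), k + 1, 0] := by
  simp [strand]

theorem strand_other (k : ℕ) {i j : ℕ} (s : Bool) (h1 : j ≠ i) (h2 : j ≠ i + 1) :
    strand k (some (i, s)) j = strand k none j := by
  simp [strand, h1, h2]

/-- The position of the upper end of a strand. -/
def upper (o : Option (ℕ × Bool)) (j : ℕ) : ℕ :=
  match o with
  | none => j
  | some (i, _) => Equiv.swap i (i + 1) j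

theorem mem_vertical {x : R3} {j : ℝ} {y₀ y₁ z : ℝ} (h : x ∈ segment ℝ ![j, y₀, z] ![j, y₁, z]) :
    x 0 = j ∧ x 2 = z := by
  obtain ⟨t, -, -, h0, -, h2⟩ := mem_segment_coord h
  simp only [Matrix.cons_val] at h0 h2
  exact ⟨by rw [h0]; ring, by rw [h2]; ring⟩

/-- A strand is vertical, straight or bent; each is parametrised by the height above the bottom of
the layer. Later incidence statements about strands are read off from this. -/
theorem strand_cases {k : ℕ} {o : Option (ℕ × Bool)} {j : ℕ} {x : R3} (hx : x ∈ strand k o j) :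
    (upper o j = j ∧ x 0 = j ∧ x 2 = 0 ∧ ∃ t : ℝ, 0 ≤ t ∧ t ≤ 1 ∧ x 1 = k + t) ∨
    (∃ s, o = some (j, s) ∧ upper o j = j + 1 ∧
      ∃ t : ℝ, 0 ≤ t ∧ t ≤ 1 ∧ x 0 = j + t ∧ x 1 = k + t ∧ x 2 = 0) ∨
    (∃ i s, o = some (i, s) ∧ j = i + 1 ∧ upper o j = i ∧
      ∃ t : ℝ, 0 ≤ t ∧ t ≤ 1 ∧ x 0 = j - t ∧ x 1 = k + t ∧
        (t ≤ 1 / 2 ∧ x 2 = 2 * t * elev s ∨ 1 / 2 ≤ t ∧ x 2 = 2 * (1 - t) * elev s)) := by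
  have hvert : x ∈ strand k none j → x 0 = j ∧ x 2 = 0 ∧ ∃ t : ℝ, 0 ≤ t ∧ t ≤ 1 ∧ x 1 = k + t := by
    intro hx
    obtain ⟨h0, h2⟩ := mem_vertical hx
    obtain ⟨t, ht0, ht1, -, h1, -⟩ := mem_segment_coord hx
    simp only [Matrix.cons_val] at h1
    exact ⟨h0, h2, t, ht0, ht1, by rw [h1]; ring⟩
  match o with
  | none => exact Or.inl ⟨rfl, hvert hx⟩
  | some (i, s) =>
    by_cases h1 : j = i
    · subst h1
      rw [strand_left] at hx
      obtain ⟨t, ht0, ht1, e0, e1, e2⟩ := mem_segment_coord hx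
      simp only [Matrix.cons_val] at e0 e1 e2
      exact Or.inr (Or.inl ⟨s, rfl, by simp [upper], t, ht0, ht1, by rw [e0]; ring,
        by rw [e1]; ring, by rw [e2]; ring⟩)
    by_cases h2 : j = i + 1
    · subst h2
      rw [strand_right] at hx
      refine Or.inr (Or.inr ⟨i, s, rfl, rfl, by simp [upper], ?_⟩)
      rcases hx with hx | hx
      · obtain ⟨t, ht0, ht1, e0, e1, e2⟩ := mem_segment_coord hx
        simp only [Matrix.cons_val] at e0 e1 e2
        refine ⟨t / 2, by linarith, by linarith, ?_, by rw [e1]; ring,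
          Or.inl ⟨by linarith, by rw [e2]; ring⟩⟩
        rw [e0]; push_cast; ring
      · obtain ⟨t, ht0, ht1, e0, e1, e2⟩ := mem_segment_coord hx
        simp only [Matrix.cons_val] at e0 e1 e2
        refine ⟨1 / 2 + t / 2, by linarith, by linarith, ?_, by rw [e1]; ring,
          Or.inr ⟨by linarith, by rw [e2]; ring⟩⟩
        rw [e0]; push_cast; ring
    · rw [strand_other k s h1 h2] at hx
      refine Or.inl ⟨?_, hvert hx⟩
      simp [upper, Equiv.swap_apply_of_ne_of_ne h1 h2]

theorem strand_height {k : ℕ} {o : Option (ℕ × Bool)} {j : ℕ} {x : R3} (hx : x ∈ strand k o j) :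
    (k : ℝ) ≤ x 1 ∧ x 1 ≤ k + 1 := by
  rcases strand_cases hx with ⟨-, -, -, t, h0, h1, h⟩ | ⟨s, -, -, t, h0, h1, -, h, -⟩ |
    ⟨i, s, -, -, -, t, h0, h1, -, h, -⟩ <;> constructor <;> linarith

theorem strand_bottom {k : ℕ} {o : Option (ℕ × Bool)} {j : ℕ} {x : R3} (hx : x ∈ strand k o j)
    (h : x 1 = k) : x 0 = j ∧ x 2 = 0 := by
  rcases strand_cases hx with ⟨-, h0, h2, -⟩ | ⟨s, -, -, t, -, -, e0, e1, e2⟩ |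
    ⟨i, s, -, -, -, t, ht, -, e0, e1, e2⟩
  · exact ⟨h0, h2⟩
  · exact ⟨by linarith, e2⟩
  · have : t = 0 := by linarith
    subst this
    refine ⟨by linarith, ?_⟩
    rcases e2 with ⟨-, e2⟩ | ⟨e, -⟩
    · rw [e2]; ring
    · norm_num at e

theorem strand_top {k : ℕ} {o : Option (ℕ × Bool)} {j : ℕ} {x : R3} (hx : x ∈ strand k o j)
    (h : x 1 = k + 1) : x 0 = upper o j ∧ x 2 = 0 := by
  rcases strand_cases hx with ⟨hu, h0, h2, -⟩ | ⟨s, -, hu, t, -, -, e0, e1, e2⟩ |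
    ⟨i, s, -, hj, hu, t, ht, -, e0, e1, e2⟩
  · exact ⟨by rw [hu, h0], h2⟩
  · refine ⟨?_, e2⟩
    rw [hu, e0]; push_cast; linarith
  · have : t = 1 := by linarith
    subst this
    refine ⟨?_, ?_⟩
    · rw [hu, e0, hj]; push_cast; ring
    · rcases e2 with ⟨e, -⟩ | ⟨-, e2⟩
      · norm_num at e
      · rw [e2]; ring

theorem closingArc_cases {L j : ℕ} {x : R3} (hx : x ∈ closingArc L j) : x 0 = j ∧
    (x 1 = L ∧ 0 ≤ x 2 ∧ x 2 ≤ 1 ∨ x 2 = 1 ∧ x 1 ≤ L ∧ -1 ≤ x 1 ∨ x 1 = -1 ∨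
      -1 ≤ x 1 ∧ x 1 ≤ 0 ∧ x 2 = 0) := by
  have hL : (0 : ℝ) ≤ L := Nat.cast_nonneg L
  rcases hx with ((hx | hx) | hx) | hx <;> obtain ⟨t, ht0, ht1, e0, e1, e2⟩ := mem_segment_coord hx <;>
    simp only [Matrix.cons_val] at e0 e1 e2 <;> refine ⟨by linarith, ?_⟩
  · exact Or.inl ⟨by linarith, by linarith, by linarith⟩
  · exact Or.inr (Or.inl ⟨by linarith, by nlinarith, by nlinarith⟩)
  · exact Or.inr (Or.inr (Or.inl (by linarith)))
  · exact Or.inr (Or.inr (Or.inr ⟨by linarith, by linarith, by linarith⟩))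

/-- Stacks are more flexible than words: layers without crossings are allowed, so letters can be
erased without changing heights, and the range of positions is free, so both halves of a cut braid
can be described in place. -/
theorem braidClosure_eq {n : ℕ} (w : BraidWord n) :
    braidClosure w = closedStack 0 n (w.map fun l => some ((l.1 : ℕ), l.2)) := by
  have hlet : ∀ (k : ℕ) (l : Fin (n - 1) × Bool) (x : R3), x ∈ letterSet n k l ↔
      ∃ j, j < n ∧ x ∈ strand k (some ((l.1 : ℕ), l.2)) j := by
    intro k l x
    have hl := l.1.2
    have he : (if l.2 = true then (1 : ℝ) / 2 else -1 / 2) = elev l.2 := rfl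
    simp only [letterSet, he, mem_union, mem_iUnion]
    constructor
    · rintro (((hx | hx) | hx) | ⟨j, ⟨h1, h2⟩, hx⟩)
      · exact ⟨l.1, by omega, by rw [strand_left]; exact hx⟩
      · exact ⟨l.1 + 1, by omega, by rw [strand_right]; exact Or.inl hx⟩
      · exact ⟨l.1 + 1, by omega, by rw [strand_right]; exact Or.inr hx⟩
      · exact ⟨j, j.2, by rw [strand_other k l.2 h1 h2]; exact hx⟩
    · rintro ⟨j, hj, hx⟩
      by_cases h1 : j = l.1
      · subst h1
        rw [strand_left] at hx
        exact Or.inl (Or.inl (Or.inl hx))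
      by_cases h2 : j = l.1 + 1
      · subst h2
        rw [strand_right] at hx
        rcases hx with hx | hx
        · exact Or.inl (Or.inl (Or.inr hx))
        · exact Or.inl (Or.inr hx)
      · rw [strand_other k l.2 h1 h2] at hx
        exact Or.inr ⟨⟨j, hj⟩, ⟨h1, h2⟩, hx⟩
  ext x
  simp only [braidClosure, closedStack, mem_union, mem_iUnion, hlet, mem_ofPred_eq, List.length_map]
  refine or_congr ⟨?_, ?_⟩ ⟨?_, ?_⟩
  · rintro ⟨k, j, hj, hx⟩
    refine ⟨k, some ((w.get k).1, (w.get k).2), j, ?_, Nat.zero_le _, hj, hx⟩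
    simp
  · rintro ⟨k, o, j, hk, -, hj, hx⟩
    rw [List.getElem?_map, Option.map_eq_some_iff] at hk
    obtain ⟨l, hl, rfl⟩ := hk
    obtain ⟨hk, rfl⟩ := List.getElem?_eq_some_iff.1 hl
    exact ⟨⟨k, hk⟩, j, hj, hx⟩
  · rintro ⟨j, hx⟩
    exact ⟨j, Nat.zero_le _, j.2, hx⟩
  · rintro ⟨j, -, hj, hx⟩
    exact ⟨⟨j, hj⟩, hx⟩

theorem getElem?_append_pair {α : Type*} (v₁ v₂ : List α) (a b c d : α) {k : ℕ}
    (h1 : k ≠ v₁.length) (h2 : k ≠ v₁.length + 1) :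
    (v₁ ++ a :: b :: v₂)[k]? = (v₁ ++ c :: d :: v₂)[k]? := by
  rcases lt_or_ge k v₁.length with h | h
  · rw [List.getElem?_append_left h, List.getElem?_append_left h]
  · rw [List.getElem?_append_right h, List.getElem?_append_right h]
    obtain ⟨m, hm⟩ : ∃ m, k - v₁.length = m + 2 := ⟨k - v₁.length - 2, by omega⟩
    rw [hm]
    simp

theorem union_rearrange {α : Type*} (r a b c d e : Set α) :
    r ∪ ((a ∪ b) ∪ (c ∪ (d ∪ e))) = r ∪ ((b ∪ a) ∪ ((c ∪ e) ∪ d)) := by ac_rfl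

set_option maxHeartbeats 1000000 in
/-- A crossing can be moved down past a layer without crossings. -/
theorem closedStack_slide (lo hi : ℕ) (v₁ v₂ : List (Option (ℕ × Bool))) {i : ℕ} (s : Bool)
    (hlo : lo ≤ i) (hhi : i + 1 < hi) :
    Isotopic (closedStack lo hi (v₁ ++ none :: some (i, s) :: v₂))
      (closedStack lo hi (v₁ ++ some (i, s) :: none :: v₂)) := by
  set v := v₁ ++ none :: some (i, s) :: v₂ with hv
  set v' := v₁ ++ some (i, s) :: none :: v₂ with hv'
  set k := v₁.length with hk
  have hlen : v'.length = v.length := by simp [hv, hv']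
  have hlenk : k + 2 ≤ v.length := by simp [hv, hk]
  have vk : v[k]? = some none := by simp [hv, hk]
  have vk1 : v[k + 1]? = some (some (i, s)) := by
    rw [hv, List.getElem?_append_right (by omega)]; simp [← hk]
  have vk' : v'[k]? = some (some (i, s)) := by simp [hv', hk]
  have vk1' : v'[k + 1]? = some none := by
    rw [hv', List.getElem?_append_right (by omega)]; simp [← hk]
  -- The rest: everything except the four strands of the two layers that begin at the positions `i`
  -- and `i + 1`.
  set R : Set R3 := {x | ∃ k' o j, v[k']? = some o ∧ lo ≤ j ∧ j < hi ∧
    ¬ ((k' = k ∨ k' = k + 1) ∧ (j = i ∨ j = i + 1)) ∧ x ∈ strand k' o j} ∪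
    {x | ∃ j, lo ≤ j ∧ j < hi ∧ x ∈ closingArc v.length j} with hR
  have e1 : closedStack lo hi v = R ∪ ((strand k none i ∪ strand (k + 1) (some (i, s)) i) ∪
      (strand k none (i + 1) ∪ strand (k + 1) (some (i, s)) (i + 1))) := by
    apply Subset.antisymm
    · rintro x (⟨k', o, j, hk', h1, h2, hx⟩ | hx)
      · by_cases hF : (k' = k ∨ k' = k + 1) ∧ (j = i ∨ j = i + 1)
        · right
          obtain ⟨rfl | rfl, rfl | rfl⟩ := hF
          all_goals first | rw [vk] at hk' | rw [vk1] at hk'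
          all_goals obtain rfl := Option.some.inj hk'
          exacts [Or.inl (Or.inl hx), Or.inr (Or.inl hx), Or.inl (Or.inr hx), Or.inr (Or.inr hx)]
        · exact Or.inl (Or.inl ⟨k', o, j, hk', h1, h2, hF, hx⟩)
      · exact Or.inl (Or.inr hx)
    · rintro x ((⟨k', o, j, hk', h1, h2, -, hx⟩ | hx) | (hx | hx) | (hx | hx))
      · exact Or.inl ⟨k', o, j, hk', h1, h2, hx⟩
      · exact Or.inr hx
      · exact Or.inl ⟨k, _, i, vk, hlo, by omega, hx⟩
      · exact Or.inl ⟨k + 1, _, i, vk1, hlo, by omega, hx⟩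
      · exact Or.inl ⟨k, _, i + 1, vk, by omega, hhi, hx⟩
      · exact Or.inl ⟨k + 1, _, i + 1, vk1, by omega, hhi, hx⟩
  have e2 : closedStack lo hi v' = R ∪ ((strand k (some (i, s)) i ∪ strand (k + 1) none (i + 1)) ∪
      (strand (k + 1) none i ∪ strand k (some (i, s)) (i + 1))) := by
    -- Away from the positions `i` and `i + 1` both layers consist of vertical strands, so
    -- exchanging them has no effect on the rest.
    have hswap : ∀ k' j, ¬ ((k' = k ∨ k' = k + 1) ∧ (j = i ∨ j = i + 1)) → ∀ x,
        (∃ o, v'[k']? = some o ∧ x ∈ strand k' o j) ↔ ∃ o, v[k']? = some o ∧ x ∈ strand k' o j := by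
      intro k' j hF x
      by_cases hk1 : k' = k
      · subst hk1
        have h1 : j ≠ i := fun h => hF ⟨Or.inl rfl, Or.inl h⟩
        have h2 : j ≠ i + 1 := fun h => hF ⟨Or.inl rfl, Or.inr h⟩
        rw [vk, vk']
        simp [strand_other _ s h1 h2]
      by_cases hk2 : k' = k + 1
      · subst hk2
        have h1 : j ≠ i := fun h => hF ⟨Or.inr rfl, Or.inl h⟩
        have h2 : j ≠ i + 1 := fun h => hF ⟨Or.inr rfl, Or.inr h⟩
        rw [vk1, vk1']
        simp [strand_other _ s h1 h2]
      · rw [hv, hv', getElem?_append_pair v₁ v₂ none (some (i, s)) (some (i, s)) none hk1 hk2]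
    apply Subset.antisymm
    · rintro x (⟨k', o, j, hk', h1, h2, hx⟩ | hx)
      · by_cases hF : (k' = k ∨ k' = k + 1) ∧ (j = i ∨ j = i + 1)
        · right
          obtain ⟨rfl | rfl, rfl | rfl⟩ := hF
          all_goals first | rw [vk'] at hk' | rw [vk1'] at hk'
          all_goals obtain rfl := Option.some.inj hk'
          exacts [Or.inl (Or.inl hx), Or.inr (Or.inr hx), Or.inr (Or.inl hx), Or.inl (Or.inr hx)]
        · obtain ⟨o', ho', hx'⟩ := (hswap k' j hF x).1 ⟨o, hk', hx⟩
          exact Or.inl (Or.inl ⟨k', o', j, ho', h1, h2, hF, hx'⟩)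
      · rw [hlen] at hx
        exact Or.inl (Or.inr hx)
    · rintro x ((⟨k', o, j, hk', h1, h2, hF, hx⟩ | hx) | (hx | hx) | (hx | hx))
      · obtain ⟨o', ho', hx'⟩ := (hswap k' j hF x).2 ⟨o, hk', hx⟩
        exact Or.inl ⟨k', o', j, ho', h1, h2, hx'⟩
      · rw [← hlen] at hx
        exact Or.inr hx
      · exact Or.inl ⟨k, _, i, vk', hlo, by omega, hx⟩
      · exact Or.inl ⟨k + 1, _, i + 1, vk1', by omega, hhi, hx⟩
      · exact Or.inl ⟨k + 1, _, i, vk1', by omega, by omega, hx⟩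
      · exact Or.inl ⟨k, _, i + 1, vk', by omega, hhi, hx⟩
  have hbox : ∀ x ∈ R, (i : ℝ) + 1 / 2 - 1 / 2 ≤ x 0 → x 0 ≤ (i : ℝ) + 1 / 2 + 1 / 2 →
      (k : ℝ) + 1 - 1 < x 1 → x 1 < (k : ℝ) + 1 + 1 → -1 < x 2 → x 2 < 1 → False := by
    rintro x (⟨k', o, j, hk', -, -, hF, hx⟩ | ⟨j, -, -, hx⟩) b1 b2 b3 b4 b5 b6
    · obtain ⟨h1, h2⟩ := strand_height hx
      have hk1 : k ≤ k' := by
        by_contra hcon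
        have : (k' : ℝ) + 1 ≤ k := by exact_mod_cast not_le.1 hcon
        linarith
      have hk2 : k' ≤ k + 1 := by
        by_contra hcon
        have : (k : ℝ) + 1 + 1 ≤ k' := by exact_mod_cast not_le.1 hcon
        linarith
      have hkk : k' = k ∨ k' = k + 1 := by omega
      have hj : ¬ (j = i ∨ j = i + 1) := fun h => hF ⟨hkk, h⟩
      push Not at hj
      have hxv : x ∈ strand k' none j := by
        rcases hkk with rfl | rfl
        · rw [vk] at hk'
          rwa [← Option.some.inj hk'] at hx
        · rw [vk1] at hk'
          rwa [← Option.some.inj hk', strand_other _ s hj.1 hj.2] at hx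
      have hx0 := (mem_vertical hxv).1
      have hj1 : i ≤ j := by
        have : (i : ℝ) ≤ j := by linarith
        exact_mod_cast this
      have hj2 : j ≤ i + 1 := by
        have : (j : ℝ) ≤ i + 1 := by linarith
        exact_mod_cast this
      omega
    · have hL : (k : ℝ) + 2 ≤ v.length := by exact_mod_cast hlenk
      have hk0 : (0 : ℝ) ≤ k := Nat.cast_nonneg k
      rcases (closingArc_cases hx).2 with ⟨h, -⟩ | ⟨h, -⟩ | h | ⟨-, h, -⟩ <;> linarith
  -- Both stacks are isotopic to the one with a single crossing stretched over the two layers. For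
  -- the crossing in the lower layer the picture is read upside down, with `σ = -1`.
  have hup := isotopic_stretch (R := R) (c := i + 1 / 2) (m := k + 1) (σ := 1) (e := elev s)
    (Or.inl rfl) (elev_cases s) hbox
  have hdown := isotopic_stretch (R := R) (c := i + 1 / 2) (m := k + 1) (σ := -1) (e := elev s)
    (Or.inr rfl) (elev_cases s) hbox
  have a1 : (i : ℝ) + 1 / 2 - 1 / 2 = i := by ring
  have a2 : (i : ℝ) + 1 / 2 + 1 / 2 = i + 1 := by ring
  have a3 : (k : ℝ) + 1 - 1 = k := by ring
  have a4 : (i : ℝ) + 1 / 2 - -1 / 2 = i + 1 := by ring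
  have a5 : (i : ℝ) + 1 / 2 + -1 / 2 = i := by ring
  have a6 : (k : ℝ) + 1 - -1 = k + 1 + 1 := by ring
  have a7 : (k : ℝ) + 1 + -1 = k := by ring
  have a8 : (k : ℝ) + 1 + -1 / 2 = k + 1 / 2 := by ring
  simp only [a1, a2, a3] at hup
  simp only [a4, a5, a6, a7, a8] at hdown
  have f1 : closedStack lo hi v = R ∪
      ((segment ℝ ![(i : ℝ), k, 0] ![(i : ℝ), k + 1, 0] ∪
        segment ℝ ![(i : ℝ), k + 1, 0] ![(i : ℝ) + 1, k + 1 + 1, 0]) ∪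
      (segment ℝ ![(i : ℝ) + 1, k, 0] ![(i : ℝ) + 1, k + 1, 0] ∪
        segment ℝ ![(i : ℝ) + 1, k + 1, 0] ![(i : ℝ) + 1 / 2, k + 1 + 1 / 2, elev s] ∪
        segment ℝ ![(i : ℝ) + 1 / 2, k + 1 + 1 / 2, elev s] ![(i : ℝ), k + 1 + 1, 0])) := by
    rw [e1, strand_none, strand_none, strand_left, strand_right]
    push_cast
    simp only [union_assoc]
  have f2 : closedStack lo hi v' = R ∪
      ((segment ℝ ![(i : ℝ) + 1, k + 1 + 1, 0] ![(i : ℝ) + 1, k + 1, 0] ∪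
        segment ℝ ![(i : ℝ) + 1, k + 1, 0] ![(i : ℝ), k, 0]) ∪
      (segment ℝ ![(i : ℝ), k + 1 + 1, 0] ![(i : ℝ), k + 1, 0] ∪
        segment ℝ ![(i : ℝ), k + 1, 0] ![(i : ℝ) + 1 / 2, k + 1 / 2, elev s] ∪
        segment ℝ ![(i : ℝ) + 1 / 2, k + 1 / 2, elev s] ![(i : ℝ) + 1, k, 0])) := by
    rw [e2, strand_none, strand_none, strand_left, strand_right]
    push_cast
    rw [segment_symm ℝ ![(i : ℝ) + 1, (k : ℝ) + 1 + 1, 0],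
      segment_symm ℝ ![(i : ℝ), (k : ℝ) + 1 + 1, 0],
      segment_symm ℝ ![(i : ℝ) + 1, (k : ℝ) + 1, 0] ![(i : ℝ), (k : ℝ), 0],
      segment_symm ℝ ![(i : ℝ), (k : ℝ) + 1, 0] ![(i : ℝ) + 1 / 2, _, _],
      segment_symm ℝ ![(i : ℝ) + 1 / 2, (k : ℝ) + 1 / 2, elev s] ![(i : ℝ) + 1, _, _]]
    exact union_rearrange _ _ _ _ _ _
  rw [f1, f2]
  refine hup.trans (Isotopic.symm ?_)
  convert hdown using 1
  rw [segment_symm ℝ ![(i : ℝ) + 1, (k : ℝ) + 1 + 1, 0] ![(i : ℝ), (k : ℝ), 0],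
    segment_symm ℝ ![(i : ℝ), (k : ℝ) + 1 + 1, 0],
    segment_symm ℝ ![(i : ℝ) + 1 / 2, (k : ℝ) + 1, elev s] ![(i : ℝ) + 1, _, _]]
  ac_rfl

/-- The pieces are exchanged one at a time. At each stage some of the other pieces are already new
and some still old, so the hypothesis admits both among the rest. -/
theorem isotopic_biUnion (s : Finset ℕ) {X Y : ℕ → Set R3} {B : Set R3}
    (h : ∀ j ∈ s, ∀ R : Set R3, (∀ x ∈ R, x ∈ B ∨ ∃ i ∈ s, i ≠ j ∧ (x ∈ X i ∨ x ∈ Y i)) →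
      Isotopic (R ∪ X j) (R ∪ Y j)) :
    Isotopic (B ∪ ⋃ j ∈ s, X j) (B ∪ ⋃ j ∈ s, Y j) := by
  induction s using Finset.induction_on generalizing B with
  | empty => simpa using isotopic_refl B
  | insert a s ha ih =>
    rw [Finset.set_biUnion_insert, Finset.set_biUnion_insert]
    have h1 := h a (Finset.mem_insert_self a s) (B ∪ ⋃ j ∈ s, X j) (by
      rintro x (hx | hx)
      · exact Or.inl hx
      · simp only [mem_iUnion] at hx
        obtain ⟨i, hi, hx⟩ := hx
        exact Or.inr ⟨i, Finset.mem_insert_of_mem hi, fun e => ha (e ▸ hi), Or.inl hx⟩)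
    have h2 := ih (B := B ∪ Y a) (by
      intro j hj R hR
      refine h j (Finset.mem_insert_of_mem hj) R fun x hx => ?_
      rcases hR x hx with (h1 | h1) | ⟨i, hi, hij, h1⟩
      · exact Or.inl h1
      · exact Or.inr ⟨a, Finset.mem_insert_self a s, fun e => ha (e ▸ hj), Or.inr h1⟩
      · exact Or.inr ⟨i, Finset.mem_insert_of_mem hi, hij, h1⟩)
    rw [← union_assoc, union_right_comm, ← union_assoc B]
    refine h1.trans ?_
    rw [union_right_comm]
    exact h2

theorem closedStack_eq_biUnion (lo hi : ℕ) (v : List (Option (ℕ × Bool))) :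
    closedStack lo hi v = {x | ∃ k o j, v[k]? = some o ∧ lo ≤ j ∧ j < hi ∧ x ∈ strand k o j} ∪
      ⋃ j ∈ Finset.Ico lo hi, closingArc v.length j := by
  ext x
  simp only [closedStack, mem_union, mem_ofPred_eq, mem_iUnion, Finset.mem_Ico, exists_prop,
    and_assoc]

-- The corners `c` and `d` of the higher arc are removed. Both triangles lie in the plane of the arc
-- at height at least `L`, where the rest has no points above height `L` and at height `L` only
-- points with last coordinate `0`.
set_option maxHeartbeats 1000000 in
theorem isotopic_lower_arc {R : Set R3} {L j : ℕ}
    (hR : ∀ x ∈ R, x 0 = j → x 1 ≤ L ∧ (x 1 = L → x 2 = 0)) :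
    Isotopic (R ∪ (strand L none j ∪ closingArc (L + 1) j)) (R ∪ closingArc L j) := by
  have hL : (0 : ℝ) ≤ L := Nat.cast_nonneg L
  rw [strand_none, closingArc, closingArc]
  push_cast
  set b₀ : R3 := ![(j : ℝ), L, 0] with hb
  set c : R3 := ![(j : ℝ), L + 1, 0] with hc
  set d : R3 := ![(j : ℝ), L + 1, 1] with hd
  set e : R3 := ![(j : ℝ), L, 1] with he
  set g : R3 := ![(j : ℝ), -1, 1] with hg
  set h : R3 := ![(j : ℝ), -1, 0] with hh
  set o : R3 := ![(j : ℝ), 0, 0] with ho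
  have s1 : Isotopic (R ∪ (segment ℝ b₀ d ∪ segment ℝ d g ∪ segment ℝ g h ∪ segment ℝ h o))
      (R ∪ (segment ℝ b₀ c ∪ (segment ℝ c d ∪ segment ℝ d g ∪ segment ℝ g h ∪ segment ℝ h o))) := by
    refine isotopic_vertex (R := R ∪ (segment ℝ d g ∪ segment ℝ g h ∪ segment ℝ h o)) b₀ d c 2 1
      (by simp [hb, hc, hd]) ?_ (by ac_rfl) (by ac_rfl)
    intro x hx β γ hβ hγ hs e0 e1 e2
    simp only [hb, hc, hd, Matrix.cons_val] at e0 e1 e2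
    rcases hx with hx | (hx | hx) | hx
    · have := (hR x hx (by linarith)).1
      exact ⟨by linarith, Or.inl (by linarith)⟩
    · obtain ⟨t, ht0, ht1, f0, f1, f2⟩ := mem_segment_coord hx
      simp only [hd, hg, Matrix.cons_val] at f0 f1 f2
      exact ⟨by linarith, Or.inr (by linarith)⟩
    · obtain ⟨t, ht0, ht1, f0, f1, f2⟩ := mem_segment_coord hx
      simp only [hh, hg, Matrix.cons_val] at f0 f1 f2
      exfalso; linarith
    · obtain ⟨t, ht0, ht1, f0, f1, f2⟩ := mem_segment_coord hx
      simp only [hh, ho, Matrix.cons_val] at f0 f1 f2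
      exact ⟨by linarith, Or.inl (by linarith)⟩
  have hdg : segment ℝ d g = segment ℝ d e ∪ segment ℝ e g := by
    have hm : e ∈ segment ℝ d g := by
      have hpos : (0 : ℝ) < L + 2 := by linarith
      refine mem_segment_of_coord (t := 1 / (L + 2)) (by positivity)
        ((div_le_one hpos).2 (by linarith)) ?_ ?_ ?_
      · simp [hd, he, hg]
      · simp only [hd, he, hg, Matrix.cons_val]; field_simp; ring
      · simp [hd, he, hg]
    rw [segment_split hm, segment_symm ℝ e d]
  have s2 : Isotopic (R ∪ (segment ℝ b₀ e ∪ segment ℝ e g ∪ segment ℝ g h ∪ segment ℝ h o))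
      (R ∪ (segment ℝ b₀ d ∪ segment ℝ d g ∪ segment ℝ g h ∪ segment ℝ h o)) := by
    rw [hdg]
    refine isotopic_vertex (R := R ∪ (segment ℝ e g ∪ segment ℝ g h ∪ segment ℝ h o)) b₀ e d 2 1
      (by simp [hb, he, hd]) ?_ (by ac_rfl) (by ac_rfl)
    intro x hx β γ hβ hγ hs e0 e1 e2
    simp only [hb, he, hd, Matrix.cons_val] at e0 e1 e2
    rcases hx with hx | (hx | hx) | hx
    · obtain ⟨h1, h2⟩ := hR x hx (by linarith)
      have hγ0 : γ = 0 := by linarith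
      have := h2 (by rw [e1, hγ0]; ring)
      exact ⟨by linarith, Or.inl (by linarith)⟩
    · obtain ⟨t, ht0, ht1, f0, f1, f2⟩ := mem_segment_coord hx
      simp only [he, hg, Matrix.cons_val] at f0 f1 f2
      have : γ = 0 := by nlinarith
      exact ⟨by linarith, Or.inr (by linarith)⟩
    · obtain ⟨t, ht0, ht1, f0, f1, f2⟩ := mem_segment_coord hx
      simp only [hh, hg, Matrix.cons_val] at f0 f1 f2
      exfalso; linarith
    · obtain ⟨t, ht0, ht1, f0, f1, f2⟩ := mem_segment_coord hx
      simp only [hh, ho, Matrix.cons_val] at f0 f1 f2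
      exact ⟨by linarith, Or.inl (by linarith)⟩
  exact (s2.trans s1).symm

theorem closedStack_top (lo hi : ℕ) (v : List (Option (ℕ × Bool))) :
    Isotopic (closedStack lo hi (v ++ [none])) (closedStack lo hi v) := by
  set B : Set R3 := {x | ∃ k o j, v[k]? = some o ∧ lo ≤ j ∧ j < hi ∧ x ∈ strand k o j} with hB
  have e1 : closedStack lo hi (v ++ [none]) = B ∪ ⋃ j ∈ Finset.Ico lo hi,
      (strand v.length none j ∪ closingArc (v.length + 1) j) := by
    ext x
    simp only [closedStack, hB, mem_union, mem_ofPred_eq, mem_iUnion, Finset.mem_Ico, exists_prop,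
      List.length_append, List.length_singleton]
    constructor
    · rintro (⟨k, o, j, hk, h1, h2, hx⟩ | ⟨j, h1, h2, hx⟩)
      · rcases lt_or_ge k v.length with h | h
        · rw [List.getElem?_append_left h] at hk
          exact Or.inl ⟨k, o, j, hk, h1, h2, hx⟩
        · rw [List.getElem?_append_right h, List.getElem?_singleton] at hk
          split_ifs at hk with h3
          obtain rfl : k = v.length := by omega
          obtain rfl := Option.some.inj hk
          exact Or.inr ⟨j, ⟨h1, h2⟩, Or.inl hx⟩
      · exact Or.inr ⟨j, ⟨h1, h2⟩, Or.inr hx⟩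
    · rintro (⟨k, o, j, hk, h1, h2, hx⟩ | ⟨j, ⟨h1, h2⟩, hx | hx⟩)
      · have h := (List.getElem?_eq_some_iff.1 hk).1
        exact Or.inl ⟨k, o, j, by rw [List.getElem?_append_left h]; exact hk, h1, h2, hx⟩
      · exact Or.inl ⟨v.length, none, j, by simp, h1, h2, hx⟩
      · exact Or.inr ⟨j, h1, h2, hx⟩
  rw [e1, closedStack_eq_biUnion]
  refine isotopic_biUnion _ fun j _ R hR => isotopic_lower_arc fun x hx hx0 => ?_
  rcases hR x hx with ⟨k, o, j', hk, -, -, hx⟩ | ⟨i, -, hij, hx⟩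
  · have hk' : (k : ℝ) + 1 ≤ v.length := by exact_mod_cast (List.getElem?_eq_some_iff.1 hk).1
    have hh := strand_height hx
    exact ⟨by linarith, fun h => (strand_top hx (by linarith)).2⟩
  · exfalso
    apply hij
    have : x 0 = i := by
      rcases hx with (hx | hx) | hx
      exacts [(mem_vertical hx).1, (closingArc_cases hx).1, (closingArc_cases hx).1]
    rw [hx0] at this
    exact_mod_cast this.symm

/-- Layers without crossings can be removed. -/
theorem closedStack_remove (lo hi : ℕ) (v₁ v₂ : List (Option (ℕ × Bool)))
    (hv : ∀ i s, some (i, s) ∈ v₂ → lo ≤ i ∧ i + 1 < hi) :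
    Isotopic (closedStack lo hi (v₁ ++ none :: v₂)) (closedStack lo hi (v₁ ++ v₂)) := by
  induction v₂ generalizing v₁ with
  | nil => simpa using closedStack_top lo hi v₁
  | cons o v₂ ih =>
    have h2 := ih (v₁ ++ [o]) fun i s h => hv i s (List.mem_cons_of_mem _ h)
    rw [List.append_assoc, List.append_assoc, List.singleton_append, List.singleton_append] at h2
    match o with
    | none => exact h2
    | some (i, s) =>
      obtain ⟨h3, h4⟩ := hv i s (by simp)
      exact (closedStack_slide lo hi v₁ v₂ s h3 h4).trans h2

theorem closedStack_filter (lo hi : ℕ) (v₁ v₂ : List (Option (ℕ × Bool)))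
    (hv : ∀ i s, some (i, s) ∈ v₂ → lo ≤ i ∧ i + 1 < hi) :
    Isotopic (closedStack lo hi (v₁ ++ v₂)) (closedStack lo hi (v₁ ++ v₂.filter (·.isSome))) := by
  induction v₂ generalizing v₁ with
  | nil => simpa using isotopic_refl _
  | cons o v₂ ih =>
    have hv' : ∀ i s, some (i, s) ∈ v₂ → lo ≤ i ∧ i + 1 < hi := fun i s h =>
      hv i s (List.mem_cons_of_mem _ h)
    match o with
    | none => simpa using (closedStack_remove lo hi v₁ v₂ hv').trans (ih v₁ hv')
    | some (i, s) => simpa using ih (v₁ ++ [some (i, s)]) hv'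

/-! ### Stabilization -/

set_option maxHeartbeats 2000000 in
/-- The path of a new strand in a stabilization. -/
theorem isotopic_loop {R : Set R3} {N L e : ℝ} (hL : 0 ≤ L) (he : e = 1 / 2)
    (hR : ∀ x ∈ R, x 0 ≤ N ∧ (x 0 = N → x 2 = 0 → L ≤ x 1 → x 1 ≤ L + 1 → x 1 = L ∨ x 1 = L + 1)) :
    Isotopic (R ∪ segment ℝ ![N, L, 0] ![N, L + 1, 0])
      (R ∪ (segment ℝ ![N, L, 0] ![N + 1, L + 1, 0] ∪
        segment ℝ ![N + 1, L + 1, 0] ![N + 1, L + 1, 1] ∪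
        segment ℝ ![N + 1, L + 1, 1] ![N + 1, -1, 1] ∪
        segment ℝ ![N + 1, -1, 1] ![N + 1, -1, 0] ∪ segment ℝ ![N + 1, -1, 0] ![N + 1, L, 0] ∪
        segment ℝ ![N + 1, L, 0] ![N + 1 / 2, L + 1 / 2, e] ∪
        segment ℝ ![N + 1 / 2, L + 1 / 2, e] ![N, L + 1, 0])) := by
  subst he
  set a₀ : R3 := ![N, L, 0] with ha
  set b₀ : R3 := ![N, L + 1, 0] with hb
  set B : R3 := ![N + 1, L + 1, 0] with hB
  set D : R3 := ![N + 1, L + 1, 1] with hD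
  set E : R3 := ![N + 1, -1, 1] with hE
  set F : R3 := ![N + 1, -1, 0] with hF
  set H : R3 := ![N + 1, L, 0] with hH
  set q : R3 := ![N + 1 / 2, L + 1 / 2, 1 / 2] with hq
  -- The loop is built from the vertical segment by six insertions of a vertex. All new vertices
  -- have first coordinate larger than `N`, so the rest can meet the triangles only on the original
  -- segment; the remaining checks concern the loop itself.
  have s1 : Isotopic (R ∪ segment ℝ a₀ b₀) (R ∪ (segment ℝ a₀ q ∪ segment ℝ q b₀)) := by
    refine isotopic_vertex (R := R) a₀ b₀ q 1 0 (by simp [ha, hb, hq]) ?_ rfl rfl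
    intro x hx β γ hβ hγ hs e0 e1 e2
    simp only [ha, hb, hq, Matrix.cons_val] at e0 e1 e2
    obtain ⟨h1, h2⟩ := hR x hx
    have hγ0 : γ = 0 := by linarith
    rw [hγ0] at e0 e1 e2
    refine ⟨hγ0, ?_⟩
    rcases h2 (by linarith) (by linarith) (by linarith) (by linarith) with h | h
    · exact Or.inl (by linarith)
    · exact Or.inr (by linarith)
  have s2 : Isotopic (R ∪ (segment ℝ a₀ q ∪ segment ℝ q b₀))
      (R ∪ (segment ℝ a₀ H ∪ segment ℝ H q ∪ segment ℝ q b₀)) := by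
    refine isotopic_vertex (R := R ∪ segment ℝ q b₀) a₀ q H 1 0 (by simp [ha, hH, hq]) ?_
      (by ac_rfl) (by ac_rfl)
    intro x hx β γ hβ hγ hs e0 e1 e2
    simp only [ha, hH, hq, Matrix.cons_val] at e0 e1 e2
    rcases hx with hx | hx
    · have := (hR x hx).1
      exact ⟨by linarith, Or.inl (by linarith)⟩
    · obtain ⟨t, ht0, ht1, f0, f1, f2⟩ := mem_segment_coord hx
      simp only [hq, hb, Matrix.cons_val] at f0 f1 f2
      exact ⟨by linarith, Or.inr (by linarith)⟩
  have s3 : Isotopic (R ∪ (segment ℝ a₀ H ∪ segment ℝ H q ∪ segment ℝ q b₀))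
      (R ∪ (segment ℝ a₀ B ∪ segment ℝ B H ∪ segment ℝ H q ∪ segment ℝ q b₀)) := by
    refine isotopic_vertex (R := R ∪ (segment ℝ H q ∪ segment ℝ q b₀)) a₀ H B 0 1
      (by simp [ha, hH, hB]) ?_ (by ac_rfl) (by ac_rfl)
    intro x hx β γ hβ hγ hs e0 e1 e2
    simp only [ha, hH, hB, Matrix.cons_val] at e0 e1 e2
    rcases hx with hx | hx | hx
    · have := (hR x hx).1
      exact ⟨by linarith, Or.inl (by linarith)⟩
    · obtain ⟨t, ht0, ht1, f0, f1, f2⟩ := mem_segment_coord hx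
      simp only [hq, hH, Matrix.cons_val] at f0 f1 f2
      exact ⟨by linarith, Or.inr (by linarith)⟩
    · obtain ⟨t, ht0, ht1, f0, f1, f2⟩ := mem_segment_coord hx
      simp only [hq, hb, Matrix.cons_val] at f0 f1 f2
      exfalso; linarith
  have s4 : Isotopic (R ∪ (segment ℝ a₀ B ∪ segment ℝ B H ∪ segment ℝ H q ∪ segment ℝ q b₀))
      (R ∪ (segment ℝ a₀ B ∪ segment ℝ B E ∪ segment ℝ E H ∪ segment ℝ H q ∪ segment ℝ q b₀)) := by
    refine isotopic_vertex (R := R ∪ (segment ℝ a₀ B ∪ segment ℝ H q ∪ segment ℝ q b₀)) B H E 1 2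
      (by simp [hE, hH, hB]) ?_ (by ac_rfl) (by ac_rfl)
    intro x hx β γ hβ hγ hs e0 e1 e2
    simp only [hE, hH, hB, Matrix.cons_val] at e0 e1 e2
    rcases hx with hx | (hx | hx) | hx
    · have := (hR x hx).1
      exfalso; linarith
    · obtain ⟨t, ht0, ht1, f0, f1, f2⟩ := mem_segment_coord hx
      simp only [ha, hB, Matrix.cons_val] at f0 f1 f2
      have h1 : γ = 0 := by linarith
      rw [h1] at e1
      exact ⟨h1, Or.inl (by linarith)⟩
    · obtain ⟨t, ht0, ht1, f0, f1, f2⟩ := mem_segment_coord hx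
      simp only [hq, hH, Matrix.cons_val] at f0 f1 f2
      have h1 : γ = 0 := by linarith
      rw [h1] at e1
      exact ⟨h1, Or.inr (by linarith)⟩
    · obtain ⟨t, ht0, ht1, f0, f1, f2⟩ := mem_segment_coord hx
      simp only [hq, hb, Matrix.cons_val] at f0 f1 f2
      exfalso; linarith
  have s5 : Isotopic
      (R ∪ (segment ℝ a₀ B ∪ segment ℝ B E ∪ segment ℝ E H ∪ segment ℝ H q ∪ segment ℝ q b₀))
      (R ∪ (segment ℝ a₀ B ∪ segment ℝ B E ∪ segment ℝ E F ∪ segment ℝ F H ∪ segment ℝ H q ∪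
        segment ℝ q b₀)) := by
    refine isotopic_vertex (R := R ∪ (segment ℝ a₀ B ∪ segment ℝ B E ∪ segment ℝ H q ∪
      segment ℝ q b₀)) E H F 1 2 ?_ ?_ (by ac_rfl) (by ac_rfl)
    · simp [hE, hH, hF]; intro h; linarith
    intro x hx β γ hβ hγ hs e0 e1 e2
    simp only [hE, hH, hF, Matrix.cons_val] at e0 e1 e2
    rcases hx with hx | ((hx | hx) | hx) | hx
    · have := (hR x hx).1
      exfalso; linarith
    · obtain ⟨t, ht0, ht1, f0, f1, f2⟩ := mem_segment_coord hx
      simp only [ha, hB, Matrix.cons_val] at f0 f1 f2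
      exfalso; nlinarith
    · obtain ⟨t, ht0, ht1, f0, f1, f2⟩ := mem_segment_coord hx
      simp only [hE, hB, Matrix.cons_val] at f0 f1 f2
      have h1 : t = 1 - β - γ := by linarith
      rw [h1] at f1
      have h2 : γ * (L + 1) + (β + γ) = 0 := by linear_combination e1 - f1
      have h3 : 0 ≤ γ * (L + 1) := by positivity
      exact ⟨by linarith, Or.inl (by linarith)⟩
    · obtain ⟨t, ht0, ht1, f0, f1, f2⟩ := mem_segment_coord hx
      simp only [hq, hH, Matrix.cons_val] at f0 f1 f2
      have h1 : β + γ = 1 := by linarith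
      have h2 : γ * (L + 1) = 0 := by
        have : β = 1 - γ := by linarith
        rw [this] at e1
        have ht : t = 0 := by linarith
        rw [ht] at f1
        linear_combination e1 - f1
      have h3 : γ = 0 := (mul_eq_zero.1 h2).resolve_right (by linarith)
      exact ⟨h3, Or.inr (by linarith)⟩
    · obtain ⟨t, ht0, ht1, f0, f1, f2⟩ := mem_segment_coord hx
      simp only [hq, hb, Matrix.cons_val] at f0 f1 f2
      exfalso; linarith
  have s6 : Isotopic
      (R ∪ (segment ℝ a₀ B ∪ segment ℝ B E ∪ segment ℝ E F ∪ segment ℝ F H ∪ segment ℝ H q ∪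
        segment ℝ q b₀))
      (R ∪ (segment ℝ a₀ B ∪ segment ℝ B D ∪ segment ℝ D E ∪ segment ℝ E F ∪ segment ℝ F H ∪
        segment ℝ H q ∪ segment ℝ q b₀)) := by
    refine isotopic_vertex (R := R ∪ (segment ℝ a₀ B ∪ segment ℝ E F ∪ segment ℝ F H ∪
      segment ℝ H q ∪ segment ℝ q b₀)) B E D 1 2 ?_ ?_ (by ac_rfl) (by ac_rfl)
    · simp [hE, hB, hD]; intro h; linarith
    intro x hx β γ hβ hγ hs e0 e1 e2
    simp only [hE, hB, hD, Matrix.cons_val] at e0 e1 e2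
    have z0 : x 2 = 0 → γ = 0 ∧ β = 0 := fun h => ⟨by linarith, by linarith⟩
    rcases hx with hx | (((hx | hx) | hx) | hx) | hx
    · have := (hR x hx).1
      exfalso; linarith
    · obtain ⟨t, ht0, ht1, f0, f1, f2⟩ := mem_segment_coord hx
      simp only [ha, hB, Matrix.cons_val] at f0 f1 f2
      obtain ⟨h1, h2⟩ := z0 (by linarith)
      exact ⟨h1, Or.inl h2⟩
    · obtain ⟨t, ht0, ht1, f0, f1, f2⟩ := mem_segment_coord hx
      simp only [hE, hF, Matrix.cons_val] at f0 f1 f2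
      have h1 : (1 - β) * (L + 2) = 0 := by linear_combination f1 - e1
      have h2 : β = 1 := by
        linarith [(mul_eq_zero.1 h1).resolve_right (by linarith)]
      exact ⟨by linarith, Or.inr h2⟩
    · obtain ⟨t, ht0, ht1, f0, f1, f2⟩ := mem_segment_coord hx
      simp only [hF, hH, Matrix.cons_val] at f0 f1 f2
      obtain ⟨h1, h2⟩ := z0 (by linarith)
      exact ⟨h1, Or.inl h2⟩
    · obtain ⟨t, ht0, ht1, f0, f1, f2⟩ := mem_segment_coord hx
      simp only [hq, hH, Matrix.cons_val] at f0 f1 f2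
      obtain ⟨h1, h2⟩ := z0 (by linarith)
      exact ⟨h1, Or.inl h2⟩
    · obtain ⟨t, ht0, ht1, f0, f1, f2⟩ := mem_segment_coord hx
      simp only [hq, hb, Matrix.cons_val] at f0 f1 f2
      exfalso; linarith
  exact s1.trans (s2.trans (s3.trans (s4.trans (s5.trans s6))))

/-- Vertical segments in successive layers form one segment. -/
theorem mem_vertical_iff {x : R3} {L j : ℕ} : x ∈ segment ℝ ![(j : ℝ), -1, 0] ![(j : ℝ), L, 0] ↔
    x ∈ segment ℝ ![(j : ℝ), -1, 0] ![(j : ℝ), 0, 0] ∨ ∃ k < L, x ∈ strand k none j := by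
  have hL : (0 : ℝ) ≤ L := Nat.cast_nonneg L
  have key : ∀ y₀ y₁ : ℝ, y₀ < y₁ → (x ∈ segment ℝ ![(j : ℝ), y₀, 0] ![(j : ℝ), y₁, 0] ↔
      x 0 = j ∧ x 2 = 0 ∧ y₀ ≤ x 1 ∧ x 1 ≤ y₁) := by
    intro y₀ y₁ hy
    constructor
    · intro h
      obtain ⟨t, h0, h1, e0, e1, e2⟩ := mem_segment_coord h
      simp only [Matrix.cons_val] at e0 e1 e2
      exact ⟨by linarith, by linarith, by nlinarith, by nlinarith⟩
    · rintro ⟨h0, h2, h3, h4⟩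
      have hpos : 0 < y₁ - y₀ := by linarith
      refine mem_segment_of_coord (t := (x 1 - y₀) / (y₁ - y₀)) (div_nonneg (by linarith) hpos.le)
        ((div_le_one hpos).2 (by linarith)) ?_ ?_ ?_
      · simp [h0]
      · simp only [Matrix.cons_val]; field_simp; ring
      · simp [h2]
  simp only [strand_none]
  rw [key _ _ (by linarith), key _ _ (by norm_num)]
  constructor
  · rintro ⟨h0, h2, h3, h4⟩
    by_cases h : x 1 ≤ 0
    · exact Or.inl ⟨h0, h2, h3, h⟩
    · right
      push Not at h
      have hc : 0 < ⌈x 1⌉₊ := Nat.ceil_pos.2 h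
      have hc' : ((⌈x 1⌉₊ - 1 : ℕ) : ℝ) = (⌈x 1⌉₊ : ℝ) - 1 := by
        rw [Nat.cast_sub hc, Nat.cast_one]
      have hle := Nat.le_ceil (x 1)
      have hlt := Nat.ceil_lt_add_one h.le
      have hcL : ⌈x 1⌉₊ ≤ L := Nat.ceil_le.2 h4
      refine ⟨⌈x 1⌉₊ - 1, by omega, (key _ _ (by linarith)).2 ⟨h0, h2, ?_, ?_⟩⟩
      · rw [hc']; linarith
      · rw [hc']; linarith
  · rintro (⟨h0, h2, h3, h4⟩ | ⟨k, hk, h⟩)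
    · exact ⟨h0, h2, h3, by linarith⟩
    · obtain ⟨h0, h2, h3, h4⟩ := (key _ _ (by linarith)).1 h
      have hk0 : (0 : ℝ) ≤ k := Nat.cast_nonneg k
      have hk1 : (k : ℝ) + 1 ≤ L := by exact_mod_cast hk
      exact ⟨h0, h2, by linarith, by linarith⟩

set_option maxHeartbeats 1000000 in
/-- Stabilization. -/
theorem closedStack_stabilize (N : ℕ) (v : List (Option (ℕ × Bool)))
    (hv : ∀ i s, some (i, s) ∈ v → i + 1 < N + 1) :
    Isotopic (closedStack 0 (N + 1) v) (closedStack 0 (N + 2) (v ++ [some (N, true)])) := by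
  -- A layer without crossings is first added on top; its last vertical strand is the one that is
  -- replaced by the loop around the axis.
  refine (closedStack_top 0 (N + 1) v).symm.trans ?_
  set L := v.length with hL
  have hget : ∀ (o : Option (ℕ × Bool)) {k : ℕ} {o' : Option (ℕ × Bool)},
      (v ++ [o])[k]? = some o' ↔ v[k]? = some o' ∨ k = L ∧ o' = o := by
    intro o k o'
    rcases lt_trichotomy k v.length with h | h | h
    · rw [List.getElem?_append_left h]
      constructor
      · exact Or.inl
      · rintro (h1 | h1)
        exacts [h1, absurd h1.1 (by omega)]
    · subst h
      simp [hL, eq_comm]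
    · rw [List.getElem?_eq_none (by simp; omega), List.getElem?_eq_none (by omega)]
      simp; omega
  have hlt : ∀ {k : ℕ} {o : Option (ℕ × Bool)}, v[k]? = some o → k < L := fun h =>
    (List.getElem?_eq_some_iff.1 h).1
  set R : Set R3 := {x | ∃ k o j, v[k]? = some o ∧ j < N + 1 ∧ x ∈ strand k o j} ∪
    {x | ∃ j < N, x ∈ strand L none j} ∪ {x | ∃ j < N + 1, x ∈ closingArc (L + 1) j} with hR
  have e1 : closedStack 0 (N + 1) (v ++ [none]) = R ∪ strand L none N := by
    apply Subset.antisymm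
    · rintro x (⟨k, o, j, hk, -, hj, hx⟩ | ⟨j, -, hj, hx⟩)
      · rcases (hget none).1 hk with h | ⟨rfl, rfl⟩
        · exact Or.inl (Or.inl (Or.inl ⟨k, o, j, h, hj, hx⟩))
        · rcases (Nat.lt_succ_iff.1 hj).lt_or_eq with h | rfl
          · exact Or.inl (Or.inl (Or.inr ⟨j, h, hx⟩))
          · exact Or.inr hx
      · exact Or.inl (Or.inr ⟨j, hj, by simpa [hL] using hx⟩)
    · rintro x (((⟨k, o, j, hk, hj, hx⟩ | ⟨j, hj, hx⟩) | ⟨j, hj, hx⟩) | hx)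
      · exact Or.inl ⟨k, o, j, (hget none).2 (Or.inl hk), Nat.zero_le _, hj, hx⟩
      · exact Or.inl ⟨L, none, j, (hget none).2 (Or.inr ⟨rfl, rfl⟩), Nat.zero_le _, by omega, hx⟩
      · exact Or.inr ⟨j, Nat.zero_le _, hj, by simpa [hL] using hx⟩
      · exact Or.inl ⟨L, none, N, (hget none).2 (Or.inr ⟨rfl, rfl⟩), Nat.zero_le _, by omega, hx⟩
  have hnew : ∀ {k : ℕ} {o : Option (ℕ × Bool)}, v[k]? = some o →
      strand k o (N + 1) = strand k none (N + 1) := by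
    intro k o hk
    match o with
    | none => rfl
    | some (i, s) =>
      have := hv i s (List.mem_of_getElem? hk)
      exact strand_other k s (by omega) (by omega)
  have e2 : closedStack 0 (N + 2) (v ++ [some (N, true)]) = R ∪
      (segment ℝ ![(N : ℝ), L, 0] ![(N : ℝ) + 1, L + 1, 0] ∪
        segment ℝ ![(N : ℝ) + 1, L + 1, 0] ![(N : ℝ) + 1, L + 1, 1] ∪
        segment ℝ ![(N : ℝ) + 1, L + 1, 1] ![(N : ℝ) + 1, -1, 1] ∪
        segment ℝ ![(N : ℝ) + 1, -1, 1] ![(N : ℝ) + 1, -1, 0] ∪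
        segment ℝ ![(N : ℝ) + 1, -1, 0] ![(N : ℝ) + 1, L, 0] ∪
        segment ℝ ![(N : ℝ) + 1, L, 0] ![(N : ℝ) + 1 / 2, L + 1 / 2, 1 / 2] ∪
        segment ℝ ![(N : ℝ) + 1 / 2, L + 1 / 2, 1 / 2] ![(N : ℝ), L + 1, 0]) := by
    have hvert := fun x : R3 => mem_vertical_iff (x := x) (L := L) (j := N + 1)
    push_cast at hvert
    have harc : closingArc (L + 1) (N + 1) =
        segment ℝ ![(N : ℝ) + 1, L + 1, 0] ![(N : ℝ) + 1, L + 1, 1] ∪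
        segment ℝ ![(N : ℝ) + 1, L + 1, 1] ![(N : ℝ) + 1, -1, 1] ∪
        segment ℝ ![(N : ℝ) + 1, -1, 1] ![(N : ℝ) + 1, -1, 0] ∪
        segment ℝ ![(N : ℝ) + 1, -1, 0] ![(N : ℝ) + 1, 0, 0] := by
      rw [closingArc]; push_cast; rfl
    have hst : strand L (some (N, true)) (N + 1) =
        segment ℝ ![(N : ℝ) + 1, L, 0] ![(N : ℝ) + 1 / 2, L + 1 / 2, 1 / 2] ∪
        segment ℝ ![(N : ℝ) + 1 / 2, L + 1 / 2, 1 / 2] ![(N : ℝ), L + 1, 0] := by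
      rw [strand_right]; simp [elev]
    have hlast := (hget (some (N, true))).2 (Or.inr ⟨rfl, rfl⟩)
    apply Subset.antisymm
    · rintro x (⟨k, o, j, hk, -, hj, hx⟩ | ⟨j, -, hj, hx⟩)
      · rcases (hget _).1 hk with h | ⟨rfl, rfl⟩
        · rcases (Nat.lt_succ_iff.1 hj).lt_or_eq with h1 | rfl
          · exact Or.inl (Or.inl (Or.inl ⟨k, o, j, h, h1, hx⟩))
          · rw [hnew h] at hx
            exact Or.inr (Or.inl (Or.inl (Or.inr ((hvert x).2 (Or.inr ⟨k, hlt h, hx⟩)))))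
        · rcases (Nat.lt_succ_iff.1 hj).lt_or_eq with h1 | rfl
          · rcases (Nat.lt_succ_iff.1 h1).lt_or_eq with h2 | rfl
            · rw [strand_other _ _ (by omega) (by omega)] at hx
              exact Or.inl (Or.inl (Or.inr ⟨j, h2, hx⟩))
            · rw [strand_left] at hx
              exact Or.inr (Or.inl (Or.inl (Or.inl (Or.inl (Or.inl (Or.inl hx))))))
          · rw [hst] at hx
            rcases hx with hx | hx
            · exact Or.inr (Or.inl (Or.inr hx))
            · exact Or.inr (Or.inr hx)
      · rw [List.length_append, List.length_singleton] at hx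
        rcases (Nat.lt_succ_iff.1 hj).lt_or_eq with h1 | rfl
        · exact Or.inl (Or.inr ⟨j, h1, hx⟩)
        · rw [harc] at hx
          rcases hx with ((hx | hx) | hx) | hx
          · exact Or.inr (Or.inl (Or.inl (Or.inl (Or.inl (Or.inl (Or.inr hx))))))
          · exact Or.inr (Or.inl (Or.inl (Or.inl (Or.inl (Or.inr hx)))))
          · exact Or.inr (Or.inl (Or.inl (Or.inl (Or.inr hx))))
          · exact Or.inr (Or.inl (Or.inl (Or.inr ((hvert x).2 (Or.inl hx)))))
    · have harc' : closingArc (L + 1) (N + 1) ⊆ closedStack 0 (N + 2) (v ++ [some (N, true)]) :=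
        fun x hx => Or.inr ⟨N + 1, Nat.zero_le _, by omega, by simpa [hL] using hx⟩
      rw [harc] at harc'
      have hst' : strand L (some (N, true)) (N + 1) ⊆
          closedStack 0 (N + 2) (v ++ [some (N, true)]) := fun x hx =>
        Or.inl ⟨L, _, N + 1, hlast, Nat.zero_le _, by omega, hx⟩
      rw [hst] at hst'
      rintro x (((⟨k, o, j, hk, hj, hx⟩ | ⟨j, hj, hx⟩) | ⟨j, hj, hx⟩) |
        (((((hx | hx) | hx) | hx) | hx) | hx) | hx)
      · exact Or.inl ⟨k, o, j, (hget _).2 (Or.inl hk), Nat.zero_le _, by omega, hx⟩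
      · exact Or.inl ⟨L, _, j, hlast, Nat.zero_le _, by omega,
          by rwa [strand_other _ _ (by omega) (by omega)]⟩
      · exact Or.inr ⟨j, Nat.zero_le _, by omega, by simpa [hL] using hx⟩
      · exact Or.inl ⟨L, _, N, hlast, Nat.zero_le _, by omega, by rwa [strand_left]⟩
      · exact harc' (Or.inl (Or.inl (Or.inl hx)))
      · exact harc' (Or.inl (Or.inl (Or.inr hx)))
      · exact harc' (Or.inl (Or.inr hx))
      · rcases (hvert x).1 hx with hx | ⟨k, hk, hx⟩
        · exact harc' (Or.inr hx)
        · obtain ⟨o, ho⟩ : ∃ o, v[k]? = some o := ⟨v[k], List.getElem?_eq_getElem hk⟩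
          refine Or.inl ⟨k, o, N + 1, (hget _).2 (Or.inl ho), Nat.zero_le _, by omega, ?_⟩
          rwa [hnew ho]
      · exact hst' (Or.inl hx)
      · exact hst' (Or.inr hx)
  rw [e1, e2, strand_none]
  have hL0 : (0 : ℝ) ≤ L := Nat.cast_nonneg L
  refine isotopic_loop hL0 rfl ?_
  rintro x ((⟨k, o, j, hk, hj, hx⟩ | ⟨j, hj, hx⟩) | ⟨j, hj, hx⟩)
  · have hjN : (j : ℝ) ≤ N := by exact_mod_cast Nat.lt_succ_iff.1 hj
    have hkL : (k : ℝ) + 1 ≤ L := by exact_mod_cast hlt hk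
    have hh := strand_height hx
    refine ⟨?_, fun _ _ h _ => Or.inl (by linarith)⟩
    rcases strand_cases hx with ⟨-, h0, -⟩ | ⟨s, ho, -, t, h0, h1, e0, -⟩ |
      ⟨i, s, -, -, -, t, h0, h1, e0, -⟩
    · rw [h0]; exact hjN
    · subst ho
      have : j + 1 ≤ N := by
        have := hv j s (List.mem_of_getElem? hk)
        omega
      have : (j : ℝ) + 1 ≤ N := by exact_mod_cast this
      linarith
    · linarith
  · have hx0 := (mem_vertical hx).1
    have : (j : ℝ) < N := by exact_mod_cast hj
    exact ⟨by linarith, fun h => absurd h (by linarith)⟩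
  · obtain ⟨h0, h1⟩ := closingArc_cases hx
    have hjN : (j : ℝ) ≤ N := by exact_mod_cast Nat.lt_succ_iff.1 hj
    refine ⟨by linarith, fun _ h2 h3 h4 => ?_⟩
    push_cast at h1
    rcases h1 with ⟨h, -⟩ | ⟨h, -⟩ | h | ⟨-, h, -⟩
    · exact Or.inr h
    · exfalso; linarith
    · exfalso; linarith
    · exact Or.inl (by linarith)

/-! ### Cutting a closed braid at a single crossing -/

/-- A germ determined by two segments on the two sides of a plane. -/
theorem germ_of_two_segments {P : Set R3} {x a b : R3} {f : R3 →ₗ[ℝ] ℝ} (hP : LocArc P x)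
    (ha : segment ℝ x a ⊆ P) (hb : segment ℝ x b ⊆ P) (hfa : f a < f x) (hfb : f x < f b) :
    ∃ u v, f u < 0 ∧ 0 < f v ∧ P =ᶠ[𝓝 x] (ray x u ∪ ray x v : Set R3) := by
  have hxa : x ≠ a := by rintro rfl; exact lt_irrefl _ hfa
  have hxb : x ≠ b := by rintro rfl; exact lt_irrefl _ hfb
  have h1 : f (a - x) < 0 := by rw [map_sub]; linarith
  have h2 : 0 < f (b - x) := by rw [map_sub]; linarith
  refine ⟨a - x, b - x, h1, h2, hP.eq_rays ?_ ?_ ?_⟩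
  · rintro (h | h | ⟨s, t, hs, ht, h⟩)
    · exact hxa (sub_eq_zero.1 h).symm
    · exact hxb (sub_eq_zero.1 h).symm
    · have := congrArg f h
      simp only [map_smul, smul_eq_mul] at this
      nlinarith [mul_pos ht h2]
  · filter_upwards [eventuallyEq_set.1 (segment_germ_left hxa)] with y hy h using ha (hy.2 h)
  · filter_upwards [eventuallyEq_set.1 (segment_germ_left hxb)] with y hy h using hb (hy.2 h)

/-- Straightening a strand that reaches over to the cutting plane and back. -/
theorem isotopic_bump {R : Set R3} {ξ y δ e₁ e₂ : ℝ} (hδ : δ = 1 / 2 ∨ δ = -1 / 2) (he : e₁ ≠ e₂)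
    (hR : ∀ x ∈ R, δ * (x 0 - ξ) ≤ 0 ∧
      (x 0 = ξ → x 2 = 0 → y ≤ x 1 → x 1 ≤ y + 1 → x 1 = y ∨ x 1 = y + 1)) :
    Isotopic (R ∪ segment ℝ ![ξ, y, 0] ![ξ, y + 1, 0])
      (R ∪ (segment ℝ ![ξ, y, 0] ![ξ + δ, y + 1 / 2, e₁] ∪
        segment ℝ ![ξ + δ, y + 1 / 2, e₁] ![ξ + δ, y + 1 / 2, e₂] ∪
        segment ℝ ![ξ + δ, y + 1 / 2, e₂] ![ξ, y + 1, 0])) := by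
  set a : R3 := ![ξ, y, 0] with ha
  set b : R3 := ![ξ, y + 1, 0] with hb
  set p : R3 := ![ξ + δ, y + 1 / 2, e₁] with hp
  set q : R3 := ![ξ + δ, y + 1 / 2, e₂] with hq
  have s1 : Isotopic (R ∪ segment ℝ a b) (R ∪ (segment ℝ a p ∪ segment ℝ p b)) := by
    refine isotopic_vertex (R := R) a b p 1 0 ?_ ?_ rfl rfl
    · rcases hδ with rfl | rfl <;> simp [ha, hb, hp]
    intro x hx β γ hβ hγ hs e0 e1 e2
    simp only [ha, hb, hp, Matrix.cons_val] at e0 e1 e2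
    obtain ⟨h1, h2⟩ := hR x hx
    have hγ0 : γ = 0 := by rcases hδ with rfl | rfl <;> linarith
    rw [hγ0] at e0 e1 e2
    refine ⟨hγ0, ?_⟩
    rcases h2 (by linarith) (by linarith) (by linarith) (by linarith) with h | h
    · exact Or.inl (by linarith)
    · exact Or.inr (by linarith)
  have s2 : Isotopic (R ∪ (segment ℝ a p ∪ segment ℝ p b))
      (R ∪ (segment ℝ a p ∪ segment ℝ p q ∪ segment ℝ q b)) := by
    refine isotopic_vertex (R := R ∪ segment ℝ a p) p b q 1 2 ?_ ?_ (by ac_rfl) (by ac_rfl)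
    · simp [hq, hb, hp, sub_eq_zero, he.symm]
    intro x hx β γ hβ hγ hs e0 e1 e2
    simp only [hq, hb, hp, Matrix.cons_val] at e0 e1 e2
    rcases hx with hx | hx
    · obtain ⟨h1, h2⟩ := hR x hx
      have hβ1 : β = 1 := by rcases hδ with rfl | rfl <;> linarith
      exact ⟨by linarith, Or.inr hβ1⟩
    · obtain ⟨t, ht0, ht1, f0, f1, f2⟩ := mem_segment_coord hx
      simp only [ha, hp, Matrix.cons_val] at f0 f1 f2
      have hβ0 : β = 0 := by linarith
      have ht : t = 1 := by linarith
      rw [hβ0] at e2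
      rw [ht] at f2
      have hγ0 : γ * (e₂ - e₁) = 0 := by linarith
      exact ⟨(mul_eq_zero.1 hγ0).resolve_right (sub_ne_zero.2 he.symm), Or.inl hβ0⟩
  exact s1.trans s2

section CutStack

variable {v : List (Option (ℕ × Bool))} {i k₀ : ℕ} {s : Bool}

/-- The part of a stack that stays away from the only crossing between `i` and `i + 1`. -/
def cutRest (v : List (Option (ℕ × Bool))) (i k₀ lo hi : ℕ) : Set R3 :=
  {x | ∃ k o j, v[k]? = some o ∧ lo ≤ j ∧ j < hi ∧ ¬ (k = k₀ ∧ (j = i ∨ j = i + 1)) ∧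
    x ∈ strand k o j} ∪ {x | ∃ j, lo ≤ j ∧ j < hi ∧ x ∈ closingArc v.length j}

/-- Passing between the positions `i` and `i + 1` takes the generator `i`, which occurs only in the
layer `k₀`. So every remaining strand stays on the side on which it begins. -/
theorem cutRest_side (hk : v[k₀]? = some (some (i, s)))
    (hne : ∀ k l t, v[k]? = some (some (l, t)) → k ≠ k₀ → l ≠ i) {k : ℕ} {o : Option (ℕ × Bool)}
    {j : ℕ} {x : R3} (ho : v[k]? = some o) (hF : ¬ (k = k₀ ∧ (j = i ∨ j = i + 1)))
    (hx : x ∈ strand k o j) : (j ≤ i → x 0 ≤ i) ∧ (i + 1 ≤ j → (i : ℝ) + 1 ≤ x 0) := by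
  have hcast : ∀ {a b : ℕ}, a ≤ b → (a : ℝ) ≤ b := fun h => by exact_mod_cast h
  have hlet : ∀ l t, o = some (l, t) → (j = l ∨ j = l + 1) → l ≠ i := by
    rintro l t rfl hj rfl
    by_cases hkk : k = k₀
    · exact hF ⟨hkk, hj⟩
    · exact hne k l t ho hkk rfl
  rcases strand_cases hx with ⟨-, h0, -⟩ | ⟨t, h1, -, u, hu0, hu1, e0, -⟩ |
    ⟨l, t, h1, h2, -, u, hu0, hu1, e0, -⟩
  · rw [h0]
    exact ⟨fun h => hcast h, fun h => by exact_mod_cast h⟩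
  · have hji := hlet j t h1 (Or.inl rfl)
    constructor
    · intro h
      have : (j : ℝ) + 1 ≤ i := by exact_mod_cast (lt_of_le_of_ne h hji)
      linarith
    · intro h
      have : (i : ℝ) + 1 ≤ j := by exact_mod_cast h
      linarith
  · have hli := hlet l t h1 (Or.inr h2)
    constructor
    · intro h
      have := hcast h
      linarith
    · intro h
      have h3 : i + 2 ≤ j := by omega
      have : (i : ℝ) + 2 ≤ j := by exact_mod_cast h3
      linarith

theorem cutRest_lower (hk : v[k₀]? = some (some (i, s)))
    (hne : ∀ k l t, v[k]? = some (some (l, t)) → k ≠ k₀ → l ≠ i) {x : R3}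
    (hx : x ∈ cutRest v i k₀ 0 (i + 1)) : x 0 ≤ i := by
  rcases hx with ⟨k, o, j, ho, -, hj, hF, hx⟩ | ⟨j, -, hj, hx⟩
  · exact (cutRest_side hk hne ho hF hx).1 (by omega)
  · rw [(closingArc_cases hx).1]
    exact_mod_cast Nat.lt_succ_iff.1 hj

theorem cutRest_upper (hk : v[k₀]? = some (some (i, s)))
    (hne : ∀ k l t, v[k]? = some (some (l, t)) → k ≠ k₀ → l ≠ i) {n : ℕ} {x : R3}
    (hx : x ∈ cutRest v i k₀ (i + 1) n) : (i : ℝ) + 1 ≤ x 0 := by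
  rcases hx with ⟨k, o, j, ho, hj, -, hF, hx⟩ | ⟨j, hj, -, hx⟩
  · exact (cutRest_side hk hne ho hF hx).2 hj
  · rw [(closingArc_cases hx).1]
    exact_mod_cast hj

/-- The condition needed for `isotopic_bump`: the vertical strand put in place of the crossing is
touched by the rest at most at its two ends. -/
theorem cutRest_ends (hk : v[k₀]? = some (some (i, s))) {lo hi j₀ : ℕ} (hj0 : j₀ = i ∨ j₀ = i + 1)
    {x : R3} (hx : x ∈ cutRest v i k₀ lo hi) (h0 : x 0 = j₀) (h2 : x 2 = 0) (h3 : (k₀ : ℝ) ≤ x 1)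
    (h4 : x 1 ≤ k₀ + 1) : x 1 = k₀ ∨ x 1 = k₀ + 1 := by
  rcases hx with ⟨k, o, j, ho, -, -, hF, hx⟩ | ⟨j, -, -, hx⟩
  · have hh := strand_height hx
    rcases lt_trichotomy k k₀ with h | h | h
    · have : (k : ℝ) + 1 ≤ k₀ := by exact_mod_cast h
      exact Or.inl (by linarith)
    · subst h
      rw [hk] at ho
      obtain rfl := Option.some.inj ho
      have hj : ¬ (j = i ∨ j = i + 1) := fun h => hF ⟨rfl, h⟩
      push Not at hj
      rw [strand_other _ _ hj.1 hj.2] at hx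
      have := (mem_vertical hx).1
      rw [h0] at this
      have : j₀ = j := by exact_mod_cast this
      omega
    · have : (k₀ : ℝ) + 1 ≤ k := by exact_mod_cast h
      exact Or.inr (by linarith)
  · have hL : (k₀ : ℝ) + 1 ≤ v.length := by exact_mod_cast (List.getElem?_eq_some_iff.1 hk).1
    have hk0 : (0 : ℝ) ≤ k₀ := Nat.cast_nonneg k₀
    rcases (closingArc_cases hx).2 with ⟨h, -⟩ | ⟨h, -⟩ | h | ⟨-, h, -⟩
    · exact Or.inr (by linarith)
    · exfalso; linarith
    · exfalso; linarith
    · exact Or.inl (by linarith)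

/-- The map `g` turns the single crossing into an empty layer and may also erase the letters of the
other side, since it is tested only on the strands in the given range. Up to the one vertical strand
the result is the rest of the cut. -/
theorem closedStack_map_eq (hk : v[k₀]? = some (some (i, s)))
    (hne : ∀ k l t, v[k]? = some (some (l, t)) → k ≠ k₀ → l ≠ i) {lo hi j₀ : ℕ}
    (hj0 : lo ≤ j₀ ∧ j₀ < hi) (hj1 : ∀ j, lo ≤ j → j < hi → ((j = i ∨ j = i + 1) ↔ j = j₀))
    {g : Option (ℕ × Bool) → Option (ℕ × Bool)} (hg : g (some (i, s)) = none)
    (hg' : ∀ o, (∀ t, o ≠ some (i, t)) → ∀ k j, lo ≤ j → j < hi → strand k (g o) j = strand k o j) :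
    closedStack lo hi (v.map g) = cutRest v i k₀ lo hi ∪ strand k₀ none j₀ := by
  have key : ∀ {k o j}, v[k]? = some o → lo ≤ j → j < hi → ¬ (k = k₀ ∧ (j = i ∨ j = i + 1)) →
      strand k (g o) j = strand k o j := by
    intro k o j ho h1 h2 hF
    by_cases hkk : k = k₀
    · subst hkk
      rw [hk] at ho
      obtain rfl := Option.some.inj ho
      have hj : ¬ (j = i ∨ j = i + 1) := fun h => hF ⟨rfl, h⟩
      push Not at hj
      rw [hg, strand_other _ _ hj.1 hj.2]
    · exact hg' o (fun t h => hne k i t (h ▸ ho) hkk rfl) k j h1 h2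
  apply Subset.antisymm
  · rintro x (⟨k, o, j, ho, h1, h2, hx⟩ | ⟨j, h1, h2, hx⟩)
    · rw [List.getElem?_map, Option.map_eq_some_iff] at ho
      obtain ⟨o, ho, rfl⟩ := ho
      by_cases hF : k = k₀ ∧ (j = i ∨ j = i + 1)
      · obtain ⟨rfl, hj⟩ := hF
        rw [hk] at ho
        obtain rfl := Option.some.inj ho
        rw [hg] at hx
        rw [(hj1 j h1 h2).1 hj] at hx
        exact Or.inr hx
      · rw [key ho h1 h2 hF] at hx
        exact Or.inl (Or.inl ⟨k, o, j, ho, h1, h2, hF, hx⟩)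
    · rw [List.length_map] at hx
      exact Or.inl (Or.inr ⟨j, h1, h2, hx⟩)
  · rintro x ((⟨k, o, j, ho, h1, h2, hF, hx⟩ | ⟨j, h1, h2, hx⟩) | hx)
    · refine Or.inl ⟨k, g o, j, by rw [List.getElem?_map, ho]; rfl, h1, h2, ?_⟩
      rwa [key ho h1 h2 hF]
    · exact Or.inr ⟨j, h1, h2, by rwa [List.length_map]⟩
    · exact Or.inl ⟨k₀, none, j₀, by rw [List.getElem?_map, hk, ← hg]; rfl, hj0.1, hj0.2, hx⟩

theorem closedStack_eq_cut (hk : v[k₀]? = some (some (i, s))) {n : ℕ} (hi : i + 1 < n) :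
    closedStack 0 n v = cutRest v i k₀ 0 (i + 1) ∪ cutRest v i k₀ (i + 1) n ∪
      (strand k₀ (some (i, s)) i ∪ strand k₀ (some (i, s)) (i + 1)) := by
  apply Subset.antisymm
  · rintro x (⟨k, o, j, ho, -, h2, hx⟩ | ⟨j, -, h2, hx⟩)
    · by_cases hF : k = k₀ ∧ (j = i ∨ j = i + 1)
      · obtain ⟨rfl, hj⟩ := hF
        rw [hk] at ho
        obtain rfl := Option.some.inj ho
        rcases hj with rfl | rfl
        · exact Or.inr (Or.inl hx)
        · exact Or.inr (Or.inr hx)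
      · rcases le_or_gt j i with h | h
        · exact Or.inl (Or.inl (Or.inl ⟨k, o, j, ho, by omega, by omega, hF, hx⟩))
        · exact Or.inl (Or.inr (Or.inl ⟨k, o, j, ho, h, h2, hF, hx⟩))
    · rcases le_or_gt j i with h | h
      · exact Or.inl (Or.inl (Or.inr ⟨j, by omega, by omega, hx⟩))
      · exact Or.inl (Or.inr (Or.inr ⟨j, h, h2, hx⟩))
  · rintro x (((⟨k, o, j, ho, -, h2, -, hx⟩ | ⟨j, -, h2, hx⟩) |
      (⟨k, o, j, ho, -, h2, -, hx⟩ | ⟨j, -, h2, hx⟩)) | hx | hx)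
    · exact Or.inl ⟨k, o, j, ho, Nat.zero_le _, by omega, hx⟩
    · exact Or.inr ⟨j, Nat.zero_le _, by omega, hx⟩
    · exact Or.inl ⟨k, o, j, ho, Nat.zero_le _, h2, hx⟩
    · exact Or.inr ⟨j, Nat.zero_le _, h2, hx⟩
    · exact Or.inl ⟨k₀, _, i, hk, Nat.zero_le _, by omega, hx⟩
    · exact Or.inl ⟨k₀, _, i + 1, hk, Nat.zero_le _, hi, hx⟩

end CutStack

/-- The first coordinate. -/
def xcoord : R3 →ₗ[ℝ] ℝ := LinearMap.proj 0

theorem xcoord_apply (x : R3) : xcoord x = x 0 := rfl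

theorem union_swap_right {α : Type*} (R A B C : Set α) : R ∪ (A ∪ B) ∪ C = R ∪ (A ∪ C ∪ B) := by
  rw [union_assoc, union_right_comm]

/-- A closed braid with a single crossing between the positions `i` and `i + 1` is cut by a plane
into two closed braids. -/
theorem closedStack_cut {v : List (Option (ℕ × Bool))} {i k₀ n : ℕ} {s : Bool}
    (hk : v[k₀]? = some (some (i, s)))
    (hne : ∀ k l t, v[k]? = some (some (l, t)) → k ≠ k₀ → l ≠ i) (hi : i + 1 < n)
    (hlink : IsLink (closedStack 0 n v)) {g h : Option (ℕ × Bool) → Option (ℕ × Bool)}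
    (hg : g (some (i, s)) = none) (hh : h (some (i, s)) = none)
    (hg' : ∀ o, (∀ t, o ≠ some (i, t)) → ∀ k j, 0 ≤ j → j < i + 1 → strand k (g o) j = strand k o j)
    (hh' : ∀ o, (∀ t, o ≠ some (i, t)) → ∀ k j, i + 1 ≤ j → j < n →
      strand k (h o) j = strand k o j) :
    ∃ p q, Cut (closedStack 0 n v) xcoord (i + 1 / 2) p q ∧
      Isotopic (closedStack 0 (i + 1) (v.map g))
        ((closedStack 0 n v ∩ {x | xcoord x ≤ i + 1 / 2}) ∪ segment ℝ p q) ∧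
      Isotopic (closedStack (i + 1) n (v.map h))
        ((closedStack 0 n v ∩ {x | i + 1 / 2 ≤ xcoord x}) ∪ segment ℝ p q) := by
  set P := closedStack 0 n v with hP
  have he : elev s ≠ 0 := by rcases elev_cases s with h | h <;> rw [h] <;> norm_num
  have eL := closedStack_map_eq hk hne (lo := 0) (hi := i + 1) (j₀ := i) (by omega)
    (fun j _ _ => by omega) hg hg'
  have eR := closedStack_map_eq hk hne (lo := i + 1) (hi := n) (j₀ := i + 1) (by omega)
    (fun j _ _ => by omega) hh hh'
  have eP := closedStack_eq_cut hk hi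
  rw [strand_left, strand_right, ← hP] at eP
  rw [strand_none] at eL eR
  push_cast at eR
  set RL := cutRest v i k₀ 0 (i + 1) with hRL
  set RR := cutRest v i k₀ (i + 1) n with hRR
  have hL := fun x (hx : x ∈ RL) => cutRest_lower hk hne hx
  have hR := fun x (hx : x ∈ RR) => cutRest_upper hk hne hx
  set a : R3 := ![(i : ℝ), k₀, 0] with ha
  set b : R3 := ![(i : ℝ), k₀ + 1, 0] with hb
  set B : R3 := ![(i : ℝ) + 1, k₀ + 1, 0] with hB
  set H : R3 := ![(i : ℝ) + 1, k₀, 0] with hH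
  -- The plane meets the crossing in the midpoints of its strands: `p` on the straight strand, at
  -- elevation `0`, and `q` on the bent one, at elevation `±1 / 2`.
  set p : R3 := ![(i : ℝ) + 1 / 2, k₀ + 1 / 2, 0] with hp
  set q : R3 := ![(i : ℝ) + 1 / 2, k₀ + 1 / 2, elev s] with hq
  have hpab : p ∈ segment ℝ a B := by
    refine mem_segment_of_coord (t := 1 / 2) (by norm_num) (by norm_num) ?_ ?_ ?_ <;>
      simp [ha, hB, hp]
  have haB : segment ℝ a B = segment ℝ a p ∪ segment ℝ p B := by
    rw [segment_split hpab, segment_symm ℝ p a]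
  rw [haB] at eP
  have c1 : ∀ x ∈ segment ℝ a p, x 0 ≤ i + 1 / 2 ∧ (x 0 = i + 1 / 2 → x = p) := by
    intro x hx
    obtain ⟨t, h0, h1, e0, e1, e2⟩ := mem_segment_coord hx
    simp only [ha, hp, Matrix.cons_val] at e0 e1 e2
    refine ⟨by linarith, fun h => eq_vec_iff.2 ?_⟩
    have : t = 1 := by linarith
    subst this
    exact ⟨h, by linarith, by linarith⟩
  have c2 : ∀ x ∈ segment ℝ p B, i + 1 / 2 ≤ x 0 ∧ (x 0 = i + 1 / 2 → x = p) := by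
    intro x hx
    obtain ⟨t, h0, h1, e0, e1, e2⟩ := mem_segment_coord hx
    simp only [hB, hp, Matrix.cons_val] at e0 e1 e2
    refine ⟨by linarith, fun h => eq_vec_iff.2 ?_⟩
    have : t = 0 := by linarith
    subst this
    exact ⟨h, by linarith, by linarith⟩
  have c3 : ∀ x ∈ segment ℝ H q, i + 1 / 2 ≤ x 0 ∧ (x 0 = i + 1 / 2 → x = q) := by
    intro x hx
    obtain ⟨t, h0, h1, e0, e1, e2⟩ := mem_segment_coord hx
    simp only [hH, hq, Matrix.cons_val] at e0 e1 e2
    refine ⟨by linarith, fun h => eq_vec_iff.2 ?_⟩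
    have : t = 1 := by linarith
    subst this
    exact ⟨h, by linarith, by linarith⟩
  have c4 : ∀ x ∈ segment ℝ q b, x 0 ≤ i + 1 / 2 ∧ (x 0 = i + 1 / 2 → x = q) := by
    intro x hx
    obtain ⟨t, h0, h1, e0, e1, e2⟩ := mem_segment_coord hx
    simp only [hb, hq, Matrix.cons_val] at e0 e1 e2
    refine ⟨by linarith, fun h => eq_vec_iff.2 ?_⟩
    have : t = 0 := by linarith
    subst this
    exact ⟨h, by linarith, by linarith⟩
  have hP1 : segment ℝ a p ⊆ P := by
    rw [eP]; exact fun x hx => Or.inr (Or.inl (Or.inl hx))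
  have hP2 : segment ℝ p B ⊆ P := by
    rw [eP]; exact fun x hx => Or.inr (Or.inl (Or.inr hx))
  have hP3 : segment ℝ H q ⊆ P := by
    rw [eP]; exact fun x hx => Or.inr (Or.inr (Or.inl hx))
  have hP4 : segment ℝ q b ⊆ P := by
    rw [eP]; exact fun x hx => Or.inr (Or.inr (Or.inr hx))
  have hpP : p ∈ P := hP1 (right_mem_segment ℝ _ _)
  have hqP : q ∈ P := hP4 (left_mem_segment ℝ _ _)
  have hpx : xcoord p = i + 1 / 2 := by simp [xcoord_apply, hp]
  have hqx : xcoord q = i + 1 / 2 := by simp [xcoord_apply, hq]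
  have hlow : P ∩ {x | xcoord x ≤ i + 1 / 2} = RL ∪ (segment ℝ a p ∪ segment ℝ q b) := by
    apply Subset.antisymm
    · rintro x ⟨hx, hxf⟩
      have hxf : x 0 ≤ i + 1 / 2 := hxf
      rw [eP] at hx
      rcases hx with (hx | hx) | (hx | hx) | (hx | hx)
      · exact Or.inl hx
      · have := hR x hx
        exfalso; linarith
      · exact Or.inr (Or.inl hx)
      · rw [(c2 x hx).2 (le_antisymm hxf (c2 x hx).1)]
        exact Or.inr (Or.inl (right_mem_segment ℝ _ _))
      · rw [(c3 x hx).2 (le_antisymm hxf (c3 x hx).1)]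
        exact Or.inr (Or.inr (left_mem_segment ℝ _ _))
      · exact Or.inr (Or.inr hx)
    · rintro x (hx | hx | hx)
      · refine ⟨by rw [eP]; exact Or.inl (Or.inl hx), ?_⟩
        have := hL x hx
        show x 0 ≤ _
        linarith
      · exact ⟨hP1 hx, (c1 x hx).1⟩
      · exact ⟨hP4 hx, (c4 x hx).1⟩
  have hupp : P ∩ {x | i + 1 / 2 ≤ xcoord x} = RR ∪ (segment ℝ H q ∪ segment ℝ p B) := by
    apply Subset.antisymm
    · rintro x ⟨hx, hxf⟩
      have hxf : i + 1 / 2 ≤ x 0 := hxf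
      rw [eP] at hx
      rcases hx with (hx | hx) | (hx | hx) | (hx | hx)
      · have := hL x hx
        exfalso; linarith
      · exact Or.inl hx
      · rw [(c1 x hx).2 (le_antisymm (c1 x hx).1 hxf)]
        exact Or.inr (Or.inr (left_mem_segment ℝ _ _))
      · exact Or.inr (Or.inr hx)
      · exact Or.inr (Or.inl hx)
      · rw [(c4 x hx).2 (le_antisymm (c4 x hx).1 hxf)]
        exact Or.inr (Or.inl (right_mem_segment ℝ _ _))
    · rintro x (hx | hx | hx)
      · refine ⟨by rw [eP]; exact Or.inl (Or.inr hx), ?_⟩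
        have := hR x hx
        show _ ≤ x 0
        linarith
      · exact ⟨hP3 hx, (c3 x hx).1⟩
      · exact ⟨hP2 hx, (c2 x hx).1⟩
  refine ⟨p, q, ⟨hlink, ?_, ?_, ?_, ?_⟩, ?_, ?_⟩
  · intro h
    have := congrFun h 2
    simp only [hp, hq, Matrix.cons_val] at this
    exact he this.symm
  · apply Subset.antisymm
    · rintro x ⟨hx, hxf⟩
      have hxf : x 0 = i + 1 / 2 := hxf
      rw [eP] at hx
      rcases hx with (hx | hx) | (hx | hx) | (hx | hx)
      · have := hL x hx
        exfalso; linarith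
      · have := hR x hx
        exfalso; linarith
      · exact Or.inl ((c1 x hx).2 hxf)
      · exact Or.inl ((c2 x hx).2 hxf)
      · exact Or.inr ((c3 x hx).2 hxf)
      · exact Or.inr ((c4 x hx).2 hxf)
    · rintro x (rfl | rfl)
      exacts [⟨hpP, hpx⟩, ⟨hqP, hqx⟩]
  · exact germ_of_two_segments (hlink.2 p hpP) (by rw [segment_symm]; exact hP1) hP2
      (by rw [hpx, xcoord_apply]; simp [ha]) (by rw [hpx, xcoord_apply]; simp [hB]; norm_num)
  · exact germ_of_two_segments (hlink.2 q hqP) hP4 (by rw [segment_symm]; exact hP3)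
      (by rw [hqx, xcoord_apply]; simp [hb]) (by rw [hqx, xcoord_apply]; simp [hH]; norm_num)
  -- The left half with the chord runs `a`, `p`, `q`, `b`: a detour to the cutting plane and back,
  -- isotopic to the vertical strand `ab`. The right half below is the mirror image with `q` before
  -- `p`.
  · have := isotopic_bump (R := RL) (ξ := i) (y := k₀) (δ := 1 / 2) (e₁ := 0) (e₂ := elev s)
      (Or.inl rfl) he.symm (fun x hx => ⟨by have := hL x hx; linarith,
        fun h0 h2 h3 h4 => cutRest_ends hk (Or.inl rfl) hx h0 h2 h3 h4⟩)
    rw [hlow, eL, union_swap_right]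
    exact this
  · have hx1 : (i : ℝ) + 1 + -1 / 2 = i + 1 / 2 := by ring
    have := isotopic_bump (R := RR) (ξ := i + 1) (y := k₀) (δ := -1 / 2) (e₁ := elev s) (e₂ := 0)
      (Or.inr rfl) he (fun x hx => ⟨by have := hR x hx; linarith,
        fun h0 h2 h3 h4 => cutRest_ends hk (Or.inr rfl) hx (by push_cast; exact h0) h2 h3 h4⟩)
    rw [hx1] at this
    rw [hupp, eR, union_swap_right, segment_symm ℝ p q]
    exact this

/-! ### From stacks back to braid words -/

/-- The horizontal shift by `d` positions. -/
noncomputable def shift (d : ℕ) : R3 ≃ᵃ[ℝ] R3 := AffineEquiv.constVAdd ℝ R3 ![(d : ℝ), 0, 0]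

theorem shift_good (d : ℕ) : Good (shift d) := by
  refine good_of_family (fun t => AffineEquiv.constVAdd ℝ R3 (t • ![(d : ℝ), 0, 0])) ?_ ?_ ?_
  · intro x
    simp only [AffineEquiv.constVAdd_apply, vadd_eq_add]
    fun_prop
  · intro x
    simp
  · intro x
    simp [shift]

theorem shift_image_segment (d : ℕ) (x y z x' y' z' : ℝ) :
    shift d '' segment ℝ ![x, y, z] ![x', y', z'] = segment ℝ ![x + d, y, z] ![x' + d, y', z'] := by
  have := segment_translate_image ℝ ![(d : ℝ), 0, 0] ![x, y, z] ![x', y', z']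
  have e : ∀ x y z : ℝ, ![(d : ℝ), 0, 0] + ![x, y, z] = ![x + d, y, z] := by
    intro x y z
    ext j
    fin_cases j <;> simp [add_comm]
  rw [e, e] at this
  exact this

theorem shift_image_strand (d k j : ℕ) (l : ℕ × Bool) :
    shift d '' strand k (some l) j = strand k (some (l.1 + d, l.2)) (j + d) := by
  obtain ⟨i, s⟩ := l
  have e : (i : ℝ) + 1 / 2 + d = ((i + d : ℕ) : ℝ) + 1 / 2 := by push_cast; ring
  have e' : (i : ℝ) + 1 + d = ((i + d : ℕ) : ℝ) + 1 := by push_cast; ring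
  by_cases h1 : j = i
  · subst h1
    rw [strand_left, strand_left, shift_image_segment, e']
    push_cast
    rfl
  by_cases h2 : j = i + 1
  · subst h2
    rw [strand_right, show i + 1 + d = i + d + 1 by ring, strand_right, image_union,
      shift_image_segment, shift_image_segment, e', e]
    push_cast
    rfl
  · rw [strand_other k s h1 h2, strand_other k s (by simpa using h1) (by omega), strand_none,
      strand_none, shift_image_segment]
    push_cast
    rfl

theorem shift_image_closingArc (d L j : ℕ) : shift d '' closingArc L j = closingArc L (j + d) := by
  simp only [closingArc, image_union, shift_image_segment, Nat.cast_add]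

theorem closedStack_shift (d n : ℕ) (u : List (ℕ × Bool)) :
    shift d '' closedStack 0 n (u.map some) =
      closedStack d (n + d) (u.map fun l => some (l.1 + d, l.2)) := by
  apply Subset.antisymm
  · rintro _ ⟨x, ⟨k, o, j, ho, -, hj, hx⟩ | ⟨j, -, hj, hx⟩, rfl⟩
    · simp only [List.getElem?_map, Option.map_eq_some_iff] at ho
      obtain ⟨l, hl, rfl⟩ := ho
      refine Or.inl ⟨k, some (l.1 + d, l.2), j + d, by simp [hl], by omega, by omega, ?_⟩
      rw [← shift_image_strand]
      exact mem_image_of_mem _ hx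
    · refine Or.inr ⟨j + d, by omega, by omega, ?_⟩
      rw [← shift_image_closingArc]
      exact mem_image_of_mem _ (by simpa using hx)
  · rintro x (⟨k, o, j, ho, hdj, hj, hx⟩ | ⟨j, hdj, hj, hx⟩)
    · simp only [List.getElem?_map, Option.map_eq_some_iff] at ho
      obtain ⟨l, hl, rfl⟩ := ho
      obtain ⟨j, rfl⟩ := Nat.exists_eq_add_of_le' hdj
      rw [← shift_image_strand] at hx
      exact image_mono (fun y hy => Or.inl ⟨k, some l, j, by simp [hl], by omega, by omega, hy⟩) hx
    · obtain ⟨j, rfl⟩ := Nat.exists_eq_add_of_le' hdj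
      rw [← shift_image_closingArc] at hx
      exact image_mono (fun y hy => Or.inr ⟨j, by omega, by omega, by simpa using hy⟩) hx

theorem exists_word_of_closedStack {n : ℕ} {K : Set R3} (u : List (ℕ × Bool))
    (hu : ∀ l ∈ u, l.1 + 1 < n) (h : Isotopic (closedStack 0 n (u.map some)) K) :
    ∃ w : BraidWord n, Represents w K ∧ w.length = u.length := by
  have key : ∀ u : List (ℕ × Bool), (∀ l ∈ u, l.1 + 1 < n) →
      ∃ w : BraidWord n, w.map (fun l => some ((l.1 : ℕ), l.2)) = u.map some := by
    intro u
    induction u with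
    | nil => exact fun _ => ⟨[], rfl⟩
    | cons l u ih =>
      intro hu
      obtain ⟨w, hw⟩ := ih fun l hl => hu l (List.mem_cons_of_mem _ hl)
      have := hu l List.mem_cons_self
      exact ⟨(⟨l.1, by omega⟩, l.2) :: w, by simp [hw]⟩
  obtain ⟨w, hw⟩ := key u hu
  refine ⟨w, ?_, by simpa using congrArg List.length hw⟩
  rw [Represents, braidClosure_eq, hw]
  exact h

theorem filter_isSome_map (u : List (ℕ × Bool)) (p : ℕ × Bool → Bool) :
    (u.map fun l => if p l then some l else none).filter (·.isSome) = (u.filter p).map some := by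
  induction u with
  | nil => rfl
  | cons l u ih => by_cases h : p l <;> simp [h, ih]

theorem exists_unique_of_countP_eq_one {u : List (ℕ × Bool)} {i : ℕ}
    (h : u.countP (fun l => l.1 = i) = 1) :
    ∃ (k₀ : ℕ) (s : Bool), u[k₀]? = some (i, s) ∧
      ∀ (k l : ℕ) (t : Bool), u[k]? = some (l, t) → k ≠ k₀ → l ≠ i := by
  induction u with
  | nil => simp at h
  | cons l u ih =>
    by_cases hl : l.1 = i
    · have h0 : u.countP (fun l => l.1 = i) = 0 := by
        rw [List.countP_cons_of_pos (by simpa using hl)] at h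
        omega
      rw [List.countP_eq_zero] at h0
      refine ⟨0, l.2, by simp [← hl], ?_⟩
      intro k l' t hk hk0
      obtain ⟨k, rfl⟩ := Nat.exists_eq_succ_of_ne_zero hk0
      rw [Nat.succ_eq_add_one, List.getElem?_cons_succ] at hk
      simpa using h0 _ (List.mem_of_getElem? hk)
    · rw [List.countP_cons_of_neg (by simpa using hl)] at h
      obtain ⟨k₀, s, hk, hne⟩ := ih h
      refine ⟨k₀ + 1, s, by simpa using hk, ?_⟩
      intro k l' t hk hk0
      cases k with
      | zero =>
        simp only [List.getElem?_cons_zero, Option.some.injEq] at hk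
        rw [hk] at hl
        exact hl
      | succ k => exact hne k l' t (by simpa using hk) (by omega)

/-- If a generator occurs just once in a braid word for a prime knot, then one of the two parts of
the word to the left and to the right of this generator represents the knot. -/
theorem exists_word_of_single {n i : ℕ} {K : Set R3} (hK : IsPrimeKnot K) {w : BraidWord n}
    (hw : Represents w K) (hi : i + 1 < n) (h1 : w.countP (fun l => (l.1 : ℕ) = i) = 1) :
    (∃ w' : BraidWord (i + 1), Represents w' K ∧
      w'.length = w.countP (fun l => (l.1 : ℕ) < i)) ∨
    (∃ w' : BraidWord (n - (i + 1)), Represents w' K ∧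
      w'.length = w.countP (fun l => i < (l.1 : ℕ))) := by
  set u : List (ℕ × Bool) := w.map fun l => ((l.1 : ℕ), l.2) with hu
  have huv : braidClosure w = closedStack 0 n (u.map some) := by
    rw [braidClosure_eq, hu, List.map_map]; rfl
  have hvalid : ∀ l ∈ u, l.1 + 1 < n := by
    intro l hl
    obtain ⟨a, -, rfl⟩ := List.mem_map.1 hl
    have := a.1.2
    simp only
    omega
  have hlink : IsLink (closedStack 0 n (u.map some)) := by
    rw [← huv]; exact (Isotopic.symm hw).isLink.1 hK.1.isLink
  obtain ⟨k₀, s, hk, hne⟩ := exists_unique_of_countP_eq_one (u := u) (i := i)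
    (by rw [hu, List.countP_map]; exact h1)
  -- The maps `g` and `h` keep the letters to the left and to the right of `i` and turn all others
  -- into empty layers, which `closedStack_filter` removes.
  let g : Option (ℕ × Bool) → Option (ℕ × Bool) := fun o =>
    o.bind fun l => if l.1 < i then some l else none
  let h : Option (ℕ × Bool) → Option (ℕ × Bool) := fun o =>
    o.bind fun l => if i < l.1 then some l else none
  have hgm : (u.map some).map g = u.map fun l => if l.1 < i then some l else none := by
    rw [List.map_map]; rfl
  have hhm : (u.map some).map h = u.map fun l => if i < l.1 then some l else none := by
    rw [List.map_map]; rfl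
  obtain ⟨p, q, hcut, hL, hR⟩ := closedStack_cut (v := u.map some) (i := i) (k₀ := k₀) (n := n)
    (s := s) (g := g) (h := h) (by simp [hk])
    (fun k l t hkl hk0 => hne k l t (by simpa using hkl) hk0) hi hlink (by simp [g]) (by simp [h])
    (by
      rintro (_ | ⟨l, t⟩) ho k j - hj
      · rfl
      · by_cases hl : l < i
        · simp [g, hl]
        · have : l ≠ i := fun h => ho t (by rw [h])
          simp only [g, Option.bind_some, hl, if_false]
          rw [strand_other k t (by omega) (by omega)])
    (by
      rintro (_ | ⟨l, t⟩) ho k j hj -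
      · rfl
      · by_cases hl : i < l
        · simp [h, hl]
        · have : l ≠ i := fun h => ho t (by rw [h])
          simp only [h, Option.bind_some, hl, if_false]
          rw [strand_other k t (by omega) (by omega)])
  rw [hgm] at hL
  rw [hhm] at hR
  rcases hcut.prime hK (by rw [← huv]; exact Isotopic.symm hw) with hc | hc
  · left
    have hf := closedStack_filter 0 (i + 1) [] (u.map fun l => if l.1 < i then some l else none) (by
      intro a t ha
      obtain ⟨l, -, hl⟩ := List.mem_map.1 ha
      split_ifs at hl with hli
      cases hl
      exact ⟨by omega, by simp only at hli; omega⟩)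
    have e := filter_isSome_map u (fun l => l.1 < i)
    simp only [decide_eq_true_eq] at e
    rw [List.nil_append, List.nil_append, e] at hf
    obtain ⟨w', hw', hlen⟩ := exists_word_of_closedStack (K := K) (u.filter fun l => l.1 < i) (by
      intro l hl
      have := (List.mem_filter.1 hl).2
      simp only [decide_eq_true_eq] at this
      omega) (hf.symm.trans (hL.trans hc.symm))
    refine ⟨w', hw', ?_⟩
    rw [hlen, ← List.countP_eq_length_filter, hu, List.countP_map]
    rfl
  · right
    have hf := closedStack_filter (i + 1) n [] (u.map fun l => if i < l.1 then some l else none) (by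
      intro a t ha
      obtain ⟨l, hlu, hl⟩ := List.mem_map.1 ha
      split_ifs at hl with hli
      cases hl
      exact ⟨hli, hvalid _ hlu⟩)
    have e := filter_isSome_map u (fun l => i < l.1)
    simp only [decide_eq_true_eq] at e
    rw [List.nil_append, List.nil_append, e] at hf
    have hiso := hf.symm.trans (hR.trans hc.symm)
    set u' := u.filter fun l => i < l.1 with hu'
    have hmem : ∀ l ∈ u', i < l.1 ∧ l.1 + 1 < n := by
      intro l hl
      obtain ⟨hl, hl'⟩ := List.mem_filter.1 hl
      exact ⟨by simpa using hl', hvalid l hl⟩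
    -- The right part occupies the positions from `i + 1` on and has to be shifted back to begin at
    -- `0`.
    have hsh := closedStack_shift (i + 1) (n - (i + 1)) (u'.map fun l => (l.1 - (i + 1), l.2))
    have e2 : ((u'.map fun l => (l.1 - (i + 1), l.2)).map fun l => some (l.1 + (i + 1), l.2)) =
        u'.map some := by
      rw [List.map_map]
      refine List.map_congr_left fun l hl => ?_
      have := hmem l hl
      simp only [Function.comp]
      rw [Nat.sub_add_cancel this.1]
    rw [e2, Nat.sub_add_cancel hi.le] at hsh
    have hl1 : IsLink (closedStack (i + 1) n (u'.map some)) :=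
      hiso.symm.isLink.1 hK.1.isLink
    have hsym : closedStack 0 (n - (i + 1)) ((u'.map fun l => (l.1 - (i + 1), l.2)).map some) =
        (shift (i + 1)).symm '' closedStack (i + 1) n (u'.map some) := by
      rw [← hsh, image_image]; simp
    obtain ⟨w', hw', hlen⟩ := exists_word_of_closedStack (K := K)
      (u'.map fun l => (l.1 - (i + 1), l.2)) (by
        intro l hl
        obtain ⟨a, ha, rfl⟩ := List.mem_map.1 hl
        have := hmem a ha
        show a.1 - (i + 1) + 1 < n - (i + 1)
        omega) (by
        rw [hsym]
        exact ((shift_good (i + 1)).symm _ hl1).symm.trans hiso)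
    refine ⟨w', hw', ?_⟩
    rw [hlen, List.length_map, hu', ← List.countP_eq_length_filter, hu, List.countP_map]
    rfl

/-! ### Connectedness, generators and the parity of the length -/

theorem upper_eq_self {i j : ℕ} {s : Bool} (h : upper (some (i, s)) j = j) : j ≠ i ∧ j ≠ i + 1 := by
  constructor
  · rintro rfl
    simp [upper] at h
  · rintro rfl
    simp [upper] at h

/-- Vertical strands lie outside the two positions of a crossing. The two strands of the crossing
have the same first coordinate only at half height, where their elevations are `0` and `±1 / 2`. -/
theorem strand_unique {k : ℕ} {o : Option (ℕ × Bool)} {j j' : ℕ} {x : R3} (hx : x ∈ strand k o j)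
    (hx' : x ∈ strand k o j') : j = j' := by
  have hmixed : ∀ {j j' : ℕ}, upper o j = j → x 0 = j → (∃ s, o = some (j', s) ∧
      ∃ t : ℝ, 0 ≤ t ∧ t ≤ 1 ∧ x 0 = j' + t) → False := by
    rintro j j' hu h0 ⟨s, rfl, t, ht0, ht1, h0'⟩
    obtain ⟨n1, n2⟩ := upper_eq_self hu
    have a1 : (j' : ℝ) ≤ j := by linarith
    have a2 : (j : ℝ) ≤ (j' + 1 : ℕ) := by push_cast; linarith
    have a1 := Nat.cast_le.1 a1
    have a2 := Nat.cast_le.1 a2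
    omega
  have hcross : ∀ {i : ℕ} {s s' : Bool} {j j' : ℕ} {t t' : ℝ}, o = some (j, s) → o = some (i, s') →
      j' = i + 1 → x 0 = j + t → x 0 = j' - t' → x 1 = k + t → x 1 = k + t' → x 2 = 0 →
      (t' ≤ 1 / 2 ∧ x 2 = 2 * t' * elev s' ∨ 1 / 2 ≤ t' ∧ x 2 = 2 * (1 - t') * elev s') →
      False := by
    intro i s s' j j' t t' h1 h2 h3 a0 b0 a1 b1 a2 b2
    have hij : j = i := by
      rw [h1] at h2
      simp only [Option.some.injEq, Prod.mk.injEq] at h2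
      exact h2.1
    subst hij h3
    push_cast at b0
    have ht : t' = 1 / 2 := by linarith
    rw [a2, ht] at b2
    rcases elev_cases s' with h | h <;> rw [h] at b2 <;> norm_num at b2
  rcases strand_cases hx with ⟨hu, h0, h2, t, ht0, ht1, h1⟩ |
    ⟨s, ho, -, t, ht0, ht1, h0, h1, h2⟩ | ⟨i, s, ho, hj, -, t, ht0, ht1, h0, h1, h2⟩ <;>
  rcases strand_cases hx' with ⟨hu', h0', h2', t', ht0', ht1', h1'⟩ |
    ⟨s', ho', -, t', ht0', ht1', h0', h1', h2'⟩ | ⟨i', s', ho', hj', -, t', ht0', ht1', h0', h1', h2'⟩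
  · exact Nat.cast_injective (R := ℝ) (by linarith)
  · exact (hmixed hu h0 ⟨s', ho', t', ht0', ht1', h0'⟩).elim
  · exact (hmixed hu h0 ⟨s', ho', 1 - t', by linarith, by linarith,
      by rw [h0', hj']; push_cast; ring⟩).elim
  · exact (hmixed hu' h0' ⟨s, ho, t, ht0, ht1, h0⟩).elim
  · rw [ho] at ho'
    simp only [Option.some.injEq, Prod.mk.injEq] at ho'
    exact ho'.1
  · exact (hcross ho ho' hj' h0 h0' h1 h1' h2 h2').elim
  · exact (hmixed hu' h0' ⟨s, ho, 1 - t, by linarith, by linarith,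
      by rw [h0, hj]; push_cast; ring⟩).elim
  · exact (hcross ho' ho hj h0' h0 h1' h1 h2' h2).elim
  · rw [ho] at ho'
    simp only [Option.some.injEq, Prod.mk.injEq] at ho'
    rw [hj, hj', ho'.1]

/-- Strands have elevation at most `1 / 2` in absolute value, so they never meet the return path of
a closing arc at elevation `1`. -/
theorem strand_ne_one {k : ℕ} {o : Option (ℕ × Bool)} {j : ℕ} {x : R3} (hx : x ∈ strand k o j) :
    x 2 ≠ 1 := by
  intro h
  rcases strand_cases hx with ⟨-, -, h2, -⟩ | ⟨s, -, -, t, -, -, -, -, h2⟩ |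
    ⟨i, s, -, -, -, t, h0, h1, -, -, h2⟩
  · linarith
  · linarith
  · rcases elev_cases s with e | e <;> rw [e] at h2 <;> rcases h2 with h2 | h2 <;> linarith [h2.1, h2.2]

theorem isCompact_strand (k : ℕ) (o : Option (ℕ × Bool)) (j : ℕ) : IsCompact (strand k o j) := by
  have hs := isCompact_segment
  unfold strand
  split
  · exact hs _ _
  · split_ifs
    exacts [hs _ _, (hs _ _).union (hs _ _), hs _ _]

theorem isCompact_closingArc (L j : ℕ) : IsCompact (closingArc L j) := by
  have hs := isCompact_segment
  exact (((hs _ _).union (hs _ _)).union (hs _ _)).union (hs _ _)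

/-- The part of a closed stack that consists of the strands and arcs selected by `χ`, which depends
on the height and the position of the lower end. -/
def colored (n : ℕ) (v : List (Option (ℕ × Bool))) (χ : ℕ → ℕ → Prop) : Set R3 :=
  {x | ∃ k o j, v[k]? = some o ∧ j < n ∧ χ k j ∧ x ∈ strand k o j} ∪
    {x | ∃ j, j < n ∧ χ 0 j ∧ x ∈ closingArc v.length j}

theorem isClosed_colored (n : ℕ) (v : List (Option (ℕ × Bool))) (χ : ℕ → ℕ → Prop) :
    IsClosed (colored n v χ) := by
  have e1 : {x | ∃ k o j, v[k]? = some o ∧ j < n ∧ χ k j ∧ x ∈ strand k o j} =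
      ⋃ a ∈ {a : Fin v.length × Fin n | χ a.1 a.2}, strand a.1 (v.get a.1) a.2 := by
    ext x
    simp only [mem_ofPred_eq, mem_iUnion, exists_prop, Prod.exists]
    constructor
    · rintro ⟨k, o, j, hk, hj, hχ, hx⟩
      obtain ⟨hk', rfl⟩ := List.getElem?_eq_some_iff.1 hk
      exact ⟨⟨k, hk'⟩, ⟨j, hj⟩, hχ, hx⟩
    · rintro ⟨k, j, hχ, hx⟩
      exact ⟨k, v.get k, j, by simp, j.2, hχ, hx⟩
  have e2 : {x | ∃ j, j < n ∧ χ 0 j ∧ x ∈ closingArc v.length j} =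
      ⋃ j ∈ {j : Fin n | χ 0 j}, closingArc v.length j := by
    ext x
    simp only [mem_ofPred_eq, mem_iUnion, exists_prop]
    constructor
    · rintro ⟨j, hj, hχ, hx⟩
      exact ⟨⟨j, hj⟩, hχ, hx⟩
    · rintro ⟨j, hχ, hx⟩
      exact ⟨j, j.2, hχ, hx⟩
  rw [colored, e1, e2]
  exact ((toFinite _).isClosed_biUnion fun a _ => (isCompact_strand _ _ _).isClosed).union
    ((toFinite _).isClosed_biUnion fun j _ => (isCompact_closingArc _ _).isClosed)

/-- The colour is constant along strands and through the closure. Two pieces meet only if they are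
the same strand or arc, or are joined end to end, so pieces that touch have the same colour. -/
theorem colored_disjoint {n : ℕ} {v : List (Option (ℕ × Bool))} {χ : ℕ → ℕ → Prop}
    (hstep : ∀ k o j, v[k]? = some o → j < n → (χ (k + 1) (upper o j) ↔ χ k j))
    (hclose : ∀ j, j < n → (χ v.length j ↔ χ 0 j)) :
    Disjoint (colored n v χ) (colored n v fun k j => ¬ χ k j) := by
  have hss : ∀ {x : R3} {k k' j j' : ℕ} {o o' : Option (ℕ × Bool)}, v[k]? = some o →
      v[k']? = some o' → j < n → j' < n → x ∈ strand k o j → x ∈ strand k' o' j' → k ≤ k' →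
      (χ k j ↔ χ k' j') := by
    intro x k k' j j' o o' ho ho' hj hj' hx hx' hkk
    have h1 := (strand_height hx).2
    have h2 := (strand_height hx').1
    have h3 : (k' : ℝ) ≤ (k + 1 : ℕ) := by push_cast; linarith
    rcases (Nat.cast_le.1 h3).eq_or_lt with h | h
    · subst h
      push_cast at h2
      have t1 := (strand_top hx (le_antisymm h1 h2)).1
      have t2 := (strand_bottom hx' (by push_cast; linarith)).1
      have : upper o j = j' := Nat.cast_injective (R := ℝ) (by linarith)
      rw [← this]
      exact (hstep k o j ho hj).symm
    · have : k = k' := by omega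
      subst this
      rw [ho] at ho'
      cases ho'
      rw [strand_unique hx hx']
  have hsa : ∀ {x : R3} {k j j' : ℕ} {o : Option (ℕ × Bool)}, v[k]? = some o → j < n → j' < n →
      x ∈ strand k o j → x ∈ closingArc v.length j' → (χ k j ↔ χ 0 j') := by
    intro x k j j' o ho hj hj' hx hx'
    obtain ⟨hkl, -⟩ := List.getElem?_eq_some_iff.1 ho
    have hk0 : (0 : ℝ) ≤ k := Nat.cast_nonneg k
    have hkl' : ((k + 1 : ℕ) : ℝ) ≤ v.length := Nat.cast_le.2 hkl
    have hh := strand_height hx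
    obtain ⟨h0, h | h | h | h⟩ := closingArc_cases hx'
    · have hkL : v.length = k + 1 := by
        refine le_antisymm (Nat.cast_le (α := ℝ).1 ?_) hkl
        push_cast
        linarith
      have hx1 : x 1 = k + 1 := by rw [h.1, hkL]; push_cast; ring
      have t1 := (strand_top hx hx1).1
      have : upper o j = j' := Nat.cast_injective (R := ℝ) (by linarith)
      rw [← hclose j' hj', hkL, ← this]
      exact (hstep k o j ho hj).symm
    · exact absurd h.1 (strand_ne_one hx)
    · linarith
    · have hk : k = 0 := by
        have : (k : ℝ) ≤ (0 : ℕ) := by push_cast; linarith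
        exact Nat.le_zero.1 (Nat.cast_le.1 this)
      subst hk
      push_cast at hh
      have t1 := (strand_bottom hx (by push_cast; linarith)).1
      have : j = j' := Nat.cast_injective (R := ℝ) (by linarith)
      rw [this]
  rw [Set.disjoint_left]
  rintro x (⟨k, o, j, ho, hj, hc, hx⟩ | ⟨j, hj, hc, hx⟩)
    (⟨k', o', j', ho', hj', hc', hx'⟩ | ⟨j', hj', hc', hx'⟩)
  · rcases le_total k k' with h | h
    · exact hc' ((hss ho ho' hj hj' hx hx' h).1 hc)
    · exact hc' ((hss ho' ho hj' hj hx' hx h).2 hc)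
  · exact hc' ((hsa ho hj hj' hx hx').1 hc)
  · exact hc' ((hsa ho' hj' hj hx' hx).2 hc)
  · have : j = j' := Nat.cast_injective (R := ℝ) (by
      rw [← (closingArc_cases hx).1, ← (closingArc_cases hx').1])
    exact hc' (this ▸ hc)

/-- The two colour classes are disjoint closed sets that cover the closure, so only one of them can
be present. The two uses are the colourings by side and by cycle. -/
theorem colored_of_connected {n : ℕ} {v : List (Option (ℕ × Bool))} {χ : ℕ → ℕ → Prop}
    (hstep : ∀ k o j, v[k]? = some o → j < n → (χ (k + 1) (upper o j) ↔ χ k j))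
    (hclose : ∀ j, j < n → (χ v.length j ↔ χ 0 j)) (hc : IsConnected (closedStack 0 n v))
    {j j' : ℕ} (hj : j < n) (hj' : j' < n) (h : χ 0 j) : χ 0 j' := by
  by_contra h'
  have hd := colored_disjoint hstep hclose
  have hpt : ∀ j, (![(j : ℝ), 0, 0] : R3) ∈ closingArc v.length j := fun j =>
    Or.inr (right_mem_segment ℝ _ _)
  have hm : (![(j : ℝ), 0, 0] : R3) ∈ colored n v χ := Or.inr ⟨j, hj, h, hpt j⟩
  have hm' : (![(j' : ℝ), 0, 0] : R3) ∈ colored n v fun k j => ¬ χ k j :=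
    Or.inr ⟨j', hj', h', hpt j'⟩
  have hsub : closedStack 0 n v ⊆ colored n v χ ∪ colored n v fun k j => ¬ χ k j := by
    rintro x (⟨k, o, j, ho, -, hj, hx⟩ | ⟨j, -, hj, hx⟩)
    · by_cases hχ : χ k j
      exacts [Or.inl (Or.inl ⟨k, o, j, ho, hj, hχ, hx⟩), Or.inr (Or.inl ⟨k, o, j, ho, hj, hχ, hx⟩)]
    · by_cases hχ : χ 0 j
      exacts [Or.inl (Or.inr ⟨j, hj, hχ, hx⟩), Or.inr (Or.inr ⟨j, hj, hχ, hx⟩)]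
  rcases isPreconnected_iff_subset_of_disjoint_closed.1 hc.isPreconnected _ _
    (isClosed_colored n v χ) (isClosed_colored n v _) hsub (by rw [hd.inter_eq, inter_empty])
    with hs | hs
  · exact Set.disjoint_left.1 hd (hs (Or.inr ⟨j', Nat.zero_le _, hj', hpt j'⟩)) hm'
  · exact Set.disjoint_left.1 hd hm (hs (Or.inr ⟨j, Nat.zero_le _, hj, hpt j⟩))

/-- Without a crossing between the positions `i` and `i + 1`, the colouring of strands by `j ≤ i` is
consistent and both colours occur. -/
theorem countP_pos_of_connected {n i : ℕ} {w : BraidWord n} (hc : IsConnected (braidClosure w))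
    (hi : i + 1 < n) : 0 < w.countP (fun l => (l.1 : ℕ) = i) := by
  by_contra h0
  have h0 : ∀ l ∈ w, (l.1 : ℕ) ≠ i := by
    simpa using List.countP_eq_zero.1 (Nat.eq_zero_of_not_pos h0)
  rw [braidClosure_eq] at hc
  have := colored_of_connected (χ := fun _ j => j ≤ i) ?_ (fun j _ => Iff.rfl) hc
    (show i < n by omega) hi le_rfl
  · omega
  · intro k o j ho hj
    simp only [List.getElem?_map, Option.map_eq_some_iff] at ho
    obtain ⟨l, hl, rfl⟩ := ho
    have := h0 l (List.mem_of_getElem? hl)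
    show Equiv.swap (l.1 : ℕ) (l.1 + 1) j ≤ i ↔ j ≤ i
    rw [Equiv.swap_apply_def]
    split_ifs <;> omega

/-- The transposition of two neighbouring positions. -/
def adjSwap {n : ℕ} (i : Fin (n - 1)) : Equiv.Perm (Fin n) :=
  Equiv.swap ⟨i, by omega⟩ ⟨i + 1, by omega⟩

theorem val_adjSwap {n : ℕ} (i : Fin (n - 1)) (s : Bool) (j : Fin n) :
    (adjSwap i j : ℕ) = upper (some ((i : ℕ), s)) j := by
  simp only [adjSwap, upper, Equiv.swap_apply_def, Fin.ext_iff]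
  split_ifs <;> rfl

/-- The permutation that sends the upper ends of the strands of a braid to the lower ends. -/
def braidPerm {n : ℕ} (w : BraidWord n) : Equiv.Perm (Fin n) := (w.map fun l => adjSwap l.1).prod

theorem sign_braidPerm {n : ℕ} (w : BraidWord n) :
    Equiv.Perm.sign (braidPerm w) = (-1) ^ w.length := by
  induction w with
  | nil => simp [braidPerm]
  | cons l w ih =>
    have : Equiv.Perm.sign (adjSwap l.1) = -1 := Equiv.Perm.sign_swap (by simp)
    rw [braidPerm, List.map_cons, List.prod_cons, Equiv.Perm.sign_mul, this, List.length_cons,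
      pow_succ']
    exact congrArg _ ih

/-- A strand is coloured if, followed down to the bottom of the braid, it arrives in the cycle of
`x`. Passing through the closure applies `braidPerm w`, which preserves cycles, so by connectedness
there is only one cycle. -/
theorem sameCycle_braidPerm {n : ℕ} {w : BraidWord n} (hc : IsConnected (braidClosure w))
    (x y : Fin n) : (braidPerm w).SameCycle x y := by
  rw [braidClosure_eq] at hc
  let χ : ℕ → ℕ → Prop := fun k j =>
    ∃ h : j < n, (braidPerm w).SameCycle x (braidPerm (w.take k) ⟨j, h⟩)
  have h0 : ∀ j : Fin n, χ 0 j ↔ (braidPerm w).SameCycle x j := by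
    intro j
    simp only [χ, List.take_zero]
    exact ⟨fun ⟨_, h⟩ => h, fun h => ⟨j.2, h⟩⟩
  refine (h0 y).1 (colored_of_connected (χ := χ) ?_ ?_ hc x.2 y.2 ((h0 x).2 (.refl _ _)))
  · intro k o j ho hj
    simp only [List.getElem?_map, Option.map_eq_some_iff] at ho
    obtain ⟨l, hl, rfl⟩ := ho
    obtain ⟨hk, rfl⟩ := List.getElem?_eq_some_iff.1 hl
    have e : braidPerm (w.take (k + 1)) = braidPerm (w.take k) * adjSwap (w[k].1) := by
      rw [braidPerm, List.take_add_one, List.getElem?_eq_getElem hk]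
      simp only [Option.toList_some, List.map_append, List.map_cons, List.map_nil, List.prod_append,
        List.prod_singleton, braidPerm]
    have hv := val_adjSwap w[k].1 w[k].2 ⟨j, hj⟩
    have hinv : adjSwap w[k].1 (adjSwap w[k].1 ⟨j, hj⟩) = ⟨j, hj⟩ := Equiv.swap_apply_self _ _ _
    simp only [χ]
    rw [← hv]
    constructor
    · rintro ⟨h, hs⟩
      refine ⟨hj, ?_⟩
      rw [e, Equiv.Perm.mul_apply, Fin.eta, hinv] at hs
      exact hs
    · rintro ⟨h, hs⟩
      refine ⟨(adjSwap w[k].1 ⟨j, hj⟩).2, ?_⟩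
      rw [e, Equiv.Perm.mul_apply, Fin.eta, hinv]
      exact hs
  · intro j hj
    rw [h0 ⟨j, hj⟩]
    simp only [χ, List.length_map, List.take_length]
    constructor
    · rintro ⟨_, hs⟩
      exact Equiv.Perm.sameCycle_apply_right.1 hs
    · exact fun hs => ⟨hj, Equiv.Perm.sameCycle_apply_right.2 hs⟩

/-- For more than one strand the permutation is a cycle through all `n` points, with sign `-(-1) ^
n`, and at the same time a product of one transposition per letter. On one strand there are no
letters. -/
theorem odd_length_add {n : ℕ} (hn : 0 < n) {w : BraidWord n}
    (hc : IsConnected (braidClosure w)) : Odd (w.length + n) := by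
  rcases Nat.lt_or_ge 1 n with h1 | h1
  · have hne : ∀ x, braidPerm w x ≠ x := by
      intro x hx
      have : Nontrivial (Fin n) := Fin.nontrivial_iff_two_le.2 h1
      obtain ⟨y, hy⟩ := exists_ne x
      exact hy ((sameCycle_braidPerm hc x y).eq_of_left hx).symm
    have hcyc : (braidPerm w).IsCycle :=
      ⟨⟨0, hn⟩, hne _, fun y _ => sameCycle_braidPerm hc _ y⟩
    have hsupp : (braidPerm w).support = Finset.univ := by
      ext x; simp [hne x]
    have hs := hcyc.sign
    rw [sign_braidPerm, hsupp, Finset.card_univ, Fintype.card_fin] at hs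
    rw [← Nat.not_even_iff_odd]
    intro he
    have : (-1 : ℤˣ) ^ (w.length + n) = 1 := he.neg_one_pow
    rw [pow_add, hs, neg_mul, ← pow_add, (Even.add_self n).neg_one_pow] at this
    exact absurd this (by decide)
  · have hn1 : n = 1 := by omega
    subst hn1
    have : w = [] := by
      rcases w with _ | ⟨l, w⟩
      · rfl
      · exact l.1.elim0
    simp [this]

theorem pos_of_connected {n : ℕ} {w : BraidWord n} (hc : IsConnected (braidClosure w)) : 0 < n := by
  obtain ⟨x, hx⟩ := hc.nonempty
  rw [braidClosure_eq] at hx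
  rcases hx with ⟨_, _, j, -, -, hj, -⟩ | ⟨j, -, hj, -⟩ <;> omega

/-! ### Counting letters and the proof of the theorem -/

/-- `K` is the closure of a braid word of length `c` on `n` strands. -/
def HasBraidRepOfLength (K : Set R3) (n c : ℕ) : Prop :=
  ∃ w : BraidWord n, Represents w K ∧ w.length = c

theorem Represents.isConnected {n : ℕ} {w : BraidWord n} {K : Set R3} (h : Represents w K)
    (hK : IsKnot K) : IsConnected (braidClosure w) :=
  ((Isotopic.symm h).isConnected hK.isLink).1 hK.isConnected

theorem HasBraidRepOfLength.succ {K : Set R3} {n c : ℕ} (h : HasBraidRepOfLength K n c)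
    (hn : 0 < n) : HasBraidRepOfLength K (n + 1) (c + 1) := by
  obtain ⟨w, hw, rfl⟩ := h
  obtain ⟨N, rfl⟩ := Nat.exists_eq_succ_of_ne_zero hn.ne'
  set u : List (ℕ × Bool) := w.map fun l => ((l.1 : ℕ), l.2) with hu
  have huv : braidClosure w = closedStack 0 (N + 1) (u.map some) := by
    rw [braidClosure_eq, hu, List.map_map]; rfl
  have hvalid : ∀ l ∈ u, l.1 + 1 < N + 1 := by
    intro l hl
    obtain ⟨a, -, rfl⟩ := List.mem_map.1 hl
    have := a.1.2
    simp only
    omega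
  have hs := closedStack_stabilize N (u.map some) (by
    intro i s hi
    obtain ⟨l, hl, e⟩ := List.mem_map.1 hi
    cases e
    exact hvalid _ hl)
  have e : u.map some ++ [some (N, true)] = (u ++ [(N, true)]).map some := by simp
  rw [e, ← huv] at hs
  obtain ⟨w', hw', hlen⟩ := exists_word_of_closedStack (u ++ [(N, true)]) (by
    intro l hl
    rcases List.mem_append.1 hl with hl | hl
    · have := hvalid l hl
      omega
    · rw [List.mem_singleton.1 hl]
      simp) (hs.symm.trans hw)
  exact ⟨w', hw', by rw [hlen]; simp [hu]⟩

theorem HasBraidRepOfLength.add {K : Set R3} {n c : ℕ} (h : HasBraidRepOfLength K n c)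
    (hn : 0 < n) (d : ℕ) : HasBraidRepOfLength K (n + d) (c + d) := by
  induction d with
  | zero => exact h
  | succ d ih => exact ih.succ (by omega)

theorem countP_lt_succ {n : ℕ} (w : BraidWord n) (m : ℕ) :
    w.countP (fun l => (l.1 : ℕ) < m + 1) =
      w.countP (fun l => (l.1 : ℕ) < m) + w.countP (fun l => (l.1 : ℕ) = m) := by
  induction w with
  | nil => rfl
  | cons l w ih =>
    simp only [List.countP_cons, decide_eq_true_eq, ih]
    split_ifs <;> omega

theorem countP_lt_add {n : ℕ} (w : BraidWord n) (i : ℕ) :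
    w.countP (fun l => (l.1 : ℕ) < i + 1) + w.countP (fun l => i < (l.1 : ℕ)) = w.length := by
  induction w with
  | nil => rfl
  | cons l w ih =>
    simp only [List.countP_cons, decide_eq_true_eq, List.length_cons]
    split_ifs <;> omega

theorem countP_lt_top {n : ℕ} (w : BraidWord n) :
    w.countP (fun l => (l.1 : ℕ) < n - 1) = w.length := by
  rw [List.countP_eq_length]
  intro l _
  simp

/-- The form of the pigeonhole principle used for letters: each generator from `i` to `m - 1`
contributes at least `a` letters. -/
theorem add_mul_le_countP {n a i m : ℕ} {w : BraidWord n}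
    (h : ∀ i, i < m → a ≤ w.countP (fun l => (l.1 : ℕ) = i)) (him : i ≤ m) :
    w.countP (fun l => (l.1 : ℕ) < i) + a * (m - i) ≤ w.countP (fun l => (l.1 : ℕ) < m) := by
  induction m, him using Nat.le_induction with
  | base => simp
  | succ m him ih =>
    have h1 := ih fun j hj => h j (by omega)
    have h2 := h m (by omega)
    rw [countP_lt_succ, Nat.succ_sub him, Nat.mul_succ]
    omega

/-- A short braid word for a prime knot can be replaced by a shorter one with fewer strands. -/
theorem HasBraidRepOfLength.pred {K : Set R3} (hK : IsPrimeKnot K) {n c : ℕ}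
    (h : HasBraidRepOfLength K (n + 1) c) (hc : c < 2 * n) :
    ∃ c', HasBraidRepOfLength K n c' ∧ c' + 1 ≤ c := by
  obtain ⟨w, hw, rfl⟩ := h
  have hpos : ∀ i, i < n → 1 ≤ w.countP (fun l => (l.1 : ℕ) = i) := fun i hi =>
    countP_pos_of_connected (hw.isConnected hK.1) (by omega)
  have htop : w.countP (fun l => (l.1 : ℕ) < n) = w.length := countP_lt_top w
  -- There are `n` generators on `n + 1` strands and fewer than `2 * n` letters.
  obtain ⟨i, hi, hi1⟩ : ∃ i, i < n ∧ w.countP (fun l => (l.1 : ℕ) = i) < 2 := by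
    by_contra! hcon
    have := add_mul_le_countP hcon (Nat.zero_le n)
    omega
  have h1 := hpos i hi
  -- The discarded part pays for the stabilizations: there are at least `i` letters to the left of
  -- `i` and at least `n - (i + 1)` to the right, exactly the numbers of strands to be added in the
  -- two cases. The single letter `i` is saved.
  have hle : i ≤ w.countP (fun l => (l.1 : ℕ) < i) := by
    have := add_mul_le_countP (fun j (hj : j < i) => hpos j (by omega)) (Nat.zero_le i)
    omega
  have hge := add_mul_le_countP hpos (show i + 1 ≤ n from hi)
  have hsum := countP_lt_add w i
  have hsucc := countP_lt_succ w i
  rcases exists_word_of_single hK hw (show i + 1 < n + 1 by omega) (by omega) with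
    ⟨w', hw', hl⟩ | ⟨w', hw', hl⟩
  · have := HasBraidRepOfLength.add ⟨w', hw', rfl⟩ (by omega) (n - (i + 1))
    rw [Nat.add_sub_of_le hi] at this
    exact ⟨_, this, by omega⟩
  · have := HasBraidRepOfLength.add ⟨w', hw', rfl⟩ (by omega) i
    rw [show n + 1 - (i + 1) + i = n by omega] at this
    exact ⟨_, this, by omega⟩

theorem HasBraidRepOfLength.b_le {K : Set R3} {n c : ℕ} (h : HasBraidRepOfLength K n c) :
    b n K ≤ c :=
  Nat.sInf_le h

theorem HasBraidRepOfLength.hasBraidRep {K : Set R3} {n c : ℕ} (h : HasBraidRepOfLength K n c) :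
    HasBraidRep K n :=
  let ⟨w, hw, _⟩ := h
  ⟨w, hw⟩

theorem HasBraidRep.b_attained {K : Set R3} {n : ℕ} (h : HasBraidRep K n) :
    HasBraidRepOfLength K n (b n K) :=
  let ⟨w, hw⟩ := h
  Nat.sInf_mem (s := {c | ∃ w : BraidWord n, Represents w K ∧ w.length = c}) ⟨_, w, hw, rfl⟩

theorem HasBraidRep.pos {K : Set R3} (hK : IsKnot K) {n : ℕ} (h : HasBraidRep K n) : 0 < n :=
  let ⟨_, hw⟩ := h
  pos_of_connected (hw.isConnected hK)

theorem HasBraidRep.odd_b_add {K : Set R3} (hK : IsKnot K) {n : ℕ} (h : HasBraidRep K n) :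
    Odd (b n K + n) := by
  obtain ⟨w, hw, hl⟩ := h.b_attained
  rw [← hl]
  exact odd_length_add (h.pos hK) (hw.isConnected hK)

/-- Stabilization gives `≤`. If the values differ, parity excludes equality with `b n K` as well, so
`b (n + 1) K ≤ b n K - 1 < 2 * n`. Then the reduction in `HasBraidRepOfLength.pred` gives an
`n`-strand word shorter than `b n K`. Parity matters in the boundary case `b n K = 2 * n`, where
otherwise no generator need occur just once. -/
theorem b_succ_eq {K : Set R3} (hK : IsPrimeKnot K) {n : ℕ} (h : HasBraidRep K n)
    (hb : b n K ≤ 2 * n) : b (n + 1) K = b n K + 1 := by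
  have hn := h.pos hK.1
  have hs := h.b_attained.succ hn
  have hle := hs.b_le
  by_contra hne
  have hodd := h.odd_b_add hK.1
  have hodd' := hs.hasBraidRep.odd_b_add hK.1
  rw [Nat.odd_iff] at hodd hodd'
  obtain ⟨c', hc', hlt⟩ := hs.hasBraidRep.b_attained.pred hK (by omega)
  have := hc'.b_le
  omega

/-- If `b' n K ≤ n`, then the sequence `b' k K` is constant from `k = n` on. -/
theorem b'_eq_of_le {K : Set R3} (hK : IsPrimeKnot K) {n₀ : ℕ} (h : HasBraidRep K n₀)
    (hb : b' n₀ K ≤ n₀) {n : ℕ} (hn : n₀ ≤ n) : HasBraidRep K n ∧ b' n K = b' n₀ K := by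
  induction n, hn using Nat.le_induction with
  | base => exact ⟨h, rfl⟩
  | succ n hn ih =>
    have hs := (ih.1.b_attained.succ (ih.1.pos hK.1)).hasBraidRep
    have := ih.2
    simp only [b'] at this hb ⊢
    -- The bound persists: `b' n K = b' n₀ K ≤ n₀ ≤ n`, that is, `b n K ≤ 2 * n`.
    rw [b_succ_eq hK ih.1 (by omega)]
    exact ⟨hs, by push_cast; omega⟩

end KnotBraid

/-- The existence of representations on `n` strands belongs to the conclusion, because `b n K` is an
infimum in `ℕ` and would be the default value `0` if there were none. -/
theorem theorem3p5 (K : Set KnotBraid.R3) (hK : KnotBraid.IsPrimeKnot K)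
    (m c : ℕ) (hm : KnotBraid.HasBraidRep K m) (hc : KnotBraid.b m K = c)
    (N : ℤ) (hN : N = (c : ℤ) - (m : ℤ)) :
    ((m : ℤ) ≤ N → ∀ n : ℕ, N ≤ (n : ℤ) →
      KnotBraid.HasBraidRep K n ∧ KnotBraid.b' n K = KnotBraid.b' N.toNat K) ∧
    (N < (KnotBraid.braidIndex K : ℤ) → ∀ n : ℕ, m ≤ n →
      KnotBraid.HasBraidRep K n ∧ KnotBraid.b' n K = KnotBraid.b' m K) := by
  refine ⟨fun hmN n hn => ?_, fun hlt n hn => ?_⟩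
  -- Stabilizing a shortest word from `m` to `N` strands gives length `c + (N - m) = 2 * N`, hence
  -- `b' N K ≤ N`.
  · obtain ⟨d, hd⟩ := Nat.exists_eq_add_of_le (show m ≤ N.toNat by omega)
    have hrep := hm.b_attained.add (hm.pos hK.1) d
    rw [← hd] at hrep
    refine KnotBraid.b'_eq_of_le hK hrep.hasBraidRep ?_ (by omega)
    have := hrep.b_le
    simp only [KnotBraid.b']
    omega
  -- Here `b' m K = N` is less than the braid index, which is at most `m`, so the sequence is
  -- constant already from `m` on.
  · have hle : KnotBraid.braidIndex K ≤ m := Nat.sInf_le hm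
    refine KnotBraid.b'_eq_of_le hK hm ?_ hn
    simp only [KnotBraid.b']
    omega
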